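/- **Setting.** Let $\mathbb T=\mathbb R/2\pi\mathbb Z$ and $\Pi=[0,1]\times\mathbb T$ with coordinates $(\psi,\theta)$; all functions are complex valued. Let $m\ge 2$ be an integer, $\gamma>1/2$ and $\sigma\ge 0$ real. Write $$\|v\|_{H^m(\mathbb T)}^2=\sum_{k\in\mathbb Z}(1+k^2)^m|\hat v_k|^2,\qquad \|w\|_{K^m_\gamma(\Pi)}^2=\sum_{p+q\le m}\big\|\psi^{p-\gamma}\partial_\psi^p\partial_\theta^q w\big\|_{L^2(\Pi)}^2$$ (weak derivatives on $(0,1)\times\mathbb T$), and let $J^m_{0,\gamma}(\Pi)=\{v(\theta)+w(\psi,\theta): v\in H^m(\mathbb T),\ w\in K^m_\gamma(\Pi)\}$, with the norm of the direct sum $H^m(\mathbb T)\oplus K^m_\gamma(\Pi)$. Let $$J^{m,\sigma}_{0,\gamma}(\Pi)=\Big\{a\in J^m_{0,\gamma}(\Pi):\ a_\sigma:=\sum_k \hat a_k(\psi)e^{\sigma|k|}e^{ik\theta}\in J^m_{0,\gamma}(\Pi)\Big\},\qquad \|a\|_{J^{m,\sigma}_{0,\gamma}(\Pi)}=\|a_\sigma\|_{J^m_{0,\gamma}(\Pi)},$$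 where $\hat a_k(\psi)$ are the Fourier coefficients of $a(\psi,\cdot)$. **Statement.** 1. $J^{m,\sigma}_{0,\gamma}(\Pi)$ is complete and closed under pointwise multiplication, and there is a constant $C=C(m,\gamma,\sigma)$ with $\|uv\|\le C\|u\|\,\|v\|$ for all $u,v\in J^{m,\sigma}_{0,\gamma}(\Pi)$ (all norms being that of $J^{m,\sigma}_{0,\gamma}(\Pi)$). 2. The map $(u,v)\mapsto uv$, $J^{m,\sigma}_{0,\gamma}(\Pi)\times J^{m,\sigma}_{0,\gamma}(\Pi)\to J^{m,\sigma}_{0,\gamma}(\Pi)$, is complex analytic. 3. Every $u\in J^{m,\sigma}_{0,\gamma}(\Pi)$ extends to a continuous function $u(\psi,z)$ on $[0,1]\times\{z\in\mathbb C:|\operatorname{Im}z|\le\sigma\}$ which is $2\pi$-periodic in $z$ and holomorphic in $z$ for $|\operatorname{Im}z|<\sigma$. Let $\Omega\subset\mathbb C$ be open and $f:\Omega\to\mathbb C$ holomorphic. Then the set $\mathcal U_\Omega$ of those $u\in J^{m,\sigma}_{0,\gamma}(\Pi)$ with $u(\psi,z)\in\Omega$ for all $\psi\in[0,1]$, $|\operatorname{Im}z|\le\sigma$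 is open, $f(u)\in J^{m,\sigma}_{0,\gamma}(\Pi)$ for every $u\in\mathcal U_\Omega$, with extension $f(u(\psi,z))$, and $u\mapsto f(u)$, $\mathcal U_\Omega\to J^{m,\sigma}_{0,\gamma}(\Pi)$, is complex analytic. -/

import Mathlib

open MeasureTheory Set Filter Topology
open scoped ENNReal ContDiff

noncomputable section

namespace Kondratev

instance instTwoPiPos : Fact (0 < 2 * Real.pi) := ⟨Real.two_pi_pos⟩

/-- The circle `𝕋 = ℝ / 2πℤ`. -/
abbrev Circ := AddCircle (2 * Real.pi)

/-- Lebesgue measure `dψ dθ` on `Π = [0,1] × 𝕋`, as a measure on `ℝ × 𝕋`. -/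
abbrev muPi : Measure (ℝ × Circ) := (volume.restrict (Ioc (0 : ℝ) 1)).prod volume

/-- Complex measurable functions on `Π` modulo almost everywhere equality. -/
abbrev FunPi := (ℝ × Circ) →ₘ[muPi] ℂ

/-- Complex measurable functions on `𝕋` modulo almost everywhere equality. -/
abbrev FunCirc := Circ →ₘ[volume] ℂ

/-! ### Test functions and weak derivatives -/

/-- The partial derivative `∂_ψ`. -/
def dPsi (φ : ℝ × Circ → ℂ) : ℝ × Circ → ℂ := fun x => deriv (fun s : ℝ => φ (s, x.2)) x.1

/-- The partial derivative `∂_θ`. -/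
def dTheta (φ : ℝ × Circ → ℂ) : ℝ × Circ → ℂ :=
  fun x => deriv (fun t : ℝ => φ (x.1, x.2 + (t : Circ))) 0

/-- Smooth functions with compact support in `(0,1) × 𝕋`. -/
structure IsTest (φ : ℝ × Circ → ℂ) : Prop where
  smooth : ContDiff ℝ ∞ (fun y : ℝ × ℝ => φ (y.1, (y.2 : Circ)))
  supp : ∃ K : Set ℝ, IsCompact K ∧ K ⊆ Ioo 0 1 ∧ ∀ x, φ x ≠ 0 → x.1 ∈ K

/-- `g` is the weak derivative `∂_ψ^p ∂_θ^q w` on `(0,1) × 𝕋`. It is only used for `w` and `g` that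
are square integrable on each `[a,1] × 𝕋` with `0 < a`. -/
def IsWeakDeriv (p q : ℕ) (w g : FunPi) : Prop :=
  ∀ φ : ℝ × Circ → ℂ, IsTest φ →
    ∫ x, w x * (dPsi^[p] (dTheta^[q] φ)) x ∂muPi = (-1) ^ (p + q) * ∫ x, g x * φ x ∂muPi

/-- `ψ^s g` belongs to `L²(Π)`. -/
def WeightedL2 (s : ℝ) (g : FunPi) : Prop :=
  MemLp (fun x => ((x.1 ^ s : ℝ) : ℂ) * g x) 2 muPi

theorem ae_fst_mem : ∀ᵐ x ∂muPi, x.1 ∈ Ioc (0 : ℝ) 1 :=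
  Measure.quasiMeasurePreserving_fst.ae (ae_restrict_mem measurableSet_Ioc)

theorem IsTest.dPsi_lift {φ : ℝ × Circ → ℂ} (h : IsTest φ) (y : ℝ × ℝ) :
    dPsi φ (y.1, (y.2 : Circ)) =
      fderiv ℝ (fun y : ℝ × ℝ => φ (y.1, (y.2 : Circ))) y (1, 0) := by
  have hd := (h.smooth.differentiable (by simp)) y
  have hl : HasDerivAt (fun s : ℝ => ((s, y.2) : ℝ × ℝ)) ((1 : ℝ), (0 : ℝ)) y.1 :=
    (hasDerivAt_id y.1).prodMk (hasDerivAt_const _ _)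
  exact (hd.hasFDerivAt.comp_hasDerivAt y.1 hl).deriv

theorem IsTest.dTheta_lift {φ : ℝ × Circ → ℂ} (h : IsTest φ) (y : ℝ × ℝ) :
    dTheta φ (y.1, (y.2 : Circ)) =
      fderiv ℝ (fun y : ℝ × ℝ => φ (y.1, (y.2 : Circ))) y (0, 1) := by
  have hd := (h.smooth.differentiable (by simp)) y
  have hl : HasDerivAt (fun t : ℝ => ((y.1, y.2 + t) : ℝ × ℝ)) ((0 : ℝ), (1 : ℝ)) 0 :=
    (hasDerivAt_const _ _).prodMk ((hasDerivAt_id (0 : ℝ)).const_add _)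
  have hd' : HasFDerivAt (fun y : ℝ × ℝ => φ (y.1, (y.2 : Circ)))
      (fderiv ℝ (fun y : ℝ × ℝ => φ (y.1, (y.2 : Circ))) y) (y.1, y.2 + (0 : ℝ)) := by
    simpa using hd.hasFDerivAt
  have := (hd'.comp_hasDerivAt (0 : ℝ) hl).deriv
  simpa [dTheta, Function.comp_def] using this

theorem IsTest.dPsi {φ : ℝ × Circ → ℂ} (h : IsTest φ) : IsTest (dPsi φ) := by
  refine ⟨?_, ?_⟩
  · simp_rw [h.dPsi_lift]
    exact (h.smooth.fderiv_right (by simp)).clm_apply contDiff_const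
  · obtain ⟨K, hK, hKs, hφ⟩ := h.supp
    refine ⟨K, hK, hKs, fun x hx => ?_⟩
    by_contra hxK
    apply hx
    have : (fun s : ℝ => φ (s, x.2)) =ᶠ[𝓝 x.1] fun _ => 0 := by
      filter_upwards [hK.isClosed.isOpen_compl.mem_nhds hxK] with s hs
      by_contra h0
      exact hs (hφ (s, x.2) h0)
    simp [Kondratev.dPsi, this.deriv_eq]

theorem IsTest.dTheta {φ : ℝ × Circ → ℂ} (h : IsTest φ) : IsTest (dTheta φ) := by
  refine ⟨?_, ?_⟩
  · simp_rw [h.dTheta_lift]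
    exact (h.smooth.fderiv_right (by simp)).clm_apply contDiff_const
  · obtain ⟨K, hK, hKs, hφ⟩ := h.supp
    refine ⟨K, hK, hKs, fun x hx => ?_⟩
    by_contra hxK
    apply hx
    have : (fun t : ℝ => φ (x.1, x.2 + (t : Circ))) = fun _ => 0 := by
      funext t
      by_contra h0
      exact hxK (hφ (x.1, x.2 + (t : Circ)) h0)
    simp [Kondratev.dTheta, this]

theorem IsTest.mixed {φ : ℝ × Circ → ℂ} (h : IsTest φ) (p q : ℕ) :
    IsTest (Kondratev.dPsi^[p] (Kondratev.dTheta^[q] φ)) := by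
  have hq : IsTest (Kondratev.dTheta^[q] φ) := by
    induction q with
    | zero => exact h
    | succ n ih => rw [Function.iterate_succ_apply']; exact ih.dTheta
  induction p with
  | zero => exact hq
  | succ n ih => rw [Function.iterate_succ_apply']; exact ih.dPsi

theorem IsTest.continuous {φ : ℝ × Circ → ℂ} (h : IsTest φ) : Continuous φ := by
  have hq : IsOpenQuotientMap (Prod.map (id : ℝ → ℝ) (fun t : ℝ => (t : Circ))) :=
    IsOpenQuotientMap.prodMap IsOpenQuotientMap.id QuotientAddGroup.isOpenQuotientMap_mk
  exact hq.continuous_comp_iff.1 h.smooth.continuous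

theorem IsTest.weighted_memLp {φ : ℝ × Circ → ℂ} (h : IsTest φ) (s : ℝ) :
    MemLp (fun x => ((x.1 ^ s : ℝ) : ℂ) * φ x) 2 muPi := by
  obtain ⟨K, hK, hKs, hφ⟩ := h.supp
  have hc : ContinuousOn (fun x : ℝ × Circ => ((x.1 ^ s : ℝ) : ℂ) * φ x) (K ×ˢ univ) := by
    refine ContinuousOn.mul ?_ h.continuous.continuousOn
    refine Complex.continuous_ofReal.comp_continuousOn ?_
    exact continuous_fst.continuousOn.rpow_const
      fun x hx => Or.inl (hKs hx.1).1.ne'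
  obtain ⟨C, hC⟩ := (hK.prod isCompact_univ).exists_bound_of_continuousOn hc
  refine MemLp.of_bound ?_ (max C 0) (Eventually.of_forall fun x => ?_)
  · refine AEStronglyMeasurable.mul ?_ h.continuous.aestronglyMeasurable
    have : Measurable fun x : ℝ × Circ => ((x.1 ^ s : ℝ) : ℂ) := by fun_prop
    exact this.aestronglyMeasurable
  · by_cases hx : φ x = 0
    · simp [hx]
    · exact (hC x ⟨hφ x hx, mem_univ _⟩).trans (le_max_left _ _)

theorem WeightedL2.integrable_mul_test {s : ℝ} {g : FunPi} (hg : WeightedL2 s g)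
    {φ : ℝ × Circ → ℂ} (h : IsTest φ) : Integrable (fun x => g x * φ x) muPi := by
  refine (MemLp.integrable_mul hg (h.weighted_memLp (-s))).congr ?_
  filter_upwards [ae_fst_mem] with x hx
  have : ((x.1 ^ s : ℝ) : ℂ) * ((x.1 ^ (-s) : ℝ) : ℂ) = 1 := by
    rw [← Complex.ofReal_mul, ← Real.rpow_add hx.1]; simp
  simp only [Pi.mul_apply]
  linear_combination (g x * φ x) * this

theorem WeightedL2.zero (s : ℝ) : WeightedL2 s 0 := by
  refine (MemLp.zero (p := 2) (μ := muPi) (ε := ℂ)).ae_eq ?_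
  filter_upwards [AEEqFun.coeFn_zero (α := ℝ × Circ) (β := ℂ) (μ := muPi)] with x hx
  simp [hx]

theorem WeightedL2.add {s : ℝ} {g h : FunPi} (hg : WeightedL2 s g) (hh : WeightedL2 s h) :
    WeightedL2 s (g + h) := by
  refine (MemLp.add hg hh).ae_eq ?_
  filter_upwards [AEEqFun.coeFn_add g h] with x hx
  simp [hx, mul_add]

theorem WeightedL2.smul {s : ℝ} {g : FunPi} (c : ℂ) (hg : WeightedL2 s g) :
    WeightedL2 s (c • g) := by
  refine (MemLp.const_smul hg c).ae_eq ?_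
  filter_upwards [AEEqFun.coeFn_smul c g] with x hx
  simp only [Pi.smul_apply, hx, smul_eq_mul]
  ring

theorem WeightedL2.mono {s t : ℝ} (hst : s ≤ t) {g : FunPi} (hg : WeightedL2 s g) :
    WeightedL2 t g := by
  refine MemLp.mono hg ?_ ?_
  · refine AEStronglyMeasurable.mul ?_ g.aestronglyMeasurable
    have : Measurable fun x : ℝ × Circ => ((x.1 ^ t : ℝ) : ℂ) := by fun_prop
    exact this.aestronglyMeasurable
  · filter_upwards [ae_fst_mem] with x hx
    have h1 : |x.1 ^ t| ≤ |x.1 ^ s| := by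
      rw [abs_of_nonneg (Real.rpow_nonneg hx.1.le _), abs_of_nonneg (Real.rpow_nonneg hx.1.le _)]
      exact Real.rpow_le_rpow_of_exponent_ge hx.1 hx.2 hst
    simpa using mul_le_mul_of_nonneg_right h1 (norm_nonneg (g x))

theorem IsWeakDeriv.zero (p q : ℕ) : IsWeakDeriv p q 0 0 := by
  intro φ _
  have h0 := AEEqFun.coeFn_zero (α := ℝ × Circ) (β := ℂ) (μ := muPi)
  rw [integral_eq_zero_of_ae, integral_eq_zero_of_ae, mul_zero] <;>
  · filter_upwards [h0] with x hx
    simp [hx]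

theorem IsWeakDeriv.add {p q : ℕ} {w w' g g' : FunPi} {r r' s s' : ℝ}
    (h : IsWeakDeriv p q w g) (h' : IsWeakDeriv p q w' g')
    (hw : WeightedL2 r w) (hw' : WeightedL2 r' w') (hg : WeightedL2 s g) (hg' : WeightedL2 s' g') :
    IsWeakDeriv p q (w + w') (g + g') := by
  intro φ hφ
  have e1 : ∫ x, (w + w') x * (Kondratev.dPsi^[p] (Kondratev.dTheta^[q] φ)) x ∂muPi =
      ∫ x, w x * (Kondratev.dPsi^[p] (Kondratev.dTheta^[q] φ)) x +
        w' x * (Kondratev.dPsi^[p] (Kondratev.dTheta^[q] φ)) x ∂muPi := by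
    refine integral_congr_ae ?_
    filter_upwards [AEEqFun.coeFn_add w w'] with x hx
    simp [hx, add_mul]
  have e2 : ∫ x, (g + g') x * φ x ∂muPi = ∫ x, g x * φ x + g' x * φ x ∂muPi := by
    refine integral_congr_ae ?_
    filter_upwards [AEEqFun.coeFn_add g g'] with x hx
    simp [hx, add_mul]
  rw [e1, e2, integral_add (hw.integrable_mul_test (hφ.mixed p q))
    (hw'.integrable_mul_test (hφ.mixed p q)), integral_add (hg.integrable_mul_test hφ)
    (hg'.integrable_mul_test hφ), h φ hφ, h' φ hφ, mul_add]

theorem IsWeakDeriv.smul {p q : ℕ} {w g : FunPi} (c : ℂ) (h : IsWeakDeriv p q w g) :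
    IsWeakDeriv p q (c • w) (c • g) := by
  intro φ hφ
  have e (u : FunPi) (f : ℝ × Circ → ℂ) :
      ∫ x, (c • u) x * f x ∂muPi = c * ∫ x, u x * f x ∂muPi := by
    rw [← integral_const_mul]
    refine integral_congr_ae ?_
    filter_upwards [AEEqFun.coeFn_smul c u] with x hx
    simp [hx, mul_assoc]
  rw [e, e, h φ hφ]
  ring

/-! ### Uniqueness of weak derivatives -/

theorem ae_eq_zero_of_fourierCoeff_eq_zero {f : Circ → ℂ} (hf : MemLp f 2 volume)
    (h : ∀ k, fourierCoeff f k = 0) : f =ᵐ[volume] 0 := by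
  have hf' : MemLp f 2 AddCircle.haarAddCircle := hf.haarAddCircle
  have h0 : hf'.toLp f = 0 := by
    apply (fourierBasis (T := 2 * Real.pi)).repr.injective
    ext k
    rw [fourierBasis_repr, fourierCoeff_congr_ae hf'.coeFn_toLp, h]
    simp
  have h1 : f =ᵐ[AddCircle.haarAddCircle] 0 := by
    have := hf'.coeFn_toLp
    rw [h0] at this
    exact this.symm.trans (Lp.coeFn_zero _ _ _)
  rw [AddCircle.volume_eq_smul_haarAddCircle]
  exact Measure.ae_smul_measure h1 _

theorem WeightedL2.ae_memLp_slice {s : ℝ} {g : FunPi} (hg : WeightedL2 s g) :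
    ∀ᵐ r ∂(volume.restrict (Ioc (0 : ℝ) 1)), MemLp (fun θ : Circ => g (r, θ)) 2 volume := by
  have hsq := (memLp_two_iff_integrable_sq_norm hg.1).1 hg
  filter_upwards [hsq.prod_right_ae, ae_restrict_mem measurableSet_Ioc] with r hr hr0
  have hm : AEStronglyMeasurable (fun θ : Circ => g (r, θ)) volume :=
    (g.stronglyMeasurable.comp_measurable measurable_prodMk_left).aestronglyMeasurable
  rw [memLp_two_iff_integrable_sq_norm hm]
  have hpos : 0 < r ^ s := Real.rpow_pos_of_pos hr0.1 s
  refine (hr.const_mul ((r ^ s) ^ 2)⁻¹).congr (Eventually.of_forall fun θ => ?_)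
  simp only [norm_mul, Complex.norm_real, Real.norm_eq_abs, abs_of_pos hpos, mul_pow]
  rw [inv_mul_cancel_left₀ (by positivity)]

theorem WeightedL2.eq_zero_of_fourierCoeff {s : ℝ} {g : FunPi} (hg : WeightedL2 s g)
    (h : ∀ k : ℤ, ∀ᵐ r ∂(volume.restrict (Ioc (0 : ℝ) 1)),
      fourierCoeff (fun θ : Circ => g (r, θ)) k = 0) : g = 0 := by
  refine AEEqFun.ext (EventuallyEq.trans ?_ AEEqFun.coeFn_zero.symm)
  have hm : MeasurableSet {x : ℝ × Circ | g x = (0 : ℝ × Circ → ℂ) x} :=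
    measurableSet_eq_fun g.stronglyMeasurable.measurable measurable_const
  refine (Measure.ae_prod_iff_ae_ae hm).2 ?_
  filter_upwards [hg.ae_memLp_slice, ae_all_iff.2 h] with r hr hk
  exact ae_eq_zero_of_fourierCoeff_eq_zero hr hk

theorem isTest_mul_fourier {χ : ℝ → ℝ} (hχ : ContDiff ℝ ∞ χ) (hc : HasCompactSupport χ)
    (hs : tsupport χ ⊆ Ioo 0 1) (k : ℤ) :
    IsTest (fun x : ℝ × Circ => (χ x.1 : ℂ) * fourier k x.2) := by
  refine ⟨?_, tsupport χ, hc, hs, fun x hx => subset_tsupport _ ?_⟩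
  · simp only [fourier_coe_apply]
    refine ContDiff.mul (Complex.ofRealCLM.contDiff.comp (hχ.comp contDiff_fst)) ?_
    refine ContDiff.cexp (ContDiff.div_const (contDiff_const.mul ?_) _)
    exact Complex.ofRealCLM.contDiff.comp contDiff_snd
  · intro h0
    simp [h0] at hx

theorem WeightedL2.eq_zero_of_integral_test {s : ℝ} {g : FunPi} (hg : WeightedL2 s g)
    (h : ∀ φ, IsTest φ → ∫ x, g x * φ x ∂muPi = 0) : g = 0 := by
  refine hg.eq_zero_of_fourierCoeff fun k => ?_
  have hint : Integrable (fun x : ℝ × Circ => ((x.1 ^ s : ℝ) : ℂ) * g x * fourier (-k) x.2)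
      muPi := by
    refine (hg.integrable (by norm_num)).mul_bdd (c := 1) ?_ (Eventually.of_forall fun x => ?_)
    · exact ((fourier (-k)).continuous.comp continuous_snd).aestronglyMeasurable
    · rw [fourier_apply, Circle.norm_coe]
  have hslice (r : ℝ) : ∫ θ : Circ, g (r, θ) * fourier (-k) θ =
      (2 * Real.pi : ℝ) * fourierCoeff (fun θ : Circ => g (r, θ)) k := by
    rw [fourierCoeff, AddCircle.integral_haarAddCircle]
    simp only [smul_eq_mul, Complex.real_smul, mul_comm (g _)]
    rw [← mul_assoc, ← Complex.ofReal_mul, mul_inv_cancel₀ Real.two_pi_pos.ne']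
    simp
  have hc1 : Integrable (fun r : ℝ => ((r ^ s : ℝ) : ℂ) * ((2 * Real.pi : ℝ) *
      fourierCoeff (fun θ : Circ => g (r, θ)) k)) (volume.restrict (Ioc (0 : ℝ) 1)) := by
    refine hint.integral_prod_left.congr (Eventually.of_forall fun r => ?_)
    simp only [mul_assoc]
    rw [integral_const_mul, hslice]
  have hloc : LocallyIntegrableOn (fun r : ℝ => ((r ^ (-s) : ℝ) : ℂ) * (((r ^ s : ℝ) : ℂ) *
      ((2 * Real.pi : ℝ) * fourierCoeff (fun θ : Circ => g (r, θ)) k))) (Ioo 0 1)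
      (volume.restrict (Ioc (0 : ℝ) 1)) := by
    refine (hc1.locallyIntegrable.locallyIntegrableOn _).continuousOn_mul ?_
      isOpen_Ioo.isLocallyClosed
    refine Complex.continuous_ofReal.comp_continuousOn ?_
    exact continuousOn_id.rpow_const fun x hx => Or.inl hx.1.ne'
  have key := isOpen_Ioo.ae_eq_zero_of_integral_contDiff_smul_eq_zero hloc ?_
  · have hne : ∀ᵐ r ∂(volume.restrict (Ioc (0 : ℝ) 1)), r ≠ 1 :=
      ae_restrict_of_ae (Measure.ae_ne volume 1)
    filter_upwards [key, ae_restrict_mem measurableSet_Ioc, hne] with r hr hr0 hr1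
    have h1 := hr ⟨hr0.1, lt_of_le_of_ne hr0.2 hr1⟩
    have p1 : ((r ^ (-s) : ℝ) : ℂ) ≠ 0 := by
      exact_mod_cast (Real.rpow_pos_of_pos hr0.1 _).ne'
    have p2 : ((r ^ s : ℝ) : ℂ) ≠ 0 := by
      exact_mod_cast (Real.rpow_pos_of_pos hr0.1 _).ne'
    have p3 : ((2 * Real.pi : ℝ) : ℂ) ≠ 0 := by exact_mod_cast Real.two_pi_pos.ne'
    simpa [p1, p2, p3] using h1
  · intro χ hχ hcs hts
    have ht := isTest_mul_fourier hχ hcs hts (-k)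
    have h0 := h _ ht
    rw [integral_prod _ (hg.integrable_mul_test ht)] at h0
    rw [← h0]
    refine integral_congr_ae ?_
    filter_upwards [ae_restrict_mem measurableSet_Ioc] with r hr
    have e : ∀ θ : Circ, g (r, θ) * ((χ r : ℂ) * fourier (-k) θ) =
        (χ r : ℂ) * (g (r, θ) * fourier (-k) θ) := fun θ => by ring
    simp only [e]
    rw [integral_const_mul, hslice, Complex.real_smul]
    have p : ((r ^ (-s) : ℝ) : ℂ) * ((r ^ s : ℝ) : ℂ) = 1 := by
      rw [← Complex.ofReal_mul, ← Real.rpow_add hr.1]; simp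
    linear_combination (χ r : ℂ) * ((2 * Real.pi : ℝ) : ℂ) *
      fourierCoeff (fun θ : Circ => g (r, θ)) k * p

theorem IsWeakDeriv.unique {p q : ℕ} {w g g' : FunPi} {s : ℝ}
    (h : IsWeakDeriv p q w g) (h' : IsWeakDeriv p q w g')
    (hg : WeightedL2 s g) (hg' : WeightedL2 s g') : g = g' := by
  have hs : WeightedL2 s (g + (-1 : ℂ) • g') := hg.add (hg'.smul _)
  have h0 : g + (-1 : ℂ) • g' = 0 := by
    refine hs.eq_zero_of_integral_test fun φ hφ => ?_
    have e1 : ∫ x, (g + (-1 : ℂ) • g') x * φ x ∂muPi =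
        ∫ x, g x * φ x - g' x * φ x ∂muPi := by
      refine integral_congr_ae ?_
      filter_upwards [AEEqFun.coeFn_add g ((-1 : ℂ) • g'), AEEqFun.coeFn_smul (-1 : ℂ) g']
        with x hx hx'
      simp only [hx, Pi.add_apply, hx', Pi.smul_apply, smul_eq_mul]
      ring
    have hh := (h φ hφ).symm.trans (h' φ hφ)
    rw [e1, integral_sub (hg.integrable_mul_test hφ) (hg'.integrable_mul_test hφ), sub_eq_zero]
    exact mul_left_cancel₀ (by simp) hh
  have hn : (-1 : ℂ) • g' = -g' := neg_one_smul ℂ g'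
  rwa [hn, ← sub_eq_add_neg, sub_eq_zero] at h0

theorem isWeakDeriv_zero_zero (w : FunPi) : IsWeakDeriv 0 0 w w := by
  intro φ _
  simp

/-! ### The Kondratev space `K^m_γ(Π)` -/

/-- `K^m_γ(Π)`: functions `w` whose weak derivatives of order at most `m` satisfy
`ψ^(p-γ) ∂_ψ^p ∂_θ^q w ∈ L²(Π)`. -/
def K (m : ℕ) (γ : ℝ) : Submodule ℂ FunPi where
  carrier := {w | WeightedL2 (-γ) w ∧ ∀ p q : ℕ, p + q ≤ m →
    ∃ g : FunPi, IsWeakDeriv p q w g ∧ WeightedL2 (p - γ) g}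
  zero_mem' := ⟨.zero _, fun p q _ => ⟨0, .zero p q, .zero _⟩⟩
  add_mem' := by
    rintro w w' ⟨hw, h⟩ ⟨hw', h'⟩
    refine ⟨hw.add hw', fun p q hpq => ?_⟩
    obtain ⟨g, hg, hg2⟩ := h p q hpq
    obtain ⟨g', hg', hg2'⟩ := h' p q hpq
    exact ⟨g + g', hg.add hg' hw hw' hg2 hg2', hg2.add hg2'⟩
  smul_mem' := by
    rintro c w ⟨hw, h⟩
    refine ⟨hw.smul c, fun p q hpq => ?_⟩
    obtain ⟨g, hg, hg2⟩ := h p q hpq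
    exact ⟨c • g, hg.smul c, hg2.smul c⟩

/-- Pairs `(p,q)` with `p + q ≤ m`. -/
abbrev Idx (m : ℕ) := {i : Fin (m + 1) × Fin (m + 1) // (i.1 : ℕ) + (i.2 : ℕ) ≤ m}

/-- The weak derivative `∂_ψ^p ∂_θ^q w` of `w ∈ K^m_γ(Π)`. -/
def weakDeriv {m : ℕ} {γ : ℝ} (w : K m γ) (i : Idx m) : FunPi :=
  (w.2.2 i.1.1 i.1.2 i.2).choose

theorem isWeakDeriv_weakDeriv {m : ℕ} {γ : ℝ} (w : K m γ) (i : Idx m) :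
    IsWeakDeriv i.1.1 i.1.2 w (weakDeriv w i) := (w.2.2 i.1.1 i.1.2 i.2).choose_spec.1

theorem weightedL2_weakDeriv {m : ℕ} {γ : ℝ} (w : K m γ) (i : Idx m) :
    WeightedL2 ((i.1.1 : ℕ) - γ) (weakDeriv w i) := (w.2.2 i.1.1 i.1.2 i.2).choose_spec.2

theorem weakDeriv_eq {m : ℕ} {γ : ℝ} (w : K m γ) (i : Idx m) {g : FunPi}
    (hg : IsWeakDeriv i.1.1 i.1.2 w g) (hg2 : WeightedL2 ((i.1.1 : ℕ) - γ) g) :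
    weakDeriv w i = g :=
  (isWeakDeriv_weakDeriv w i).unique hg (weightedL2_weakDeriv w i) hg2

/-- The family `(ψ^(p-γ) ∂_ψ^p ∂_θ^q w)_{p+q ≤ m}` in `L²(Π)`. -/
def jet (m : ℕ) (γ : ℝ) : K m γ →ₗ[ℂ] PiLp 2 (fun _ : Idx m => Lp ℂ 2 muPi) where
  toFun w := WithLp.toLp 2 fun i => (weightedL2_weakDeriv w i).toLp
  map_add' w w' := by
    ext1 i
    have e : weakDeriv (w + w') i = weakDeriv w i + weakDeriv w' i :=
      weakDeriv_eq _ _ ((isWeakDeriv_weakDeriv w i).add (isWeakDeriv_weakDeriv w' i) w.2.1 w'.2.1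
        (weightedL2_weakDeriv w i) (weightedL2_weakDeriv w' i))
        ((weightedL2_weakDeriv w i).add (weightedL2_weakDeriv w' i))
    refine Eq.trans ?_ (MemLp.toLp_add (weightedL2_weakDeriv w i) (weightedL2_weakDeriv w' i))
    refine (MemLp.toLp_eq_toLp_iff (weightedL2_weakDeriv (w + w') i) _).2 ?_
    rw [e]
    filter_upwards [AEEqFun.coeFn_add (weakDeriv w i) (weakDeriv w' i)] with x hx
    simp [hx, mul_add]
  map_smul' c w := by
    ext1 i
    have e : weakDeriv (c • w) i = c • weakDeriv w i :=
      weakDeriv_eq _ _ ((isWeakDeriv_weakDeriv w i).smul c) ((weightedL2_weakDeriv w i).smul c)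
    refine Eq.trans ?_ (MemLp.toLp_const_smul c (weightedL2_weakDeriv w i))
    refine (MemLp.toLp_eq_toLp_iff (weightedL2_weakDeriv (c • w) i) _).2 ?_
    rw [e]
    filter_upwards [AEEqFun.coeFn_smul c (weakDeriv w i)] with x hx
    simp only [hx, Pi.smul_apply, smul_eq_mul]
    ring

theorem WeightedL2.eq_zero_of_toLp {s : ℝ} {g : FunPi} (hg : WeightedL2 s g)
    (h : MemLp.toLp _ hg = 0) : g = 0 := by
  refine AEEqFun.ext (EventuallyEq.trans ?_ AEEqFun.coeFn_zero.symm)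
  have h1 := hg.coeFn_toLp
  rw [h] at h1
  filter_upwards [h1, Lp.coeFn_zero ℂ 2 muPi, ae_fst_mem] with x hx hx0 hpos
  rw [hx0] at hx
  have p : ((x.1 ^ s : ℝ) : ℂ) ≠ 0 := by exact_mod_cast (Real.rpow_pos_of_pos hpos.1 _).ne'
  simpa [p] using hx.symm

theorem jet_injective (m : ℕ) (γ : ℝ) : Function.Injective (jet m γ) := by
  refine (injective_iff_map_eq_zero _).2 ?_
  intro w hw
  let i : Idx m := ⟨(0, 0), by simp⟩
  have e : weakDeriv w i = w :=
    weakDeriv_eq w i (isWeakDeriv_zero_zero _) (by simpa [i] using w.2.1)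
  have h0 : MemLp.toLp _ (weightedL2_weakDeriv w i) = 0 :=
    congrArg (fun G : PiLp 2 (fun _ : Idx m => Lp ℂ 2 muPi) => G i) hw
  have h1 := (weightedL2_weakDeriv w i).eq_zero_of_toLp h0
  exact Subtype.ext (e.symm.trans h1)

/-- `‖w‖² = ∑_{p+q ≤ m} ‖ψ^(p-γ) ∂_ψ^p ∂_θ^q w‖²_{L²(Π)}`. -/
instance instNormedAddCommGroupK (m : ℕ) (γ : ℝ) : NormedAddCommGroup (K m γ) :=
  NormedAddCommGroup.induced _ _ (jet m γ) (jet_injective m γ)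

instance instNormedSpaceK (m : ℕ) (γ : ℝ) : NormedSpace ℂ (K m γ) :=
  NormedSpace.induced ℂ _ _ (jet m γ)

theorem norm_sq_K {m : ℕ} {γ : ℝ} (w : K m γ) :
    ‖w‖ ^ 2 = ∑ i : Idx m, ∫ x, ‖((x.1 ^ ((i.1.1 : ℕ) - γ) : ℝ) : ℂ) * weakDeriv w i x‖ ^ 2 ∂muPi := by
  change ‖jet m γ w‖ ^ 2 = _
  rw [PiLp.norm_sq_eq_of_L2]
  refine Finset.sum_congr rfl fun i _ => ?_
  change ‖MemLp.toLp _ (weightedL2_weakDeriv w i)‖ ^ 2 = _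
  rw [← inner_self_eq_norm_sq (𝕜 := ℂ), L2.inner_def, ← integral_re (L2.integrable_inner _ _)]
  refine integral_congr_ae ?_
  filter_upwards [(weightedL2_weakDeriv w i).coeFn_toLp] with x hx
  rw [hx]
  exact inner_self_eq_norm_sq (𝕜 := ℂ) _

/-! ### The Sobolev space `H^m(𝕋)` -/

theorem integrable_of_memLp_circ {v : Circ → ℂ} (h : MemLp v 2 volume) :
    Integrable v AddCircle.haarAddCircle :=
  h.haarAddCircle.integrable (by norm_num)

theorem fourierCoeff_congr_circ {f g : Circ → ℂ} (h : f =ᵐ[volume] g) :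
    fourierCoeff f = fourierCoeff g := by
  refine fourierCoeff_congr_ae ?_
  rw [AddCircle.volume_eq_smul_haarAddCircle] at h
  exact (Measure.ae_ennreal_smul_measure_iff
    (ENNReal.ofReal_pos.2 Real.two_pi_pos).ne').1 h

/-- `H^m(𝕋)`: functions `v ∈ L²(𝕋)` with `∑_k (1+k²)^m |v̂_k|² < ∞`. -/
def H (m : ℕ) : Submodule ℂ FunCirc where
  carrier := {v | MemLp v 2 volume ∧
    Memℓp (fun k : ℤ => ((1 + (k : ℝ) ^ 2) ^ ((m : ℝ) / 2) : ℝ) * fourierCoeff v k) 2}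
  zero_mem' := by
    have h0 : (0 : FunCirc) =ᵐ[volume] (0 : Circ → ℂ) := AEEqFun.coeFn_zero
    refine ⟨(MemLp.zero (ε := ℂ)).ae_eq h0.symm, ?_⟩
    rw [fourierCoeff_congr_circ h0]
    convert zero_memℓp with k
    simp [fourierCoeff]
  add_mem' := by
    rintro v v' ⟨h, hs⟩ ⟨h', hs'⟩
    refine ⟨(h.add h').ae_eq (AEEqFun.coeFn_add v v').symm, ?_⟩
    rw [fourierCoeff_congr_circ (AEEqFun.coeFn_add v v'),
      fourierCoeff.add (integrable_of_memLp_circ h) (integrable_of_memLp_circ h')]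
    convert hs.add hs' using 1
    funext k
    simp [mul_add]
  smul_mem' := by
    rintro c v ⟨h, hs⟩
    refine ⟨(h.const_smul c).ae_eq (AEEqFun.coeFn_smul c v).symm, ?_⟩
    rw [fourierCoeff_congr_circ (AEEqFun.coeFn_smul c v)]
    convert hs.const_smul c using 1
    funext k
    rw [fourierCoeff.const_smul]
    simp only [Pi.smul_apply, smul_eq_mul]
    ring

/-- The sequence `((1+k²)^(m/2) v̂_k)_k` in `ℓ²(ℤ)`. -/
def coeffs (m : ℕ) : H m →ₗ[ℂ] lp (fun _ : ℤ => ℂ) 2 where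
  toFun v := ⟨_, v.2.2⟩
  map_add' v v' := by
    ext k
    change _ * fourierCoeff ((v : FunCirc) + (v' : FunCirc) : FunCirc) k = _ * _ + _ * _
    rw [fourierCoeff_congr_circ (AEEqFun.coeFn_add (v : FunCirc) v'),
      fourierCoeff.add (integrable_of_memLp_circ v.2.1) (integrable_of_memLp_circ v'.2.1)]
    simp only [Pi.add_apply]
    ring
  map_smul' c v := by
    ext k
    change _ * fourierCoeff (c • (v : FunCirc) : FunCirc) k = c * (_ * _)
    rw [fourierCoeff_congr_circ (AEEqFun.coeFn_smul c (v : FunCirc)), fourierCoeff.const_smul]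
    simp only [smul_eq_mul]
    ring

theorem coeffs_apply {m : ℕ} (v : H m) (k : ℤ) :
    coeffs m v k = ((1 + (k : ℝ) ^ 2) ^ ((m : ℝ) / 2) : ℝ) * fourierCoeff (v : FunCirc) k := rfl

theorem coeffs_injective (m : ℕ) : Function.Injective (coeffs m) := by
  refine (injective_iff_map_eq_zero _).2 ?_
  intro v hv
  refine Subtype.ext (AEEqFun.ext (EventuallyEq.trans ?_ AEEqFun.coeFn_zero.symm))
  refine ae_eq_zero_of_fourierCoeff_eq_zero v.2.1 fun k => ?_
  have h : coeffs m v k = 0 := by rw [hv]; rfl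
  rw [coeffs_apply] at h
  have p : (((1 + (k : ℝ) ^ 2) ^ ((m : ℝ) / 2) : ℝ) : ℂ) ≠ 0 := by
    exact_mod_cast (Real.rpow_pos_of_pos (by positivity) _).ne'
  exact (mul_eq_zero.1 h).resolve_left p

/-- `‖v‖² = ∑_k (1+k²)^m |v̂_k|²`. -/
instance instNormedAddCommGroupH (m : ℕ) : NormedAddCommGroup (H m) :=
  NormedAddCommGroup.induced _ _ (coeffs m) (coeffs_injective m)

instance instNormedSpaceH (m : ℕ) : NormedSpace ℂ (H m) :=
  NormedSpace.induced ℂ _ _ (coeffs m)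

/-! ### The space `J^m_{0,γ}(Π) = H^m(𝕋) ⊕ K^m_γ(Π)` -/

/-- A function `v(θ)` regarded as a function of `(ψ,θ)`. -/
def lift : FunCirc →ₗ[ℂ] FunPi where
  toFun v := v.compQuasiMeasurePreserving Prod.snd Measure.quasiMeasurePreserving_snd
  map_add' v v' := by
    have hq := Measure.quasiMeasurePreserving_snd (μ := volume.restrict (Ioc (0 : ℝ) 1))
      (ν := (volume : Measure Circ))
    refine AEEqFun.ext ?_
    filter_upwards [AEEqFun.coeFn_compQuasiMeasurePreserving (v + v') hq,
      AEEqFun.coeFn_compQuasiMeasurePreserving v hq,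
      AEEqFun.coeFn_compQuasiMeasurePreserving v' hq, hq.ae (AEEqFun.coeFn_add v v'),
      AEEqFun.coeFn_add (v.compQuasiMeasurePreserving Prod.snd hq)
        (v'.compQuasiMeasurePreserving Prod.snd hq)] with x h1 h2 h3 h4 h5
    rw [h1, h5]
    simp only [Function.comp_apply, Pi.add_apply, h2, h3, h4]
  map_smul' c v := by
    have hq := Measure.quasiMeasurePreserving_snd (μ := volume.restrict (Ioc (0 : ℝ) 1))
      (ν := (volume : Measure Circ))
    refine AEEqFun.ext ?_
    filter_upwards [AEEqFun.coeFn_compQuasiMeasurePreserving (c • v) hq,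
      AEEqFun.coeFn_compQuasiMeasurePreserving v hq, hq.ae (AEEqFun.coeFn_smul c v),
      AEEqFun.coeFn_smul c (v.compQuasiMeasurePreserving Prod.snd hq)] with x h1 h2 h4 h5
    rw [h1]
    refine Eq.trans ?_ h5.symm
    simp only [Function.comp_apply, Pi.smul_apply, h2, h4]

theorem coeFn_lift (v : FunCirc) : lift v =ᵐ[muPi] fun x => v x.2 :=
  AEEqFun.coeFn_compQuasiMeasurePreserving v Measure.quasiMeasurePreserving_snd

/-- The map `(v,w) ↦ v(θ) + w(ψ,θ)` on `H^m(𝕋) ⊕ K^m_γ(Π)`. -/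
def sumMap (m : ℕ) (γ : ℝ) : WithLp 2 (H m × K m γ) →ₗ[ℂ] FunPi :=
  ((lift.domRestrict (H m)).coprod (K m γ).subtype) ∘ₗ
    (WithLp.linearEquiv 2 ℂ (H m × K m γ)).toLinearMap

theorem sumMap_apply {m : ℕ} {γ : ℝ} (a : WithLp 2 (H m × K m γ)) :
    sumMap m γ a = lift (a.fst : FunCirc) + (a.snd : FunPi) := rfl

/-- `J^m_{0,γ}(Π)`: functions `v(θ) + w(ψ,θ)` with `v ∈ H^m(𝕋)` and `w ∈ K^m_γ(Π)`. -/
def J0 (m : ℕ) (γ : ℝ) : Submodule ℂ FunPi := LinearMap.range (sumMap m γ)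

theorem weightedL2_lift {v : FunCirc} (hv : MemLp v 2 volume) : WeightedL2 0 (lift v) := by
  have h : MemLp (fun x : ℝ × Circ => v x.2) 2 muPi := hv.comp_snd _
  refine h.ae_eq ?_
  filter_upwards [coeFn_lift v] with x hx
  simp [hx]

theorem eq_zero_of_weightedL2_lift {γ : ℝ} (hγ : 1 / 2 < γ) {v : FunCirc}
    (h : WeightedL2 (-γ) (lift v)) : v = 0 := by
  have h1 : MemLp (fun x : ℝ × Circ => ((x.1 ^ (-γ) : ℝ) : ℂ) * v x.2) 2 muPi := by
    refine h.ae_eq ?_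
    filter_upwards [coeFn_lift v] with x hx
    rw [hx]
  have hsq := (memLp_two_iff_integrable_sq_norm h1.1).1 h1
  refine AEEqFun.ext (EventuallyEq.trans ?_ AEEqFun.coeFn_zero.symm)
  filter_upwards [hsq.prod_left_ae] with θ hθ
  by_contra hne
  change v θ ≠ 0 at hne
  have hp : (0 : ℝ) < ‖v θ‖ ^ 2 := by positivity
  have h2 : IntegrableOn (fun r : ℝ => r ^ (-2 * γ)) (Ioc 0 1) := by
    refine (hθ.mul_const (‖v θ‖ ^ 2)⁻¹).congr ?_
    filter_upwards [ae_restrict_mem measurableSet_Ioc] with r hr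
    simp only [norm_mul, Complex.norm_real, Real.norm_eq_abs, mul_pow, sq_abs]
    rw [mul_inv_cancel_right₀ hp.ne', ← Real.rpow_natCast, ← Real.rpow_mul hr.1.le]
    congr 1
    push_cast
    ring
  have h3 := (intervalIntegral.integrableOn_Ioo_rpow_iff (s := -2 * γ) one_pos).1
    (h2.mono_set Ioo_subset_Ioc_self)
  linarith

theorem sumMap_injective (m : ℕ) {γ : ℝ} (hγ : 1 / 2 < γ) :
    Function.Injective (sumMap m γ) := by
  refine (injective_iff_map_eq_zero _).2 fun a ha => ?_
  rw [sumMap_apply] at ha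
  have h1 : lift (a.fst : FunCirc) = (-1 : ℂ) • (a.snd : FunPi) := by
    rw [eq_neg_of_add_eq_zero_left ha]
    exact (neg_one_smul ℂ (a.snd : FunPi)).symm
  have h2 : WeightedL2 (-γ) (lift (a.fst : FunCirc)) := by
    rw [h1]
    exact a.snd.2.1.smul _
  have hv := eq_zero_of_weightedL2_lift hγ h2
  have hw : (a.snd : FunPi) = 0 := by
    rw [hv, map_zero, zero_add] at ha
    exact ha
  refine (WithLp.linearEquiv 2 ℂ (H m × K m γ)).injective ?_
  exact Prod.ext (Subtype.ext hv) (Subtype.ext hw)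

/-- The unique decomposition `a = v + w`, for `γ > 1/2`. -/
def decomp (m : ℕ) (γ : ℝ) [hγ : Fact (1 / 2 < γ)] : J0 m γ ≃ₗ[ℂ] WithLp 2 (H m × K m γ) :=
  (LinearEquiv.ofInjective (sumMap m γ) (sumMap_injective m hγ.out)).symm

/-- `‖v + w‖² = ‖v‖²_{H^m(𝕋)} + ‖w‖²_{K^m_γ(Π)}`. -/
instance instNormedAddCommGroupJ0 (m : ℕ) (γ : ℝ) [Fact (1 / 2 < γ)] :
    NormedAddCommGroup (J0 m γ) :=
  NormedAddCommGroup.induced _ _ (decomp m γ) (decomp m γ).injective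

instance instNormedSpaceJ0 (m : ℕ) (γ : ℝ) [Fact (1 / 2 < γ)] : NormedSpace ℂ (J0 m γ) :=
  NormedSpace.induced ℂ _ _ (decomp m γ)

theorem norm_sq_J0 {m : ℕ} {γ : ℝ} [Fact (1 / 2 < γ)] (a : J0 m γ) (v : H m) (w : K m γ)
    (h : (a : FunPi) = lift (v : FunCirc) + (w : FunPi)) : ‖a‖ ^ 2 = ‖v‖ ^ 2 + ‖w‖ ^ 2 := by
  have e : decomp m γ a = WithLp.toLp 2 (v, w) := by
    refine (LinearEquiv.symm_apply_eq _).2 (Subtype.ext ?_)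
    exact h
  change ‖decomp m γ a‖ ^ 2 = _
  rw [e, WithLp.prod_norm_sq_eq_of_L2]
  rfl

theorem J0_weightedL2 {m : ℕ} {γ : ℝ} (a : J0 m γ) : WeightedL2 |γ| (a : FunPi) := by
  obtain ⟨b, hb⟩ := a.2
  rw [← hb, sumMap_apply]
  exact ((weightedL2_lift b.fst.2.1).mono (abs_nonneg γ)).add (b.snd.2.1.mono (neg_le_abs γ))

/-! ### The space `J^{m,σ}_{0,γ}(Π)` -/

/-- `b = F⁻¹{ â_k(ψ) e^{σ|k|} }`, where `â_k(ψ)` are the Fourier coefficients of `a(ψ,·)`. -/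
def IsMultiplied (σ : ℝ) (a b : FunPi) : Prop :=
  ∀ k : ℤ, ∀ᵐ r ∂(volume.restrict (Ioc (0 : ℝ) 1)),
    fourierCoeff (fun θ : Circ => b (r, θ)) k =
      (Real.exp (σ * |(k : ℝ)|) : ℂ) * fourierCoeff (fun θ : Circ => a (r, θ)) k

theorem ae_slice {f g : ℝ × Circ → ℂ} (h : f =ᵐ[muPi] g) :
    ∀ᵐ r ∂(volume.restrict (Ioc (0 : ℝ) 1)),
      (fun θ : Circ => f (r, θ)) =ᵐ[volume] fun θ => g (r, θ) :=
  Measure.ae_ae_of_ae_prod h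

theorem fourierCoeff_slice_add {s : ℝ} {a b : FunPi} (ha : WeightedL2 s a) (hb : WeightedL2 s b) :
    ∀ᵐ r ∂(volume.restrict (Ioc (0 : ℝ) 1)), ∀ k : ℤ,
      fourierCoeff (fun θ : Circ => (a + b) (r, θ)) k =
        fourierCoeff (fun θ : Circ => a (r, θ)) k + fourierCoeff (fun θ : Circ => b (r, θ)) k := by
  filter_upwards [ae_slice (AEEqFun.coeFn_add a b), ha.ae_memLp_slice, hb.ae_memLp_slice]
    with r h1 h2 h3 k
  rw [fourierCoeff_congr_circ h1]
  exact congrFun (fourierCoeff.add (integrable_of_memLp_circ h2) (integrable_of_memLp_circ h3)) k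

theorem fourierCoeff_slice_smul (c : ℂ) (a : FunPi) :
    ∀ᵐ r ∂(volume.restrict (Ioc (0 : ℝ) 1)), ∀ k : ℤ,
      fourierCoeff (fun θ : Circ => (c • a) (r, θ)) k =
        c * fourierCoeff (fun θ : Circ => a (r, θ)) k := by
  filter_upwards [ae_slice (AEEqFun.coeFn_smul c a)] with r h1 k
  rw [fourierCoeff_congr_circ h1]
  exact fourierCoeff.const_smul _ c k

theorem fourierCoeff_slice_zero :
    ∀ᵐ r ∂(volume.restrict (Ioc (0 : ℝ) 1)), ∀ k : ℤ,
      fourierCoeff (fun θ : Circ => (0 : FunPi) (r, θ)) k = 0 := by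
  have h0 : (0 : FunPi) =ᵐ[muPi] (0 : ℝ × Circ → ℂ) := AEEqFun.coeFn_zero
  filter_upwards [ae_slice h0] with r h1 k
  rw [fourierCoeff_congr_circ h1]
  simp [fourierCoeff]

theorem IsMultiplied.zero (σ : ℝ) : IsMultiplied σ 0 0 := by
  intro k
  filter_upwards [fourierCoeff_slice_zero] with r hr
  rw [hr k, mul_zero]

theorem IsMultiplied.add {σ s : ℝ} {a b a' b' : FunPi} (h : IsMultiplied σ a b)
    (h' : IsMultiplied σ a' b') (ha : WeightedL2 s a) (ha' : WeightedL2 s a')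
    (hb : WeightedL2 s b) (hb' : WeightedL2 s b') : IsMultiplied σ (a + a') (b + b') := by
  intro k
  filter_upwards [h k, h' k, fourierCoeff_slice_add ha ha', fourierCoeff_slice_add hb hb']
    with r h1 h2 h3 h4
  rw [h3, h4, h1, h2, mul_add]

theorem IsMultiplied.smul {σ : ℝ} {a b : FunPi} (c : ℂ) (h : IsMultiplied σ a b) :
    IsMultiplied σ (c • a) (c • b) := by
  intro k
  filter_upwards [h k, fourierCoeff_slice_smul c a, fourierCoeff_slice_smul c b] with r h1 h2 h3
  rw [h2, h3, h1]
  ring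

theorem IsMultiplied.unique {σ s : ℝ} {a b b' : FunPi} (h : IsMultiplied σ a b)
    (h' : IsMultiplied σ a b') (hb : WeightedL2 s b) (hb' : WeightedL2 s b') : b = b' := by
  have hs : WeightedL2 s (b + (-1 : ℂ) • b') := hb.add (hb'.smul _)
  have h0 : b + (-1 : ℂ) • b' = 0 := by
    refine hs.eq_zero_of_fourierCoeff fun k => ?_
    filter_upwards [h k, h' k, fourierCoeff_slice_add hb (hb'.smul (-1)),
      fourierCoeff_slice_smul (-1) b'] with r h1 h2 h3 h4
    rw [h3, h4, h1, h2]
    ring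
  have hn : (-1 : ℂ) • b' = -b' := neg_one_smul ℂ b'
  rwa [hn, ← sub_eq_add_neg, sub_eq_zero] at h0

theorem IsMultiplied.eq_zero {σ s : ℝ} {a : FunPi} (h : IsMultiplied σ a 0)
    (ha : WeightedL2 s a) : a = 0 := by
  refine ha.eq_zero_of_fourierCoeff fun k => ?_
  filter_upwards [h k, fourierCoeff_slice_zero] with r h1 h2
  rw [h2 k] at h1
  exact (mul_eq_zero.1 h1.symm).resolve_left
    (by exact_mod_cast (Real.exp_pos (σ * |(k : ℝ)|)).ne')

/-- `J^{m,σ}_{0,γ}(Π)`: functions `a ∈ J^m_{0,γ}(Π)` such that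
`F⁻¹{ â_k(ψ) e^{σ|k|} } ∈ J^m_{0,γ}(Π)`. -/
def J (m : ℕ) (γ σ : ℝ) : Submodule ℂ FunPi where
  carrier := {a | a ∈ J0 m γ ∧ ∃ b ∈ J0 m γ, IsMultiplied σ a b}
  zero_mem' := ⟨zero_mem _, 0, zero_mem _, .zero σ⟩
  add_mem' := by
    rintro a a' ⟨ha, b, hb, h⟩ ⟨ha', b', hb', h'⟩
    exact ⟨add_mem ha ha', b + b', add_mem hb hb', h.add h' (J0_weightedL2 ⟨a, ha⟩)
      (J0_weightedL2 ⟨a', ha'⟩) (J0_weightedL2 ⟨b, hb⟩) (J0_weightedL2 ⟨b', hb'⟩)⟩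
  smul_mem' := by
    rintro c a ⟨ha, b, hb, h⟩
    exact ⟨Submodule.smul_mem _ c ha, c • b, Submodule.smul_mem _ c hb, h.smul c⟩

/-- The map `a ↦ F⁻¹{ â_k(ψ) e^{σ|k|} }` from `J^{m,σ}_{0,γ}(Π)` to `J^m_{0,γ}(Π)`. -/
def mult (m : ℕ) (γ σ : ℝ) : J m γ σ →ₗ[ℂ] J0 m γ where
  toFun a := ⟨a.2.2.choose, a.2.2.choose_spec.1⟩
  map_add' a a' := by
    refine Subtype.ext (IsMultiplied.unique (s := |γ|) (a + a').2.2.choose_spec.2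
      (a.2.2.choose_spec.2.add a'.2.2.choose_spec.2 (J0_weightedL2 ⟨a, a.2.1⟩)
        (J0_weightedL2 ⟨a', a'.2.1⟩) (J0_weightedL2 ⟨_, a.2.2.choose_spec.1⟩)
        (J0_weightedL2 ⟨_, a'.2.2.choose_spec.1⟩)) ?_ ?_)
    · exact J0_weightedL2 ⟨_, (a + a').2.2.choose_spec.1⟩
    · exact (J0_weightedL2 ⟨_, a.2.2.choose_spec.1⟩).add (J0_weightedL2 ⟨_, a'.2.2.choose_spec.1⟩)
  map_smul' c a := by
    refine Subtype.ext (IsMultiplied.unique (s := |γ|) (c • a).2.2.choose_spec.2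
      (a.2.2.choose_spec.2.smul c) ?_ ?_)
    · exact J0_weightedL2 ⟨_, (c • a).2.2.choose_spec.1⟩
    · exact (J0_weightedL2 ⟨_, a.2.2.choose_spec.1⟩).smul c

theorem isMultiplied_mult {m : ℕ} {γ σ : ℝ} (a : J m γ σ) :
    IsMultiplied σ (a : FunPi) (mult m γ σ a : FunPi) := a.2.2.choose_spec.2

theorem mult_injective (m : ℕ) (γ σ : ℝ) : Function.Injective (mult m γ σ) := by
  refine (injective_iff_map_eq_zero _).2 fun a ha => Subtype.ext ?_
  have h := isMultiplied_mult a
  rw [ha] at h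
  exact IsMultiplied.eq_zero h (J0_weightedL2 ⟨a, a.2.1⟩)

/-- `‖a‖ = ‖F⁻¹{ â_k(ψ) e^{σ|k|} }‖_{J^m_{0,γ}(Π)}`. -/
instance instNormedAddCommGroupJ (m : ℕ) (γ σ : ℝ) [Fact (1 / 2 < γ)] :
    NormedAddCommGroup (J m γ σ) :=
  NormedAddCommGroup.induced _ _ (mult m γ σ) (mult_injective m γ σ)

instance instNormedSpaceJ (m : ℕ) (γ σ : ℝ) [Fact (1 / 2 < γ)] : NormedSpace ℂ (J m γ σ) :=
  NormedSpace.induced ℂ _ _ (mult m γ σ)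

theorem norm_J {m : ℕ} {γ σ : ℝ} [Fact (1 / 2 < γ)] (a : J m γ σ) (b : J0 m γ)
    (h : IsMultiplied σ (a : FunPi) (b : FunPi)) : ‖a‖ = ‖b‖ := by
  have e : mult m γ σ a = b :=
    Subtype.ext ((isMultiplied_mult a).unique h (J0_weightedL2 _) (J0_weightedL2 b))
  change ‖mult m γ σ a‖ = _
  rw [e]

/-! ### Values on the closed strip -/

/-- `U` is the continuous function on `[0,1] × {|Im z| ≤ σ}`, `2π`-periodic and holomorphic in `z`
for `|Im z| < σ`, which coincides with `a` on `Π`. -/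
structure IsStripExtension (σ : ℝ) (a : FunPi) (U : ℝ → ℂ → ℂ) : Prop where
  continuousOn : ContinuousOn (Function.uncurry U) (Icc (0 : ℝ) 1 ×ˢ {z : ℂ | |z.im| ≤ σ})
  periodic : ∀ r ∈ Icc (0 : ℝ) 1, ∀ z : ℂ, |z.im| ≤ σ → U r (z + (2 * Real.pi : ℝ)) = U r z
  holomorphic : ∀ r ∈ Icc (0 : ℝ) 1, DifferentiableOn ℂ (U r) {z : ℂ | |z.im| < σ}
  ae_eq : ∀ᵐ x ∂muPi, ∀ t : ℝ, (t : Circ) = x.2 → a x = U x.1 (t : ℂ)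

/-- The functions `u ∈ J^{m,σ}_{0,γ}(Π)` whose image, on `[0,1] × {|Im z| ≤ σ}`, lies in `Ω`. -/
def imageIn (m : ℕ) (γ σ : ℝ) (Ω : Set ℂ) : Set (J m γ σ) :=
  {u | ∃ U : ℝ → ℂ → ℂ, IsStripExtension σ (u : FunPi) U ∧
    ∀ r ∈ Icc (0 : ℝ) 1, ∀ z : ℂ, |z.im| ≤ σ → U r z ∈ Ω}

end Kondratev

end

open MeasureTheory Set Filter Topology
open scoped ENNReal ContDiff

noncomputable section

namespace Kondratev

/-! Everything is read off from the Fourier coefficients in θ. A square integrable function on Π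
belongs to `J` exactly when its coefficients have the form c_k + a_k(ψ), with c in a weighted
Sobolev space of sequences (`Y`) and a in a space of sequences of functions (`X`) that is controlled
by the weight ψ^(-γ), the factor e^(σ|k|), powers of k and iterates of the Euler operator ψ∂_ψ; this
is `mem_J_iff`. The Euler operator replaces ψ^p ∂_ψ^p because it is a derivation, so that the
Leibniz rule becomes a plain recursion; `X.of_chain` and `X.exists_chain` translate between the two.

Products become convolutions. Since e^(σ|k|) is submultiplicative, Cauchy–Schwarz against ∑ (1+k²)⁻¹
gives the algebra estimate in θ (`wN_conv_le`). In ψ, one Euler derivative gives |f(ψ)|² ≤ C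
ψ^(2γ-1) (`HasDer.enorm_sq_le`), a bound that tends to 0 at ψ = 0 because γ > 1/2. With the Leibniz
rule these yield `X.cmul`, and its requirement m + 2 ≤ m + m is where m ≥ 2 enters. The product
(c+a)(d+b) splits into the boundary part cd and the decaying part cb + da + ab (`J.mul_mem`). Only
membership is proved by hand: the norm inequality follows from the closed graph theorem, used in one
factor and then in the other (`continuous_mulLin`). A bounded bilinear map is analytic.

The same bounds make ∑ û_k(ψ) e^(ikz) converge absolutely on the closed strip
(`J.exists_isStripExtension`). The extension is unique (`IsStripExtension.unique`), so evaluation at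
a point of [0,1] × strip is a character of the Banach algebra. Conversely every character is such an
evaluation (`exists_eq_ev`). On the functions e^(ikθ) it is a homomorphism of ℤ whose growth is
limited by the norms, hence e^(ikz) with |Im z| ≤ σ; on functions of ψ alone, compactness of [0,1]
and invertibility of nonvanishing functions (`S.inv`) produce a point; the two cases suffice because
Fourier series converge in `J`. By Gelfand theory an element whose extension has no zeros is
invertible (`isUnit_of_ext_ne_zero`).

For f(u), the Cauchy–Pompeiu formula applied to f times a cutoff gives f(w) = ∫_S k(z) (z-w)⁻¹ dz
for w in a neighbourhood V of the compact set of values of u, with S compact and disjoint from V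
(`exists_cauchy_kernel`). An area integral avoids any choice of contours. For z in S the element z -
u is invertible, the family of inverses is an analytic function of u with values in the Banach
algebra C(S, A), and integration against k is a bounded linear map. Characters commute with the
integral, so the result has the extension f(u(ψ,z)) (`exists_analyticAt_comp`). -/

/-! ### Locally absolutely continuous functions on `(0,1]` -/

/-- Lebesgue measure on `(0,1]`. -/
abbrev mu1 : Measure ℝ := volume.restrict (Ioc (0 : ℝ) 1)

/-- Serves to reduce complex-valued primitives to the real primitive of the norm of the integrand.
-/
theorem absolutelyContinuousOnInterval_of_dist_le {X Y : Type*} [PseudoMetricSpace X]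
    [PseudoMetricSpace Y] {f : ℝ → X} {F : ℝ → Y} {a b : ℝ}
    (hF : AbsolutelyContinuousOnInterval F a b)
    (h : ∀ x ∈ uIcc a b, ∀ y ∈ uIcc a b, dist (f x) (f y) ≤ dist (F x) (F y)) :
    AbsolutelyContinuousOnInterval f a b := by
  rw [absolutelyContinuousOnInterval_iff] at hF ⊢
  intro ε hε
  obtain ⟨δ, hδ, H⟩ := hF ε hε
  refine ⟨δ, hδ, fun E hE hs => (Finset.sum_le_sum fun i hi => ?_).trans_lt (H E hE hs)⟩
  exact h _ (hE.1 i hi).1 _ (hE.1 i hi).2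

theorem absolutelyContinuousOnInterval_integral {g : ℝ → ℂ} {a b c : ℝ}
    (h : IntervalIntegrable g volume a b) (hc : c ∈ uIcc a b) :
    AbsolutelyContinuousOnInterval (fun x => ∫ s in c..x, g s) a b := by
  refine absolutelyContinuousOnInterval_of_dist_le
    (h.norm.absolutelyContinuousOnInterval_intervalIntegral hc) fun x hx y hy => ?_
  have hi : ∀ z ∈ uIcc a b, IntervalIntegrable g volume c z := fun z hz =>
    h.mono_set (uIcc_subset_uIcc hc hz)
  rw [dist_eq_norm, dist_eq_norm, intervalIntegral.integral_interval_sub_left (hi x hx) (hi y hy),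
    intervalIntegral.integral_interval_sub_left (hi x hx).norm (hi y hy).norm]
  exact intervalIntegral.norm_integral_le_abs_integral_norm

/-- The product of the two primitives minus the primitive of the product-rule integrand is
absolutely continuous with derivative zero almost everywhere, hence constant; the constant is its
value at 1. -/
theorem primitive_mul_primitive {g g' : ℝ → ℂ} {x : ℝ} (c c' : ℂ)
    (hg : IntervalIntegrable g volume x 1) (hg' : IntervalIntegrable g' volume x 1) :
    (c - ∫ s in x..1, g s) * (c' - ∫ s in x..1, g' s) =
      c * c' - ∫ s in x..1, (g s * (c' - ∫ t in s..1, g' t) + (c - ∫ t in s..1, g t) * g' s) := by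
  have h1 : (1 : ℝ) ∈ uIcc x 1 := right_mem_uIcc
  have hx : x ∈ uIcc x 1 := left_mem_uIcc
  have key : ∀ (c : ℂ) (g : ℝ → ℂ), IntervalIntegrable g volume x 1 →
      AbsolutelyContinuousOnInterval (fun y => c - ∫ s in y..1, g s) x 1 := by
    intro c g hg
    refine absolutelyContinuousOnInterval_of_dist_le
      (absolutelyContinuousOnInterval_integral hg h1) fun y _ z _ => ?_
    rw [intervalIntegral.integral_symm 1 y, intervalIntegral.integral_symm 1 z]
    simp
  have hF := key c g hg
  have hF' := key c' g' hg'
  set F := fun y => c - ∫ s in y..1, g s with hFd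
  set F' := fun y => c' - ∫ s in y..1, g' s with hFd'
  have hi : IntervalIntegrable (fun s => g s * F' s + F s * g' s) volume x 1 :=
    (hg.mul_continuousOn hF'.continuousOn).add (hg'.continuousOn_mul hF.continuousOn)
  have hE : AbsolutelyContinuousOnInterval
      (F • F' - fun y => ∫ s in (1 : ℝ)..y, (g s * F' s + F s * g' s)) x 1 :=
    (hF.smul hF').sub (absolutelyContinuousOnInterval_integral hi h1)
  obtain ⟨C, hC⟩ := hE.const_of_ae_hasDerivAt_zero (by
    filter_upwards [hg.ae_hasDerivAt_integral, hg'.ae_hasDerivAt_integral,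
      hi.ae_hasDerivAt_integral] with y a1 a2 a3 hy
    have b1 : HasDerivAt F (g y) y := by
      have := (a1 hy 1 h1).const_add c
      refine this.congr_of_eventuallyEq (Eventually.of_forall fun z => ?_)
      simp only [hFd]
      rw [intervalIntegral.integral_symm 1 z, sub_neg_eq_add]
    have b2 : HasDerivAt F' (g' y) y := by
      have := (a2 hy 1 h1).const_add c'
      refine this.congr_of_eventuallyEq (Eventually.of_forall fun z => ?_)
      simp only [hFd']
      rw [intervalIntegral.integral_symm 1 z, sub_neg_eq_add]
    have := (b1.mul b2).sub (a3 hy 1 h1)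
    simpa using this)
  have e := (hC x hx).trans (hC 1 h1).symm
  simp only [Pi.sub_apply, Pi.mul_apply, smul_eq_mul, intervalIntegral.integral_same,
    sub_zero] at e
  rw [intervalIntegral.integral_symm x 1] at e
  have e1 : F 1 = c := by simp [hFd]
  have e2 : F' 1 = c' := by simp [hFd']
  rw [e1, e2] at e
  change F x * F' x = _
  rw [← e]
  ring

/-- `g` is the derivative of `f`, which is (almost everywhere equal to) a locally absolutely
continuous function on `(0,1]`. -/
def HasDer (f g : ℝ → ℂ) : Prop :=
  (∀ x ∈ Ioc (0 : ℝ) 1, IntegrableOn g (Ioc x 1)) ∧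
    ∃ c : ℂ, ∀ᵐ x ∂mu1, f x = c - ∫ s in x..1, g s

theorem HasDer.intervalIntegrable {f g : ℝ → ℂ} (h : HasDer f g) {x : ℝ}
    (hx : x ∈ Ioc (0 : ℝ) 1) : IntervalIntegrable g volume x 1 :=
  (intervalIntegrable_iff_integrableOn_Ioc_of_le hx.2).2 (h.1 x hx)

theorem continuousOn_primitive {g : ℝ → ℂ}
    (h : ∀ x ∈ Ioc (0 : ℝ) 1, IntegrableOn g (Ioc x 1)) (c : ℂ) :
    ContinuousOn (fun x => c - ∫ s in x..1, g s) (Ioc 0 1) := by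
  intro x hx
  -- Starting at x/2 makes the closed interval a neighbourhood of x within (0,1].
  have hx2 : x / 2 ∈ Ioc (0 : ℝ) 1 := ⟨by linarith [hx.1], by linarith [hx.1, hx.2]⟩
  have h1 := (intervalIntegrable_iff_integrableOn_Ioc_of_le hx2.2).2 (h _ hx2)
  have h2 := (absolutelyContinuousOnInterval_integral h1 right_mem_uIcc).continuousOn
  rw [uIcc_of_le hx2.2] at h2
  have h3 : ContinuousOn (fun x => c - ∫ s in x..1, g s) (Icc (x / 2) 1) := by
    refine (continuousOn_const.add h2 (g := fun x => ∫ s in (1 : ℝ)..x, g s)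
      (f := fun _ => c)).congr fun z _ => ?_
    rw [intervalIntegral.integral_symm 1 z, sub_neg_eq_add]
    rfl
  refine (h3 x ⟨by linarith [hx.1], hx.2⟩).mono_of_mem_nhdsWithin ?_
  filter_upwards [self_mem_nhdsWithin, mem_nhdsWithin_of_mem_nhds
    (lt_mem_nhds (show x / 2 < x by linarith [hx.1]))] with z hz hz2 using ⟨hz2.le, hz.2⟩

theorem HasDer.congr {f g f' g' : ℝ → ℂ} (h : HasDer f g) (hf : f =ᵐ[mu1] f')
    (hg : g =ᵐ[mu1] g') : HasDer f' g' := by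
  have hsub : ∀ x ∈ Ioc (0 : ℝ) 1, g =ᵐ[volume.restrict (Ioc x 1)] g' := fun x hx =>
    ae_restrict_of_ae_restrict_of_subset (Ioc_subset_Ioc_left hx.1.le) hg
  obtain ⟨c, hc⟩ := h.2
  refine ⟨fun x hx => (h.1 x hx).congr (hsub x hx), c, ?_⟩
  filter_upwards [hc, hf, ae_restrict_mem measurableSet_Ioc] with x h1 h2 h3
  rw [← h2, h1, intervalIntegral.integral_of_le h3.2, intervalIntegral.integral_of_le h3.2,
    integral_congr_ae (hsub x h3)]

theorem HasDer.add {f g f' g' : ℝ → ℂ} (h : HasDer f g) (h' : HasDer f' g') :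
    HasDer (fun x => f x + f' x) (fun x => g x + g' x) := by
  obtain ⟨c, hc⟩ := h.2
  obtain ⟨c', hc'⟩ := h'.2
  refine ⟨fun x hx => (h.1 x hx).add (h'.1 x hx), c + c', ?_⟩
  filter_upwards [hc, hc', ae_restrict_mem measurableSet_Ioc] with x h1 h2 h3
  rw [intervalIntegral.integral_add (h.intervalIntegrable h3) (h'.intervalIntegrable h3), h1, h2]
  ring

theorem HasDer.const_mul {f g : ℝ → ℂ} (h : HasDer f g) (a : ℂ) :
    HasDer (fun x => a * f x) (fun x => a * g x) := by
  obtain ⟨c, hc⟩ := h.2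
  refine ⟨fun x hx => (h.1 x hx).const_mul a, a * c, ?_⟩
  filter_upwards [hc] with x h1
  rw [intervalIntegral.integral_const_mul, h1]
  ring

theorem HasDer.const (a : ℂ) : HasDer (fun _ => a) (fun _ => 0) :=
  ⟨fun x _ => by simp, a, by simp⟩

theorem HasDer.conj {f g : ℝ → ℂ} (h : HasDer f g) :
    HasDer (fun x => (starRingEnd ℂ) (f x)) (fun x => (starRingEnd ℂ) (g x)) := by
  obtain ⟨c, hc⟩ := h.2
  refine ⟨fun x hx => (Complex.conjCLE.toContinuousLinearMap.integrable_comp (h.1 x hx)),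
    (starRingEnd ℂ) c, ?_⟩
  filter_upwards [hc, ae_restrict_mem measurableSet_Ioc] with x h1 h3
  rw [h1, map_sub, intervalIntegral.integral_of_le h3.2, intervalIntegral.integral_of_le h3.2,
    integral_conj]

theorem HasDer.mul {f g f' g' : ℝ → ℂ} (h : HasDer f g) (h' : HasDer f' g') :
    HasDer (fun x => f x * f' x) (fun x => g x * f' x + f x * g' x) := by
  obtain ⟨c, hc⟩ := h.2
  obtain ⟨c', hc'⟩ := h'.2
  have H : HasDer (fun x => (c - ∫ s in x..1, g s) * (c' - ∫ s in x..1, g' s))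
      (fun s => g s * (c' - ∫ t in s..1, g' t) + (c - ∫ t in s..1, g t) * g' s) := by
    refine ⟨fun x hx => ?_, c * c', ?_⟩
    · have hsub : uIcc x 1 ⊆ Ioc 0 1 := by
        rw [uIcc_of_le hx.2]
        exact fun y hy => ⟨hx.1.trans_le hy.1, hy.2⟩
      refine (intervalIntegrable_iff_integrableOn_Ioc_of_le hx.2).1 ?_
      exact ((h.intervalIntegrable hx).mul_continuousOn
        ((continuousOn_primitive h'.1 c').mono hsub)).add
        ((h'.intervalIntegrable hx).continuousOn_mul ((continuousOn_primitive h.1 c).mono hsub))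
    · filter_upwards [ae_restrict_mem measurableSet_Ioc] with x hx
      exact primitive_mul_primitive c c' (h.intervalIntegrable hx) (h'.intervalIntegrable hx)
  refine H.congr ?_ ?_
  · filter_upwards [hc, hc'] with x h1 h2
    rw [h1, h2]
  · filter_upwards [hc, hc'] with x h1 h2
    rw [h1, h2]

/-- A function of class `C¹` on `(0,1]`. -/
theorem HasDer.of_hasDerivAt {f g : ℝ → ℂ} (hf : ContinuousOn f (Ioc 0 1))
    (hg : ContinuousOn g (Ioc 0 1)) (h : ∀ x ∈ Ioo (0 : ℝ) 1, HasDerivAt f (g x) x) :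
    HasDer f g := by
  have hi : ∀ x ∈ Ioc (0 : ℝ) 1, ContinuousOn g (Icc x 1) := fun x hx =>
    hg.mono fun y hy => ⟨hx.1.trans_le hy.1, hy.2⟩
  refine ⟨fun x hx => ((hi x hx).integrableOn_Icc).mono_set Ioc_subset_Icc_self, f 1, ?_⟩
  filter_upwards [ae_restrict_mem measurableSet_Ioc] with x hx
  rw [intervalIntegral.integral_eq_sub_of_hasDerivAt_of_le hx.2 (f := f)]
  · ring
  · exact hf.mono fun z hz => ⟨hx.1.trans_le hz.1, hz.2⟩
  · exact fun y hy => h y ⟨hx.1.trans hy.1, hy.2⟩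
  · exact (intervalIntegrable_iff_integrableOn_Ioc_of_le hx.2).2
      (((hi x hx).integrableOn_Icc).mono_set Ioc_subset_Icc_self)

/-- The derivative of a sum of functions. -/
theorem HasDer.tsum {ι : Type*} [Countable ι] {f g : ι → ℝ → ℂ} (h : ∀ j, HasDer (f j) (g j))
    (hf : ∀ᵐ x ∂mu1, Summable fun j => f j x)
    (hg : ∀ x ∈ Ioc (0 : ℝ) 1, ∫⁻ s in Ioc x 1, ∑' j, ‖g j s‖ₑ ≠ ⊤) :
    HasDer (fun x => ∑' j, f j x) (fun x => ∑' j, g j x) := by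
  choose c hc using fun j => (h j).2
  have hm : ∀ x ∈ Ioc (0 : ℝ) 1, ∀ j, AEStronglyMeasurable (g j) (volume.restrict (Ioc x 1)) :=
    fun x hx j => ((h j).1 x hx).1
  have hsum : ∀ x ∈ Ioc (0 : ℝ) 1, ∑' j, ∫⁻ s in Ioc x 1, ‖g j s‖ₑ ≠ ⊤ := by
    intro x hx
    rw [← lintegral_tsum fun j => (hm x hx j).enorm]
    exact hg x hx
  have hHas : ∀ x ∈ Ioc (0 : ℝ) 1, HasSum (fun j => ∫ s in Ioc x 1, g j s)
      (∫ s in Ioc x 1, ∑' j, g j s) := by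
    intro x hx
    refine hasSum_integral_of_summable_integral_norm (fun j => (h j).1 x hx) ?_
    refine (ENNReal.summable_toReal (hsum x hx)).congr fun j => ?_
    rw [integral_norm_eq_lintegral_enorm (hm x hx j)]
  have hall := ae_all_iff.2 hc
  -- A single point at which the series converges and all representations hold is enough: it forces
  -- the constants c_j to be summable.
  have hex : ∃ x ∈ Ioc (0 : ℝ) 1, (Summable fun j => f j x) ∧
      ∀ j, f j x = c j - ∫ s in x..1, g j s := by
    have hne : (ae mu1).NeBot := by
      rw [ae_neBot]
      intro h0
      have := congrArg (fun μ : Measure ℝ => μ univ) h0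
      simp at this
    obtain ⟨x, hx⟩ := (hall.and (hf.and (ae_restrict_mem measurableSet_Ioc))).exists
    exact ⟨x, hx.2.2, hx.2.1, hx.1⟩
  obtain ⟨x₀, hx₀, hs₀, he₀⟩ := hex
  have hcs : Summable c := by
    refine (hs₀.add (hHas x₀ hx₀).summable).congr fun j => ?_
    rw [he₀ j, intervalIntegral.integral_of_le hx₀.2]
    ring
  refine ⟨fun x hx => ?_, ∑' j, c j, ?_⟩
  · refine ⟨?_, ?_⟩
    · refine AEStronglyMeasurable.congr (f := fun s => ∑' j, (hm x hx j).mk _ s) ?_ ?_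
      · exact (Measurable.tsum fun j =>
          (hm x hx j).stronglyMeasurable_mk.measurable).aestronglyMeasurable
      · filter_upwards [ae_all_iff.2 fun j => (hm x hx j).ae_eq_mk] with s hs
        exact tsum_congr fun j => (hs j).symm
    · refine lt_of_le_of_lt (lintegral_mono fun s => ?_) (lt_top_iff_ne_top.2 (hg x hx))
      exact enorm_tsum_le_tsum_enorm
  · filter_upwards [hall, ae_restrict_mem measurableSet_Ioc] with x h1 h2
    rw [intervalIntegral.integral_of_le h2.2, ← (hHas x h2).tsum_eq,
      ← hcs.tsum_sub (hHas x h2).summable]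
    refine tsum_congr fun j => ?_
    rw [h1 j, intervalIntegral.integral_of_le h2.2]

/-! ### Weighted `L²` spaces on `(0,1]` -/

theorem sq_lintegral_mul_le {α : Type*} [MeasurableSpace α] (μ : Measure α) {f g : α → ℝ≥0∞}
    (hf : AEMeasurable f μ) (hg : AEMeasurable g μ) :
    (∫⁻ a, f a * g a ∂μ) ^ 2 ≤ (∫⁻ a, f a ^ 2 ∂μ) * ∫⁻ a, g a ^ 2 ∂μ := by
  have h := ENNReal.lintegral_mul_le_Lp_mul_Lq μ Real.HolderConjugate.two_two hf hg
  simp only [ENNReal.rpow_two, Pi.mul_apply] at h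
  refine (pow_le_pow_left' h 2).trans_eq ?_
  rw [mul_pow, ← ENNReal.rpow_natCast, ← ENNReal.rpow_natCast, ← ENNReal.rpow_mul,
    ← ENNReal.rpow_mul]
  norm_num

theorem sq_tsum_mul_le {ι : Type*} (f g : ι → ℝ≥0∞) :
    (∑' i, f i * g i) ^ 2 ≤ (∑' i, f i ^ 2) * ∑' i, g i ^ 2 := by
  let _ : MeasurableSpace ι := ⊤
  have h := sq_lintegral_mul_le (Measure.count : Measure ι) (f := f) (g := g)
    measurable_from_top.aemeasurable measurable_from_top.aemeasurable
  simpa only [lintegral_count] using h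

theorem enorm_add_sq_le (a b : ℝ≥0∞) : (a + b) ^ 2 ≤ 2 * (a ^ 2 + b ^ 2) := by
  have := ENNReal.rpow_add_le_mul_rpow_add_rpow a b (p := 2) (by norm_num)
  norm_num at this
  exact this

/-- `∫_0^1 ψ^(-2γ) F dψ`. -/
def wI (γ : ℝ) (F : ℝ → ℝ≥0∞) : ℝ≥0∞ := ∫⁻ r, ENNReal.ofReal (r ^ (-2 * γ)) * F r ∂mu1

theorem wI_mono {γ : ℝ} {F G : ℝ → ℝ≥0∞} (h : ∀ᵐ r ∂mu1, F r ≤ G r) : wI γ F ≤ wI γ G := by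
  refine lintegral_mono_ae ?_
  filter_upwards [h] with r hr
  gcongr

theorem wI_congr {γ : ℝ} {F G : ℝ → ℝ≥0∞} (h : ∀ᵐ r ∂mu1, F r = G r) : wI γ F = wI γ G := by
  refine lintegral_congr_ae ?_
  filter_upwards [h] with r hr
  rw [hr]

theorem measurable_weight (γ : ℝ) : Measurable fun r : ℝ => ENNReal.ofReal (r ^ (-2 * γ)) := by
  fun_prop

theorem wI_const_mul {γ : ℝ} {F : ℝ → ℝ≥0∞} {c : ℝ≥0∞} (hc : c ≠ ⊤) :
    wI γ (fun r => c * F r) = c * wI γ F := by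
  rw [wI, wI, ← lintegral_const_mul' _ _ hc]
  exact lintegral_congr fun r => by ring

theorem wI_add {γ : ℝ} {F G : ℝ → ℝ≥0∞} (hF : AEMeasurable F mu1) :
    wI γ (fun r => F r + G r) = wI γ F + wI γ G := by
  have hm : AEMeasurable (fun r => ENNReal.ofReal (r ^ (-2 * γ)) * F r) mu1 :=
    (measurable_weight γ).aemeasurable.mul hF
  rw [wI, wI, wI, ← lintegral_add_left' hm]
  exact lintegral_congr fun r => by ring

theorem wI_tsum {ι : Type*} [Countable ι] {γ : ℝ} {F : ι → ℝ → ℝ≥0∞}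
    (hF : ∀ i, AEMeasurable (F i) mu1) :
    wI γ (fun r => ∑' i, F i r) = ∑' i, wI γ (F i) := by
  have hm : ∀ i, AEMeasurable (fun r => ENNReal.ofReal (r ^ (-2 * γ)) * F i r) mu1 :=
    fun i => (measurable_weight γ).aemeasurable.mul (hF i)
  simp only [wI]
  rw [← lintegral_tsum hm]
  exact lintegral_congr fun r => ENNReal.tsum_mul_left.symm

/-- On the interval the weight s^(-2γ) is at least y^(-2γ). The factor y^(2γ) is kept since it is
the source of the decay at ψ = 0; with y = 1 the bound gives local integrability. -/
theorem lintegral_Ioc_le_wI {γ : ℝ} (hγ : 0 ≤ γ) {x y : ℝ} (hx : 0 ≤ x) (hy : y ≤ 1)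
    (F : ℝ → ℝ≥0∞) :
    ∫⁻ s in Ioc x y, F s ≤ ENNReal.ofReal (y ^ (2 * γ)) * wI γ F := by
  have hsub : Ioc x y ⊆ Ioc 0 1 := Ioc_subset_Ioc hx hy
  calc ∫⁻ s in Ioc x y, F s
      ≤ ∫⁻ s in Ioc x y, ENNReal.ofReal (y ^ (2 * γ)) * (ENNReal.ofReal (s ^ (-2 * γ)) * F s) := by
        refine lintegral_mono_ae ?_
        filter_upwards [ae_restrict_mem measurableSet_Ioc] with s hs
        have hs0 : 0 < s := hx.trans_lt hs.1
        rw [← mul_assoc, ← ENNReal.ofReal_mul (Real.rpow_nonneg (hs0.le.trans hs.2) _)]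
        have : 1 ≤ y ^ (2 * γ) * s ^ (-2 * γ) := by
          rw [show -2 * γ = -(2 * γ) by ring, Real.rpow_neg hs0.le, ← div_eq_mul_inv,
            one_le_div (Real.rpow_pos_of_pos hs0 _)]
          exact Real.rpow_le_rpow hs0.le hs.2 (by positivity)
        calc F s = 1 * F s := (one_mul _).symm
          _ ≤ _ := by gcongr; exact ENNReal.one_le_ofReal.2 this
    _ = ENNReal.ofReal (y ^ (2 * γ)) * ∫⁻ s in Ioc x y, ENNReal.ofReal (s ^ (-2 * γ)) * F s :=
        lintegral_const_mul' _ _ ENNReal.ofReal_ne_top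
    _ ≤ _ := by
        gcongr
        exact lintegral_mono_set hsub

/-- A Sobolev inequality at scale x. For y in (x/2, x] one has |f(x)| ≤ |f(y)| + ∫ |g|/s, where 1/s
≤ 2/x; averaging over y and applying Cauchy–Schwarz bounds |f(x)|² by (2/x) times the integral of
(|f|+|g|)² over (x/2, x], and the weight contributes x^(2γ). -/
theorem HasDer.enorm_sq_le {γ : ℝ} (hγ : 0 ≤ γ) {f g : ℝ → ℂ}
    (h : HasDer f fun s => (s : ℂ)⁻¹ * g s) (hf : AEStronglyMeasurable f mu1)
    (hg : AEStronglyMeasurable g mu1) :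
    ∀ᵐ x ∂mu1, ‖f x‖ₑ ^ 2 ≤ ENNReal.ofReal (4 * x ^ (2 * γ - 1)) *
      (wI γ (fun r => ‖f r‖ₑ ^ 2) + wI γ (fun r => ‖g r‖ₑ ^ 2)) := by
  obtain ⟨c, hc⟩ := h.2
  filter_upwards [hc, ae_restrict_mem measurableSet_Ioc] with x hx hx1
  have hx0 := hx1.1
  have hsub : Ioc (x / 2) x ⊆ Ioc 0 1 := Ioc_subset_Ioc (by linarith) hx1.2
  have hle : volume.restrict (Ioc (x / 2) x) ≤ mu1 := Measure.restrict_mono hsub le_rfl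
  have hmf := (hf.mono_measure hle).enorm
  have hmg := (hg.mono_measure hle).enorm
  have step : ∀ᵐ y ∂volume.restrict (Ioc (x / 2) x),
      ‖f x‖ₑ ≤ ‖f y‖ₑ + ∫⁻ s in Ioc (x / 2) x, ‖(s : ℂ)⁻¹ * g s‖ₑ := by
    filter_upwards [ae_restrict_of_ae_restrict_of_subset hsub hc,
      ae_restrict_mem measurableSet_Ioc] with y hy hy1
    have hy2 : y ∈ Ioc (0 : ℝ) 1 := hsub hy1
    have e : f x = f y + ∫ s in y..x, (s : ℂ)⁻¹ * g s := by
      rw [hx, hy, ← intervalIntegral.integral_add_adjacent_intervals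
        ((h.intervalIntegrable hy2).trans (h.intervalIntegrable hx1).symm)
        (h.intervalIntegrable hx1)]
      ring
    calc ‖f x‖ₑ ≤ ‖f y‖ₑ + ‖∫ s in y..x, (s : ℂ)⁻¹ * g s‖ₑ := by
          rw [e]; exact enorm_add_le _ _
      _ ≤ _ := by
          gcongr
          rw [intervalIntegral.integral_of_le hy1.2]
          refine (enorm_integral_le_lintegral_enorm _).trans ?_
          exact lintegral_mono_set (Ioc_subset_Ioc_left hy1.1.le)
  have hvol : volume (Ioc (x / 2) x) = ENNReal.ofReal (x / 2) := by
    rw [Real.volume_Ioc]; congr 1; ring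
  have hk : ENNReal.ofReal (x / 2) * ∫⁻ s in Ioc (x / 2) x, ‖(s : ℂ)⁻¹ * g s‖ₑ ≤
      ∫⁻ s in Ioc (x / 2) x, ‖g s‖ₑ := by
    rw [← lintegral_const_mul' _ _ ENNReal.ofReal_ne_top]
    refine lintegral_mono_ae ?_
    filter_upwards [ae_restrict_mem measurableSet_Ioc] with s hs
    have hs0 : 0 < s := by linarith [hs.1]
    rw [enorm_mul, ← mul_assoc]
    calc ENNReal.ofReal (x / 2) * ‖(s : ℂ)⁻¹‖ₑ * ‖g s‖ₑ ≤ 1 * ‖g s‖ₑ := by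
          gcongr
          rw [← ofReal_norm, ← ENNReal.ofReal_mul (by positivity), ENNReal.ofReal_le_one,
            norm_inv, Complex.norm_real, Real.norm_of_nonneg hs0.le, ← div_eq_mul_inv,
            div_le_one hs0]
          exact hs.1.le
      _ = _ := one_mul _
  have h1 : ENNReal.ofReal (x / 2) * ‖f x‖ₑ ≤ ∫⁻ s in Ioc (x / 2) x, (‖f s‖ₑ + ‖g s‖ₑ) * 1 := by
    have := lintegral_mono_ae step
    rw [lintegral_const, Measure.restrict_apply_univ, hvol, mul_comm,
      lintegral_add_left' hmf, lintegral_const, Measure.restrict_apply_univ, hvol] at this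
    simp only [mul_one]
    rw [lintegral_add_left' hmf]
    refine this.trans ?_
    gcongr
    rw [mul_comm]
    exact hk
  have h2 : (ENNReal.ofReal (x / 2) * ‖f x‖ₑ) ^ 2 ≤
      (ENNReal.ofReal (x ^ (2 * γ)) * (2 * (wI γ (fun r => ‖f r‖ₑ ^ 2) +
        wI γ (fun r => ‖g r‖ₑ ^ 2)))) * ENNReal.ofReal (x / 2) := by
    refine (pow_le_pow_left' h1 2).trans ?_
    refine (sq_lintegral_mul_le _ (hmf.add hmg) aemeasurable_const).trans ?_
    simp only [one_pow, lintegral_const, Measure.restrict_apply_univ, one_mul, hvol]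
    gcongr
    refine (lintegral_Ioc_le_wI hγ (by positivity) hx1.2 _).trans ?_
    gcongr
    rw [← wI_add (hf.enorm.pow_const 2), ← wI_const_mul (by simp)]
    exact wI_mono (Eventually.of_forall fun r => enorm_add_sq_le _ _)
  have hp : ENNReal.ofReal (x / 2) ^ 2 ≠ 0 := by
    simp [hx0]
  have hpt : ENNReal.ofReal (x / 2) ^ 2 ≠ ⊤ := by simp
  rw [mul_pow] at h2
  refine (ENNReal.mul_le_mul_iff_right hp hpt).1 (h2.trans_eq ?_)
  have e : ENNReal.ofReal (x ^ (2 * γ)) * 2 * ENNReal.ofReal (x / 2) =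
      ENNReal.ofReal (x / 2) ^ 2 * ENNReal.ofReal (4 * x ^ (2 * γ - 1)) := by
    rw [show (2 : ℝ≥0∞) = ENNReal.ofReal 2 by simp, ← ENNReal.ofReal_mul (by positivity),
      ← ENNReal.ofReal_mul (by positivity), ← ENNReal.ofReal_pow (by positivity),
      ← ENNReal.ofReal_mul (by positivity)]
    congr 1
    rw [Real.rpow_sub hx0, Real.rpow_one]
    field_simp
    ring
  rw [← mul_assoc (ENNReal.ofReal (x / 2) ^ 2), ← e]
  ring

/-! ### Sequences of Fourier coefficients -/

/-- `∑_k (e^{σ|k|} |x_k|)²`. -/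
def wN (σ : ℝ) (x : ℤ → ℂ) : ℝ≥0∞ :=
  ∑' k : ℤ, (ENNReal.ofReal (Real.exp (σ * |(k : ℝ)|)) * ‖x k‖ₑ) ^ 2

/-- The convolution of two sequences. -/
def conv (x y : ℤ → ℂ) : ℤ → ℂ := fun k => ∑' j : ℤ, x j * y (k - j)

theorem wN_add_le (σ : ℝ) (x y : ℤ → ℂ) :
    wN σ (fun k => x k + y k) ≤ 2 * (wN σ x + wN σ y) := by
  rw [wN, wN, wN, ← ENNReal.tsum_add, ← ENNReal.tsum_mul_left]
  refine ENNReal.tsum_le_tsum fun k => (pow_le_pow_left' ?_ 2).trans (enorm_add_sq_le _ _)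
  rw [← mul_add]
  gcongr
  exact enorm_add_le _ _

theorem wN_const_mul (σ : ℝ) (c : ℂ) (x : ℤ → ℂ) :
    wN σ (fun k => c * x k) = ‖c‖ₑ ^ 2 * wN σ x := by
  rw [wN, wN, ← ENNReal.tsum_mul_left]
  refine tsum_congr fun k => ?_
  rw [enorm_mul]
  ring

theorem tsum_sq_le_wN {σ : ℝ} (hσ : 0 ≤ σ) (x : ℤ → ℂ) : ∑' k, ‖x k‖ₑ ^ 2 ≤ wN σ x := by
  refine ENNReal.tsum_le_tsum fun k => pow_le_pow_left' ?_ 2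
  calc ‖x k‖ₑ = 1 * ‖x k‖ₑ := (one_mul _).symm
    _ ≤ _ := by
      gcongr
      rw [ENNReal.one_le_ofReal, Real.one_le_exp_iff]
      positivity

/-- Termwise, a product is at most the square of the larger factor. -/
theorem tsum_enorm_conv_le (x y : ℤ → ℂ) (k : ℤ) :
    ∑' j, ‖x j * y (k - j)‖ₑ ≤ ∑' j, ‖x j‖ₑ ^ 2 + ∑' j, ‖y j‖ₑ ^ 2 := by
  rw [← (Equiv.subLeft k).tsum_eq fun j => ‖y j‖ₑ ^ 2, ← ENNReal.tsum_add]
  refine ENNReal.tsum_le_tsum fun j => ?_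
  simp only [Equiv.subLeft_apply, enorm_mul]
  rcases le_total ‖x j‖ₑ ‖y (k - j)‖ₑ with h | h
  · calc _ ≤ ‖y (k - j)‖ₑ * ‖y (k - j)‖ₑ := by gcongr
      _ = ‖y (k - j)‖ₑ ^ 2 := (sq _).symm
      _ ≤ _ := le_add_self
  · calc _ ≤ ‖x j‖ₑ * ‖x j‖ₑ := by gcongr
      _ = ‖x j‖ₑ ^ 2 := (sq _).symm
      _ ≤ _ := le_self_add

theorem summable_conv {σ : ℝ} (hσ : 0 ≤ σ) {x y : ℤ → ℂ} (hx : wN σ x ≠ ⊤) (hy : wN σ y ≠ ⊤)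
    (k : ℤ) : Summable fun j => x j * y (k - j) := by
  refine Summable.of_enorm fun h => ?_
  have h1 := tsum_enorm_conv_le x y k
  rw [h, top_le_iff, ENNReal.add_eq_top] at h1
  rcases h1 with h1 | h1
  · exact hx (top_le_iff.1 (h1 ▸ tsum_sq_le_wN hσ x))
  · exact hy (top_le_iff.1 (h1 ▸ tsum_sq_le_wN hσ y))

theorem conv_comm (x y : ℤ → ℂ) : conv x y = conv y x := by
  funext k
  rw [conv, conv, ← (Equiv.subLeft k).tsum_eq]
  refine tsum_congr fun j => ?_
  simp [mul_comm]

theorem mul_conv {σ : ℝ} (hσ : 0 ≤ σ) {x y : ℤ → ℂ} (hx : wN σ x ≠ ⊤) (hy : wN σ y ≠ ⊤)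
    (hx' : wN σ (fun k => k * x k) ≠ ⊤) (hy' : wN σ (fun k => k * y k) ≠ ⊤) (k : ℤ) :
    k * conv x y k = conv (fun k => k * x k) y k + conv x (fun k => k * y k) k := by
  rw [conv, conv, conv, ← (summable_conv hσ hx' hy k).tsum_add (summable_conv hσ hx hy' k),
    ← tsum_mul_left]
  refine tsum_congr fun j => ?_
  push_cast
  ring

/-- `∑_k (1+k²)⁻¹`. -/
def invSq : ℝ≥0∞ := ∑' k : ℤ, (1 + ‖(k : ℂ)‖ₑ ^ 2)⁻¹

theorem invSq_ne_top : invSq ≠ ⊤ := by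
  have h : Summable fun k : ℤ => (1 + (k : ℝ) ^ 2)⁻¹ := by
    have h1 : Summable fun n : ℕ => (1 + (n : ℝ) ^ 2)⁻¹ := by
      have h2 : Summable fun n : ℕ => ((n : ℝ) ^ 2)⁻¹ := Real.summable_nat_pow_inv.2 one_lt_two
      refine Summable.of_norm_bounded_eventually_nat h2 ?_
      filter_upwards [eventually_gt_atTop 0] with n hn
      have : (0 : ℝ) < n := by exact_mod_cast hn
      rw [Real.norm_of_nonneg (by positivity)]
      exact inv_anti₀ (by positivity) (by linarith)
    refine Summable.of_nat_of_neg (by simpa using h1) (by simpa using h1)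
  have e : invSq = ∑' k : ℤ, ENNReal.ofReal (1 + (k : ℝ) ^ 2)⁻¹ := by
    refine tsum_congr fun k => ?_
    rw [ENNReal.ofReal_inv_of_pos (by positivity), ENNReal.ofReal_add (by norm_num) (by positivity),
      ENNReal.ofReal_one, ← ofReal_norm, ← ENNReal.ofReal_pow (by positivity)]
    congr 3
    simp
  rw [e]
  exact h.tsum_ofReal_ne_top

/-- The triangle inequality distributes e^(σ|k|) over the two factors. Cauchy–Schwarz in j, with
weight 1 + (k-j)² given to y and its inverse to x, leaves a double sum in which the inverse weights
add up to `invSq`. Only one factor pays with a power of k. -/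
theorem wN_conv_le {σ : ℝ} (hσ : 0 ≤ σ) (x y : ℤ → ℂ) :
    wN σ (conv x y) ≤ invSq * wN σ x * (wN σ y + wN σ fun k => k * y k) := by
  set E : ℤ → ℝ≥0∞ := fun k => ENNReal.ofReal (Real.exp (σ * |(k : ℝ)|)) with hE
  set w : ℤ → ℝ≥0∞ := fun k => 1 + ‖(k : ℂ)‖ₑ ^ 2 with hw
  have hw0 : ∀ k, w k ≠ 0 := fun k => by simp [hw]
  have hwt : ∀ k, w k ≠ ⊤ := fun k => by simp [hw]
  have hsub : ∀ j k : ℤ, E k ≤ E j * E (k - j) := by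
    intro j k
    simp only [hE]
    rw [← ENNReal.ofReal_mul (Real.exp_pos _).le, ← Real.exp_add, ← mul_add]
    gcongr
    push_cast
    calc |(k : ℝ)| = |(j : ℝ) + (k - j)| := by ring_nf
      _ ≤ _ := abs_add_le _ _
  have hsum : ∑' k, w k * (E k * ‖y k‖ₑ) ^ 2 = wN σ y + wN σ fun k => k * y k := by
    rw [wN, wN, ← ENNReal.tsum_add]
    refine tsum_congr fun k => ?_
    rw [enorm_mul]
    simp only [hw, hE]
    ring
  rw [← hsum]
  have h1 : ∀ k, (E k * ‖conv x y k‖ₑ) ^ 2 ≤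
      (∑' j, (E j * ‖x j‖ₑ) ^ 2 * (w (k - j))⁻¹) * ∑' k, w k * (E k * ‖y k‖ₑ) ^ 2 := by
    intro k
    -- The weight is split as a square root in each factor of the Cauchy–Schwarz inequality.
    set s : ℤ → ℝ≥0∞ := fun k => (w k) ^ (1 / 2 : ℝ) with hs
    have hss : ∀ k, s k ^ 2 = w k := fun k => by
      simp only [hs]
      rw [← ENNReal.rpow_natCast, ← ENNReal.rpow_mul]
      norm_num
    have hs0 : ∀ k, s k ≠ 0 := fun k h => hw0 k (by rw [← hss, h]; simp)
    have hst : ∀ k, s k ≠ ⊤ := fun k h => hwt k (by rw [← hss, h]; simp)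
    have h2 : E k * ‖conv x y k‖ₑ ≤
        ∑' j, (E j * ‖x j‖ₑ * (s (k - j))⁻¹) * (s (k - j) * (E (k - j) * ‖y (k - j)‖ₑ)) := by
      calc E k * ‖conv x y k‖ₑ ≤ E k * ∑' j, ‖x j * y (k - j)‖ₑ := by
            gcongr; exact enorm_tsum_le_tsum_enorm
        _ = ∑' j, E k * ‖x j * y (k - j)‖ₑ := ENNReal.tsum_mul_left.symm
        _ ≤ _ := by
            refine ENNReal.tsum_le_tsum fun j => ?_
            rw [enorm_mul]
            calc _ ≤ (E j * E (k - j)) * (‖x j‖ₑ * ‖y (k - j)‖ₑ) := by gcongr; exact hsub j k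
              _ = (E j * ‖x j‖ₑ) * ((s (k - j))⁻¹ * s (k - j)) * (E (k - j) * ‖y (k - j)‖ₑ) := by
                  rw [ENNReal.inv_mul_cancel (hs0 _) (hst _)]; ring
              _ = _ := by ring
    refine (pow_le_pow_left' h2 2).trans ((sq_tsum_mul_le _ _).trans_eq ?_)
    congr 1
    · refine tsum_congr fun j => ?_
      rw [mul_pow, ← ENNReal.inv_pow, hss]
    · rw [← (Equiv.subLeft k).tsum_eq fun k => w k * (E k * ‖y k‖ₑ) ^ 2]
      refine tsum_congr fun j => ?_
      rw [mul_pow, hss]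
      rfl
  calc wN σ (conv x y) ≤ ∑' k, (∑' j, (E j * ‖x j‖ₑ) ^ 2 * (w (k - j))⁻¹) *
        ∑' k, w k * (E k * ‖y k‖ₑ) ^ 2 := ENNReal.tsum_le_tsum h1
    _ = invSq * wN σ x * _ := by
      rw [ENNReal.tsum_mul_right, ENNReal.tsum_comm]
      congr 1
      rw [mul_comm, wN, ← ENNReal.tsum_mul_right]
      refine tsum_congr fun j => ?_
      rw [ENNReal.tsum_mul_left]
      congr 1
      exact (Equiv.subRight j).tsum_eq fun k => (w k)⁻¹

/-! ### Scales of spaces of sequences of functions -/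

/-- Sequences of functions with `∫_0^1 ψ^(-2γ) ∑_k (e^{σ|k|}|a_k|)² dψ < ∞`. -/
def X0 (γ σ : ℝ) (a : ℤ → ℝ → ℂ) : Prop :=
  (∀ k, AEStronglyMeasurable (a k) mu1) ∧ wI γ (fun r => wN σ fun k => a k r) ≠ ⊤

/-- Sequences `a` of functions for which `k^q (ψ∂_ψ)^p a`, `p + q ≤ n`, belongs to `X0`. -/
def X (γ σ : ℝ) : ℕ → (ℤ → ℝ → ℂ) → Prop
  | 0, a => X0 γ σ a
  | n + 1, a => X0 γ σ a ∧ X γ σ n (fun k r => k * a k r) ∧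
      ∃ a', X γ σ n a' ∧ ∀ k, HasDer (a k) fun s => (s : ℂ)⁻¹ * a' k s

/-- Sequences `c` for which `∑_k (e^{σ|k|}|k|^q|c_k|)² < ∞` for `q ≤ n`. -/
def Y (σ : ℝ) : ℕ → (ℤ → ℂ) → Prop
  | 0, c => wN σ c ≠ ⊤
  | n + 1, c => wN σ c ≠ ⊤ ∧ Y σ n fun k => k * c k

theorem aemeasurable_wN {μ : Measure ℝ} (σ : ℝ) {a : ℤ → ℝ → ℂ}
    (h : ∀ k, AEStronglyMeasurable (a k) μ) : AEMeasurable (fun r => wN σ fun k => a k r) μ :=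
  AEMeasurable.tsum fun k => ((h k).enorm.const_mul _).pow_const 2

theorem aestronglyMeasurable_conv {μ : Measure ℝ} {a b : ℤ → ℝ → ℂ}
    (ha : ∀ k, AEStronglyMeasurable (a k) μ) (hb : ∀ k, AEStronglyMeasurable (b k) μ) (k : ℤ) :
    AEStronglyMeasurable (fun r => conv (fun k => a k r) (fun k => b k r) k) μ := by
  refine AEStronglyMeasurable.congr
    (f := fun s => ∑' j, ((ha j).mk _ s) * ((hb (k - j)).mk _ s)) ?_ ?_
  · exact (Measurable.tsum fun j => (ha j).stronglyMeasurable_mk.measurable.mul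
      (hb (k - j)).stronglyMeasurable_mk.measurable).aestronglyMeasurable
  · filter_upwards [ae_all_iff.2 fun j => (ha j).ae_eq_mk, ae_all_iff.2 fun j => (hb j).ae_eq_mk]
      with s h1 h2
    refine tsum_congr fun j => ?_
    rw [← h1, ← h2]

/-- Local integrability on `(0,1]` of `∑_k (e^{σ|k|}|a_k|)²`. -/
def LocX (σ : ℝ) (a : ℤ → ℝ → ℂ) : Prop :=
  (∀ k, AEStronglyMeasurable (a k) mu1) ∧
    ∀ x ∈ Ioc (0 : ℝ) 1, ∫⁻ s in Ioc x 1, wN σ (fun k => a k s) ≠ ⊤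

theorem X0.locX {γ σ : ℝ} (hγ : 0 ≤ γ) {a : ℤ → ℝ → ℂ} (h : X0 γ σ a) : LocX σ a :=
  ⟨h.1, fun _ hx => ((lintegral_Ioc_le_wI hγ hx.1.le le_rfl _).trans_lt
    (ENNReal.mul_lt_top ENNReal.ofReal_lt_top (lt_top_iff_ne_top.2 h.2))).ne⟩

/-- For γ > 1/2 a nonzero constant sequence is not in `X0`, because ψ^(-2γ) is not integrable at 0.
Local integrability is the common ground on which boundary parts and decaying parts can be
multiplied. -/
theorem locX_const {σ : ℝ} {c : ℤ → ℂ} (h : wN σ c ≠ ⊤) : LocX σ fun k _ => c k := by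
  refine ⟨fun k => aestronglyMeasurable_const, fun _ _ => ?_⟩
  rw [lintegral_const]
  exact ENNReal.mul_ne_top h (by simp)

/-- The interval (0,1] is exhausted by the intervals (1/(n+1), 1], on each of which the integral is
finite. -/
theorem LocX.ae_ne_top {σ : ℝ} {a : ℤ → ℝ → ℂ} (h : LocX σ a) :
    ∀ᵐ r ∂mu1, wN σ (fun k => a k r) ≠ ⊤ := by
  have hU : (⋃ n : ℕ, Ioc ((1 : ℝ) / (n + 1)) 1) = Ioc 0 1 := by
    ext x
    simp only [mem_iUnion, mem_Ioc, exists_and_right, and_congr_left_iff]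
    intro _
    refine ⟨fun ⟨n, hn⟩ => lt_trans (by positivity) hn, fun hx => exists_nat_one_div_lt hx⟩
  rw [mu1, ← hU, ae_restrict_iUnion_iff]
  intro n
  have hn : (1 : ℝ) / (n + 1) ∈ Ioc (0 : ℝ) 1 :=
    ⟨by positivity, by rw [div_le_one (by positivity)]; linarith [n.cast_nonneg (α := ℝ)]⟩
  have hm : AEMeasurable (fun r => wN σ fun k => a k r) (volume.restrict (Ioc (1 / (n + 1)) 1)) :=
    (aemeasurable_wN σ h.1).mono_measure (Measure.restrict_mono (Ioc_subset_Ioc_left hn.1.le) le_rfl)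
  filter_upwards [ae_lt_top' hm (h.2 _ hn)] with r hr using hr.ne

/-- The convolution is differentiated term by term. On (x,1] the factor 1/s is at most 1/x, and the
series of derivatives is dominated by the four locally integrable quadratic sums. -/
theorem hasDer_conv {σ : ℝ} (hσ : 0 ≤ σ) {a b a' b' : ℤ → ℝ → ℂ} (ha : LocX σ a) (hb : LocX σ b)
    (ha' : LocX σ a') (hb' : LocX σ b') (h : ∀ k, HasDer (a k) fun s => (s : ℂ)⁻¹ * a' k s)
    (h' : ∀ k, HasDer (b k) fun s => (s : ℂ)⁻¹ * b' k s) (k : ℤ) :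
    HasDer (fun r => conv (fun k => a k r) (fun k => b k r) k) fun s => (s : ℂ)⁻¹ *
      (conv (fun k => a' k s) (fun k => b k s) k + conv (fun k => a k s) (fun k => b' k s) k) := by
  have H := HasDer.tsum (f := fun j r => a j r * b (k - j) r) (fun j => (h j).mul (h' (k - j)))
    ?_ ?_
  · refine H.congr (Eventually.of_forall fun _ => rfl) ?_
    filter_upwards [ha.ae_ne_top, hb.ae_ne_top, ha'.ae_ne_top, hb'.ae_ne_top] with s h1 h2 h3 h4
    rw [conv, conv, ← (summable_conv hσ h3 h2 k).tsum_add (summable_conv hσ h1 h4 k),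
      ← tsum_mul_left]
    exact tsum_congr fun j => by ring
  · filter_upwards [ha.ae_ne_top, hb.ae_ne_top] with s h1 h2
    exact summable_conv hσ h1 h2 k
  · intro x hx
    have hle : volume.restrict (Ioc x 1) ≤ mu1 :=
      Measure.restrict_mono (Ioc_subset_Ioc_left hx.1.le) le_rfl
    have hm : ∀ {a : ℤ → ℝ → ℂ}, LocX σ a →
        AEMeasurable (fun s => wN σ fun k => a k s) (volume.restrict (Ioc x 1)) :=
      fun h => (aemeasurable_wN σ h.1).mono_measure hle
    have hb1 : ∀ᵐ s : ℝ ∂volume.restrict (Ioc x 1),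
        ∑' j, ‖(s : ℂ)⁻¹ * a' j s * b (k - j) s + a j s * ((s : ℂ)⁻¹ * b' (k - j) s)‖ₑ ≤
        ENNReal.ofReal x⁻¹ * ((wN σ (fun k => a' k s) + wN σ (fun k => b k s)) +
          (wN σ (fun k => a k s) + wN σ (fun k => b' k s))) := by
      filter_upwards [ae_restrict_mem measurableSet_Ioc] with s hs
      have hs0 : 0 < s := hx.1.trans hs.1
      have hsx : ‖(s : ℂ)⁻¹‖ₑ ≤ ENNReal.ofReal x⁻¹ := by
        rw [← ofReal_norm, norm_inv, Complex.norm_real, Real.norm_of_nonneg hs0.le]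
        exact ENNReal.ofReal_le_ofReal (inv_anti₀ hx.1 hs.1.le)
      calc _ ≤ ∑' j, ‖(s : ℂ)⁻¹‖ₑ * (‖a' j s * b (k - j) s‖ₑ + ‖a j s * b' (k - j) s‖ₑ) := by
            refine ENNReal.tsum_le_tsum fun j => ?_
            rw [show (s : ℂ)⁻¹ * a' j s * b (k - j) s + a j s * ((s : ℂ)⁻¹ * b' (k - j) s) =
              (s : ℂ)⁻¹ * (a' j s * b (k - j) s + a j s * b' (k - j) s) by ring, enorm_mul]
            gcongr
            exact enorm_add_le _ _
        _ ≤ _ := by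
            rw [ENNReal.tsum_mul_left, ENNReal.tsum_add]
            gcongr
            · exact (tsum_enorm_conv_le _ _ k).trans
                (add_le_add (tsum_sq_le_wN hσ _) (tsum_sq_le_wN hσ _))
            · exact (tsum_enorm_conv_le _ _ k).trans
                (add_le_add (tsum_sq_le_wN hσ _) (tsum_sq_le_wN hσ _))
    refine ((lintegral_mono_ae hb1).trans_lt ?_).ne
    have hm2 : AEMeasurable (fun s => wN σ (fun k => a' k s) + wN σ (fun k => b k s))
        (volume.restrict (Ioc x 1)) := (hm ha').add (hm hb)
    rw [lintegral_const_mul' _ _ ENNReal.ofReal_ne_top, lintegral_add_left' hm2,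
      lintegral_add_left' (hm ha'), lintegral_add_left' (hm ha)]
    refine ENNReal.mul_lt_top ENNReal.ofReal_lt_top ?_
    simp [lt_top_iff_ne_top, ha.2 x hx, hb.2 x hx, ha'.2 x hx, hb'.2 x hx]

/-! ### Linear structure and monotonicity of the scales `X` and `Y`. -/

theorem X0.congr {γ σ : ℝ} {a b : ℤ → ℝ → ℂ} (h : X0 γ σ a) (hab : ∀ k, a k =ᵐ[mu1] b k) :
    X0 γ σ b := by
  refine ⟨fun k => (h.1 k).congr (hab k), ?_⟩
  rw [← wI_congr (F := fun r => wN σ fun k => a k r)]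
  · exact h.2
  · filter_upwards [ae_all_iff.2 hab] with r hr
    simp only [hr]

theorem X.congr {γ σ : ℝ} {n : ℕ} {a b : ℤ → ℝ → ℂ} (h : X γ σ n a)
    (hab : ∀ k, a k =ᵐ[mu1] b k) : X γ σ n b := by
  induction n generalizing a b with
  | zero => exact X0.congr h hab
  | succ n ih =>
    obtain ⟨h0, h1, a', h2, h3⟩ := h
    refine ⟨h0.congr hab, ih h1 fun k => ?_, a', h2, fun k => (h3 k).congr (hab k) .rfl⟩
    filter_upwards [hab k] with r hr
    rw [hr]

theorem X0.add {γ σ : ℝ} {a b : ℤ → ℝ → ℂ} (h : X0 γ σ a) (h' : X0 γ σ b) :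
    X0 γ σ fun k r => a k r + b k r := by
  refine ⟨fun k => (h.1 k).add (h'.1 k), ?_⟩
  refine ((wI_mono (Eventually.of_forall fun r => wN_add_le σ _ _)).trans_lt ?_).ne
  rw [wI_const_mul (by simp), wI_add (aemeasurable_wN σ h.1)]
  exact ENNReal.mul_lt_top (by simp) (ENNReal.add_lt_top.2
    ⟨lt_top_iff_ne_top.2 h.2, lt_top_iff_ne_top.2 h'.2⟩)

theorem X.add {γ σ : ℝ} {n : ℕ} {a b : ℤ → ℝ → ℂ} (h : X γ σ n a) (h' : X γ σ n b) :
    X γ σ n fun k r => a k r + b k r := by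
  induction n generalizing a b with
  | zero => exact X0.add h h'
  | succ n ih =>
    obtain ⟨h0, h1, a', h2, h3⟩ := h
    obtain ⟨k0, k1, b', k2, k3⟩ := h'
    refine ⟨h0.add k0, ?_, _, ih h2 k2, fun k => ?_⟩
    · convert ih h1 k1 using 3
      ring
    · convert (h3 k).add (k3 k) using 2
      ring

theorem X0.const_mul {γ σ : ℝ} {a : ℤ → ℝ → ℂ} (h : X0 γ σ a) (c : ℂ) :
    X0 γ σ fun k r => c * a k r := by
  refine ⟨fun k => (h.1 k).const_mul c, ?_⟩
  simp only [wN_const_mul]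
  rw [wI_const_mul (by simp)]
  exact ENNReal.mul_ne_top (by simp) h.2

theorem X.const_mul {γ σ : ℝ} {n : ℕ} {a : ℤ → ℝ → ℂ} (h : X γ σ n a) (c : ℂ) :
    X γ σ n fun k r => c * a k r := by
  induction n generalizing a with
  | zero => exact X0.const_mul h c
  | succ n ih =>
    obtain ⟨h0, h1, a', h2, h3⟩ := h
    refine ⟨h0.const_mul c, ?_, _, ih h2, fun k => ?_⟩
    · convert ih h1 using 3
      ring
    · convert (h3 k).const_mul c using 2
      ring

theorem X.base {γ σ : ℝ} {n : ℕ} {a : ℤ → ℝ → ℂ} (h : X γ σ n a) : X0 γ σ a := by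
  cases n with
  | zero => exact h
  | succ n => exact h.1

theorem X.of_succ {γ σ : ℝ} {n : ℕ} {a : ℤ → ℝ → ℂ} (h : X γ σ (n + 1) a) : X γ σ n a := by
  induction n generalizing a with
  | zero => exact h.1
  | succ n ih =>
    obtain ⟨h0, h1, a', h2, h3⟩ := h
    exact ⟨h0, ih h1, a', ih h2, h3⟩

theorem X.mono {γ σ : ℝ} {n n' : ℕ} (hn : n ≤ n') {a : ℤ → ℝ → ℂ} (h : X γ σ n' a) :
    X γ σ n a := by
  induction hn with
  | refl => exact h
  | step _ ih => exact ih h.of_succ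

theorem X.mul_int {γ σ : ℝ} {n : ℕ} {a : ℤ → ℝ → ℂ} (h : X γ σ (n + 1) a) :
    X γ σ n fun k r => k * a k r := h.2.1

theorem Y.base {σ : ℝ} {n : ℕ} {c : ℤ → ℂ} (h : Y σ n c) : wN σ c ≠ ⊤ := by
  cases n with
  | zero => exact h
  | succ n => exact h.1

theorem Y.of_succ {σ : ℝ} {n : ℕ} {c : ℤ → ℂ} (h : Y σ (n + 1) c) : Y σ n c := by
  induction n generalizing c with
  | zero => exact h.1
  | succ n ih => exact ⟨h.1, ih h.2⟩

theorem Y.mono {σ : ℝ} {n n' : ℕ} (hn : n ≤ n') {c : ℤ → ℂ} (h : Y σ n' c) : Y σ n c := by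
  induction hn with
  | refl => exact h
  | step _ ih => exact ih h.of_succ

theorem Y.add {σ : ℝ} {n : ℕ} {c d : ℤ → ℂ} (h : Y σ n c) (h' : Y σ n d) :
    Y σ n fun k => c k + d k := by
  have h0 : ∀ {c d : ℤ → ℂ}, Kondratev.wN σ c ≠ ⊤ → Kondratev.wN σ d ≠ ⊤ →
      Kondratev.wN σ (fun k => c k + d k) ≠ ⊤ := fun hc hd =>
    ((wN_add_le σ _ _).trans_lt (ENNReal.mul_lt_top (by simp)
      (ENNReal.add_lt_top.2 ⟨lt_top_iff_ne_top.2 hc, lt_top_iff_ne_top.2 hd⟩))).ne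
  induction n generalizing c d with
  | zero => exact h0 h h'
  | succ n ih =>
    refine ⟨h0 h.1 h'.1, ?_⟩
    convert ih h.2 h'.2 using 2
    ring

/-- The pointwise bound for each coefficient is summed over k with the weights e^(2σ|k|); the factor
r^(2γ-1) is at most 1 since γ > 1/2. -/
theorem X.exists_wN_le {γ σ : ℝ} (hγ : 1 / 2 < γ) {a : ℤ → ℝ → ℂ} (h : X γ σ 1 a) :
    ∃ C : ℝ≥0∞, C ≠ ⊤ ∧ ∀ᵐ r ∂mu1, wN σ (fun k => a k r) ≤ C := by
  obtain ⟨h0, h1, a', h2, h3⟩ := h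
  have hsum : ∀ {a : ℤ → ℝ → ℂ}, X0 γ σ a →
      ∑' k : ℤ, ENNReal.ofReal (Real.exp (σ * |(k : ℝ)|)) ^ 2 * wI γ (fun r => ‖a k r‖ₑ ^ 2) ≠ ⊤ := by
    intro a h0
    convert h0.2 using 1
    simp only [wN]
    rw [wI_tsum fun k => ((h0.1 k).enorm.const_mul _).pow_const 2]
    refine tsum_congr fun k => ?_
    rw [← wI_const_mul (by simp)]
    simp only [mul_pow]
  refine ⟨4 * (∑' k : ℤ, ENNReal.ofReal (Real.exp (σ * |(k : ℝ)|)) ^ 2 *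
      wI γ (fun r => ‖a k r‖ₑ ^ 2) + ∑' k : ℤ, ENNReal.ofReal (Real.exp (σ * |(k : ℝ)|)) ^ 2 *
      wI γ (fun r => ‖a' k r‖ₑ ^ 2)), ?_, ?_⟩
  · exact ENNReal.mul_ne_top (by simp) (ENNReal.add_ne_top.2 ⟨hsum h0, hsum h2⟩)
  · have hk := fun k => (h3 k).enorm_sq_le (by linarith) (h0.1 k) (h2.1 k)
    filter_upwards [ae_all_iff.2 hk, ae_restrict_mem measurableSet_Ioc] with r hr hr1
    rw [wN, ← ENNReal.tsum_add, ← ENNReal.tsum_mul_left]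
    refine ENNReal.tsum_le_tsum fun k => ?_
    rw [mul_pow, ← mul_add, mul_left_comm]
    gcongr
    refine (hr k).trans ?_
    gcongr
    rw [show (4 : ℝ≥0∞) = ENNReal.ofReal 4 by simp]
    refine ENNReal.ofReal_le_ofReal ?_
    have : r ^ (2 * γ - 1) ≤ 1 := Real.rpow_le_one hr1.1.le hr1.2 (by linarith)
    linarith

/-! ### Products -/

/-- The product of two functions, in terms of their Fourier coefficients. -/
def cmul (a b : ℤ → ℝ → ℂ) : ℤ → ℝ → ℂ := fun k r => conv (fun k => a k r) (fun k => b k r) k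

theorem cmul_comm (a b : ℤ → ℝ → ℂ) : cmul a b = cmul b a := by
  funext k r
  rw [cmul, conv_comm]
  rfl

theorem X0.cmul {γ σ : ℝ} (hσ : 0 ≤ σ) {a b : ℤ → ℝ → ℂ} (ha : X0 γ σ a)
    (hb : ∀ k, AEStronglyMeasurable (b k) mu1) {C : ℝ≥0∞} (hC : C ≠ ⊤)
    (h : ∀ᵐ r ∂mu1, wN σ (fun k => b k r) + wN σ (fun k => k * b k r) ≤ C) :
    X0 γ σ (cmul a b) := by
  refine ⟨aestronglyMeasurable_conv ha.1 hb, ?_⟩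
  have : wI γ (fun r => wN σ fun k => Kondratev.cmul a b k r) ≤
      wI γ (fun r => (invSq * C) * wN σ fun k => a k r) := by
    refine wI_mono ?_
    filter_upwards [h] with r hr
    refine (wN_conv_le hσ _ _).trans ?_
    rw [mul_right_comm]
    gcongr
  rw [wI_const_mul (ENNReal.mul_ne_top invSq_ne_top hC)] at this
  exact (this.trans_lt (ENNReal.mul_lt_top (ENNReal.mul_lt_top (lt_top_iff_ne_top.2 invSq_ne_top)
    (lt_top_iff_ne_top.2 hC)) (lt_top_iff_ne_top.2 ha.2))).ne

/-- Complements `X0.cmul`: here the factor bounded in ψ is the one without a power of k, and the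
factor that carries the power of k is the one integrated against the weight. -/
theorem X.cmul_base {γ σ : ℝ} (hσ : 0 ≤ σ) {a b : ℤ → ℝ → ℂ}
    (ha : ∀ k, AEStronglyMeasurable (a k) mu1) {C : ℝ≥0∞} (hC : C ≠ ⊤)
    (h : ∀ᵐ r ∂mu1, wN σ (fun k => a k r) ≤ C) (hb : X γ σ 1 b) : X0 γ σ (cmul a b) := by
  refine ⟨aestronglyMeasurable_conv ha hb.1.1, ?_⟩
  have : wI γ (fun r => wN σ fun k => cmul a b k r) ≤
      wI γ (fun r => (invSq * C) * (wN σ (fun k => b k r) + wN σ fun k => k * b k r)) := by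
    refine wI_mono ?_
    filter_upwards [h] with r hr
    refine (wN_conv_le hσ _ _).trans ?_
    gcongr
  rw [wI_const_mul (ENNReal.mul_ne_top invSq_ne_top hC), wI_add (aemeasurable_wN σ hb.1.1)] at this
  exact (this.trans_lt (ENNReal.mul_lt_top (ENNReal.mul_lt_top (lt_top_iff_ne_top.2 invSq_ne_top)
    (lt_top_iff_ne_top.2 hC)) (ENNReal.add_lt_top.2
    ⟨lt_top_iff_ne_top.2 hb.1.2, lt_top_iff_ne_top.2 hb.2.1.2⟩))).ne

theorem LocX.mul_cmul {σ : ℝ} (hσ : 0 ≤ σ) {a b : ℤ → ℝ → ℂ} (ha : LocX σ a) (hb : LocX σ b)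
    (ha' : LocX σ fun k r => k * a k r) (hb' : LocX σ fun k r => k * b k r) (k : ℤ) :
    (fun r => cmul (fun k r => k * a k r) b k r + cmul a (fun k r => k * b k r) k r)
      =ᵐ[mu1] fun r => k * cmul a b k r := by
  filter_upwards [ha.ae_ne_top, hb.ae_ne_top, ha'.ae_ne_top, hb'.ae_ne_top] with r h1 h2 h3 h4
  exact (mul_conv hσ h1 h2 h3 h4 k).symm

/-- The Leibniz rule. -/
theorem X.cmul_succ {γ σ : ℝ} (hσ : 0 ≤ σ) {n : ℕ} {a b a' b' : ℤ → ℝ → ℂ} (ha : LocX σ a)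
    (hb : LocX σ b) (hka : LocX σ fun k r => k * a k r) (hkb : LocX σ fun k r => k * b k r)
    (ha' : LocX σ a') (hb' : LocX σ b') (h : ∀ k, HasDer (a k) fun s => (s : ℂ)⁻¹ * a' k s)
    (h' : ∀ k, HasDer (b k) fun s => (s : ℂ)⁻¹ * b' k s) (h0 : X0 γ σ (cmul a b))
    (h1 : X γ σ n (cmul (fun k r => k * a k r) b)) (h2 : X γ σ n (cmul a fun k r => k * b k r))
    (h3 : X γ σ n (cmul a' b)) (h4 : X γ σ n (cmul a b')) : X γ σ (n + 1) (cmul a b) :=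
  ⟨h0, (h1.add h2).congr (ha.mul_cmul hσ hb hka hkb), _, h3.add h4,
    hasDer_conv hσ ha hb ha' hb' h h'⟩

/-- The two orders in excess pay for boundedness in ψ and for summability in k; at n = 0 both may
come from one factor or one from each. Every Leibniz term lowers n by one and exactly one of s, t by
one, so the three inequalities survive the induction. -/
theorem X.cmul {γ σ : ℝ} (hγ : 1 / 2 < γ) (hσ : 0 ≤ σ) {n s t : ℕ} {a b : ℤ → ℝ → ℂ}
    (ha : X γ σ s a) (hb : X γ σ t b) (hs : n ≤ s) (ht : n ≤ t) (hst : n + 2 ≤ s + t) :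
    X γ σ n (cmul a b) := by
  have hγ0 : 0 ≤ γ := by linarith
  have base : ∀ {s t : ℕ} {a b : ℤ → ℝ → ℂ}, X γ σ s a → X γ σ t b → 2 ≤ s + t →
      X0 γ σ (Kondratev.cmul a b) := by
    have two : ∀ {a b : ℤ → ℝ → ℂ}, X0 γ σ a → X γ σ 2 b → X0 γ σ (Kondratev.cmul a b) := by
      intro a b ha hb
      obtain ⟨C, hC, h1⟩ := hb.of_succ.exists_wN_le hγ
      obtain ⟨C', hC', h2⟩ := hb.mul_int.exists_wN_le hγ
      refine ha.cmul hσ hb.1.1 (ENNReal.add_ne_top.2 ⟨hC, hC'⟩) ?_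
      filter_upwards [h1, h2] with r k1 k2 using add_le_add k1 k2
    intro s t a b ha hb hst
    rcases Nat.lt_or_ge s 1 with hs | hs
    · exact two ha.base (hb.mono (by omega))
    rcases Nat.lt_or_ge t 1 with ht | ht
    · rw [cmul_comm]
      exact two hb.base (ha.mono (by omega))
    · obtain ⟨C, hC, h1⟩ := (ha.mono hs).exists_wN_le hγ
      exact X.cmul_base hσ ha.base.1 hC h1 (hb.mono ht)
  induction n generalizing s t a b with
  | zero => exact base ha hb (by omega)
  | succ n ih =>
    obtain ⟨s, rfl⟩ := Nat.exists_eq_add_of_le' (by omega : 1 ≤ s)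
    obtain ⟨t, rfl⟩ := Nat.exists_eq_add_of_le' (by omega : 1 ≤ t)
    obtain ⟨a', k2, k3⟩ := ha.2.2
    obtain ⟨b', l2, l3⟩ := hb.2.2
    refine X.cmul_succ hσ (ha.base.locX hγ0) (hb.base.locX hγ0) (ha.mul_int.base.locX hγ0)
      (hb.mul_int.base.locX hγ0) (k2.base.locX hγ0) (l2.base.locX hγ0) k3 l3
      (base ha hb (by omega)) ?_ ?_ ?_ ?_
    · exact ih ha.mul_int hb (by omega) (by omega) (by omega)
    · exact ih ha hb.mul_int (by omega) (by omega) (by omega)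
    · exact ih k2 hb (by omega) (by omega) (by omega)
    · exact ih ha l2 (by omega) (by omega) (by omega)

theorem X.zero {γ σ : ℝ} (n : ℕ) : X γ σ n fun _ _ => 0 := by
  have h0 : X0 γ σ fun _ _ => 0 := ⟨fun _ => aestronglyMeasurable_const, by simp [wN, wI]⟩
  induction n with
  | zero => exact h0
  | succ n ih =>
    refine ⟨h0, ?_, _, ih, fun k => ?_⟩
    · simpa using ih
    · simpa using HasDer.const 0

/-- One excess order suffices, since a factor independent of ψ is bounded in ψ for free. -/
theorem X.cmul_const {γ σ : ℝ} (hγ : 1 / 2 < γ) (hσ : 0 ≤ σ) {n s t : ℕ} {c : ℤ → ℂ}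
    {b : ℤ → ℝ → ℂ} (hc : Y σ s c) (hb : X γ σ t b) (hs : n ≤ s) (ht : n ≤ t)
    (hst : n + 1 ≤ s + t) : X γ σ n (Kondratev.cmul (fun k _ => c k) b) := by
  have hγ0 : 0 ≤ γ := by linarith
  have base : ∀ {s t : ℕ} {c : ℤ → ℂ} {b : ℤ → ℝ → ℂ}, Y σ s c → X γ σ t b → 1 ≤ s + t →
      X0 γ σ (Kondratev.cmul (fun k _ => c k) b) := by
    intro s t c b hc hb hst
    rcases Nat.lt_or_ge s 1 with hs | hs
    · exact X.cmul_base hσ (fun k => aestronglyMeasurable_const) hc.base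
        (Eventually.of_forall fun r => le_rfl) (hb.mono (by omega))
    · rw [cmul_comm]
      obtain ⟨h1, h2⟩ := hc.mono hs
      exact hb.base.cmul hσ (fun k => aestronglyMeasurable_const) (ENNReal.add_ne_top.2 ⟨h1, h2⟩)
        (Eventually.of_forall fun r => le_rfl)
  induction n generalizing s t c b with
  | zero => exact base hc hb (by omega)
  | succ n ih =>
    obtain ⟨s, rfl⟩ := Nat.exists_eq_add_of_le' (by omega : 1 ≤ s)
    obtain ⟨t, rfl⟩ := Nat.exists_eq_add_of_le' (by omega : 1 ≤ t)
    obtain ⟨b', l2, l3⟩ := hb.2.2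
    -- The Euler derivative of a factor independent of ψ is zero, so one of the four Leibniz terms
    -- disappears.
    refine X.cmul_succ (a' := fun _ _ => 0) hσ (locX_const hc.base) (hb.base.locX hγ0)
      (locX_const hc.2.base) (hb.mul_int.base.locX hγ0) ?_ (l2.base.locX hγ0)
      (fun k => ?_) l3 (base hc hb (by omega)) ?_ ?_ ?_ ?_
    · exact (X.zero (γ := γ) 0).base.locX hγ0
    · simpa using HasDer.const (c k)
    · exact ih hc.2 hb (by omega) (by omega) (by omega)
    · exact ih hc hb.mul_int (by omega) (by omega) (by omega)
    · convert X.zero n using 3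
      simp [Kondratev.cmul, conv]
    · exact ih hc l2 (by omega) (by omega) (by omega)

theorem Y.conv {σ : ℝ} (hσ : 0 ≤ σ) {n s t : ℕ} {c d : ℤ → ℂ} (hc : Y σ s c) (hd : Y σ t d)
    (hs : n ≤ s) (ht : n ≤ t) (hst : n + 1 ≤ s + t) : Y σ n (conv c d) := by
  have base : ∀ {s t : ℕ} {c d : ℤ → ℂ}, Y σ s c → Y σ t d → 1 ≤ s + t →
      wN σ (Kondratev.conv c d) ≠ ⊤ := by
    have one : ∀ {c d : ℤ → ℂ}, wN σ c ≠ ⊤ → Y σ 1 d → wN σ (Kondratev.conv c d) ≠ ⊤ :=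
      fun hc hd => ((wN_conv_le hσ _ _).trans_lt (ENNReal.mul_lt_top (ENNReal.mul_lt_top
        (lt_top_iff_ne_top.2 invSq_ne_top) (lt_top_iff_ne_top.2 hc)) (ENNReal.add_lt_top.2
        ⟨lt_top_iff_ne_top.2 hd.1, lt_top_iff_ne_top.2 hd.2⟩))).ne
    intro s t c d hc hd hst
    rcases Nat.lt_or_ge t 1 with ht | ht
    · rw [conv_comm]
      exact one hd.base (hc.mono (by omega))
    · exact one hc.base (hd.mono ht)
  induction n generalizing s t c d with
  | zero => exact base hc hd (by omega)
  | succ n ih =>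
    obtain ⟨s, rfl⟩ := Nat.exists_eq_add_of_le' (by omega : 1 ≤ s)
    obtain ⟨t, rfl⟩ := Nat.exists_eq_add_of_le' (by omega : 1 ≤ t)
    refine ⟨base hc hd (by omega), ?_⟩
    simp only [mul_conv hσ hc.base hd.base hc.2.base hd.2.base]
    exact (ih hc.2 hd (by omega) (by omega) (by omega)).add
      (ih hc hd.2 (by omega) (by omega) (by omega))

/-! ### The one-dimensional spaces -/

theorem eqOn_of_ae_eq {X : Type*} [TopologicalSpace X] [T2Space X] {f g : ℝ → X}
    (hf : ContinuousOn f (Ioc 0 1)) (hg : ContinuousOn g (Ioc 0 1)) (h : f =ᵐ[mu1] g) :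
    EqOn f g (Ioc 0 1) :=
  Measure.eqOn_Ioc_of_ae_eq volume h hf hg

/-- The inequality is the equation max(f,g) = g between continuous functions. -/
theorem le_of_ae_le {f g : ℝ → ℝ} (hf : ContinuousOn f (Ioc 0 1)) (hg : ContinuousOn g (Ioc 0 1))
    (h : ∀ᵐ r ∂mu1, f r ≤ g r) : ∀ r ∈ Ioc (0 : ℝ) 1, f r ≤ g r := by
  have := eqOn_of_ae_eq (f := fun r => max (f r) (g r)) (hf.sup hg) hg
    (by filter_upwards [h] with r hr using max_eq_right hr)
  exact fun r hr => max_eq_right_iff.1 (this hr)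

theorem HasDer.exists_continuousOn {f g : ℝ → ℂ} (h : HasDer f g) {M β : ℝ} (hβ : 0 < β)
    (hM : ∀ᵐ r ∂mu1, ‖f r‖ ≤ M * r ^ β) :
    ∃ F : ℝ → ℂ, ContinuousOn F (Icc 0 1) ∧ f =ᵐ[mu1] F ∧ ∀ r ∈ Icc (0 : ℝ) 1,
      ‖F r‖ ≤ M * r ^ β := by
  obtain ⟨c, hc⟩ := h.2
  -- The value 0 at the origin is forced by the bound M r^β with β > 0, and it makes the
  -- representative continuous on all of [0,1].
  set F : ℝ → ℂ := fun x => if x ≤ 0 then 0 else c - ∫ s in x..1, g s with hF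
  have hFe : ∀ x ∈ Ioc (0 : ℝ) 1, F x = c - ∫ s in x..1, g s := fun x hx => if_neg (not_le.2 hx.1)
  have hcont : ContinuousOn F (Ioc 0 1) := (continuousOn_primitive h.1 c).congr hFe
  have hae : f =ᵐ[mu1] F := by
    filter_upwards [hc, ae_restrict_mem measurableSet_Ioc] with x h1 h2
    rw [h1, hFe x h2]
  have hr : Continuous fun r : ℝ => r ^ β := Real.continuous_rpow_const hβ.le
  have hb1 : ∀ r ∈ Ioc (0 : ℝ) 1, ‖F r‖ ≤ M * r ^ β := by
    refine le_of_ae_le hcont.norm (hr.const_mul M).continuousOn ?_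
    filter_upwards [hM, hae] with r h1 h2
    rwa [← h2]
  have h0 : F 0 = 0 := if_pos le_rfl
  have hb : ∀ r ∈ Icc (0 : ℝ) 1, ‖F r‖ ≤ M * r ^ β := by
    intro r hr
    rcases hr.1.eq_or_lt with h1 | h1
    · rw [← h1, h0, Real.zero_rpow hβ.ne']
      simp
    · exact hb1 r ⟨h1, hr.2⟩
  refine ⟨F, fun x hx => ?_, hae, hb⟩
  rcases hx.1.eq_or_lt with h1 | h1
  · rw [← h1, ContinuousWithinAt, h0]
    refine squeeze_zero_norm' (eventually_mem_nhdsWithin.mono hb) ?_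
    have : Tendsto (fun r : ℝ => M * r ^ β) (𝓝[Icc 0 1] 0) (𝓝 (M * 0 ^ β)) :=
      ((hr.const_mul M).tendsto 0).mono_left nhdsWithin_le_nhds
    rwa [Real.zero_rpow hβ.ne', mul_zero] at this
  · refine (hcont x ⟨h1, hx.2⟩).mono_of_mem_nhdsWithin ?_
    filter_upwards [self_mem_nhdsWithin, mem_nhdsWithin_of_mem_nhds (lt_mem_nhds h1)] with z hz hz2
      using ⟨hz2, hz.2⟩

/-- Functions with `∫_0^1 ψ^(-2γ) |f|² dψ < ∞`. -/
def S0 (γ : ℝ) (f : ℝ → ℂ) : Prop :=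
  AEStronglyMeasurable f mu1 ∧ wI γ (fun r => ‖f r‖ₑ ^ 2) ≠ ⊤

/-- Functions `f` for which `(ψ∂_ψ)^p f`, `p ≤ n`, belongs to `S0`. -/
def S (γ : ℝ) : ℕ → (ℝ → ℂ) → Prop
  | 0, f => S0 γ f
  | n + 1, f => S0 γ f ∧ ∃ g, S γ n g ∧ HasDer f fun s => (s : ℂ)⁻¹ * g s

theorem S.base {γ : ℝ} {n : ℕ} {f : ℝ → ℂ} (h : S γ n f) : S0 γ f := by
  cases n with
  | zero => exact h
  | succ n => exact h.1

theorem S.of_succ {γ : ℝ} {n : ℕ} {f : ℝ → ℂ} (h : S γ (n + 1) f) : S γ n f := by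
  induction n generalizing f with
  | zero => exact h.1
  | succ n ih =>
    obtain ⟨h0, g, h2, h3⟩ := h
    exact ⟨h0, g, ih h2, h3⟩

theorem S.mono {γ : ℝ} {n n' : ℕ} (hn : n ≤ n') {f : ℝ → ℂ} (h : S γ n' f) : S γ n f := by
  induction hn with
  | refl => exact h
  | step _ ih => exact ih h.of_succ

theorem S0.mul_bdd {γ : ℝ} {f h : ℝ → ℂ} (hf : S0 γ f) (hh : AEStronglyMeasurable h mu1) {C : ℝ}
    (hC : ∀ᵐ r ∂mu1, ‖h r‖ ≤ C) : S0 γ fun r => h r * f r := by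
  refine ⟨hh.mul hf.1, ?_⟩
  have : wI γ (fun r => ‖h r * f r‖ₑ ^ 2) ≤
      wI γ (fun r => ENNReal.ofReal C ^ 2 * ‖f r‖ₑ ^ 2) := by
    refine wI_mono ?_
    filter_upwards [hC] with r hr
    rw [enorm_mul, mul_pow]
    gcongr
    rw [← ofReal_norm]
    exact ENNReal.ofReal_le_ofReal hr
  rw [wI_const_mul (by simp)] at this
  exact (this.trans_lt (ENNReal.mul_lt_top (by simp) (lt_top_iff_ne_top.2 hf.2))).ne

theorem S0.add {γ : ℝ} {f g : ℝ → ℂ} (hf : S0 γ f) (hg : S0 γ g) : S0 γ fun r => f r + g r := by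
  refine ⟨hf.1.add hg.1, ?_⟩
  have : wI γ (fun r => ‖f r + g r‖ₑ ^ 2) ≤
      wI γ (fun r => 2 * (‖f r‖ₑ ^ 2 + ‖g r‖ₑ ^ 2)) :=
    wI_mono (Eventually.of_forall fun r =>
      (pow_le_pow_left' (enorm_add_le _ _) 2).trans (enorm_add_sq_le _ _))
  rw [wI_const_mul (by simp), wI_add (hf.1.enorm.pow_const 2)] at this
  exact (this.trans_lt (ENNReal.mul_lt_top (by simp)
    (ENNReal.add_lt_top.2 ⟨lt_top_iff_ne_top.2 hf.2, lt_top_iff_ne_top.2 hg.2⟩))).ne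

theorem S0.congr {γ : ℝ} {f g : ℝ → ℂ} (hf : S0 γ f) (h : f =ᵐ[mu1] g) : S0 γ g := by
  refine ⟨hf.1.congr h, ?_⟩
  rw [← wI_congr (F := fun r => ‖f r‖ₑ ^ 2)]
  · exact hf.2
  · filter_upwards [h] with r hr
    rw [hr]

theorem S.congr {γ : ℝ} {n : ℕ} {f g : ℝ → ℂ} (hf : S γ n f) (h : f =ᵐ[mu1] g) : S γ n g := by
  cases n with
  | zero => exact S0.congr hf h
  | succ n =>
    obtain ⟨h0, f', h1, h2⟩ := hf
    exact ⟨h0.congr h, f', h1, h2.congr h .rfl⟩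

theorem S.add {γ : ℝ} {n : ℕ} {f g : ℝ → ℂ} (hf : S γ n f) (hg : S γ n g) :
    S γ n fun r => f r + g r := by
  induction n generalizing f g with
  | zero => exact S0.add hf hg
  | succ n ih =>
    obtain ⟨h0, f', h1, h2⟩ := hf
    obtain ⟨k0, g', k1, k2⟩ := hg
    refine ⟨h0.add k0, _, ih h1 k1, ?_⟩
    convert h2.add k2 using 2
    ring

theorem S.const_mul {γ : ℝ} {n : ℕ} {f : ℝ → ℂ} (hf : S γ n f) (c : ℂ) :
    S γ n fun r => c * f r := by
  have h0 : ∀ {f : ℝ → ℂ}, S0 γ f → S0 γ fun r => c * f r := fun hf =>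
    hf.mul_bdd aestronglyMeasurable_const (Eventually.of_forall fun _ => le_rfl)
  induction n generalizing f with
  | zero => exact h0 hf
  | succ n ih =>
    obtain ⟨hf0, f', h1, h2⟩ := hf
    refine ⟨h0 hf0, _, ih h1, ?_⟩
    convert h2.const_mul c using 2
    ring

theorem S.conj {γ : ℝ} {n : ℕ} {f : ℝ → ℂ} (hf : S γ n f) :
    S γ n fun r => (starRingEnd ℂ) (f r) := by
  have h0 : ∀ {f : ℝ → ℂ}, S0 γ f → S0 γ fun r => (starRingEnd ℂ) (f r) := by
    refine fun {f} hf => ⟨Complex.continuous_conj.comp_aestronglyMeasurable hf.1, ?_⟩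
    have e : ∀ r, ‖(starRingEnd ℂ) (f r)‖ₑ = ‖f r‖ₑ := fun r => by
      rw [← ofReal_norm, ← ofReal_norm, RCLike.norm_conj]
    simpa only [e] using hf.2
  induction n generalizing f with
  | zero => exact h0 hf
  | succ n ih =>
    obtain ⟨hf0, f', h1, h2⟩ := hf
    refine ⟨h0 hf0, _, ih h1, ?_⟩
    convert h2.conj using 2
    simp

theorem S.exists_norm_le {γ : ℝ} (hγ : 1 / 2 < γ) {f : ℝ → ℂ} (h : S γ 1 f) :
    ∃ M : ℝ, 0 ≤ M ∧ ∀ᵐ r ∂mu1, ‖f r‖ ≤ M * r ^ (γ - 1 / 2) := by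
  obtain ⟨h0, g, h1, h2⟩ := h
  set A := wI γ (fun r => ‖f r‖ₑ ^ 2) + wI γ (fun r => ‖g r‖ₑ ^ 2) with hA
  have hAt : A ≠ ⊤ := ENNReal.add_ne_top.2 ⟨h0.2, h1.2⟩
  refine ⟨√(4 * A.toReal), by positivity, ?_⟩
  filter_upwards [h2.enorm_sq_le (by linarith) h0.1 h1.1, ae_restrict_mem measurableSet_Ioc]
    with r hr hr0
  have e : r ^ (2 * γ - 1) = (r ^ (γ - 1 / 2)) ^ 2 := by
    rw [← Real.rpow_natCast, ← Real.rpow_mul hr0.1.le]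
    congr 1
    push_cast
    ring
  have hp : 0 ≤ r ^ (γ - 1 / 2) := Real.rpow_nonneg hr0.1.le _
  refine abs_le_of_sq_le_sq' ?_ (by positivity) |>.2
  rw [mul_pow, Real.sq_sqrt (by positivity)]
  rw [← hA, ← ENNReal.ofReal_toReal hAt, ← ENNReal.ofReal_mul (by rw [e]; positivity),
    ← ofReal_norm, ← ENNReal.ofReal_pow (norm_nonneg _), e] at hr
  have := (ENNReal.ofReal_le_ofReal_iff (by positivity)).1 hr
  linarith

theorem S.exists_bound {γ : ℝ} (hγ : 1 / 2 < γ) {f : ℝ → ℂ} (h : S γ 1 f) :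
    ∃ M : ℝ, ∀ᵐ r ∂mu1, ‖f r‖ ≤ M := by
  obtain ⟨M, hM, h1⟩ := h.exists_norm_le hγ
  refine ⟨M, ?_⟩
  filter_upwards [h1, ae_restrict_mem measurableSet_Ioc] with r hr hr0
  have : r ^ (γ - 1 / 2) ≤ 1 := Real.rpow_le_one hr0.1.le hr0.2 (by linarith)
  nlinarith

theorem S.exists_continuousOn {γ : ℝ} (hγ : 1 / 2 < γ) {f : ℝ → ℂ} (h : S γ 1 f) :
    ∃ F : ℝ → ℂ, ContinuousOn F (Icc 0 1) ∧ f =ᵐ[mu1] F ∧ F 0 = 0 := by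
  obtain ⟨M, hM, h1⟩ := h.exists_norm_le hγ
  obtain ⟨h0, g, h3, h2⟩ := h
  obtain ⟨F, hF, h4, h5⟩ := h2.exists_continuousOn (by linarith : 0 < γ - 1 / 2) h1
  refine ⟨F, hF, h4, ?_⟩
  have := h5 0 (by simp)
  rw [Real.zero_rpow (by linarith), mul_zero] at this
  exact norm_le_zero_iff.1 this

/-- The induction is that of `X.cmul`; without the variable θ one excess order, which makes one
factor bounded, is enough. -/
theorem S.mul {γ : ℝ} (hγ : 1 / 2 < γ) {n s t : ℕ} {f g : ℝ → ℂ} (hf : S γ s f) (hg : S γ t g)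
    (hs : n ≤ s) (ht : n ≤ t) (hst : n + 1 ≤ s + t) : S γ n fun r => f r * g r := by
  have base : ∀ {s t : ℕ} {f g : ℝ → ℂ}, S γ s f → S γ t g → 1 ≤ s + t →
      S0 γ fun r => f r * g r := by
    intro s t f g hf hg hst
    rcases Nat.lt_or_ge s 1 with hs | hs
    · obtain ⟨M, hM⟩ := (hg.mono (by omega : 1 ≤ t)).exists_bound hγ
      simp_rw [mul_comm (f _)]
      exact hf.base.mul_bdd hg.base.1 hM
    · obtain ⟨M, hM⟩ := (hf.mono hs).exists_bound hγ
      exact hg.base.mul_bdd hf.base.1 hM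
  induction n generalizing s t f g with
  | zero => exact base hf hg (by omega)
  | succ n ih =>
    obtain ⟨s, rfl⟩ := Nat.exists_eq_add_of_le' (by omega : 1 ≤ s)
    obtain ⟨t, rfl⟩ := Nat.exists_eq_add_of_le' (by omega : 1 ≤ t)
    obtain ⟨f', k2, k3⟩ := hf.2
    obtain ⟨g', l2, l3⟩ := hg.2
    refine ⟨base hf hg (by omega), _, (ih k2 hg (by omega) (by omega) (by omega)).add
      (ih hf l2 (by omega) (by omega) (by omega)), ?_⟩
    convert k3.mul l3 using 2
    ring

/-- The reciprocal of a nonvanishing function of the form `c + f`. -/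
theorem S.inv {γ : ℝ} (hγ : 1 / 2 < γ) {m : ℕ} (hm : 1 < m) {c : ℂ} (hc : c ≠ 0) {F : ℝ → ℂ}
    (hF : S γ m F) (hcont : ContinuousOn F (Icc 0 1)) (hne : ∀ r ∈ Icc (0 : ℝ) 1, c + F r ≠ 0) :
    S γ m fun r => (c + F r)⁻¹ - c⁻¹ := by
  obtain ⟨m, rfl⟩ := Nat.exists_eq_add_of_le' (by omega : 2 ≤ m)
  obtain ⟨hF0, g, hg, hd⟩ := hF
  -- As the order is at least 2, the Euler derivative has a continuous representative, so F is of
  -- class C¹ inside the interval and the reciprocal can be differentiated classically.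
  obtain ⟨G, hG, hgG, -⟩ := (hg.mono (by omega : 1 ≤ m + 1)).exists_continuousOn hγ
  replace hg : S γ (m + 1) G := hg.congr hgG
  replace hd : HasDer F fun s => (s : ℂ)⁻¹ * G s := hd.congr .rfl
    (by filter_upwards [hgG] with r hr; rw [hr])
  have hsub : Ioc (0 : ℝ) 1 ⊆ Icc 0 1 := Ioc_subset_Icc_self
  have hGc : ContinuousOn (fun s : ℝ => (s : ℂ)⁻¹ * G s) (Ioc 0 1) := by
    refine ContinuousOn.mul (ContinuousOn.inv₀ (by fun_prop) fun x hx => ?_) (hG.mono hsub)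
    exact_mod_cast hx.1.ne'
  obtain ⟨C, hC⟩ := hd.2
  have hFe := eqOn_of_ae_eq (hcont.mono hsub) (continuousOn_primitive hd.1 C) hC
  have hder : ∀ x ∈ Ioo (0 : ℝ) 1, HasDerivAt F ((x : ℂ)⁻¹ * G x) x := by
    intro x hx
    have hx1 : x ∈ Ioc (0 : ℝ) 1 := ⟨hx.1, hx.2.le⟩
    have hnx : Ioo (0 : ℝ) 1 ∈ 𝓝 x := Ioo_mem_nhds hx.1 hx.2
    have h1 : ContinuousOn (fun s : ℝ => (s : ℂ)⁻¹ * G s) (Ioo 0 1) :=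
      hGc.mono Ioo_subset_Ioc_self
    have h2 := intervalIntegral.integral_hasDerivAt_left (hd.intervalIntegrable hx1)
      (h1.stronglyMeasurableAtFilter isOpen_Ioo x hx) (h1.continuousAt hnx)
    have h3 := h2.const_sub C
    rw [neg_neg] at h3
    refine h3.congr_of_eventuallyEq ?_
    filter_upwards [hnx] with y hy using hFe ⟨hy.1, hy.2.le⟩
  set h : ℝ → ℂ := fun r => (c + F r)⁻¹ - c⁻¹ with hh
  have hinv : ContinuousOn (fun r => (c + F r)⁻¹) (Icc 0 1) :=
    (continuousOn_const.add hcont).inv₀ hne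
  have hdh : HasDer h fun s => (s : ℂ)⁻¹ * (-(((c + F s)⁻¹) * (((c + F s)⁻¹) * G s))) := by
    refine HasDer.of_hasDerivAt ((hinv.sub continuousOn_const).mono hsub) ?_ fun x hx => ?_
    · have := (hGc.mul ((hinv.mono hsub).mul (hinv.mono hsub))).neg
      refine this.congr fun s _ => ?_
      simp only [Pi.neg_apply, Pi.mul_apply]
      ring
    · have hnx := hne x ⟨hx.1.le, hx.2.le⟩
      have hD := (((hder x hx).const_add c).fun_inv hnx).sub_const c⁻¹
      have e : (x : ℂ)⁻¹ * -((c + F x)⁻¹ * ((c + F x)⁻¹ * G x)) =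
          -((x : ℂ)⁻¹ * G x) / (c + F x) ^ 2 := by
        rw [div_eq_mul_inv, ← inv_pow]
        ring
      rw [e]
      exact hD
  obtain ⟨B, hB⟩ := isCompact_Icc.exists_bound_of_continuousOn hinv
  have hBae : ∀ᵐ r ∂mu1, ‖(c + F r)⁻¹‖ ≤ B := by
    filter_upwards [ae_restrict_mem measurableSet_Ioc] with r hr using hB r (hsub hr)
  have hmeas : AEStronglyMeasurable (fun r => (c + F r)⁻¹) mu1 :=
    (hinv.mono hsub).aestronglyMeasurable measurableSet_Ioc
  have h0 : S0 γ h := by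
    refine ((hF0.mul_bdd hmeas hBae).mul_bdd (h := fun _ => -c⁻¹) aestronglyMeasurable_const
      (Eventually.of_forall fun _ => le_rfl)).congr ?_
    filter_upwards [ae_restrict_mem measurableSet_Ioc] with r hr
    have := hne r (hsub hr)
    simp only [hh]
    field_simp
    ring
  have h1 : S γ 1 h := by
    refine ⟨h0, _, ?_, hdh⟩
    have := (((hg.base.mul_bdd hmeas hBae).mul_bdd hmeas hBae).mul_bdd (h := fun _ => -1)
      aestronglyMeasurable_const (Eventually.of_forall fun _ => le_rfl))
    refine this.congr (Eventually.of_forall fun r => ?_)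
    simp
  -- A bootstrap: with h the difference of reciprocals, its Euler derivative is -(h + c⁻¹)² G, a
  -- polynomial in h times G. Whatever order h has, up to that of G, the derivative has it too, and
  -- h gains one. The bounded factors give the first order.
  have key : ∀ j ≤ m + 1, S γ (j + 1) h := by
    intro j
    induction j with
    | zero => exact fun _ => h1
    | succ j ih =>
      intro hj
      have ihj := ih (by omega)
      have p1 := ihj.mul hγ hg (n := j + 1) (by omega) (by omega) (by omega)
      have p2 := ihj.mul hγ p1 (n := j + 1) (by omega) (by omega) (by omega)
      refine ⟨h0, _, (((hg.mono (by omega : j + 1 ≤ m + 1)).const_mul (-(c⁻¹ * c⁻¹))).add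
        ((p1.const_mul (-(2 * c⁻¹))).add (p2.const_mul (-1)))), ?_⟩
      convert hdh using 2 with s
      simp only [hh]
      ring
  exact key (m + 1) le_rfl

theorem X0.component {γ σ : ℝ} (hσ : 0 ≤ σ) {a : ℤ → ℝ → ℂ} (h : X0 γ σ a) (k : ℤ) :
    S0 γ (a k) :=
  ⟨h.1 k, ((wI_mono (Eventually.of_forall fun r => (ENNReal.le_tsum k).trans
    (tsum_sq_le_wN hσ fun k => a k r))).trans_lt (lt_top_iff_ne_top.2 h.2)).ne⟩

theorem X.component {γ σ : ℝ} (hσ : 0 ≤ σ) {n : ℕ} {a : ℤ → ℝ → ℂ} (h : X γ σ n a) (k : ℤ) :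
    S γ n (a k) := by
  induction n generalizing a with
  | zero => exact X0.component hσ h k
  | succ n ih =>
    obtain ⟨h0, -, a', h2, h3⟩ := h
    exact ⟨h0.component hσ k, a' k, ih h2, h3 k⟩

theorem wN_single (σ : ℝ) (l : ℤ) (x : ℂ) :
    wN σ (fun k => if k = l then x else 0) =
      (ENNReal.ofReal (Real.exp (σ * |(l : ℝ)|)) * ‖x‖ₑ) ^ 2 := by
  rw [wN, tsum_eq_single l]
  · simp
  · intro k hk
    simp [hk]

theorem S0.single {γ σ : ℝ} {f : ℝ → ℂ} (h : S0 γ f) (l : ℤ) :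
    X0 γ σ fun k r => if k = l then f r else 0 := by
  refine ⟨fun k => ?_, ?_⟩
  · by_cases hk : k = l
    · simpa [hk] using h.1
    · simpa [hk] using aestronglyMeasurable_const
  · simp only [wN_single, mul_pow]
    rw [wI_const_mul (by simp)]
    exact ENNReal.mul_ne_top (by simp) h.2

theorem S.single {γ σ : ℝ} {n : ℕ} {f : ℝ → ℂ} (h : S γ n f) (l : ℤ) :
    X γ σ n fun k r => if k = l then f r else 0 := by
  induction n generalizing f with
  | zero => exact S0.single h l
  | succ n ih =>
    obtain ⟨h0, g, h1, h2⟩ := h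
    refine ⟨h0.single l, ?_, _, ih h1, fun k => ?_⟩
    · have := (ih (S.of_succ ⟨h0, g, h1, h2⟩)).const_mul (l : ℂ)
      convert this using 3 with k r
      split_ifs with hk <;> simp [hk]
    · by_cases hk : k = l
      · simpa [hk] using h2
      · simpa [hk] using HasDer.const 0

/-! ### Weak derivatives on `(0,1)` -/

/-- Real smooth functions with compact support in `(0,1)`. -/
structure IsTest1 (χ : ℝ → ℝ) : Prop where
  smooth : ContDiff ℝ ∞ χ
  compact : HasCompactSupport χ
  supp : tsupport χ ⊆ Ioo 0 1

/-- Local integrability on `(0,1]`. -/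
def LocInt (f : ℝ → ℂ) : Prop := ∀ x ∈ Ioc (0 : ℝ) 1, IntegrableOn f (Ioc x 1)

theorem IsTest1.deriv {χ : ℝ → ℝ} (h : IsTest1 χ) : IsTest1 (deriv χ) :=
  ⟨(contDiff_infty_iff_deriv.1 h.smooth).2, h.compact.deriv,
    (closure_minimal support_deriv_subset (isClosed_tsupport _)).trans h.supp⟩

theorem IsTest1.iterate_deriv {χ : ℝ → ℝ} (h : IsTest1 χ) (p : ℕ) : IsTest1 (_root_.deriv^[p] χ) := by
  induction p with
  | zero => exact h
  | succ n ih => rw [Function.iterate_succ_apply']; exact ih.deriv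

theorem exists_Icc_of_isCompact {K : Set ℝ} (hK : IsCompact K) (h : K ⊆ Ioo 0 1) :
    ∃ α ∈ Ioo (0 : ℝ) 1, ∃ β ∈ Ioo (0 : ℝ) 1, K ⊆ Icc α β := by
  rcases K.eq_empty_or_nonempty with rfl | hne
  · exact ⟨1 / 2, by norm_num, 1 / 2, by norm_num, empty_subset _⟩
  · exact ⟨sInf K, h (hK.sInf_mem hne), sSup K, h (hK.sSup_mem hne),
      fun x hx => ⟨csInf_le hK.bddBelow hx, le_csSup hK.bddAbove hx⟩⟩

theorem IsTest1.exists_Icc {χ : ℝ → ℝ} (h : IsTest1 χ) :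
    ∃ α ∈ Ioo (0 : ℝ) 1, ∃ β ∈ Ioo (0 : ℝ) 1, ∀ x ∉ Icc α β, χ x = 0 := by
  obtain ⟨α, hα, β, hβ, hK⟩ := exists_Icc_of_isCompact h.compact h.supp
  exact ⟨α, hα, β, hβ, fun x hx => image_eq_zero_of_notMem_tsupport fun hx' => hx (hK hx')⟩

theorem LocInt.integrable_mul {f : ℝ → ℂ} (hf : LocInt f) {χ : ℝ → ℝ} (h : IsTest1 χ) :
    Integrable (fun x => f x * χ x) mu1 := by
  obtain ⟨α, hα, β, hβ, h0⟩ := h.exists_Icc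
  obtain ⟨C, hC⟩ := h.compact.exists_bound_of_continuous h.smooth.continuous
  have h1 : IntegrableOn (fun x => f x * χ x) (Ioc (α / 2) 1) :=
    (hf _ ⟨by linarith [hα.1], by linarith [hα.1, hα.2]⟩).mul_bdd (c := C)
      (Complex.continuous_ofReal.comp h.smooth.continuous).aestronglyMeasurable
      (Eventually.of_forall fun x => by simpa using hC x)
  refine IntegrableOn.of_forall_sdiff_eq_zero h1 measurableSet_Ioc fun x hx => ?_
  rw [h0 x, Complex.ofReal_zero, mul_zero]
  rintro ⟨h2, h3⟩
  exact hx.2 ⟨by linarith [hα.1], hx.1.2⟩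

theorem LocInt.ae_eq_zero {f : ℝ → ℂ} (hf : LocInt f)
    (h : ∀ χ, IsTest1 χ → ∫ x, f x * χ x ∂mu1 = 0) : f =ᵐ[mu1] 0 := by
  have hloc : LocallyIntegrableOn f (Ioo 0 1) mu1 := by
    intro x hx
    have hx2 : x / 2 ∈ Ioc (0 : ℝ) 1 := ⟨by linarith [hx.1], by linarith [hx.1, hx.2]⟩
    refine ⟨Ioc (x / 2) 1, ?_, ?_⟩
    · filter_upwards [self_mem_nhdsWithin, mem_nhdsWithin_of_mem_nhds
        (lt_mem_nhds (show x / 2 < x by linarith [hx.1]))] with z hz hz2 using ⟨hz2, hz.2.le⟩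
    · rw [IntegrableOn, Measure.restrict_restrict measurableSet_Ioc,
        inter_eq_left.2 (Ioc_subset_Ioc_left hx2.1.le)]
      exact hf _ hx2
  have key := isOpen_Ioo.ae_eq_zero_of_integral_contDiff_smul_eq_zero hloc ?_
  -- Test functions see only the open interval; the endpoint 1 is a null set.
  · have hne : ∀ᵐ r ∂mu1, r ≠ 1 := ae_restrict_of_ae (Measure.ae_ne volume 1)
    filter_upwards [key, ae_restrict_mem measurableSet_Ioc, hne] with r hr hr0 hr1
    exact hr ⟨hr0.1, lt_of_le_of_ne hr0.2 hr1⟩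
  · intro χ h1 h2 h3
    rw [← h χ ⟨h1, h2, h3⟩]
    exact integral_congr_ae (Eventually.of_forall fun x => by simp [mul_comm])

theorem IsTest1.hasDer {χ : ℝ → ℝ} (h : IsTest1 χ) :
    HasDer (fun x => (χ x : ℂ)) fun x => ((_root_.deriv χ x : ℝ) : ℂ) := by
  refine HasDer.of_hasDerivAt ?_ ?_ fun x _ => ?_
  · exact (Complex.continuous_ofReal.comp h.smooth.continuous).continuousOn
  · exact (Complex.continuous_ofReal.comp h.deriv.smooth.continuous).continuousOn
  · exact ((h.smooth.differentiable (by simp)) x).hasDerivAt.ofReal_comp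

/-- By the product rule fχ equals c - ∫_x^1 F with F = gχ + fχ'. A point to the right of the support
of χ gives c = 0, and a point to its left then gives ∫ F = 0. -/
theorem HasDer.integral_mul_deriv {f g : ℝ → ℂ} (hf : HasDer f g) (hlf : LocInt f) {χ : ℝ → ℝ}
    (h : IsTest1 χ) : ∫ x, f x * (deriv χ x : ℝ) ∂mu1 = -∫ x, g x * χ x ∂mu1 := by
  obtain ⟨α, hα, β, hβ, h0⟩ := h.exists_Icc
  have h0' : ∀ x ∉ Icc α β, deriv χ x = 0 := by
    intro x hx
    have : χ =ᶠ[𝓝 x] fun _ => 0 := by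
      filter_upwards [isClosed_Icc.isOpen_compl.mem_nhds hx] with y hy using h0 y hy
    rw [this.deriv_eq, deriv_const]
  set F : ℝ → ℂ := fun x => g x * (χ x : ℂ) + f x * (deriv χ x : ℝ) with hF
  have hF0 : ∀ x ∉ Icc α β, F x = 0 := fun x hx => by simp [hF, h0 x hx, h0' x hx]
  obtain ⟨c, hc⟩ := (hf.mul h.hasDer).2
  -- The representation holds only almost everywhere, so the points are picked inside subintervals
  -- of positive length.
  have hex : ∀ a b : ℝ, 0 ≤ a → a < b → b ≤ 1 → ∃ x ∈ Ioc a b,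
      f x * (χ x : ℂ) = c - ∫ s in x..1, F s := by
    intro a b ha hab hb
    have hsub : Ioc a b ⊆ Ioc 0 1 := Ioc_subset_Ioc ha hb
    have hne : (ae (volume.restrict (Ioc a b))).NeBot := by
      rw [ae_neBot]
      intro h0
      have := congrArg (fun μ : Measure ℝ => μ univ) h0
      simp at this
      linarith
    obtain ⟨x, hx⟩ := ((ae_restrict_of_ae_restrict_of_subset hsub hc).and
      (ae_restrict_mem measurableSet_Ioc)).exists
    exact ⟨x, hx.2, hx.1⟩
  have hc0 : c = 0 := by
    obtain ⟨x, hx, hxe⟩ := hex β 1 hβ.1.le hβ.2 le_rfl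
    have : ∫ s in x..1, F s = 0 := by
      rw [intervalIntegral.integral_of_le hx.2]
      refine setIntegral_eq_zero_of_forall_eq_zero fun s hs => hF0 s fun hs' => ?_
      linarith [hs.1, hx.1, hs'.2]
    rw [this, h0 x (fun hx' => by linarith [hx.1, hx'.2])] at hxe
    simpa using hxe.symm
  obtain ⟨x, hx, hxe⟩ := hex 0 (α / 2) le_rfl (by linarith [hα.1]) (by linarith [hα.1, hα.2])
  rw [h0 x (fun hx' => by linarith [hx.2, hx'.1, hα.1]), hc0,
    intervalIntegral.integral_of_le (by linarith [hx.2, hα.1, hα.2])] at hxe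
  have h1 : ∫ s in Ioc x 1, F s = 0 := by simpa using hxe.symm
  have h2 : ∫ s, F s ∂mu1 = 0 := by
    rw [← h1]
    refine (setIntegral_eq_of_subset_of_forall_sdiff_eq_zero measurableSet_Ioc
      (Ioc_subset_Ioc_left hx.1.le) fun s hs => hF0 s fun hs' => hs.2 ⟨?_, hs.1.2⟩).symm ▸ rfl
    linarith [hx.2, hs'.1, hα.1]
  rw [integral_add (LocInt.integrable_mul hf.1 h) (hlf.integrable_mul h.deriv)] at h2
  linear_combination h2

/-- Vanishing mean is what makes the primitive vanish again to the right of the support. -/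
theorem IsTest1.primitive {η : ℝ → ℝ} (h : IsTest1 η) (h0 : ∫ x, η x ∂mu1 = 0) :
    IsTest1 (fun x => ∫ s in (0 : ℝ)..x, η s) ∧
      _root_.deriv (fun x => ∫ s in (0 : ℝ)..x, η s) = η := by
  have hc := h.smooth.continuous
  have hd : ∀ x, HasDerivAt (fun x => ∫ s in (0 : ℝ)..x, η s) (η x) x := fun x =>
    intervalIntegral.integral_hasDerivAt_right (hc.intervalIntegrable _ _)
      hc.stronglyMeasurable.stronglyMeasurableAtFilter hc.continuousAt
  have hde : _root_.deriv (fun x => ∫ s in (0 : ℝ)..x, η s) = η := funext fun x => (hd x).deriv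
  obtain ⟨α, hα, β, hβ, hz⟩ := h.exists_Icc
  have hsupp : Function.support (fun x => ∫ s in (0 : ℝ)..x, η s) ⊆ Icc α β := by
    intro x hx
    by_contra hx'
    apply hx
    rcases lt_or_ge x α with h1 | h1
    · refine (intervalIntegral.integral_congr fun s hs => hz s fun hs' => ?_).trans (by simp)
      rcases le_total 0 x with h2 | h2
      · rw [uIcc_of_le h2] at hs
        linarith [hs.2, hs'.1]
      · rw [uIcc_of_ge h2] at hs
        linarith [hs.2, hs'.1, hα.1]
    · have h2 : β < x := by
        by_contra h2
        exact hx' ⟨h1, not_lt.1 h2⟩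
      have e1 : ∫ s in (0 : ℝ)..1, η s = 0 := by
        rw [intervalIntegral.integral_of_le zero_le_one]
        exact h0
      have e2 : ∫ s in (1 : ℝ)..x, η s = 0 := by
        refine (intervalIntegral.integral_congr fun s hs => hz s fun hs' => ?_).trans (by simp)
        have : β < s := by
          rcases le_total 1 x with h3 | h3
          · rw [uIcc_of_le h3] at hs
            linarith [hs.1, hβ.2]
          · rw [uIcc_of_ge h3] at hs
            linarith [hs.1]
        linarith [hs'.2]
      change ∫ s in (0 : ℝ)..x, η s = 0
      rw [← intervalIntegral.integral_add_adjacent_intervals (hc.intervalIntegrable 0 1)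
        (hc.intervalIntegrable 1 x), e1, e2, add_zero]
  have hts : tsupport (fun x => ∫ s in (0 : ℝ)..x, η s) ⊆ Icc α β :=
    closure_minimal hsupp isClosed_Icc
  refine ⟨⟨?_, HasCompactSupport.intro (isCompact_Icc (a := α) (b := β)) fun x hx => ?_, ?_⟩, hde⟩
  · rw [contDiff_infty_iff_deriv, hde]
    exact ⟨fun x => (hd x).differentiableAt, h.smooth⟩
  · by_contra hx'
    exact hx (hsupp hx')
  · exact hts.trans fun x hx => ⟨hα.1.trans_le hx.1, hx.2.trans_lt hβ.2⟩

theorem exists_isTest1_integral_eq_one : ∃ χ, IsTest1 χ ∧ ∫ x, χ x ∂mu1 = 1 := by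
  let b : ContDiffBump (1 / 2 : ℝ) := ⟨1 / 8, 1 / 4, by norm_num, by norm_num⟩
  have hs : tsupport (b.normed volume) ⊆ Ioo 0 1 := by
    rw [b.tsupport_normed_eq, Real.closedBall_eq_Icc]
    intro x hx
    simp only [b, mem_Icc, mem_Ioo] at hx ⊢
    constructor <;> linarith [hx.1, hx.2]
  refine ⟨b.normed volume, ⟨b.contDiff_normed, b.hasCompactSupport_normed, hs⟩, ?_⟩
  rw [setIntegral_eq_integral_of_forall_compl_eq_zero, b.integral_normed]
  intro x hx
  exact image_eq_zero_of_notMem_tsupport fun hx' => hx (Ioo_subset_Ioc_self (hs hx'))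

theorem HasDer.locInt {f g : ℝ → ℂ} (h : HasDer f g) : LocInt f := by
  obtain ⟨c, hc⟩ := h.2
  intro x hx
  have hsub : Icc x 1 ⊆ Ioc 0 1 := fun y hy => ⟨hx.1.trans_le hy.1, hy.2⟩
  refine ((((continuousOn_primitive h.1 c).mono hsub).integrableOn_Icc).mono_set
    Ioc_subset_Icc_self).congr ?_
  filter_upwards [ae_restrict_of_ae_restrict_of_subset (Ioc_subset_Ioc_left hx.1.le) hc] with y hy
  exact hy.symm

/-- A weak derivative on `(0,1)` is a derivative in the sense of `HasDer`. -/
theorem HasDer.of_weak {f g : ℝ → ℂ} (hf : LocInt f) (hg : LocInt g)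
    (h : ∀ χ, IsTest1 χ → ∫ x, f x * (deriv χ x : ℝ) ∂mu1 = -∫ x, g x * χ x ∂mu1) :
    HasDer f g := by
  have hP : HasDer (fun x => 0 - ∫ s in x..1, g s) g :=
    ⟨hg, 0, Eventually.of_forall fun x => rfl⟩
  obtain ⟨χ₀, hχ₀, hχ₁⟩ := exists_isTest1_integral_eq_one
  -- The difference with a primitive of g has weak derivative zero, so it remains to prove the lemma
  -- of du Bois-Reymond: F is constant, and the constant is its integral against χ₀.
  set F : ℝ → ℂ := fun x => f x - (0 - ∫ s in x..1, g s) with hF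
  have hFl : LocInt F := fun x hx => (hf x hx).sub (hP.locInt x hx)
  have hF0 : ∀ χ, IsTest1 χ → ∫ x, F x * (deriv χ x : ℝ) ∂mu1 = 0 := by
    intro χ hχ
    have e : ∀ x, F x * (deriv χ x : ℝ) = f x * (deriv χ x : ℝ) -
      (0 - ∫ s in x..1, g s) * (deriv χ x : ℝ) := fun x => by simp only [hF]; ring
    simp only [e]
    rw [integral_sub (hf.integrable_mul hχ.deriv) (hP.locInt.integrable_mul hχ.deriv), h χ hχ,
      hP.integral_mul_deriv hP.locInt hχ, sub_self]
  set C : ℂ := ∫ x, F x * χ₀ x ∂mu1 with hC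
  have hCl : LocInt fun x => F x - C := fun x hx => (hFl x hx).sub (by simp)
  have h1 := hCl.ae_eq_zero fun χ hχ => by
    set A := ∫ x, χ x ∂mu1 with hA
    have hint : ∀ {χ : ℝ → ℝ}, IsTest1 χ → Integrable χ mu1 := fun h =>
      (h.smooth.continuous.integrable_of_hasCompactSupport h.compact).restrict
    -- Subtracting A χ₀ makes the mean zero, so that the result is the derivative of a test function
    -- and F pairs to zero with it.
    have hη : IsTest1 fun x => χ x - A * χ₀ x := by
      refine ⟨hχ.smooth.sub (contDiff_const.mul hχ₀.smooth),
        hχ.compact.sub (hχ₀.compact.mul_left), ?_⟩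
      refine (closure_minimal (t := tsupport χ ∪ tsupport χ₀) ?_
        ((isClosed_tsupport _).union (isClosed_tsupport _))).trans (union_subset hχ.supp hχ₀.supp)
      intro x hx
      by_contra hx'
      rw [mem_union, not_or] at hx'
      exact hx (by simp [image_eq_zero_of_notMem_tsupport hx'.1,
        image_eq_zero_of_notMem_tsupport hx'.2])
    have hη0 : ∫ x, (χ x - A * χ₀ x) ∂mu1 = 0 := by
      rw [integral_sub (hint hχ) ((hint hχ₀).const_mul A), integral_const_mul, hχ₁, ← hA]
      ring
    obtain ⟨hp, hpd⟩ := hη.primitive hη0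
    have h2 := hF0 _ hp
    rw [hpd] at h2
    have e : ∀ x, F x * ((χ x - A * χ₀ x : ℝ) : ℂ) = F x * χ x - A * (F x * χ₀ x) := fun x => by
      push_cast; ring
    simp only [e] at h2
    rw [integral_sub (hFl.integrable_mul hχ) ((hFl.integrable_mul hχ₀).const_mul _),
      integral_const_mul, ← hC] at h2
    simp only [sub_mul]
    have hi : Integrable (fun x => C * (χ x : ℂ)) mu1 := (hint hχ).ofReal.const_mul C
    rw [integral_sub (hFl.integrable_mul hχ) hi, integral_const_mul, integral_complex_ofReal, ← hA]
    linear_combination h2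
  refine ⟨hg, C, ?_⟩
  filter_upwards [h1] with x hx
  simp only [hF, Pi.zero_apply] at hx
  linear_combination hx

/-! ### Fourier coefficients of functions on `Π` -/

/-- The Fourier coefficients of `u(ψ,·)`. -/
def fc (u : FunPi) (k : ℤ) (r : ℝ) : ℂ := fourierCoeff (fun θ : Circ => u (r, θ)) k

theorem stronglyMeasurable_fc (u : FunPi) (k : ℤ) : StronglyMeasurable (fc u k) := by
  have h : StronglyMeasurable fun x : ℝ × Circ => fourier (-k) x.2 • u x :=
    (((fourier (-k)).continuous.comp continuous_snd).stronglyMeasurable).smul u.stronglyMeasurable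
  exact h.integral_prod_right'

/-- Parseval holds for the normalised Haar measure; passing to Lebesgue measure multiplies the right
side by 2π ≥ 1. -/
theorem tsum_enorm_sq_fourierCoeff_le {f : Circ → ℂ} (hf : MemLp f 2 volume) :
    ∑' k, ‖fourierCoeff f k‖ₑ ^ 2 ≤ ∫⁻ θ, ‖f θ‖ₑ ^ 2 := by
  have hf' : MemLp f 2 AddCircle.haarAddCircle := hf.haarAddCircle
  have h1 := hasSum_sq_fourierCoeff hf'.toLp
  have hc := fourierCoeff_congr_ae hf'.coeFn_toLp
  rw [hc] at h1
  have h2 : ∫ t, ‖hf'.toLp f t‖ ^ 2 ∂AddCircle.haarAddCircle =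
      ∫ t, ‖f t‖ ^ 2 ∂AddCircle.haarAddCircle := by
    refine integral_congr_ae ?_
    filter_upwards [hf'.coeFn_toLp] with t ht
    rw [ht]
  rw [h2] at h1
  have h3 := ENNReal.ofReal_tsum_of_nonneg (fun k => by positivity) h1.summable
  rw [h1.tsum_eq, ofReal_integral_eq_lintegral_ofReal
    ((memLp_two_iff_integrable_sq_norm hf'.1).1 hf') (Eventually.of_forall fun t => by positivity)]
    at h3
  simp only [ENNReal.ofReal_pow (norm_nonneg _), ofReal_norm] at h3
  rw [← h3, AddCircle.volume_eq_smul_haarAddCircle, lintegral_smul_measure]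
  refine le_mul_of_one_le_left' ?_
  rw [ENNReal.one_le_ofReal]
  linarith [Real.pi_gt_three]

theorem WeightedL2.lintegral_ne_top {s : ℝ} {g : FunPi} (hg : WeightedL2 s g) :
    ∫⁻ x, ENNReal.ofReal (x.1 ^ (2 * s)) * ‖g x‖ₑ ^ 2 ∂muPi ≠ ⊤ := by
  have h := hg.eLpNorm_lt_top
  rw [eLpNorm_lt_top_iff_lintegral_rpow_enorm_lt_top (by simp) (by simp)] at h
  refine (lt_of_eq_of_lt (lintegral_congr_ae ?_) h).ne
  filter_upwards [ae_fst_mem] with x hx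
  rw [enorm_mul]
  simp only [ENNReal.toReal_ofNat, ENNReal.rpow_two, mul_pow]
  congr 1
  rw [← ofReal_norm, ← ENNReal.ofReal_pow (norm_nonneg _), Complex.norm_real,
    Real.norm_of_nonneg (Real.rpow_nonneg hx.1.le _), ← Real.rpow_natCast, ← Real.rpow_mul hx.1.le]
  congr 2
  push_cast
  ring

/-- Parseval on almost every slice and Tonelli; the exponents combine as ψ^(-2γ) ψ^(2p) =
ψ^(2(p-γ)). -/
theorem WeightedL2.x0_fc {γ : ℝ} {p : ℕ} {g : FunPi} (hg : WeightedL2 (p - γ) g) :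
    X0 γ 0 fun k r => (r : ℂ) ^ p * fc g k r := by
  refine ⟨fun k => AEStronglyMeasurable.mul ?_ (stronglyMeasurable_fc g k).aestronglyMeasurable,
    ?_⟩
  · exact Continuous.aestronglyMeasurable (by fun_prop)
  have hm : Measurable fun x : ℝ × Circ => ENNReal.ofReal (x.1 ^ (2 * (p - γ))) * ‖g x‖ₑ ^ 2 :=
    Measurable.mul (by fun_prop) (g.stronglyMeasurable.measurable.enorm.pow_const 2)
  have h1 := hg.lintegral_ne_top
  rw [lintegral_prod _ hm.aemeasurable] at h1
  refine ((lintegral_mono_ae ?_).trans_lt (lt_top_iff_ne_top.2 h1)).ne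
  filter_upwards [hg.ae_memLp_slice, ae_restrict_mem measurableSet_Ioc] with r hr hr0
  rw [lintegral_const_mul' _ _ ENNReal.ofReal_ne_top]
  have e : wN 0 (fun k => (r : ℂ) ^ p * fc g k r) =
      ENNReal.ofReal (r ^ (2 * p : ℝ)) * ∑' k, ‖fc g k r‖ₑ ^ 2 := by
    rw [wN_const_mul]
    congr 1
    · rw [← ofReal_norm, ← ENNReal.ofReal_pow (norm_nonneg _), norm_pow, Complex.norm_real,
        Real.norm_of_nonneg hr0.1.le, ← pow_mul, ← Real.rpow_natCast]
      congr 2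
      push_cast
      ring
    · simp [wN]
  rw [e, ← mul_assoc, ← ENNReal.ofReal_mul (Real.rpow_nonneg hr0.1.le _), ← Real.rpow_add hr0.1]
  rw [show -2 * γ + 2 * p = 2 * (p - γ) by ring]
  gcongr
  exact tsum_enorm_sq_fourierCoeff_le hr

theorem S0.locInt {γ : ℝ} (hγ : 0 ≤ γ) {f : ℝ → ℂ} (hf : S0 γ f) : LocInt f := by
  intro x hx
  have hle : volume.restrict (Ioc x 1) ≤ mu1 :=
    Measure.restrict_mono (Ioc_subset_Ioc_left hx.1.le) le_rfl
  have : MemLp f 2 (volume.restrict (Ioc x 1)) := by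
    refine ⟨hf.1.mono_measure hle, ?_⟩
    rw [eLpNorm_lt_top_iff_lintegral_rpow_enorm_lt_top (by simp) (by simp)]
    simp only [ENNReal.toReal_ofNat, ENNReal.rpow_two]
    exact (lintegral_Ioc_le_wI hγ hx.1.le le_rfl _).trans_lt
      (ENNReal.mul_lt_top ENNReal.ofReal_lt_top (lt_top_iff_ne_top.2 hf.2))
  exact this.integrable (by norm_num)

theorem LocInt.of_pow_mul {f : ℝ → ℂ} {p : ℕ} (h : LocInt fun r => (r : ℂ) ^ p * f r) :
    LocInt f := by
  intro x hx
  have hsub : Icc x 1 ⊆ Ioc 0 1 := fun y hy => ⟨hx.1.trans_le hy.1, hy.2⟩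
  have hc : ContinuousOn (fun r : ℝ => ((r : ℂ) ^ p)⁻¹) (Icc x 1) := by
    refine ContinuousOn.inv₀ (by fun_prop) fun y hy => pow_ne_zero _ ?_
    exact_mod_cast (hsub hy).1.ne'
  have h1 := (intervalIntegrable_iff_integrableOn_Ioc_of_le hx.2).2 (h x hx)
  refine ((intervalIntegrable_iff_integrableOn_Ioc_of_le hx.2).1 (h1.continuousOn_mul
    (by rwa [uIcc_of_le hx.2]))).congr ?_
  filter_upwards [ae_restrict_mem measurableSet_Ioc] with r hr
  have : (r : ℂ) ≠ 0 := by exact_mod_cast (hx.1.trans hr.1).ne'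
  field_simp

theorem WeightedL2.locInt_fc {γ : ℝ} (hγ : 0 ≤ γ) {p : ℕ} {g : FunPi} (hg : WeightedL2 (p - γ) g)
    (k : ℤ) : LocInt (fc g k) :=
  (S0.locInt hγ (hg.x0_fc.component le_rfl k)).of_pow_mul

theorem IsTest1.isTest {χ : ℝ → ℝ} (h : IsTest1 χ) (k : ℤ) :
    IsTest (fun x : ℝ × Circ => (χ x.1 : ℂ) * fourier k x.2) :=
  isTest_mul_fourier h.smooth h.compact h.supp k

/-- Fubini: integrating in θ against e^(-ikθ) produces 2π times the k-th coefficient. Weak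
statements on Π thus become weak statements on (0,1) for each coefficient separately. -/
theorem integral_mul_isTest1 {s : ℝ} {g : FunPi} (hg : WeightedL2 s g) {χ : ℝ → ℝ}
    (h : IsTest1 χ) (k : ℤ) :
    ∫ x, g x * ((χ x.1 : ℂ) * fourier (-k) x.2) ∂muPi =
      (2 * Real.pi : ℝ) * ∫ r, fc g k r * χ r ∂mu1 := by
  rw [integral_prod _ (hg.integrable_mul_test (h.isTest (-k))), ← integral_const_mul]
  refine integral_congr_ae (Eventually.of_forall fun r => ?_)
  have hslice : ∫ θ : Circ, g (r, θ) * fourier (-k) θ = (2 * Real.pi : ℝ) * fc g k r := by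
    rw [fc, fourierCoeff, AddCircle.integral_haarAddCircle]
    simp only [smul_eq_mul, Complex.real_smul, mul_comm (g _)]
    rw [← mul_assoc, ← Complex.ofReal_mul, mul_inv_cancel₀ Real.two_pi_pos.ne']
    simp
  have e : ∀ θ : Circ, g (r, θ) * ((χ r : ℂ) * fourier (-k) θ) =
      (χ r : ℂ) * (g (r, θ) * fourier (-k) θ) := fun θ => by ring
  simp only [e]
  rw [integral_const_mul, hslice]
  ring

theorem dTheta_iterate_fourier (χ : ℝ → ℝ) (k : ℤ) (q : ℕ) :
    dTheta^[q] (fun x : ℝ × Circ => (χ x.1 : ℂ) * fourier k x.2) =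
      fun x => (Complex.I * k) ^ q * ((χ x.1 : ℂ) * fourier k x.2) := by
  induction q with
  | zero => simp
  | succ q ih =>
    rw [Function.iterate_succ_apply', ih]
    funext x
    obtain ⟨r, θ⟩ := x
    induction θ using QuotientAddGroup.induction_on with
    | H t =>
    have h1 : HasDerivAt (fun s : ℝ => fourier k ((t + s : ℝ) : Circ))
        (Complex.I * k * fourier k (t : Circ)) 0 := by
      have h2 := hasDerivAt_fourier (2 * Real.pi) k (t + 0)
      have h3 := h2.comp_const_add t 0
      have e : Complex.I * k = 2 * (Real.pi : ℂ) * Complex.I * k / ((2 * Real.pi : ℝ) : ℂ) := by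
        push_cast
        have : (Real.pi : ℂ) ≠ 0 := by exact_mod_cast Real.pi_ne_zero
        field_simp
      rw [e]
      simpa only [add_zero] using h3
    have h4 := (h1.const_mul (χ r : ℂ)).const_mul ((Complex.I * k) ^ q)
    change deriv (fun s : ℝ => (Complex.I * k) ^ q *
      ((χ r : ℂ) * fourier k ((t : Circ) + (s : Circ)))) 0 = _
    simp only [← AddCircle.coe_add]
    rw [h4.deriv, pow_succ]
    change _ = (Complex.I * k) ^ q * (Complex.I * k) * ((χ r : ℂ) * fourier k (t : Circ))
    ring

theorem dPsi_iterate_fourier {χ : ℝ → ℝ} (h : IsTest1 χ) (c : ℂ) (k : ℤ) (p : ℕ) :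
    dPsi^[p] (fun x : ℝ × Circ => c * ((χ x.1 : ℂ) * fourier k x.2)) =
      fun x => c * (((deriv^[p] χ x.1 : ℝ) : ℂ) * fourier k x.2) := by
  induction p with
  | zero => simp
  | succ p ih =>
    rw [Function.iterate_succ_apply', ih]
    funext x
    have h1 : HasDerivAt (fun s : ℝ => ((deriv^[p] χ s : ℝ) : ℂ))
        ((deriv (deriv^[p] χ) x.1 : ℝ) : ℂ) x.1 :=
      (((h.iterate_deriv p).smooth.differentiable (by simp)) x.1).hasDerivAt.ofReal_comp
    have h2 := (h1.mul_const (fourier k x.2 : ℂ)).const_mul c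
    rw [Function.iterate_succ_apply']
    exact h2.deriv

/-- The test function is χ(ψ) e^(-ikθ). Its θ-derivatives give (-ik)^q, whose sign cancels the
factor (-1)^q of the weak derivative, so only (-1)^p remains. -/
theorem IsWeakDeriv.integral_fc {p q : ℕ} {w g : FunPi} {s t : ℝ} (h : IsWeakDeriv p q w g)
    (hw : WeightedL2 s w) (hg : WeightedL2 t g) {χ : ℝ → ℝ} (hχ : IsTest1 χ) (k : ℤ) :
    (Complex.I * k) ^ q * ∫ r, fc w k r * (deriv^[p] χ r : ℝ) ∂mu1 =
      (-1) ^ p * ∫ r, fc g k r * χ r ∂mu1 := by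
  have h1 := h _ (hχ.isTest (-k))
  rw [dTheta_iterate_fourier, dPsi_iterate_fourier hχ, integral_mul_isTest1 hg hχ] at h1
  have e : ∀ x : ℝ × Circ, w x * ((Complex.I * ((-k : ℤ) : ℂ)) ^ q *
      (((deriv^[p] χ x.1 : ℝ) : ℂ) * fourier (-k) x.2)) = (Complex.I * ((-k : ℤ) : ℂ)) ^ q *
      (w x * (((deriv^[p] χ x.1 : ℝ) : ℂ) * fourier (-k) x.2)) := fun x => by ring
  simp only [e] at h1
  rw [integral_const_mul, integral_mul_isTest1 hw (hχ.iterate_deriv p)] at h1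
  have hpi : ((2 * Real.pi : ℝ) : ℂ) ≠ 0 := by exact_mod_cast Real.two_pi_pos.ne'
  have hs : (-1 : ℂ) ^ q * (-1) ^ q = 1 := by rw [← mul_pow]; simp
  refine mul_left_cancel₀ hpi ?_
  push_cast at h1 ⊢
  rw [show Complex.I * -(k : ℂ) = -1 * (Complex.I * k) by ring, mul_pow, pow_add] at h1
  linear_combination (-1 : ℂ) ^ q * h1 - (Complex.I * k) ^ q * (2 * Real.pi) *
    (∫ r, fc w k r * (deriv^[p] χ r : ℝ) ∂mu1) * hs + (-1) ^ p * (2 * Real.pi) *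
    (∫ r, fc g k r * χ r ∂mu1) * hs

/-! ### Fourier coefficients of elements of `K^m_γ(Π)` -/

theorem hasDer_pow (p : ℕ) :
    HasDer (fun r : ℝ => (r : ℂ) ^ p) fun r => p * (r : ℂ) ^ (p - 1) := by
  refine HasDer.of_hasDerivAt (by fun_prop) (by fun_prop) fun x _ => ?_
  exact (hasDerivAt_pow p (x : ℂ)).comp_ofReal

/-- Both coefficients are determined by the pairing of the coefficient of w with the p-th derivative
of a test function. -/
theorem IsWeakDeriv.fc_eq {γ : ℝ} (hγ : 0 ≤ γ) {p q : ℕ} {w g h : FunPi} {s : ℝ}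
    (hw : WeightedL2 s w) (h0 : IsWeakDeriv p 0 w h) (h1 : IsWeakDeriv p q w g)
    (hh : WeightedL2 (p - γ) h) (hg : WeightedL2 (p - γ) g) (k : ℤ) :
    fc g k =ᵐ[mu1] fun r => (Complex.I * k) ^ q * fc h k r := by
  have hl : LocInt fun r => fc g k r - (Complex.I * k) ^ q * fc h k r := fun x hx =>
    (hg.locInt_fc hγ k x hx).sub ((hh.locInt_fc hγ k x hx).const_mul _)
  have := hl.ae_eq_zero fun χ hχ => by
    have e0 := h0.integral_fc hw hh hχ k
    have e1 := h1.integral_fc hw hg hχ k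
    rw [pow_zero, one_mul] at e0
    rw [e0] at e1
    have e : ∀ r, (fc g k r - (Complex.I * k) ^ q * fc h k r) * χ r =
        fc g k r * χ r - (Complex.I * k) ^ q * (fc h k r * χ r) := fun r => by ring
    simp only [e]
    rw [integral_sub ((hg.locInt_fc hγ k).integrable_mul hχ)
      (((hh.locInt_fc hγ k).integrable_mul hχ).const_mul _), integral_const_mul]
    have hs : (-1 : ℂ) ^ p ≠ 0 := by simp
    refine mul_left_cancel₀ hs ?_
    linear_combination -e1
  filter_upwards [this] with r hr
  rwa [Pi.zero_apply, sub_eq_zero] at hr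

theorem IsWeakDeriv.hasDer_fc {γ : ℝ} (hγ : 0 ≤ γ) {p : ℕ} {w g h : FunPi} {s : ℝ}
    (hw : WeightedL2 s w) (h0 : IsWeakDeriv p 0 w h) (h1 : IsWeakDeriv (p + 1) 0 w g)
    (hh : WeightedL2 (p - γ) h) (hg : WeightedL2 ((p + 1 : ℕ) - γ) g) (k : ℤ) :
    HasDer (fc h k) (fc g k) := by
  refine HasDer.of_weak (hh.locInt_fc hγ k) (hg.locInt_fc hγ k) fun χ hχ => ?_
  have e0 := h0.integral_fc hw hh hχ.deriv k
  have e1 := h1.integral_fc hw hg hχ k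
  rw [← Function.iterate_succ_apply, pow_zero, one_mul] at e0
  rw [pow_zero, one_mul, e0, pow_succ] at e1
  have hs : (-1 : ℂ) ^ p ≠ 0 := by simp
  refine mul_left_cancel₀ hs ?_
  linear_combination e1

/-- The functions `ψ^p ∂_ψ^p w`, in terms of Fourier coefficients. -/
theorem X.of_chain {γ σ : ℝ} {m : ℕ} {f : ℕ → ℤ → ℝ → ℂ}
    (h0 : ∀ p q, p + q ≤ m → X0 γ σ fun k r => (k : ℂ) ^ q * f p k r)
    (h1 : ∀ p, p + 1 ≤ m → ∀ k,
      HasDer (f p k) fun s => (s : ℂ)⁻¹ * (p * f p k s + f (p + 1) k s)) :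
    ∀ n p q, n + p + q ≤ m → X γ σ n fun k r => (k : ℂ) ^ q * f p k r := by
  intro n
  induction n with
  | zero => exact fun p q hpq => h0 p q (by omega)
  | succ n ih =>
    intro p q hpq
    -- With f_p = ψ^p ∂_ψ^p w one has ψ∂_ψ f_p = p f_p + f_(p+1): an Euler derivative trades one
    -- unit of n for at most one of p, and multiplication by k trades it for one of q.
    refine ⟨h0 p q (by omega), ?_, _, ((ih p q (by omega)).const_mul p).add
      (ih (p + 1) q (by omega)), fun k => ?_⟩
    · convert ih p (q + 1) (by omega) using 3
      ring
    · convert (h1 p (by omega) k).const_mul ((k : ℂ) ^ q) using 2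
      ring

theorem X.of_mem_K {m : ℕ} {γ : ℝ} (hγ : 0 ≤ γ) {w : FunPi} (hw : w ∈ K m γ) :
    X γ 0 m (fc w) := by
  obtain ⟨hw0, hex⟩ := hw
  have hex' : ∀ p q, ∃ g : FunPi, p + q ≤ m → IsWeakDeriv p q w g ∧ WeightedL2 (p - γ) g := by
    intro p q
    by_cases h : p + q ≤ m
    · obtain ⟨g, hg⟩ := hex p q h
      exact ⟨g, fun _ => hg⟩
    · exact ⟨0, fun h' => absurd h' h⟩
  choose g hg using hex'
  have hg0 : g 0 0 = w := by
    obtain ⟨h1, h2⟩ := hg 0 0 (by omega)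
    exact h1.unique (isWeakDeriv_zero_zero w) h2 (by simpa using hw0)
  have key := X.of_chain (γ := γ) (σ := 0) (m := m) (f := fun p k r => (r : ℂ) ^ p * fc (g p 0) k r)
    ?_ ?_ m 0 0 (by omega)
  · simpa [hg0] using key
  · intro p q hpq
    obtain ⟨h1, h2⟩ := hg p 0 (by omega)
    obtain ⟨h3, h4⟩ := hg p q hpq
    -- The factor (-i)^q turns the (ik)^q of the θ-derivatives into k^q.
    refine (X0.const_mul h4.x0_fc ((-Complex.I) ^ q)).congr fun k => ?_
    filter_upwards [h1.fc_eq hγ hw0 h3 h2 h4 k] with r hr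
    rw [hr, mul_pow]
    have : (-Complex.I) ^ q * Complex.I ^ q = 1 := by rw [← mul_pow]; simp
    linear_combination ((r : ℂ) ^ p * k ^ q * fc (g p 0) k r) * this
  · intro p hp k
    obtain ⟨h1, h2⟩ := hg p 0 (by omega)
    obtain ⟨h3, h4⟩ := hg (p + 1) 0 (by omega)
    refine ((hasDer_pow p).mul (h1.hasDer_fc hγ hw0 h3 h2 h4 k)).congr .rfl ?_
    filter_upwards [ae_restrict_mem measurableSet_Ioc] with r hr
    have : (r : ℂ) ≠ 0 := by exact_mod_cast hr.1.ne'
    cases p with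
    | zero => simp [field]
    | succ p =>
      rw [Nat.add_sub_cancel]
      field_simp
      ring

/-! ### Completeness of `K^m_γ(Π)` -/

/-- Integration against a test function, on `ψ^s L²(Π)`. -/
theorem exists_pairing (s : ℝ) {φ : ℝ × Circ → ℂ} (hφ : IsTest φ) :
    ∃ Λ : Lp ℂ 2 muPi →L[ℂ] ℂ, ∀ F : Lp ℂ 2 muPi,
      Λ F = ∫ x, ((x.1 ^ (-s) : ℝ) : ℂ) * F x * φ x ∂muPi := by
  have hm : MemLp (fun x => (starRingEnd ℂ) (((x.1 ^ (-s) : ℝ) : ℂ) * φ x)) 2 muPi :=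
    (hφ.weighted_memLp (-s)).star
  refine ⟨innerSL ℂ hm.toLp, fun F => ?_⟩
  rw [innerSL_apply_apply, L2.inner_def]
  refine integral_congr_ae ?_
  filter_upwards [hm.coeFn_toLp] with x hx
  rw [hx, RCLike.inner_apply, RCLike.conj_conj]
  ring

theorem pairing_toLp {s : ℝ} {g : FunPi} (hg : WeightedL2 s g) (φ : ℝ × Circ → ℂ) :
    ∫ x, ((x.1 ^ (-s) : ℝ) : ℂ) * (MemLp.toLp _ hg) x * φ x ∂muPi = ∫ x, g x * φ x ∂muPi := by
  refine integral_congr_ae ?_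
  filter_upwards [hg.coeFn_toLp, ae_fst_mem] with x hx h0
  rw [hx]
  have : ((x.1 ^ (-s) : ℝ) : ℂ) * ((x.1 ^ s : ℝ) : ℂ) = 1 := by
    rw [← Complex.ofReal_mul, ← Real.rpow_add h0.1]; simp
  linear_combination (g x * φ x) * this

theorem exists_weightedL2_of_Lp (s : ℝ) (F : Lp ℂ 2 muPi) :
    ∃ (g : FunPi) (hg : WeightedL2 s g), MemLp.toLp _ hg = F := by
  have hm : AEStronglyMeasurable (fun x : ℝ × Circ => ((x.1 ^ (-s) : ℝ) : ℂ) * F x) muPi := by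
    refine AEStronglyMeasurable.mul ?_ (Lp.aestronglyMeasurable F)
    have : Measurable fun x : ℝ × Circ => ((x.1 ^ (-s) : ℝ) : ℂ) := by fun_prop
    exact this.aestronglyMeasurable
  have he : (fun x => ((x.1 ^ s : ℝ) : ℂ) * (AEEqFun.mk _ hm : FunPi) x) =ᵐ[muPi] F := by
    filter_upwards [AEEqFun.coeFn_mk _ hm, ae_fst_mem] with x hx h0
    rw [hx]
    have : ((x.1 ^ s : ℝ) : ℂ) * ((x.1 ^ (-s) : ℝ) : ℂ) = 1 := by
      rw [← Complex.ofReal_mul, ← Real.rpow_add h0.1]; simp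
    linear_combination F x * this
  have hg : WeightedL2 s (AEEqFun.mk _ hm) := (Lp.memLp F).ae_eq he.symm
  exact ⟨_, hg, Lp.ext (hg.coeFn_toLp.trans he)⟩

theorem isometry_jet (m : ℕ) (γ : ℝ) : Isometry (jet m γ) :=
  AddMonoidHomClass.isometry_of_norm (jet m γ) fun _ => rfl

theorem jet_apply {m : ℕ} {γ : ℝ} (w : K m γ) (i : Idx m) :
    jet m γ w i = MemLp.toLp _ (weightedL2_weakDeriv w i) := rfl

/-- If the jets of w_n converge in L², each component of the limit is a weighted function g_i.
Pairing with a test function is continuous in the weighted norm, so the defining identity of the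
weak derivatives passes to the limit and g_i is a derivative of the zeroth component. -/
theorem isClosed_range_jet (m : ℕ) (γ : ℝ) : IsClosed (range (jet m γ)) := by
  refine IsSeqClosed.isClosed fun x F hx hF => ?_
  choose w hw using hx
  have hFi : ∀ i, Tendsto (fun n => jet m γ (w n) i) atTop (𝓝 (F i)) := fun i => by
    have := ((PiLp.continuous_apply 2 (fun _ : Idx m => Lp ℂ 2 muPi) i).tendsto F).comp hF
    refine this.congr fun n => ?_
    rw [hw]
    rfl
  choose g hg hgF using fun i : Idx m => exists_weightedL2_of_Lp ((i.1.1 : ℕ) - γ) (F i)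
  let i₀ : Idx m := ⟨(0, 0), by simp⟩
  have hlim : ∀ i {φ}, IsTest φ → Tendsto (fun n => ∫ x, weakDeriv (w n) i x * φ x ∂muPi) atTop
      (𝓝 (∫ x, g i x * φ x ∂muPi)) := by
    intro i φ hφ
    obtain ⟨Λ, hΛ⟩ := exists_pairing ((i.1.1 : ℕ) - γ) hφ
    have h1 := (Λ.continuous.tendsto _).comp (hFi i)
    rw [hΛ, ← hgF, pairing_toLp] at h1
    refine h1.congr fun n => ?_
    rw [Function.comp_apply, hΛ, jet_apply, pairing_toLp]
  have h0 : ∀ n, weakDeriv (w n) i₀ = w n := fun n =>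
    weakDeriv_eq _ i₀ (isWeakDeriv_zero_zero _) (by simpa [i₀] using (w n).2.1)
  have hwd : ∀ i : Idx m, IsWeakDeriv i.1.1 i.1.2 (g i₀) (g i) := by
    intro i φ hφ
    have h1 := hlim i₀ (hφ.mixed i.1.1 i.1.2)
    have h2 := (hlim i hφ).const_mul ((-1 : ℂ) ^ ((i.1.1 : ℕ) + (i.1.2 : ℕ)))
    refine tendsto_nhds_unique h1 (h2.congr fun n => ?_)
    rw [h0]
    exact (isWeakDeriv_weakDeriv (w n) i φ hφ).symm
  have hmem : g i₀ ∈ K m γ := by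
    refine ⟨by simpa [i₀] using hg i₀, fun p q hpq => ?_⟩
    let i : Idx m := ⟨(⟨p, by omega⟩, ⟨q, by omega⟩), hpq⟩
    exact ⟨g i, hwd i, hg i⟩
  refine ⟨⟨g i₀, hmem⟩, ?_⟩
  ext1 i
  rw [jet_apply, ← hgF i]
  have e := weakDeriv_eq ⟨g i₀, hmem⟩ i (hwd i) (hg i)
  congr 1
  rw [e]

instance instCompleteSpaceK (m : ℕ) (γ : ℝ) : CompleteSpace (K m γ) :=
  (completeSpace_iff_isComplete_range (isometry_jet m γ).isUniformInducing).2
    (isClosed_range_jet m γ).isComplete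

theorem exists_pairing_K (m : ℕ) (γ : ℝ) {φ : ℝ × Circ → ℂ} (hφ : IsTest φ) :
    ∃ Λ : K m γ →L[ℂ] ℂ, ∀ w : K m γ, Λ w = ∫ x, (w : FunPi) x * φ x ∂muPi := by
  let i₀ : Idx m := ⟨(0, 0), by simp⟩
  obtain ⟨Λ, hΛ⟩ := exists_pairing ((i₀.1.1 : ℕ) - γ) hφ
  let j : K m γ →L[ℂ] PiLp 2 (fun _ : Idx m => Lp ℂ 2 muPi) :=
    ⟨jet m γ, (isometry_jet m γ).continuous⟩
  refine ⟨(Λ ∘L PiLp.proj 2 (fun _ : Idx m => Lp ℂ 2 muPi) i₀) ∘L j, fun w => ?_⟩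
  change Λ (jet m γ w i₀) = _
  rw [hΛ, jet_apply, pairing_toLp,
    weakDeriv_eq _ i₀ (isWeakDeriv_zero_zero _) (by simpa [i₀] using w.2.1)]

/-! ### Completeness of `H^m(𝕋)` -/

theorem isometry_coeffs (m : ℕ) : Isometry (coeffs m) :=
  AddMonoidHomClass.isometry_of_norm (coeffs m) fun _ => rfl

theorem exists_of_memℓp {x : ℤ → ℂ} (h : Memℓp x 2) :
    ∃ v : FunCirc, MemLp v 2 volume ∧ fourierCoeff v = x := by
  let f : Lp ℂ 2 (AddCircle.haarAddCircle (T := 2 * Real.pi)) :=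
    (fourierBasis (T := 2 * Real.pi)).repr.symm ⟨x, h⟩
  have hf : fourierCoeff f = x := by
    funext k
    rw [← fourierBasis_repr, LinearIsometryEquiv.apply_symm_apply]
  have hm : MemLp f 2 (volume : Measure Circ) := by
    rw [AddCircle.volume_eq_smul_haarAddCircle]
    exact (Lp.memLp f).smul_measure ENNReal.ofReal_ne_top
  have he := AEEqFun.coeFn_mk _ hm.1
  refine ⟨AEEqFun.mk _ hm.1, hm.ae_eq he.symm, ?_⟩
  rw [fourierCoeff_congr_circ he, hf]

theorem exists_H {m : ℕ} {c : ℤ → ℂ}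
    (h : Memℓp (fun k : ℤ => ((1 + (k : ℝ) ^ 2) ^ ((m : ℝ) / 2) : ℝ) * c k) 2) :
    ∃ v : H m, fourierCoeff (v : FunCirc) = c := by
  have h1 : Memℓp c 2 := by
    have h2 := (memℓp_gen_iff (by norm_num)).1 h
    refine (memℓp_gen_iff (by norm_num)).2 (Summable.of_nonneg_of_le (fun k => by positivity)
      (fun k => ?_) h2)
    refine Real.rpow_le_rpow (norm_nonneg _) ?_ (by norm_num)
    rw [norm_mul, Complex.norm_real]
    refine le_mul_of_one_le_left (norm_nonneg _) ((Real.one_le_rpow ?_ (by positivity)).trans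
      (Real.le_norm_self _))
    nlinarith [sq_nonneg (k : ℝ)]
  obtain ⟨v, hv, hc⟩ := exists_of_memℓp h1
  exact ⟨⟨v, hv, by rwa [hc]⟩, hc⟩

theorem surjective_coeffs (m : ℕ) : Function.Surjective (coeffs m) := by
  intro x
  have hp : ∀ k : ℤ, (((1 + (k : ℝ) ^ 2) ^ ((m : ℝ) / 2) : ℝ) : ℂ) ≠ 0 := fun k => by
    exact_mod_cast (Real.rpow_pos_of_pos (by positivity) _).ne'
  have e : (fun k : ℤ => (((1 + (k : ℝ) ^ 2) ^ ((m : ℝ) / 2) : ℝ) : ℂ) *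
      ((((1 + (k : ℝ) ^ 2) ^ ((m : ℝ) / 2) : ℝ) : ℂ)⁻¹ * x k)) = x := by
    funext k
    rw [mul_inv_cancel_left₀ (hp k)]
  obtain ⟨v, hv⟩ := exists_H (m := m)
    (c := fun k => (((1 + (k : ℝ) ^ 2) ^ ((m : ℝ) / 2) : ℝ) : ℂ)⁻¹ * x k) (by
      rw [e]; exact lp.memℓp x)
  refine ⟨v, ?_⟩
  ext k
  rw [coeffs_apply, hv]
  exact congrFun e k

instance instCompleteSpaceH (m : ℕ) : CompleteSpace (H m) :=
  (completeSpace_iff_isComplete_range (isometry_coeffs m).isUniformInducing).2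
    (by rw [(surjective_coeffs m).range_eq]; exact isComplete_univ)

theorem isometry_decomp (m : ℕ) (γ : ℝ) [Fact (1 / 2 < γ)] : Isometry (decomp m γ) :=
  AddMonoidHomClass.isometry_of_norm (decomp m γ) fun _ => rfl

instance instCompleteSpaceJ0 (m : ℕ) (γ : ℝ) [Fact (1 / 2 < γ)] : CompleteSpace (J0 m γ) :=
  (completeSpace_iff_isComplete_range (isometry_decomp m γ).isUniformInducing).2
    (by rw [(decomp m γ).surjective.range_eq]; exact isComplete_univ)

theorem isometry_mult (m : ℕ) (γ σ : ℝ) [Fact (1 / 2 < γ)] : Isometry (mult m γ σ) :=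
  AddMonoidHomClass.isometry_of_norm (mult m γ σ) fun _ => rfl

/-! ### Synthesis of elements of `K^m_γ(Π)` -/

/-- The converse of `X.of_chain`: set f_(p+1) = (ψ∂_ψ - (c+p)) f_p. For c = 0 the members play the
role of ψ^p ∂_ψ^p a; the offset c lets the induction restart from the first member. -/
theorem X.exists_chain {γ σ : ℝ} {m : ℕ} {a : ℤ → ℝ → ℂ} (h : X γ σ m a) (c : ℕ) :
    ∃ f : ℕ → ℤ → ℝ → ℂ, f 0 = a ∧ (∀ p, X γ σ (m - p) (f p)) ∧
      ∀ p < m, ∀ k, HasDer (f p k) fun s => (s : ℂ)⁻¹ * ((c + p) * f p k s + f (p + 1) k s) := by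
  induction m generalizing a c with
  | zero => exact ⟨fun _ => a, rfl, fun p => by simpa using h, fun p hp => absurd hp (by omega)⟩
  | succ m ih =>
    obtain ⟨h0, h1, a', h2, h3⟩ := id h
    obtain ⟨f, e, hf, hd⟩ := ih (h2.add (X.const_mul h.of_succ (-(c : ℂ)))) (c + 1)
    refine ⟨fun p => Nat.casesOn p a f, rfl, fun p => ?_, fun p hp k => ?_⟩
    · cases p with
      | zero => exact h
      | succ p => simpa using hf p
    · cases p with
      | zero =>
        refine (h3 k).congr .rfl (Eventually.of_forall fun s => ?_)
        change _ = (s : ℂ)⁻¹ * ((c + (0 : ℕ)) * a k s + f 0 k s)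
        rw [e]
        push_cast
        ring
      | succ p =>
        refine (hd p (by omega) k).congr .rfl (Eventually.of_forall fun s => ?_)
        push_cast
        ring

theorem X.pow_mul {γ σ : ℝ} {n : ℕ} {a : ℤ → ℝ → ℂ} (h : X γ σ n a) {q : ℕ} (hq : q ≤ n) :
    X0 γ σ fun k r => (k : ℂ) ^ q * a k r := by
  induction q generalizing n a with
  | zero => simpa using h.base
  | succ q ih =>
    obtain ⟨n, rfl⟩ : ∃ n', n = n' + 1 := ⟨n - 1, by omega⟩
    refine (ih h.2.1 (by omega)).congr fun k => Eventually.of_forall fun r => ?_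
    ring

theorem HasDer.inv_pow_mul {f g : ℝ → ℂ} {p : ℕ}
    (h : HasDer f fun s => (s : ℂ)⁻¹ * (p * f s + g s)) :
    HasDer (fun r => ((r : ℂ) ^ p)⁻¹ * f r) fun r => ((r : ℂ) ^ (p + 1))⁻¹ * g r := by
  have h1 : HasDer (fun r : ℝ => ((r : ℂ) ^ p)⁻¹)
      fun r => -(p * (r : ℂ) ^ (p - 1)) / ((r : ℂ) ^ p) ^ 2 := by
    have hne : ∀ x ∈ Ioc (0 : ℝ) 1, (x : ℂ) ≠ 0 := fun x hx => by exact_mod_cast hx.1.ne'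
    refine HasDer.of_hasDerivAt ?_ ?_ fun x hx => ?_
    · exact ContinuousOn.inv₀ (by fun_prop) fun x hx => pow_ne_zero _ (hne x hx)
    · exact ContinuousOn.div (by fun_prop) (by fun_prop)
        fun x hx => pow_ne_zero _ (pow_ne_zero _ (hne x hx))
    · exact ((hasDerivAt_pow p (x : ℂ)).inv
        (pow_ne_zero _ (hne x (Ioo_subset_Ioc_self hx)))).comp_ofReal
  refine (h1.mul h).congr .rfl ?_
  filter_upwards [ae_restrict_mem measurableSet_Ioc] with r hr
  have : (r : ℂ) ≠ 0 := by exact_mod_cast hr.1.ne'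
  cases p with
  | zero => simp [field]
  | succ p =>
    rw [Nat.add_sub_cancel]
    field_simp
    push_cast
    ring

/-! ### Single Fourier modes f(ψ) e^(ikθ): norms and weak derivatives. -/

theorem aestronglyMeasurable_mul_fourier {f : ℝ → ℂ} (hf : AEStronglyMeasurable f mu1) (k : ℤ) :
    AEStronglyMeasurable (fun x : ℝ × Circ => f x.1 * fourier k x.2) muPi :=
  (hf.comp_quasiMeasurePreserving Measure.quasiMeasurePreserving_fst).mul
    ((fourier k).continuous.comp continuous_snd).aestronglyMeasurable

/-- The function `f(ψ) e^{ikθ}`. -/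
def el (f : ℝ → ℂ) (k : ℤ) (hf : AEStronglyMeasurable f mu1) : FunPi :=
  AEEqFun.mk _ (aestronglyMeasurable_mul_fourier hf k)

theorem coeFn_el {f : ℝ → ℂ} {k : ℤ} (hf : AEStronglyMeasurable f mu1) :
    el f k hf =ᵐ[muPi] fun x => f x.1 * fourier k x.2 := AEEqFun.coeFn_mk _ _

theorem fourierCoeff_const_mul_fourier (c : ℂ) (k l : ℤ) :
    fourierCoeff (fun θ : Circ => c * fourier k θ) l = if l = k then c else 0 := by
  have h1 := congrFun (fourierCoeff_fourier (T := 2 * Real.pi) k) l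
  have h2 := fourierCoeff.const_mul (T := 2 * Real.pi) (fourier k) c l
  rw [h2, h1, Pi.single_apply]
  split_ifs <;> simp

theorem fc_el {f : ℝ → ℂ} {k : ℤ} (hf : AEStronglyMeasurable f mu1) (l : ℤ) :
    fc (el f k hf) l =ᵐ[mu1] fun r => if l = k then f r else 0 := by
  filter_upwards [ae_slice (coeFn_el hf)] with r hr
  rw [fc, fourierCoeff_congr_circ hr, fourierCoeff_const_mul_fourier]

theorem eLpNorm_sq {α : Type*} [MeasurableSpace α] {μ : Measure α} (f : α → ℂ) :
    eLpNorm f 2 μ ^ 2 = ∫⁻ x, ‖f x‖ₑ ^ 2 ∂μ := by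
  rw [eLpNorm_eq_lintegral_rpow_enorm_toReal (by simp) (by simp)]
  simp only [ENNReal.toReal_ofNat, ENNReal.rpow_two]
  rw [← ENNReal.rpow_natCast, ← ENNReal.rpow_mul]
  norm_num

theorem lintegral_weight_el {γ : ℝ} {p : ℕ} {f : ℝ → ℂ} {k : ℤ} (hf : AEStronglyMeasurable f mu1) :
    ∫⁻ x, ‖((x.1 ^ (p - γ) : ℝ) : ℂ) * el f k hf x‖ₑ ^ 2 ∂muPi =
      wI γ (fun r => ‖(r : ℂ) ^ p * f r‖ₑ ^ 2) * volume (univ : Set Circ) := by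
  have h1 : ∀ᵐ x ∂muPi, ‖((x.1 ^ (p - γ) : ℝ) : ℂ) * el f k hf x‖ₑ ^ 2 =
      (ENNReal.ofReal (x.1 ^ (-2 * γ)) * ‖(x.1 : ℂ) ^ p * f x.1‖ₑ ^ 2) * 1 := by
    filter_upwards [coeFn_el (k := k) hf, ae_fst_mem] with x hx h0
    have h2 : ‖(fourier k x.2 : ℂ)‖ₑ = 1 := by
      rw [← ofReal_norm, fourier_apply, Circle.norm_coe, ENNReal.ofReal_one]
    rw [hx, enorm_mul, enorm_mul, h2, mul_one, mul_one, enorm_mul, mul_pow, mul_pow, ← mul_assoc]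
    congr 1
    rw [← ofReal_norm, ← ofReal_norm, ← ENNReal.ofReal_pow (norm_nonneg _),
      ← ENNReal.ofReal_pow (norm_nonneg _), ← ENNReal.ofReal_mul (Real.rpow_nonneg h0.1.le _),
      norm_pow, Complex.norm_real, Complex.norm_real, Real.norm_of_nonneg h0.1.le,
      Real.norm_of_nonneg (Real.rpow_nonneg h0.1.le _), ← Real.rpow_natCast _ 2,
      ← Real.rpow_mul h0.1.le, ← pow_mul, ← Real.rpow_natCast _ (p * 2), ← Real.rpow_add h0.1]
    congr 2
    push_cast
    ring
  have hm : AEMeasurable (fun r : ℝ => ENNReal.ofReal (r ^ (-2 * γ)) *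
      ‖(r : ℂ) ^ p * f r‖ₑ ^ 2) mu1 := by
    refine (measurable_weight γ).aemeasurable.mul (AEMeasurable.pow_const ?_ 2)
    have h3 : AEStronglyMeasurable (fun r : ℝ => (r : ℂ) ^ p) mu1 :=
      Continuous.aestronglyMeasurable (by fun_prop)
    exact (h3.mul hf).enorm
  rw [lintegral_congr_ae h1, lintegral_prod_mul hm aemeasurable_const, wI]
  simp

theorem weightedL2_el {γ : ℝ} {p : ℕ} {f : ℝ → ℂ} (hf : S0 γ fun r => (r : ℂ) ^ p * f r)
    (k : ℤ) (hm : AEStronglyMeasurable f mu1) : WeightedL2 (p - γ) (el f k hm) := by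
  refine ⟨?_, ?_⟩
  · refine AEStronglyMeasurable.mul ?_ (el f k hm).aestronglyMeasurable
    have : Measurable fun x : ℝ × Circ => ((x.1 ^ (p - γ) : ℝ) : ℂ) := by fun_prop
    exact this.aestronglyMeasurable
  · refine lt_top_iff_ne_top.2 fun h => ?_
    have h1 := lintegral_weight_el (γ := γ) (p := p) (k := k) hm
    rw [← eLpNorm_sq, h, ENNReal.top_pow (by norm_num)] at h1
    exact ENNReal.mul_ne_top hf.2 (measure_ne_top _ _) h1.symm

theorem IsTest.slice {φ : ℝ × Circ → ℂ} (h : IsTest φ) (θ : Circ) (L : ℂ →L[ℝ] ℝ) :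
    IsTest1 fun r => L (φ (r, θ)) := by
  obtain ⟨K, hK, hs, h0⟩ := h.supp
  have hsub : Function.support (fun r => L (φ (r, θ))) ⊆ K := by
    intro r hr
    refine h0 (r, θ) fun h1 => hr ?_
    change L (φ (r, θ)) = 0
    rw [h1, map_zero]
  have ht := closure_minimal hsub hK.isClosed
  refine ⟨?_, hK.of_isClosed_subset isClosed_closure ht, ht.trans hs⟩
  induction θ using QuotientAddGroup.induction_on with
  | H t => exact L.contDiff.comp (h.smooth.comp (contDiff_id.prodMk contDiff_const))

theorem IsTest.hasDerivAt_fst {φ : ℝ × Circ → ℂ} (h : IsTest φ) (r : ℝ) (θ : Circ) :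
    HasDerivAt (fun s : ℝ => φ (s, θ)) (Kondratev.dPsi φ (r, θ)) r := by
  induction θ using QuotientAddGroup.induction_on with
  | H t =>
    have h1 : ContDiff ℝ ∞ fun s : ℝ => φ (s, (t : Circ)) :=
      h.smooth.comp (contDiff_id.prodMk contDiff_const)
    exact ((h1.differentiable (by simp)) r).hasDerivAt

theorem IsTest.hasDerivAt_snd {φ : ℝ × Circ → ℂ} (h : IsTest φ) (r t : ℝ) :
    HasDerivAt (fun s : ℝ => φ (r, (s : Circ))) (Kondratev.dTheta φ (r, (t : Circ))) t := by
  rw [h.dTheta_lift (r, t)]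
  have hd := ((h.smooth.differentiable (by simp)) (r, t)).hasFDerivAt
  have hl : HasDerivAt (fun s : ℝ => ((r, s) : ℝ × ℝ)) ((0 : ℝ), (1 : ℝ)) t :=
    (hasDerivAt_const _ _).prodMk (hasDerivAt_id t)
  exact hd.comp_hasDerivAt t hl

theorem integral_el_mul {f : ℝ → ℂ} {k : ℤ} (hf : AEStronglyMeasurable f mu1)
    (φ : ℝ × Circ → ℂ) :
    ∫ x, el f k hf x * φ x ∂muPi = ∫ x, f x.1 * fourier k x.2 * φ x ∂muPi := by
  refine integral_congr_ae ?_
  filter_upwards [coeFn_el (k := k) hf] with x hx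
  rw [hx]

/-- One-dimensional integration by parts on each line θ = const. That statement is for real test
functions, so the real and imaginary parts of φ are treated separately. -/
theorem integral_el_mul_dPsi {s t : ℝ} {f g : ℝ → ℂ} {k : ℤ} (hf : AEStronglyMeasurable f mu1)
    (hg : AEStronglyMeasurable g mu1) (hf2 : WeightedL2 s (el f k hf))
    (hg2 : WeightedL2 t (el g k hg)) (hfl : LocInt f) (h : HasDer f g) {φ : ℝ × Circ → ℂ}
    (hφ : IsTest φ) :
    ∫ x, el f k hf x * dPsi φ x ∂muPi = -∫ x, el g k hg x * φ x ∂muPi := by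
  have i1 := (hf2.integrable_mul_test hφ.dPsi).congr
    (g := fun x => f x.1 * fourier k x.2 * dPsi φ x) (by
      filter_upwards [coeFn_el (k := k) hf] with x hx
      rw [hx])
  have i2 := (hg2.integrable_mul_test hφ).congr
    (g := fun x => g x.1 * fourier k x.2 * φ x) (by
      filter_upwards [coeFn_el (k := k) hg] with x hx
      rw [hx])
  rw [integral_el_mul, integral_el_mul, integral_prod_symm _ i1, integral_prod_symm _ i2,
    ← integral_neg]
  refine integral_congr_ae (Eventually.of_forall fun θ => ?_)
  have hre := hφ.slice θ Complex.reCLM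
  have him := hφ.slice θ Complex.imCLM
  have hd : ∀ r, dPsi φ (r, θ) = ((deriv (fun r => Complex.reCLM (φ (r, θ))) r : ℝ) : ℂ) +
      ((deriv (fun r => Complex.imCLM (φ (r, θ))) r : ℝ) : ℂ) * Complex.I := by
    intro r
    have h0 := hφ.hasDerivAt_fst r θ
    have h1 : deriv (fun r => Complex.reCLM (φ (r, θ))) r = (dPsi φ (r, θ)).re :=
      (Complex.reCLM.hasFDerivAt.comp_hasDerivAt r h0).deriv
    have h2 : deriv (fun r => Complex.imCLM (φ (r, θ))) r = (dPsi φ (r, θ)).im :=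
      (Complex.imCLM.hasFDerivAt.comp_hasDerivAt r h0).deriv
    rw [h1, h2]
    exact (Complex.re_add_im _).symm
  have e1 : ∀ r, f r * fourier k θ * dPsi φ (r, θ) =
      fourier k θ * (f r * ((deriv (fun r => Complex.reCLM (φ (r, θ))) r : ℝ) : ℂ)) +
      fourier k θ * Complex.I *
        (f r * ((deriv (fun r => Complex.imCLM (φ (r, θ))) r : ℝ) : ℂ)) := fun r => by
    rw [hd]; ring
  have e2 : ∀ r, g r * fourier k θ * φ (r, θ) =
      fourier k θ * (g r * (Complex.reCLM (φ (r, θ)) : ℂ)) +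
      fourier k θ * Complex.I * (g r * (Complex.imCLM (φ (r, θ)) : ℂ)) := fun r => by
    conv_lhs => rw [← Complex.re_add_im (φ (r, θ))]
    simp only [Complex.reCLM_apply, Complex.imCLM_apply]
    ring
  simp only [e1, e2]
  rw [integral_add ((hfl.integrable_mul hre.deriv).const_mul _)
    ((hfl.integrable_mul him.deriv).const_mul _),
    integral_add ((LocInt.integrable_mul h.1 hre).const_mul _)
    ((LocInt.integrable_mul h.1 him).const_mul _), integral_const_mul, integral_const_mul,
    integral_const_mul, integral_const_mul, h.integral_mul_deriv hfl hre,
    h.integral_mul_deriv hfl him]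
  ring

theorem hasDerivAt_fourier_circ (k : ℤ) (t : ℝ) :
    HasDerivAt (fun s : ℝ => (fourier k (s : Circ) : ℂ))
      (Complex.I * k * fourier k (t : Circ)) t := by
  have h2 := hasDerivAt_fourier (2 * Real.pi) k t
  have e : Complex.I * k = 2 * (Real.pi : ℂ) * Complex.I * k / ((2 * Real.pi : ℝ) : ℂ) := by
    push_cast
    have : (Real.pi : ℂ) ≠ 0 := by exact_mod_cast Real.pi_ne_zero
    field_simp
  rw [e]
  exact h2

/-- The integral of the derivative of e^(ikθ) φ over a period is zero. -/
theorem integral_fourier_mul_dTheta {φ : ℝ × Circ → ℂ} (hφ : IsTest φ) (k : ℤ) (r : ℝ) :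
    ∫ θ : Circ, fourier k θ * dTheta φ (r, θ) =
      -(Complex.I * k) * ∫ θ : Circ, fourier k θ * φ (r, θ) := by
  have hc : ∀ {φ}, IsTest φ → Continuous fun t : ℝ => fourier k (t : Circ) * φ (r, (t : Circ)) := by
    intro φ hφ
    have h1 : Continuous fun t : ℝ => ((r, (t : Circ)) : ℝ × Circ) := by
      have := AddCircle.continuous_mk' (2 * Real.pi)
      fun_prop
    exact ((fourier k).continuous.comp (AddCircle.continuous_mk' _)).mul (hφ.continuous.comp h1)
  rw [← AddCircle.intervalIntegral_preimage (2 * Real.pi) 0, ← AddCircle.intervalIntegral_preimage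
    (2 * Real.pi) 0]
  have h1 := intervalIntegral.integral_eq_sub_of_hasDerivAt
    (fun t _ => (hasDerivAt_fourier_circ k t).mul (hφ.hasDerivAt_snd r t)) (a := 0)
    (b := 0 + 2 * Real.pi) (by
      refine Continuous.intervalIntegrable ?_ _ _
      simp only [mul_assoc]
      exact ((hc hφ).const_mul _ |>.const_mul _).add (hc hφ.dTheta))
  have e0 : ((0 + 2 * Real.pi : ℝ) : Circ) = ((0 : ℝ) : Circ) := by
    rw [zero_add, AddCircle.coe_period]; rfl
  simp only [Pi.mul_apply, e0, sub_self] at h1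
  rw [intervalIntegral.integral_add ?_ ((hc hφ.dTheta).intervalIntegrable _ _)] at h1
  · simp only [mul_assoc] at h1 ⊢
    rw [intervalIntegral.integral_const_mul, intervalIntegral.integral_const_mul] at h1
    linear_combination h1
  · simp only [mul_assoc]
    exact ((hc hφ).const_mul _ |>.const_mul _).intervalIntegrable _ _

theorem integral_el_mul_dTheta {s : ℝ} {f : ℝ → ℂ} {k : ℤ} (hf : AEStronglyMeasurable f mu1)
    (hf2 : WeightedL2 s (el f k hf)) {φ : ℝ × Circ → ℂ} (hφ : IsTest φ) :
    ∫ x, el f k hf x * dTheta φ x ∂muPi =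
      -(Complex.I * k) * ∫ x, el f k hf x * φ x ∂muPi := by
  have i1 : ∀ {φ}, IsTest φ → Integrable (fun x => f x.1 * fourier k x.2 * φ x) muPi := fun hφ =>
    (hf2.integrable_mul_test hφ).congr (by
      filter_upwards [coeFn_el (k := k) hf] with x hx
      rw [hx])
  rw [integral_el_mul, integral_el_mul, integral_prod _ (i1 hφ.dTheta), integral_prod _ (i1 hφ),
    ← integral_const_mul]
  refine integral_congr_ae (Eventually.of_forall fun r => ?_)
  simp only [mul_assoc]
  rw [integral_const_mul, integral_const_mul, integral_fourier_mul_dTheta hφ]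
  ring

theorem isWeakDeriv_el {γ : ℝ} (hγ : 0 ≤ γ) {m : ℕ} {h : ℕ → ℝ → ℂ}
    (hm : ∀ p, AEStronglyMeasurable (h p) mu1)
    (hS : ∀ p ≤ m, S0 γ fun r => (r : ℂ) ^ p * h p r) (hD : ∀ p < m, HasDer (h p) (h (p + 1)))
    (k : ℤ) {p q : ℕ} (hp : p ≤ m) :
    IsWeakDeriv p q (el (h 0) k (hm 0)) ((Complex.I * k) ^ q • el (h p) k (hm p)) := by
  have h1 : ∀ p ≤ m, ∀ φ, IsTest φ → ∫ x, el (h 0) k (hm 0) x * (dPsi^[p] φ) x ∂muPi =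
      (-1) ^ p * ∫ x, el (h p) k (hm p) x * φ x ∂muPi := by
    intro p
    induction p with
    | zero => intro _ φ _; simp
    | succ p ih =>
      intro hp φ hφ
      rw [Function.iterate_succ_apply, ih (by omega) _ hφ.dPsi, integral_el_mul_dPsi (hm p)
        (hm (p + 1)) (weightedL2_el (hS p (by omega)) k _) (weightedL2_el (hS (p + 1) hp) k _)
        (S0.locInt hγ (hS p (by omega))).of_pow_mul (hD p (by omega)) hφ, pow_succ]
      ring
  have h2 : ∀ q, ∀ φ, IsTest φ → ∫ x, el (h p) k (hm p) x * (dTheta^[q] φ) x ∂muPi =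
      (-(Complex.I * k)) ^ q * ∫ x, el (h p) k (hm p) x * φ x ∂muPi := by
    intro q
    induction q with
    | zero => intro φ _; simp
    | succ q ih =>
      intro φ hφ
      rw [Function.iterate_succ_apply, ih _ hφ.dTheta, integral_el_mul_dTheta (hm p)
        (weightedL2_el (hS p hp) k _) hφ, pow_succ]
      ring
  intro φ hφ
  have hq : IsTest (dTheta^[q] φ) := hφ.mixed 0 q
  rw [h1 p hp _ hq, h2 q φ hφ]
  have e : ∫ x, ((Complex.I * k) ^ q • el (h p) k (hm p)) x * φ x ∂muPi =
      (Complex.I * k) ^ q * ∫ x, el (h p) k (hm p) x * φ x ∂muPi := by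
    rw [← integral_const_mul]
    refine integral_congr_ae ?_
    filter_upwards [AEEqFun.coeFn_smul ((Complex.I * k) ^ q) (el (h p) k (hm p))] with x hx
    rw [hx, Pi.smul_apply, smul_eq_mul]
    ring
  rw [e, neg_pow (Complex.I * k), pow_add]
  ring

theorem el_congr {f g : ℝ → ℂ} {k : ℤ} (hf : AEStronglyMeasurable f mu1)
    (hg : AEStronglyMeasurable g mu1) (h : f =ᵐ[mu1] g) : el f k hf = el g k hg := by
  refine AEEqFun.mk_eq_mk.2 ?_
  have := Measure.quasiMeasurePreserving_fst (μ := mu1) (ν := (volume : Measure Circ)) |>.ae h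
  filter_upwards [this] with x hx
  rw [hx]

theorem integral_fourier_eq_zero {n : ℤ} (hn : n ≠ 0) : ∫ θ : Circ, fourier n θ = 0 := by
  have h1 := congrFun (fourierCoeff_fourier (T := 2 * Real.pi) n) 0
  rw [Pi.single_eq_of_ne hn.symm, fourierCoeff, AddCircle.integral_haarAddCircle] at h1
  simpa [Real.pi_ne_zero] using h1

theorem inner_toLp_el {s : ℝ} {f g : ℝ → ℂ} {k l : ℤ} (hkl : k ≠ l) (c d : ℂ)
    (hf : AEStronglyMeasurable f mu1) (hg : AEStronglyMeasurable g mu1)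
    (hf2 : WeightedL2 s (c • el f k hf)) (hg2 : WeightedL2 s (d • el g l hg)) :
    inner ℂ (MemLp.toLp _ hf2) (MemLp.toLp _ hg2) = 0 := by
  rw [L2.inner_def]
  have h1 : ∀ᵐ x ∂muPi, inner ℂ (MemLp.toLp _ hf2 x) (MemLp.toLp _ hg2 x) =
      (((x.1 ^ s : ℝ) : ℂ) ^ 2 * ((starRingEnd ℂ) (c * f x.1) * (d * g x.1))) *
        fourier (l - k) x.2 := by
    filter_upwards [hf2.coeFn_toLp, hg2.coeFn_toLp, AEEqFun.coeFn_smul c (el f k hf),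
      AEEqFun.coeFn_smul d (el g l hg), coeFn_el (k := k) hf, coeFn_el (k := l) hg]
      with x h1 h2 h3 h4 h5 h6
    rw [h1, h2, h3, h4, Pi.smul_apply, Pi.smul_apply, h5, h6, sub_eq_add_neg, fourier_add,
      fourier_neg, RCLike.inner_apply]
    simp only [smul_eq_mul, map_mul, Complex.conj_ofReal]
    ring
  rw [integral_congr_ae h1, integral_prod_mul
    (fun r : ℝ => ((r ^ s : ℝ) : ℂ) ^ 2 * ((starRingEnd ℂ) (c * f r) * (d * g r)))
    (fun θ : Circ => (fourier (l - k) θ : ℂ)), integral_fourier_eq_zero (sub_ne_zero.2 hkl.symm),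
    mul_zero]

/-- Unconditional convergence of an orthogonal series, through the orthogonal family of the lines
spanned by its terms. -/
theorem summable_of_pairwise_inner_eq_zero {E : Type*} [NormedAddCommGroup E]
    [InnerProductSpace ℂ E] [CompleteSpace E] {ι : Type*} {v : ι → E}
    (h : Pairwise fun i j => inner ℂ (v i) (v j) = 0) (hs : Summable fun i => ‖v i‖ ^ 2) :
    Summable v := by
  have hV : OrthogonalFamily ℂ (fun i => (ℂ ∙ v i : Submodule ℂ E))
      fun i => (ℂ ∙ v i).subtypeₗᵢ := by
    refine OrthogonalFamily.of_pairwise fun i j hij => ?_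
    refine Submodule.isOrtho_span.2 ?_
    rintro u (rfl : u = _) w (rfl : w = _)
    exact h hij
  exact (hV.summable_iff_norm_sq_summable
    fun i => ⟨v i, Submodule.mem_span_singleton_self _⟩).2 hs

/-- The squared norm of each mode is a weighted integral of its coefficient times the length of the
circle; the sum over k is then the integral defining `X0`. -/
theorem X0.summable_toLp {γ : ℝ} {p q : ℕ} {f g : ℤ → ℝ → ℂ}
    (hf : X0 γ 0 fun k r => (k : ℂ) ^ q * f k r) (hgf : ∀ k, ∀ᵐ r : ℝ ∂mu1, (r : ℂ) ^ p * g k r = f k r)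
    (hm : ∀ k, AEStronglyMeasurable (g k) mu1)
    (hg : ∀ k : ℤ, WeightedL2 (p - γ) ((Complex.I * k) ^ q • el (g k) k (hm k))) :
    Summable fun k => ‖MemLp.toLp _ (hg k)‖ ^ 2 := by
  have h1 : ∀ k : ℤ, ‖MemLp.toLp _ (hg k)‖ₑ ^ 2 =
      wI γ (fun r => ‖(k : ℂ) ^ q * f k r‖ₑ ^ 2) * volume (univ : Set Circ) := by
    intro k
    have e : wI γ (fun r => ‖(k : ℂ) ^ q * f k r‖ₑ ^ 2) =
        ‖(k : ℂ) ^ q‖ₑ ^ 2 * wI γ (fun r => ‖(r : ℂ) ^ p * g k r‖ₑ ^ 2) := by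
      rw [← wI_const_mul (by finiteness)]
      refine wI_congr ?_
      filter_upwards [hgf k] with r hr
      rw [hr, enorm_mul, mul_pow]
    refine (congrArg (· ^ 2) (Lp.enorm_toLp (hf := hg k))).trans ?_
    change eLpNorm _ 2 muPi ^ 2 = _
    rw [eLpNorm_sq, e, mul_assoc, ← lintegral_weight_el (hm k),
      ← lintegral_const_mul' _ _ (by finiteness)]
    refine lintegral_congr_ae ?_
    filter_upwards [AEEqFun.coeFn_smul ((Complex.I * k) ^ q) (el (g k) k (hm k))] with x hx
    rw [hx, Pi.smul_apply, smul_eq_mul, ← mul_pow, ← enorm_mul, mul_left_comm, enorm_mul,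
      mul_pow Complex.I, enorm_mul (Complex.I ^ q)]
    rw [enorm_mul ((k : ℂ) ^ q)]
    have : ‖Complex.I ^ q‖ₑ = 1 := by
      rw [← ofReal_norm, norm_pow, Complex.norm_I, one_pow, ENNReal.ofReal_one]
    rw [this, one_mul]
  have h2 : ∑' k : ℤ, ‖MemLp.toLp _ (hg k)‖ₑ ^ 2 ≠ ⊤ := by
    simp only [h1]
    rw [ENNReal.tsum_mul_right, ← wI_tsum fun k => (hf.1 k).enorm.pow_const 2]
    refine ENNReal.mul_ne_top ?_ (measure_ne_top _ _)
    convert hf.2 using 3 with r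
    simp [wN]
  refine (ENNReal.summable_toReal h2).congr fun k => ?_
  rw [ENNReal.toReal_pow, toReal_enorm]

/-- Each mode a_k(ψ) e^(ikθ) lies in `K`. Distinct modes have orthogonal jets, and the squared norms
are summable, so the series of jets converges; its sum is a jet because the range of `jet` is
closed. -/
theorem X.exists_K_hasSum {γ : ℝ} (hγ : 0 ≤ γ) {m : ℕ} {a : ℤ → ℝ → ℂ} (h : X γ 0 m a) :
    ∃ (w : ℤ → K m γ) (v : K m γ), (∀ k, (w k : FunPi) = el (a k) k (h.base.1 k)) ∧
      HasSum w v ∧ ∀ k, fc v k =ᵐ[mu1] a k := by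
  obtain ⟨f, e0, hf, hd⟩ := h.exists_chain 0
  set g : ℤ → ℕ → ℝ → ℂ := fun k p r => ((r : ℂ) ^ p)⁻¹ * f p k r with hgdef
  have hgf : ∀ p k, ∀ᵐ r : ℝ ∂mu1, (r : ℂ) ^ p * g k p r = f p k r := by
    intro p k
    filter_upwards [ae_restrict_mem measurableSet_Ioc] with r hr
    have : (r : ℂ) ≠ 0 := by exact_mod_cast hr.1.ne'
    simp only [hgdef]
    field_simp
  have hm : ∀ k p, AEStronglyMeasurable (g k p) mu1 := fun k p =>
    AEStronglyMeasurable.mul (Measurable.aestronglyMeasurable (by fun_prop)) ((hf p).base.1 k)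
  have hS : ∀ k p, S0 γ fun r => (r : ℂ) ^ p * g k p r := fun k p =>
    ((hf p).base.component le_rfl k).congr ((hgf p k).mono fun _ hr => hr.symm)
  have hD : ∀ k, ∀ p < m, HasDer (g k p) (g k (p + 1)) := fun k p hp =>
    HasDer.inv_pow_mul (by simpa using hd p hp k)
  have hW : ∀ (k : ℤ) (p q : ℕ), WeightedL2 (p - γ) ((Complex.I * k) ^ q • el (g k p) k (hm k p)) :=
    fun k p q => (weightedL2_el (hS k p) k (hm k p)).smul _
  have hmem : ∀ k, el (g k 0) k (hm k 0) ∈ K m γ := fun k =>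
    ⟨by simpa using weightedL2_el (hS k 0) k (hm k 0), fun p q hpq =>
      ⟨_, isWeakDeriv_el hγ (hm k) (fun p _ => hS k p) (hD k) k (by omega), hW k p q⟩⟩
  set w : ℤ → K m γ := fun k => ⟨_, hmem k⟩ with hw
  have hjet : ∀ k i, jet m γ (w k) i = MemLp.toLp _ (hW k i.1.1 i.1.2) := by
    intro k i
    have e := weakDeriv_eq (w k) i (isWeakDeriv_el hγ (hm k) (fun p _ => hS k p) (hD k) k
      (by have := i.2; omega)) (hW k i.1.1 i.1.2)
    rw [jet_apply]
    congr 1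
    rw [e]
  have hsum : Summable fun k => jet m γ (w k) := by
    refine summable_of_pairwise_inner_eq_zero (fun k l hkl => ?_) ?_
    · change inner ℂ (jet m γ (w k)) (jet m γ (w l)) = 0
      rw [PiLp.inner_apply]
      refine Finset.sum_eq_zero fun i _ => ?_
      rw [hjet, hjet]
      exact inner_toLp_el hkl _ _ _ _ _ _
    · simp only [PiLp.norm_sq_eq_of_L2, hjet]
      refine summable_sum fun i _ => ?_
      have hi : (i.1.2 : ℕ) ≤ m - i.1.1 := by have := i.2; omega
      exact X0.summable_toLp (g := fun k => g k i.1.1) ((hf i.1.1).pow_mul hi) (hgf i.1.1)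
        (fun k => hm k i.1.1) fun k => hW k i.1.1 i.1.2
  obtain ⟨v, hv⟩ : ∑' k, jet m γ (w k) ∈ range (jet m γ) :=
    (isClosed_range_jet m γ).mem_of_tendsto hsum.hasSum
      (Eventually.of_forall fun s => ⟨∑ k ∈ s, w k, map_sum _ _ _⟩)
  have hwv : HasSum w v := by
    refine ((isometry_jet m γ).isUniformInducing.isInducing.hasSum_iff (g := jet m γ) w v).1 ?_
    rw [hv]
    exact hsum.hasSum
  have he : ∀ k, (w k : FunPi) = el (a k) k (h.base.1 k) := fun k =>
    el_congr (hm k 0) _ (Eventually.of_forall fun r => by simp [hgdef, e0])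
  refine ⟨w, v, he, hwv, fun l => ?_⟩
  have hlv : LocInt (fc (v : FunPi) l) :=
    WeightedL2.locInt_fc (p := 0) hγ (by simpa using v.2.1) l
  have hla : LocInt (a l) := S0.locInt hγ (h.base.component le_rfl l)
  have hl : LocInt fun r => fc (v : FunPi) l r - a l r := fun x hx => (hlv x hx).sub (hla x hx)
  -- The coefficients of the sum are found by testing: the pairing with χ(ψ) e^(-ilθ) is continuous
  -- on `K`, and in the series only the term k = l contributes.
  have := hl.ae_eq_zero fun χ hχ => by
    obtain ⟨Λ, hΛ⟩ := exists_pairing_K m γ (hχ.isTest (-l))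
    have h1 := hwv.mapL Λ
    simp only [hΛ, integral_mul_isTest1 v.2.1 hχ, integral_mul_isTest1 (w _).2.1 hχ] at h1
    have h2 : ∀ k, ∫ r, fc (w k) l r * χ r ∂mu1 = if k = l then ∫ r, a l r * χ r ∂mu1 else 0 := by
      intro k
      split_ifs with hkl
      · subst hkl
        refine integral_congr_ae ?_
        filter_upwards [fc_el (h.base.1 k) (k := k) k] with r hr
        rw [he, hr, if_pos rfl]
      · refine integral_eq_zero_of_ae ?_
        filter_upwards [fc_el (h.base.1 k) (k := k) l] with r hr
        rw [he, hr, if_neg (Ne.symm hkl), zero_mul, Pi.zero_apply]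
    simp only [h2] at h1
    have h3 := h1.unique (hasSum_single l fun k hk => by rw [if_neg hk, mul_zero])
    rw [if_pos rfl] at h3
    have h4 := mul_left_cancel₀ (by exact_mod_cast Real.two_pi_pos.ne') h3
    simp only [sub_mul]
    rw [integral_sub (hlv.integrable_mul hχ) (hla.integrable_mul hχ), h4, sub_self]
  filter_upwards [this] with r hr
  rwa [Pi.zero_apply, sub_eq_zero] at hr

/-! ### Elements of `J^{m,σ}_{0,γ}(Π)` in terms of Fourier coefficients -/

/-- Exponential multipliers move along the scale in σ. All synthesis is therefore done at σ = 0 and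
transported. -/
theorem wN_exp_mul (σ τ : ℝ) (x : ℤ → ℂ) :
    wN (σ - τ) (fun k => (Real.exp (τ * |(k : ℝ)|) : ℂ) * x k) = wN σ x := by
  refine tsum_congr fun k => ?_
  rw [enorm_mul, ← ofReal_norm ((Real.exp (τ * |(k : ℝ)|) : ℂ)), Complex.norm_real,
    Real.norm_of_nonneg (Real.exp_pos _).le, ← mul_assoc,
    ← ENNReal.ofReal_mul (Real.exp_pos _).le, ← Real.exp_add]
  congr 4
  ring

theorem wN_mono {ρ σ : ℝ} (h : ρ ≤ σ) (x : ℤ → ℂ) : wN ρ x ≤ wN σ x :=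
  ENNReal.tsum_le_tsum fun k => by gcongr

theorem X.exp_mul {γ σ : ℝ} {n : ℕ} {a : ℤ → ℝ → ℂ} (h : X γ σ n a) (τ : ℝ) :
    X γ (σ - τ) n fun k r => (Real.exp (τ * |(k : ℝ)|) : ℂ) * a k r := by
  have h0 : ∀ {a : ℤ → ℝ → ℂ}, X0 γ σ a →
      X0 γ (σ - τ) fun k r => (Real.exp (τ * |(k : ℝ)|) : ℂ) * a k r := fun h =>
    ⟨fun k => (h.1 k).const_mul _, by simpa only [wN_exp_mul] using h.2⟩
  induction n generalizing a with
  | zero => exact h0 h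
  | succ n ih =>
    obtain ⟨k0, h1, a', h2, h3⟩ := h
    refine ⟨h0 k0, ?_, _, ih h2, fun k => ?_⟩
    · convert ih h1 using 3
      ring
    · convert (h3 k).const_mul (Real.exp (τ * |(k : ℝ)|) : ℂ) using 2
      ring

theorem X.weaken {γ ρ σ : ℝ} (hρ : ρ ≤ σ) {n : ℕ} {a : ℤ → ℝ → ℂ} (h : X γ σ n a) :
    X γ ρ n a := by
  have h0 : ∀ {a : ℤ → ℝ → ℂ}, X0 γ σ a → X0 γ ρ a := fun h =>
    ⟨h.1, ((wI_mono (Eventually.of_forall fun r => wN_mono hρ _)).trans_lt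
      (lt_top_iff_ne_top.2 h.2)).ne⟩
  induction n generalizing a with
  | zero => exact h0 h
  | succ n ih =>
    obtain ⟨k0, h1, a', h2, h3⟩ := h
    exact ⟨h0 k0, ih h1, a', ih h2, h3⟩

theorem Y.exp_mul {σ : ℝ} {n : ℕ} {c : ℤ → ℂ} (h : Y σ n c) (τ : ℝ) :
    Y (σ - τ) n fun k => (Real.exp (τ * |(k : ℝ)|) : ℂ) * c k := by
  induction n generalizing c with
  | zero => exact (wN_exp_mul σ τ c).trans_ne h
  | succ n ih =>
    refine ⟨(wN_exp_mul σ τ c).trans_ne h.1, ?_⟩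
    convert ih h.2 using 2
    ring

theorem Y.weaken {ρ σ : ℝ} (hρ : ρ ≤ σ) {n : ℕ} {c : ℤ → ℂ} (h : Y σ n c) : Y ρ n c := by
  induction n generalizing c with
  | zero => exact ((wN_mono hρ c).trans_lt (lt_top_iff_ne_top.2 h)).ne
  | succ n ih => exact ⟨((wN_mono hρ c).trans_lt (lt_top_iff_ne_top.2 h.1)).ne, ih h.2⟩

theorem X.exp_mul_self {γ σ : ℝ} {n : ℕ} {a : ℤ → ℝ → ℂ} (h : X γ σ n a) :
    X γ 0 n fun k r => (Real.exp (σ * |(k : ℝ)|) : ℂ) * a k r := by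
  have := h.exp_mul σ
  rwa [sub_self] at this

theorem X.exp_neg_mul {γ : ℝ} {n : ℕ} {a : ℤ → ℝ → ℂ} (h : X γ 0 n a) (σ : ℝ) :
    X γ σ n fun k r => (Real.exp (-σ * |(k : ℝ)|) : ℂ) * a k r := by
  have := h.exp_mul (-σ)
  rwa [zero_sub, neg_neg] at this

theorem Y.exp_mul_self {σ : ℝ} {n : ℕ} {c : ℤ → ℂ} (h : Y σ n c) :
    Y 0 n fun k => (Real.exp (σ * |(k : ℝ)|) : ℂ) * c k := by
  have := h.exp_mul σ
  rwa [sub_self] at this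

theorem Y.exp_neg_mul {n : ℕ} {c : ℤ → ℂ} (h : Y 0 n c) (σ : ℝ) :
    Y σ n fun k => (Real.exp (-σ * |(k : ℝ)|) : ℂ) * c k := by
  have := h.exp_mul (-σ)
  rwa [zero_sub, neg_neg] at this

theorem Y.const_mul {σ : ℝ} {n : ℕ} {c : ℤ → ℂ} (h : Y σ n c) (b : ℂ) :
    Y σ n fun k => b * c k := by
  induction n generalizing c with
  | zero => exact (wN_const_mul σ b c).trans_ne (ENNReal.mul_ne_top (by finiteness) h)
  | succ n ih =>
    refine ⟨(wN_const_mul σ b c).trans_ne (ENNReal.mul_ne_top (by finiteness) h.1), ?_⟩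
    convert ih h.2 using 2
    ring

theorem Y.single (σ : ℝ) (n : ℕ) (l : ℤ) (x : ℂ) : Y σ n fun k => if k = l then x else 0 := by
  induction n generalizing x with
  | zero => exact (wN_single σ l x).trans_ne (by finiteness)
  | succ n ih =>
    refine ⟨(wN_single σ l x).trans_ne (by finiteness), ?_⟩
    convert ih (l * x) using 2 with k
    by_cases h : k = l <;> simp [h]

theorem wN_zero (x : ℤ → ℂ) : wN 0 x = ∑' k, ‖x k‖ₑ ^ 2 := by simp [wN]

theorem memℓp_two_iff {x : ℤ → ℂ} : Memℓp x 2 ↔ wN 0 x ≠ ⊤ := by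
  rw [memℓp_gen_iff (by norm_num), wN_zero]
  have e : ∀ k, ‖x k‖ₑ ^ 2 = ENNReal.ofReal (‖x k‖ ^ (2 : ℝ≥0∞).toReal) := fun k => by
    rw [← ofReal_norm, ← ENNReal.ofReal_pow (norm_nonneg _)]
    simp
  simp only [e]
  refine ⟨fun h => ?_, fun h => ?_⟩
  · rw [← ENNReal.ofReal_tsum_of_nonneg (fun k => by positivity) h]
    exact ENNReal.ofReal_ne_top
  · refine (ENNReal.summable_toReal h).congr fun k => ?_
    rw [ENNReal.toReal_ofReal (by positivity)]

theorem wN_le_of_norm_le {σ : ℝ} {x y : ℤ → ℂ} (h : ∀ k, ‖x k‖ ≤ ‖y k‖) : wN σ x ≤ wN σ y := by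
  refine ENNReal.tsum_le_tsum fun k => pow_le_pow_left' ?_ 2
  gcongr
  exact enorm_le_iff_norm_le.2 (h k)

theorem Y.pow_mul {σ : ℝ} {n : ℕ} {c : ℤ → ℂ} (h : Y σ n c) {q : ℕ} (hq : q ≤ n) :
    wN σ (fun k => (k : ℂ) ^ q * c k) ≠ ⊤ := by
  induction q generalizing n c with
  | zero => simpa using h.base
  | succ q ih =>
    obtain ⟨n, rfl⟩ : ∃ n', n = n' + 1 := ⟨n - 1, by omega⟩
    convert ih h.2 (by omega) using 3
    ring

theorem Y.of_pow_mul {σ : ℝ} {n : ℕ} {c : ℤ → ℂ}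
    (h : ∀ q ≤ n, wN σ (fun k => (k : ℂ) ^ q * c k) ≠ ⊤) : Y σ n c := by
  induction n generalizing c with
  | zero => simpa [Y] using h 0 le_rfl
  | succ n ih =>
    refine ⟨by simpa using h 0 (by omega), ih fun q hq => ?_⟩
    convert h (q + 1) (by omega) using 3
    ring

/-- The weight (1+k²)^(m/2) is at most 2^m (1 + |k|^m), and it dominates |k|^q for every q ≤ m. -/
theorem Y.iff_memℓp {m : ℕ} {c : ℤ → ℂ} :
    Y 0 m c ↔ Memℓp (fun k : ℤ => ((1 + (k : ℝ) ^ 2) ^ ((m : ℝ) / 2) : ℝ) * c k) 2 := by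
  rw [memℓp_two_iff]
  refine ⟨fun h => ?_, fun h => Y.of_pow_mul fun q hq => ?_⟩
  · have h1 := (Y.pow_mul (h.const_mul (2 ^ m)) (Nat.zero_le m))
    have h2 := (Y.pow_mul (h.const_mul (2 ^ m)) (le_refl m))
    refine ((wN_le_of_norm_le (y := fun k => (((2 : ℝ) ^ m * (‖c k‖ + |(k : ℝ)| ^ m * ‖c k‖) : ℝ)
      : ℂ)) fun k => ?_).trans_lt (lt_of_eq_of_lt ?_ ((wN_add_le 0 (fun k => (‖(k : ℂ) ^ 0 *
      (2 ^ m * c k)‖ : ℂ)) (fun k => (‖(k : ℂ) ^ m * (2 ^ m * c k)‖ : ℂ))).trans_lt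
      (ENNReal.mul_lt_top (by simp) (ENNReal.add_lt_top.2 ⟨?_, ?_⟩))))).ne
    · rw [norm_mul, Complex.norm_real, Complex.norm_real, Real.norm_of_nonneg (by positivity),
        Real.norm_of_nonneg (by positivity), ← one_add_mul, ← mul_assoc]
      gcongr
      have h3 : (1 + (k : ℝ) ^ 2) ^ ((m : ℝ) / 2) ≤ (1 + |(k : ℝ)|) ^ m := by
        rw [← Real.rpow_natCast (1 + |(k : ℝ)|) m, show (m : ℝ) = 2 * (m / 2) by ring,
          Real.rpow_mul (by positivity), show 2 * ((m : ℝ) / 2) / 2 = m / 2 by ring]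
        refine Real.rpow_le_rpow (by positivity) ?_ (by positivity)
        rw [Real.rpow_two, ← sq_abs (k : ℝ)]
        nlinarith [abs_nonneg (k : ℝ)]
      refine h3.trans ((add_pow_le zero_le_one (abs_nonneg _) m).trans ?_)
      rw [one_pow]
      gcongr
      · norm_num
      · omega
    · congr 1
      funext k
      simp only [norm_mul, norm_pow, Complex.norm_intCast]
      push_cast
      simp
      ring
    · rw [lt_top_iff_ne_top]
      convert h1 using 1
      simp [wN, ← ofReal_norm]
    · rw [lt_top_iff_ne_top]
      convert h2 using 1
      simp [wN, ← ofReal_norm]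
  · refine ((wN_le_of_norm_le fun k => ?_).trans_lt (lt_top_iff_ne_top.2 h)).ne
    rw [norm_mul, norm_mul, Complex.norm_real, Real.norm_of_nonneg (by positivity), norm_pow,
      Complex.norm_intCast]
    gcongr
    calc |(k : ℝ)| ^ q = ((k : ℝ) ^ 2) ^ ((q : ℝ) / 2) := by
          rw [← sq_abs, ← Real.rpow_natCast, ← Real.rpow_natCast, ← Real.rpow_mul (abs_nonneg _)]
          congr 1
          push_cast
          ring
      _ ≤ (1 + (k : ℝ) ^ 2) ^ ((q : ℝ) / 2) :=
          Real.rpow_le_rpow (by positivity) (by linarith) (by positivity)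
      _ ≤ _ := Real.rpow_le_rpow_of_exponent_le (by nlinarith [sq_nonneg (k : ℝ)]) (by gcongr)

/-! ### Description of `J0` and `J` by Fourier coefficients. -/

theorem fc_lift (v : FunCirc) (k : ℤ) : fc (lift v) k =ᵐ[mu1] fun _ => fourierCoeff v k := by
  filter_upwards [ae_slice (coeFn_lift v)] with r hr
  rw [fc, fourierCoeff_congr_circ hr]

theorem fc_add {s : ℝ} {u v : FunPi} (hu : WeightedL2 s u) (hv : WeightedL2 s v) (k : ℤ) :
    fc (u + v) k =ᵐ[mu1] fun r => fc u k r + fc v k r := by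
  filter_upwards [fourierCoeff_slice_add hu hv] with r hr using hr k

theorem fc_smul (c : ℂ) (u : FunPi) (k : ℤ) :
    fc (c • u) k =ᵐ[mu1] fun r => c * fc u k r := by
  filter_upwards [fourierCoeff_slice_smul c u] with r hr using hr k

theorem WeightedL2.ext_fc {s : ℝ} {u v : FunPi} (hu : WeightedL2 s u) (hv : WeightedL2 s v)
    (h : ∀ k, fc u k =ᵐ[mu1] fc v k) : u = v := by
  have h0 : u + (-1 : ℂ) • v = 0 := by
    refine (hu.add (hv.smul _)).eq_zero_of_fourierCoeff fun k => ?_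
    filter_upwards [fc_add hu (hv.smul (-1)) k, fc_smul (-1) v k, h k] with r h1 h2 h3
    refine h1.trans ?_
    rw [h2, h3]
    ring
  have hn : (-1 : ℂ) • v = -v := neg_one_smul ℂ v
  rwa [hn, ← sub_eq_add_neg, sub_eq_zero] at h0

theorem el_add {f g : ℝ → ℂ} {k : ℤ} (hf : AEStronglyMeasurable f mu1)
    (hg : AEStronglyMeasurable g mu1) :
    el (fun r => f r + g r) k (hf.add hg) = el f k hf + el g k hg := by
  refine AEEqFun.ext ?_
  filter_upwards [coeFn_el (k := k) hf, coeFn_el (k := k) hg, coeFn_el (k := k) (hf.add hg),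
    AEEqFun.coeFn_add (el f k hf) (el g k hg)] with x h1 h2 h3 h4
  refine h3.trans (Eq.trans ?_ h4.symm)
  change (f x.1 + g x.1) * fourier k x.2 = el f k hf x + el g k hg x
  rw [h1, h2, add_mul]

theorem weightedL2_el_const (c : ℂ) (k : ℤ) :
    WeightedL2 0 (el (fun _ => c) k aestronglyMeasurable_const) := by
  have h : MemLp (fun x : ℝ × Circ => c * fourier k x.2) 2 muPi := by
    refine MemLp.of_bound (aestronglyMeasurable_mul_fourier aestronglyMeasurable_const k) ‖c‖
      (Eventually.of_forall fun x => ?_)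
    rw [norm_mul, fourier_apply, Circle.norm_coe, mul_one]
  refine h.ae_eq ?_
  filter_upwards [coeFn_el (f := fun _ => c) (k := k) aestronglyMeasurable_const] with x hx
  rw [hx]
  simp

theorem J0.exists_data {m : ℕ} {γ : ℝ} (hγ : 0 ≤ γ) {b : FunPi} (hb : b ∈ J0 m γ) :
    ∃ c a, Y 0 m c ∧ X γ 0 m a ∧ ∀ k, fc b k =ᵐ[mu1] fun r => c k + a k r := by
  obtain ⟨x, rfl⟩ := hb
  refine ⟨fourierCoeff (x.fst : FunCirc), fc x.snd, Y.iff_memℓp.2 x.fst.2.2,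
    X.of_mem_K hγ x.snd.2, fun k => ?_⟩
  rw [sumMap_apply]
  filter_upwards [fc_add ((weightedL2_lift x.fst.2.1).mono (abs_nonneg γ))
    (x.snd.2.1.mono (neg_le_abs γ)) k, fc_lift (x.fst : FunCirc) k] with r h1 h2
  rw [h1, h2]

theorem hasSum_H {m : ℕ} {c : ℤ → ℂ} (h : Y 0 m c) :
    ∃ (v : ℤ → H m) (w : H m), HasSum v w ∧ fourierCoeff (w : FunCirc) = c ∧
      ∀ k, fourierCoeff (v k : FunCirc) = fun l => if l = k then c k else 0 := by
  obtain ⟨w, hw⟩ := exists_H (Y.iff_memℓp.1 h)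
  choose v hv using fun k => exists_H (Y.iff_memℓp.1 (Y.single 0 m k (c k)))
  refine ⟨v, w, ?_, hw, hv⟩
  refine ((isometry_coeffs m).isUniformInducing.isInducing.hasSum_iff (g := coeffs m) v w).1 ?_
  convert lp.hasSum_single (E := fun _ : ℤ => ℂ) (p := 2) (by simp) (coeffs m w) using 1
  funext k
  ext l
  rw [Function.comp_apply, coeffs_apply, hv, lp.single_apply, Pi.single_apply, coeffs_apply, hw]
  by_cases hl : l = k <;> simp [hl]

/-- Boundary and decaying parts are synthesised mode by mode in `H m` and `K m γ`, and the two
convergent series are combined through the isometry `decomp`. -/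
theorem J0.hasSum {m : ℕ} {γ : ℝ} [hγ : Fact (1 / 2 < γ)] {c : ℤ → ℂ} {a : ℤ → ℝ → ℂ}
    (hc : Y 0 m c) (ha : X γ 0 m a) :
    ∃ (b : ℤ → J0 m γ) (s : J0 m γ), HasSum b s ∧
      (∀ k, fc (s : FunPi) k =ᵐ[mu1] fun r => c k + a k r) ∧
      ∀ k l, fc (b k : FunPi) l =ᵐ[mu1] fun r => if l = k then c k + a k r else 0 := by
  have hγ0 : 0 ≤ γ := by linarith [hγ.out]
  obtain ⟨v, v', hv, hv1, hv2⟩ := hasSum_H hc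
  obtain ⟨w, w', hw1, hw, hw2⟩ := ha.exists_K_hasSum hγ0
  have hfc : ∀ x : WithLp 2 (H m × K m γ), ∀ l, fc ((decomp m γ).symm x : FunPi) l =ᵐ[mu1]
      fun r => fourierCoeff (x.fst : FunCirc) l + fc (x.snd : FunPi) l r := by
    intro x l
    change fc (sumMap m γ x) l =ᵐ[mu1] _
    rw [sumMap_apply]
    filter_upwards [fc_add ((weightedL2_lift x.fst.2.1).mono (abs_nonneg γ))
      (x.snd.2.1.mono (neg_le_abs γ)) l, fc_lift (x.fst : FunCirc) l] with r h1 h2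
    rw [h1, h2]
  refine ⟨fun k => (decomp m γ).symm (WithLp.toLp 2 (v k, w k)),
    (decomp m γ).symm (WithLp.toLp 2 (v', w')), ?_, fun k => ?_, fun k l => ?_⟩
  · refine ((isometry_decomp m γ).isUniformInducing.isInducing.hasSum_iff
      (g := decomp m γ) _ _).1 ?_
    simp only [Function.comp_def, LinearEquiv.apply_symm_apply]
    exact (WithLp.prodContinuousLinearEquiv 2 ℂ (H m) (K m γ)).symm.hasSum.2 (hv.prodMk hw)
  · filter_upwards [hfc (WithLp.toLp 2 (v', w')) k, hw2 k] with r h1 h2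
    rw [h1, ← h2, ← hv1]
    rfl
  · filter_upwards [hfc (WithLp.toLp 2 (v k, w k)) l, fc_el (ha.base.1 k) (k := k) l] with r h1 h2
    rw [h1]
    change fourierCoeff (v k : FunCirc) l + fc (w k : FunPi) l r = _
    rw [hv2, hw1, h2]
    by_cases hl : l = k <;> simp [hl]

theorem mult_eq {m : ℕ} {γ σ : ℝ} (a : J m γ σ) (b : J0 m γ)
    (h : IsMultiplied σ (a : FunPi) (b : FunPi)) : mult m γ σ a = b :=
  Subtype.ext ((isMultiplied_mult a).unique h (J0_weightedL2 _) (J0_weightedL2 b))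

theorem exp_mul_exp_neg (σ : ℝ) (k : ℤ) (z : ℂ) :
    (Real.exp (σ * |(k : ℝ)|) : ℂ) * ((Real.exp (-σ * |(k : ℝ)|) : ℂ) * z) = z := by
  rw [← mul_assoc, ← Complex.ofReal_mul, ← Real.exp_add]
  simp

/-- The data without the weights e^(σ|k|) give the function, the data multiplied by them give its
image under the multiplier; σ ≥ 0 is needed for the former to lie in `J0`. -/
theorem exists_J_of_data {m : ℕ} {γ σ : ℝ} [hγ : Fact (1 / 2 < γ)] (hσ : 0 ≤ σ) {c : ℤ → ℂ}
    {a : ℤ → ℝ → ℂ} (hc : Y σ m c) (ha : X γ σ m a) :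
    ∃ u : J m γ σ, ∀ k, fc (u : FunPi) k =ᵐ[mu1] fun r => c k + a k r := by
  obtain ⟨-, u, -, hu, -⟩ := J0.hasSum (hc.weaken hσ) (ha.weaken hσ)
  obtain ⟨-, b, -, hb, -⟩ := J0.hasSum hc.exp_mul_self ha.exp_mul_self
  refine ⟨⟨u, u.2, b, b.2, fun k => ?_⟩, hu⟩
  filter_upwards [hu k, hb k] with r h1 h2
  refine h2.trans ?_
  rw [← mul_add, ← h1]
  rfl

theorem J.exists_data {m : ℕ} {γ σ : ℝ} (hγ : 0 ≤ γ) {u : FunPi} (hu : u ∈ J m γ σ) :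
    ∃ c a, Y σ m c ∧ X γ σ m a ∧ ∀ k, fc u k =ᵐ[mu1] fun r => c k + a k r := by
  obtain ⟨-, b, hb, h⟩ := hu
  obtain ⟨c, a, hc, ha, hca⟩ := J0.exists_data hγ hb
  refine ⟨_, _, hc.exp_neg_mul σ, ha.exp_neg_mul σ, fun k => ?_⟩
  filter_upwards [h k, hca k] with r h1 h2
  rw [← mul_add, ← h2]
  refine Eq.trans ?_ (congrArg _ h1.symm)
  have := exp_mul_exp_neg (-σ) k (fc u k r)
  rw [neg_neg] at this
  exact this.symm

/-- The weighted integrability is there so that u is determined by its coefficients, hence equal to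
the function synthesised from them. -/
theorem mem_J_iff {m : ℕ} {γ σ : ℝ} [hγ : Fact (1 / 2 < γ)] (hσ : 0 ≤ σ) {u : FunPi} :
    u ∈ J m γ σ ↔ WeightedL2 |γ| u ∧
      ∃ c a, Y σ m c ∧ X γ σ m a ∧ ∀ k, fc u k =ᵐ[mu1] fun r => c k + a k r := by
  refine ⟨fun h => ⟨J0_weightedL2 ⟨u, h.1⟩, J.exists_data (by linarith [hγ.out]) h⟩, ?_⟩
  rintro ⟨hu, c, a, hc, ha, h⟩
  obtain ⟨v, hv⟩ := exists_J_of_data hσ hc ha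
  have e : u = v := hu.ext_fc (J0_weightedL2 ⟨v, v.2.1⟩) fun k => (h k).trans (hv k).symm
  rw [e]
  exact v.2

/-- The preimage is obtained by damping the coefficients with e^(-σ|k|). Thus `mult` is an isometry
onto `J0`, and completeness is inherited. -/
theorem surjective_mult (m : ℕ) (γ : ℝ) {σ : ℝ} [hγ : Fact (1 / 2 < γ)] (hσ : 0 ≤ σ) :
    Function.Surjective (mult m γ σ) := by
  intro b
  obtain ⟨c, a, hc, ha, h⟩ := J0.exists_data (by linarith [hγ.out]) b.2
  obtain ⟨u, hu⟩ := exists_J_of_data (m := m) (γ := γ) hσ (hc.exp_neg_mul σ)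
    (ha.exp_neg_mul σ)
  refine ⟨u, mult_eq u b fun k => ?_⟩
  filter_upwards [hu k, h k] with r h1 h2
  refine h2.trans ?_
  change _ = _ * fc (u : FunPi) k r
  rw [h1, ← mul_add, exp_mul_exp_neg]

theorem completeSpace_J (m : ℕ) (γ : ℝ) {σ : ℝ} [Fact (1 / 2 < γ)] (hσ : 0 ≤ σ) :
    CompleteSpace (J m γ σ) :=
  (completeSpace_iff_isComplete_range (isometry_mult m γ σ).isUniformInducing).2
    (by rw [(surjective_mult m γ hσ).range_eq]; exact isComplete_univ)

/-- Fourier series converge in the norm of `J`: the series in `J0` is pulled back by `mult`. This is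
the density statement used for characters. -/
theorem J.hasSum {m : ℕ} {γ σ : ℝ} [hγ : Fact (1 / 2 < γ)] (hσ : 0 ≤ σ) (u : J m γ σ)
    {c : ℤ → ℂ} {a : ℤ → ℝ → ℂ} (hc : Y σ m c) (ha : X γ σ m a)
    (hu : ∀ k, fc (u : FunPi) k =ᵐ[mu1] fun r => c k + a k r) :
    ∃ v : ℤ → J m γ σ, HasSum v u ∧
      ∀ k l, fc (v k : FunPi) l =ᵐ[mu1] fun r => if l = k then c k + a k r else 0 := by
  obtain ⟨b, s, hbs, hs, hb⟩ := J0.hasSum hc.exp_mul_self ha.exp_mul_self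
  choose v hv using fun k => surjective_mult m γ hσ (b k)
  have hs' : mult m γ σ u = s := mult_eq u s fun k => by
    filter_upwards [hu k, hs k] with r h1 h2
    refine h2.trans ?_
    rw [← mul_add, ← h1]
    rfl
  refine ⟨v, ?_, fun k l => ?_⟩
  · refine ((isometry_mult m γ σ).isUniformInducing.isInducing.hasSum_iff
      (g := mult m γ σ) _ _).1 ?_
    rw [hs']
    simpa only [Function.comp_def, hv] using hbs
  · have h1 := isMultiplied_mult (v k) l
    rw [hv] at h1
    filter_upwards [h1, hb k l] with r h2 h3
    have h4 := h3.symm.trans h2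
    have h5 : (Real.exp (σ * |(l : ℝ)|) : ℂ) ≠ 0 := by exact_mod_cast (Real.exp_pos _).ne'
    refine mul_left_cancel₀ h5 (h4.symm.trans ?_)
    split_ifs with hl
    · rw [hl]
      ring
    · rw [mul_zero]

/-! ### Absolute convergence of Fourier series and products -/

theorem summable_of_sq {t : ℤ → ℝ} (ht : ∀ k, 0 ≤ t k)
    (h : Summable fun k : ℤ => (1 + (k : ℝ) ^ 2) * t k ^ 2) : Summable t := by
  have h0 : Summable fun k : ℤ => (1 + (k : ℝ) ^ 2)⁻¹ := by
    refine (ENNReal.summable_toReal invSq_ne_top).congr fun k => ?_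
    rw [ENNReal.toReal_inv, ENNReal.toReal_add (by simp) (by finiteness), ENNReal.toReal_pow,
      toReal_enorm, Complex.norm_intCast, sq_abs]
    simp
  refine Summable.of_nonneg_of_le ht (fun k => ?_) (h0.add h)
  have h1 : 0 < 1 + (k : ℝ) ^ 2 := by positivity
  -- The inequality t ≤ 1/w + w t² with w = 1 + k², proved by completing the square.
  have h2 : (1 + (k : ℝ) ^ 2)⁻¹ + (1 + (k : ℝ) ^ 2) * t k ^ 2 - t k =
      (1 + (k : ℝ) ^ 2)⁻¹ * (((1 + (k : ℝ) ^ 2) * t k - 1 / 2) ^ 2 + 3 / 4) := by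
    field_simp
    ring
  have h3 : 0 ≤ (1 + (k : ℝ) ^ 2)⁻¹ * (((1 + (k : ℝ) ^ 2) * t k - 1 / 2) ^ 2 + 3 / 4) := by
    positivity
  linarith

theorem summable_exp_mul_of_wN {σ : ℝ} {x : ℤ → ℂ} (h : wN σ x ≠ ⊤)
    (h' : wN σ (fun k => k * x k) ≠ ⊤) :
    Summable fun k : ℤ => Real.exp (σ * |(k : ℝ)|) * ‖x k‖ := by
  refine summable_of_sq (fun k => by positivity) ?_
  have e : ∀ {x : ℤ → ℂ}, wN σ x ≠ ⊤ →
      Summable fun k : ℤ => (Real.exp (σ * |(k : ℝ)|) * ‖x k‖) ^ 2 := by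
    intro x h
    refine (ENNReal.summable_toReal h).congr fun k => ?_
    rw [ENNReal.toReal_pow, ENNReal.toReal_mul, ENNReal.toReal_ofReal (Real.exp_pos _).le,
      toReal_enorm]
  refine ((e h).add (e h')).congr fun k => ?_
  rw [norm_mul, Complex.norm_intCast]
  linear_combination (Real.exp (σ * |(k : ℝ)|) * ‖x k‖) ^ 2 * sq_abs (k : ℝ)

theorem Y.summable {σ : ℝ} {c : ℤ → ℂ} (h : Y σ 1 c) :
    Summable fun k : ℤ => Real.exp (σ * |(k : ℝ)|) * ‖c k‖ := summable_exp_mul_of_wN h.1 h.2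

theorem X0.tsum_ne_top {γ σ : ℝ} {a : ℤ → ℝ → ℂ} (h : X0 γ σ a) :
    ∑' k : ℤ, ENNReal.ofReal (Real.exp (σ * |(k : ℝ)|)) ^ 2 * wI γ (fun r => ‖a k r‖ₑ ^ 2) ≠ ⊤ := by
  convert h.2 using 1
  simp only [wN]
  rw [wI_tsum fun k => ((h.1 k).enorm.const_mul _).pow_const 2]
  refine tsum_congr fun k => ?_
  rw [← wI_const_mul (by simp)]
  simp only [mul_pow]

/-- Two orders are spent: an Euler derivative bounds each coefficient pointwise, and a factor k
turns square summability into summability. The majorant is twice the root of the weighted energies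
of a_k and its Euler derivative. -/
theorem X.exists_majorant {γ σ : ℝ} (hγ : 1 / 2 < γ) {a : ℤ → ℝ → ℂ} (h : X γ σ 2 a) :
    ∃ M : ℤ → ℝ, (∀ k, 0 ≤ M k) ∧ (Summable fun k : ℤ => Real.exp (σ * |(k : ℝ)|) * M k) ∧
      ∀ k, ∀ᵐ r ∂mu1, ‖a k r‖ ≤ M k * r ^ (γ - 1 / 2) := by
  obtain ⟨h0, h1, a', h2, h3⟩ := h
  have hs : ∀ {b : ℤ → ℝ → ℂ}, X0 γ σ b → Summable fun k : ℤ => Real.exp (σ * |(k : ℝ)|) ^ 2 *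
      (wI γ (fun r => ‖b k r‖ₑ ^ 2)).toReal := fun hb => by
    refine (ENNReal.summable_toReal hb.tsum_ne_top).congr fun k => ?_
    rw [ENNReal.toReal_mul, ENNReal.toReal_pow, ENNReal.toReal_ofReal (Real.exp_pos _).le]
  have ht : ∀ {b : ℤ → ℝ → ℂ}, X0 γ σ b → ∀ k, wI γ (fun r => ‖b k r‖ₑ ^ 2) ≠ ⊤ := by
    intro b hb k htop
    have := ENNReal.ne_top_of_tsum_ne_top hb.tsum_ne_top k
    rw [htop, ENNReal.mul_top] at this
    · exact this rfl
    · simp [Real.exp_pos]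
  have hk : ∀ (b : ℤ → ℝ → ℂ) (k : ℤ), (wI γ (fun r => ‖k * b k r‖ₑ ^ 2)).toReal =
      (k : ℝ) ^ 2 * (wI γ (fun r => ‖b k r‖ₑ ^ 2)).toReal := by
    intro b k
    have e : wI γ (fun r => ‖k * b k r‖ₑ ^ 2) =
        ‖(k : ℂ)‖ₑ ^ 2 * wI γ (fun r => ‖b k r‖ₑ ^ 2) := by
      rw [← wI_const_mul (by finiteness)]
      simp only [enorm_mul, mul_pow]
    rw [e, ENNReal.toReal_mul, ENNReal.toReal_pow, toReal_enorm, Complex.norm_intCast, sq_abs]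
  set N : ℤ → ℝ := fun k => (wI γ (fun r => ‖a k r‖ₑ ^ 2)).toReal +
    (wI γ (fun r => ‖a' k r‖ₑ ^ 2)).toReal with hN
  have hN0 : ∀ k, 0 ≤ N k := fun k => by positivity
  refine ⟨fun k => 2 * √(N k), fun k => by positivity, summable_of_sq (fun k => by positivity) ?_,
    fun k => ?_⟩
  · refine (((hs h0).add (hs h2.base)).add ((hs h1.base).add (hs h2.mul_int))).mul_left 4
      |>.congr fun k => ?_
    simp only [hk]
    rw [mul_pow, mul_pow, Real.sq_sqrt (hN0 k), hN]
    ring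
  · filter_upwards [(h3 k).enorm_sq_le (by linarith) (h0.1 k) (h2.base.1 k),
      ae_restrict_mem measurableSet_Ioc] with r hr hr0
    have h4 : ‖a k r‖ ^ 2 ≤ 4 * r ^ (2 * γ - 1) * N k := by
      have h5 := ENNReal.toReal_mono (ENNReal.mul_ne_top ENNReal.ofReal_ne_top
        (ENNReal.add_ne_top.2 ⟨ht h0 k, ht h2.base k⟩)) hr
      rwa [ENNReal.toReal_pow, toReal_enorm, ENNReal.toReal_mul, ENNReal.toReal_ofReal
        (by have := Real.rpow_nonneg hr0.1.le (2 * γ - 1); positivity),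
        ENNReal.toReal_add (ht h0 k) (ht h2.base k)] at h5
    refine le_of_sq_le_sq (h4.trans_eq ?_) (by have := Real.rpow_nonneg hr0.1.le (γ - 1 / 2); positivity)
    rw [mul_pow, mul_pow, Real.sq_sqrt (hN0 k), ← Real.rpow_natCast (r ^ _),
      ← Real.rpow_mul hr0.1.le, show (γ - 1 / 2) * ((2 : ℕ) : ℝ) = 2 * γ - 1 by push_cast; ring]
    ring

theorem ae_eq_tsum_fourier {f : Circ → ℂ} (hf : MemLp f 2 volume)
    (hs : Summable fun k => ‖fourierCoeff f k‖) :
    ∀ᵐ θ, f θ = ∑' k, fourierCoeff f k * fourier k θ := by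
  have hf' : MemLp f 2 AddCircle.haarAddCircle := hf.haarAddCircle
  have h1 := hasSum_fourier_series_L2 hf'.toLp
  rw [fourierCoeff_congr_ae hf'.coeFn_toLp] at h1
  have hs' : Summable fun k => fourierCoeff f k • (fourier k : C(Circ, ℂ)) := by
    refine Summable.of_norm ?_
    simpa only [norm_smul, fourier_norm, mul_one] using hs
  have h2 := hs'.hasSum.mapL (ContinuousMap.toLp (E := ℂ) 2 AddCircle.haarAddCircle ℂ)
  simp only [map_smul] at h2
  have h3 := h1.unique h2
  have h4 : f =ᵐ[AddCircle.haarAddCircle]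
      ⇑(∑' k, fourierCoeff f k • (fourier k : C(Circ, ℂ))) := by
    refine hf'.coeFn_toLp.symm.trans ?_
    rw [h3]
    exact ContinuousMap.coeFn_toLp _ _
  have h5 : ∀ᵐ θ ∂AddCircle.haarAddCircle, f θ = ∑' k, fourierCoeff f k * fourier k θ := by
    filter_upwards [h4] with θ hθ
    rw [hθ, ← ContinuousMap.tsum_apply hs']
    rfl
  rw [AddCircle.volume_eq_smul_haarAddCircle]
  exact Measure.ae_smul_measure h5 _

/-- Parseval for the inner product of f with the conjugate of e^(-ikθ) g, whose j-th coefficient is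
the conjugate of ĝ(k-j). -/
theorem fourierCoeff_mul {f g : Circ → ℂ} (hf : MemLp f 2 volume) (hg : MemLp g 2 volume) :
    fourierCoeff (fun θ => f θ * g θ) = conv (fourierCoeff f) (fourierCoeff g) := by
  funext k
  have hf' : MemLp f 2 AddCircle.haarAddCircle := hf.haarAddCircle
  have hg' : MemLp g 2 AddCircle.haarAddCircle := hg.haarAddCircle
  have hm : MemLp (fun θ => (starRingEnd ℂ) (fourier (-k) θ * g θ)) 2
      AddCircle.haarAddCircle := by
    refine MemLp.star (R := ℂ) (hg'.of_le ?_ (Eventually.of_forall fun θ => ?_))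
    · exact (fourier (-k)).continuous.aestronglyMeasurable.mul hg'.1
    · rw [norm_mul, fourier_apply, Circle.norm_coe, one_mul]
  have h1 := (fourierBasis (T := 2 * Real.pi)).tsum_inner_mul_inner hm.toLp hf'.toLp
  have h2 : inner ℂ hm.toLp hf'.toLp = fourierCoeff (fun θ => f θ * g θ) k := by
    rw [L2.inner_def, fourierCoeff]
    refine integral_congr_ae ?_
    filter_upwards [hm.coeFn_toLp, hf'.coeFn_toLp] with θ h1 h2
    rw [h1, h2, RCLike.inner_apply, RCLike.conj_conj, smul_eq_mul]
    ring
  have h3 : ∀ j, inner ℂ (fourierBasis (T := 2 * Real.pi) j) hf'.toLp = fourierCoeff f j := by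
    intro j
    rw [← HilbertBasis.repr_apply_apply, fourierBasis_repr, fourierCoeff_congr_ae hf'.coeFn_toLp]
  have h4 : ∀ j, inner ℂ hm.toLp (fourierBasis (T := 2 * Real.pi) j) = fourierCoeff g (k - j) := by
    intro j
    rw [← inner_conj_symm, ← HilbertBasis.repr_apply_apply, fourierBasis_repr,
      fourierCoeff_congr_ae hm.coeFn_toLp, fourierCoeff, fourierCoeff, ← integral_conj]
    refine integral_congr_ae (Eventually.of_forall fun θ => ?_)
    simp only [smul_eq_mul, map_mul, RCLike.conj_conj]
    rw [← fourier_neg, neg_neg, ← mul_assoc, ← fourier_add]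
    congr 3
    ring
  rw [← h2, ← h1, conv]
  refine tsum_congr fun j => ?_
  rw [h3, h4, mul_comm]

theorem fc_mul {s t : ℝ} {u v : FunPi} (hu : WeightedL2 s u) (hv : WeightedL2 t v) :
    ∀ᵐ r ∂mu1, ∀ k, fc (u * v) k r = conv (fun k => fc u k r) (fun k => fc v k r) k := by
  filter_upwards [hu.ae_memLp_slice, hv.ae_memLp_slice, ae_slice (AEEqFun.coeFn_mul u v)]
    with r h1 h2 h3 k
  rw [fc, fourierCoeff_congr_circ h3]
  exact congrFun (fourierCoeff_mul h1 h2) k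

theorem WeightedL2.ae_eq_tsum {s : ℝ} {u : FunPi} (hu : WeightedL2 s u)
    (hs : ∀ᵐ r ∂mu1, Summable fun k => ‖fc u k r‖) :
    ∀ᵐ x ∂muPi, u x = ∑' k, fc u k x.1 * fourier k x.2 := by
  have hm : MeasurableSet {x : ℝ × Circ | u x = ∑' k, fc u k x.1 * fourier k x.2} := by
    refine measurableSet_eq_fun u.stronglyMeasurable.measurable (Measurable.tsum fun k => ?_)
    exact ((stronglyMeasurable_fc u k).measurable.comp measurable_fst).mul
      ((fourier k).continuous.measurable.comp measurable_snd)
  refine (Measure.ae_prod_iff_ae_ae hm).2 ?_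
  filter_upwards [hu.ae_memLp_slice, hs] with r h1 h2
  exact ae_eq_tsum_fourier h1 h2

theorem J.exists_majorant {m : ℕ} (hm : 1 < m) {γ σ : ℝ} (hγ : 1 / 2 < γ) {u : FunPi}
    (hu : u ∈ J m γ σ) :
    ∃ M : ℤ → ℝ, (∀ k, 0 ≤ M k) ∧ (Summable fun k : ℤ => Real.exp (σ * |(k : ℝ)|) * M k) ∧
      ∀ᵐ r ∂mu1, ∀ k, ‖fc u k r‖ ≤ M k := by
  obtain ⟨c, a, hc, ha, h⟩ := J.exists_data (by linarith) hu
  obtain ⟨M, hM0, hM, hM1⟩ := (ha.mono (by omega : 2 ≤ m)).exists_majorant hγ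
  refine ⟨fun k => ‖c k‖ + M k, fun k => add_nonneg (norm_nonneg _) (hM0 k), ?_, ?_⟩
  · simpa only [mul_add] using (hc.mono (by omega : 1 ≤ m)).summable.add hM
  · filter_upwards [ae_all_iff.2 h, ae_all_iff.2 hM1, ae_restrict_mem measurableSet_Ioc]
      with r h1 h2 h3 k
    rw [h1 k]
    refine (norm_add_le _ _).trans (add_le_add le_rfl ((h2 k).trans ?_))
    exact mul_le_of_le_one_right (hM0 k) (Real.rpow_le_one h3.1.le h3.2 (by linarith))

theorem summable_of_exp_mul {σ : ℝ} (hσ : 0 ≤ σ) {M : ℤ → ℝ} (h0 : ∀ k, 0 ≤ M k)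
    (h : Summable fun k : ℤ => Real.exp (σ * |(k : ℝ)|) * M k) : Summable M :=
  Summable.of_nonneg_of_le h0 (fun k => le_mul_of_one_le_left (h0 k)
    (Real.one_le_exp (by positivity))) h

theorem J.exists_bound {m : ℕ} (hm : 1 < m) {γ σ : ℝ} (hγ : 1 / 2 < γ) (hσ : 0 ≤ σ) {u : FunPi}
    (hu : u ∈ J m γ σ) : ∃ B : ℝ, ∀ᵐ x ∂muPi, ‖u x‖ ≤ B := by
  obtain ⟨M, hM0, hM, h⟩ := J.exists_majorant hm hγ hu
  have hM' := summable_of_exp_mul hσ hM0 hM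
  refine ⟨∑' k, M k, ?_⟩
  have h1 := (J0_weightedL2 ⟨u, hu.1⟩).ae_eq_tsum
    (by filter_upwards [h] with r hr using Summable.of_nonneg_of_le (fun k => norm_nonneg _) hr hM')
  filter_upwards [h1, Measure.quasiMeasurePreserving_fst (ν := (volume : Measure Circ)) |>.ae h]
    with x h2 h3
  rw [h2]
  refine tsum_of_norm_bounded hM'.hasSum fun k => ?_
  rw [norm_mul, fourier_apply, Circle.norm_coe, mul_one]
  exact h3 k

/-- In coefficients (c+a)(d+b) = cd + (cb + da + ab), where cd is independent of ψ and the other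
three terms decay. The term ab is the one that needs m ≥ 2. Boundedness of u keeps the product in
the weighted L² space. -/
theorem J.mul_mem {m : ℕ} (hm : 1 < m) {γ σ : ℝ} [hγ : Fact (1 / 2 < γ)] (hσ : 0 ≤ σ) {u v : FunPi}
    (hu : u ∈ J m γ σ) (hv : v ∈ J m γ σ) : u * v ∈ J m γ σ := by
  have hγ0 : 0 ≤ γ := by linarith [hγ.out]
  have wu : WeightedL2 |γ| u := J0_weightedL2 ⟨u, hu.1⟩
  have wv : WeightedL2 |γ| v := J0_weightedL2 ⟨v, hv.1⟩
  obtain ⟨B, hB⟩ := J.exists_bound hm hγ.out hσ hu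
  obtain ⟨c, a, hc, ha, h⟩ := J.exists_data hγ0 hu
  obtain ⟨d, b, hd, hb, h'⟩ := J.exists_data hγ0 hv
  refine (mem_J_iff hσ).2 ⟨?_, conv c d, _, Y.conv hσ hc hd le_rfl le_rfl (by omega),
    ((X.cmul_const hγ.out hσ hc hb le_rfl le_rfl (by omega)).add
      (X.cmul_const hγ.out hσ hd ha le_rfl le_rfl (by omega))).add
      (X.cmul hγ.out hσ ha hb le_rfl le_rfl (by omega)), fun k => ?_⟩
  · refine MemLp.of_le_mul (c := B) wv ?_ ?_
    · refine AEStronglyMeasurable.mul ?_ (u * v).aestronglyMeasurable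
      have : Measurable fun x : ℝ × Circ => ((x.1 ^ |γ| : ℝ) : ℂ) := by fun_prop
      exact this.aestronglyMeasurable
    · filter_upwards [hB, AEEqFun.coeFn_mul u v] with x h1 h2
      rw [h2, Pi.mul_apply, norm_mul, norm_mul, norm_mul, mul_left_comm]
      gcongr
  · have hc0 : wN σ c ≠ ⊤ := hc.base
    have hd0 : wN σ d ≠ ⊤ := hd.base
    filter_upwards [fc_mul wu wv, ae_all_iff.2 h, ae_all_iff.2 h', (ha.base.locX hγ0).ae_ne_top,
      (hb.base.locX hγ0).ae_ne_top] with r h1 h2 h3 h4 h5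
    rw [h1, cmul, cmul, cmul, conv_comm d]
    simp only [h2, h3, conv]
    rw [add_assoc, ← (summable_conv hσ h4 hd0 k).tsum_add (summable_conv hσ h4 h5 k),
      ← (summable_conv hσ hc0 h5 k).tsum_add
        ((summable_conv hσ h4 hd0 k).add (summable_conv hσ h4 h5 k)),
      ← (summable_conv hσ hc0 hd0 k).tsum_add ((summable_conv hσ hc0 h5 k).add
        ((summable_conv hσ h4 hd0 k).add (summable_conv hσ h4 h5 k)))]
    exact tsum_congr fun j => by ring

/-! ### Multiplication on `J^{m,σ}_{0,γ}(Π)` -/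

theorem J0.weightedL2_zero {m : ℕ} {γ : ℝ} (hγ : 0 ≤ γ) {b : FunPi} (hb : b ∈ J0 m γ) :
    WeightedL2 0 b := by
  obtain ⟨x, rfl⟩ := hb
  rw [sumMap_apply]
  exact (weightedL2_lift x.fst.2.1).add (x.snd.2.1.mono (by linarith))

theorem WeightedL2.memLp {u : FunPi} (h : WeightedL2 0 u) : MemLp u 2 muPi :=
  h.ae_eq (Eventually.of_forall fun x => by simp)

theorem J.memLp {m : ℕ} {γ σ : ℝ} [hγ : Fact (1 / 2 < γ)] (u : J m γ σ) :
    MemLp (u : FunPi) 2 muPi :=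
  (J0.weightedL2_zero (by linarith [hγ.out]) u.2.1).memLp

theorem exists_fourierCoeff_clm (m : ℕ) (l : ℤ) :
    ∃ Λ : H m →L[ℂ] ℂ, ∀ v : H m, Λ v = fourierCoeff (v : FunCirc) l := by
  let c : ℂ := (((1 + (l : ℝ) ^ 2) ^ ((m : ℝ) / 2) : ℝ) : ℂ)
  have hc : c ≠ 0 :=
    Complex.ofReal_ne_zero.2 (Real.rpow_pos_of_pos (by positivity) _).ne'
  let j : H m →L[ℂ] lp (fun _ : ℤ => ℂ) 2 := ⟨coeffs m, (isometry_coeffs m).continuous⟩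
  refine ⟨c⁻¹ • (lp.evalCLM ℂ (fun _ : ℤ => ℂ) 2 l ∘L j), fun v => ?_⟩
  change c⁻¹ * coeffs m v l = _
  rw [coeffs_apply, inv_mul_cancel_left₀ hc]

/-- Continuous functionals that separate points, for use with the closed graph theorem. They are
read off from the two components of the image under `mult`; the factor e^(-σ|l|) removes the weight.
-/
theorem exists_pairing_J (m : ℕ) (γ : ℝ) (σ : ℝ) [hγ : Fact (1 / 2 < γ)] {χ : ℝ → ℝ}
    (hχ : IsTest1 χ) (l : ℤ) :
    ∃ Λ : J m γ σ →L[ℂ] ℂ, ∀ u : J m γ σ, Λ u = ∫ r, fc (u : FunPi) l r * χ r ∂mu1 := by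
  obtain ⟨Λ₁, h₁⟩ := exists_fourierCoeff_clm m l
  obtain ⟨Λ₂, h₂⟩ := exists_pairing_K m γ (hχ.isTest (-l))
  have hγ0 : 0 ≤ γ := by linarith [hγ.out]
  let e : J m γ σ →L[ℂ] WithLp 2 (H m × K m γ) :=
    ⟨(decomp m γ).toLinearMap ∘ₗ mult m γ σ,
      (isometry_decomp m γ).continuous.comp (isometry_mult m γ σ).continuous⟩
  let e' : J m γ σ →L[ℂ] H m × K m γ :=
    (WithLp.prodContinuousLinearEquiv 2 ℂ (H m) (K m γ)).toContinuousLinearMap ∘L e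
  refine ⟨(Real.exp (-σ * |(l : ℝ)|) : ℂ) • (((∫ r, (χ r : ℂ) ∂mu1) •
    (Λ₁ ∘L ContinuousLinearMap.fst ℂ _ _ ∘L e')) +
    ((2 * Real.pi : ℝ) : ℂ)⁻¹ • (Λ₂ ∘L ContinuousLinearMap.snd ℂ _ _ ∘L e')), fun u => ?_⟩
  set x := decomp m γ (mult m γ σ u) with hx
  change (Real.exp (-σ * |(l : ℝ)|) : ℂ) * ((∫ r, (χ r : ℂ) ∂mu1) * Λ₁ x.fst +
    ((2 * Real.pi : ℝ) : ℂ)⁻¹ * Λ₂ x.snd) = _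
  have hb : (mult m γ σ u : FunPi) = lift (x.fst : FunCirc) + (x.snd : FunPi) := by
    have := (decomp m γ).symm_apply_apply (mult m γ σ u)
    rw [← hx] at this
    rw [← this]
    rfl
  have hpi : ((2 * Real.pi : ℝ) : ℂ) ≠ 0 := by exact_mod_cast Real.two_pi_pos.ne'
  have hl : LocInt (fc (x.snd : FunPi) l) :=
    WeightedL2.locInt_fc (p := 0) hγ0 (by simpa using x.snd.2.1) l
  have hχi : Integrable (fun r => (χ r : ℂ)) mu1 := by
    have : LocInt fun _ => (1 : ℂ) := fun x _ => by simp
    simpa using this.integrable_mul hχ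
  rw [h₁, h₂, integral_mul_isTest1 x.snd.2.1 hχ, inv_mul_cancel_left₀ hpi, mul_comm (∫ r, _ ∂mu1),
    ← integral_const_mul, ← integral_add (hχi.const_mul _) (hl.integrable_mul hχ),
    ← integral_const_mul]
  refine integral_congr_ae ?_
  filter_upwards [isMultiplied_mult u l, fc_lift (x.fst : FunCirc) l,
    fc_add ((weightedL2_lift x.fst.2.1).mono (abs_nonneg γ)) (x.snd.2.1.mono (neg_le_abs γ)) l]
    with r h3 h4 h5
  have h6 : fourierCoeff (x.fst : FunCirc) l + fc (x.snd : FunPi) l r =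
      (Real.exp (σ * |(l : ℝ)|) : ℂ) * fc (u : FunPi) l r := by
    rw [← h4, ← h5, ← hb]
    exact h3
  rw [← add_mul, h6, mul_assoc]
  have := exp_mul_exp_neg (-σ) l (fc (u : FunPi) l r * χ r)
  rwa [neg_neg] at this

theorem WeightedL2.ext_integral {u v : FunPi}
    (hu : WeightedL2 0 u) (hv : WeightedL2 0 v)
    (h : ∀ χ, IsTest1 χ → ∀ l, ∫ r, fc u l r * χ r ∂mu1 = ∫ r, fc v l r * χ r ∂mu1) : u = v := by
  have hl : ∀ {u : FunPi}, WeightedL2 0 u → ∀ l, LocInt (fc u l) := fun hu l =>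
    WeightedL2.locInt_fc (γ := 0) (p := 0) le_rfl (by simpa using hu) l
  refine hu.ext_fc hv fun l => ?_
  have hd : LocInt fun r => fc u l r - fc v l r := fun x hx => (hl hu l x hx).sub (hl hv l x hx)
  have := hd.ae_eq_zero fun χ hχ => by
    simp only [sub_mul]
    rw [integral_sub ((hl hu l).integrable_mul hχ) ((hl hv l).integrable_mul hχ), h χ hχ l, sub_self]
  filter_upwards [this] with r hr
  rwa [Pi.zero_apply, sub_eq_zero] at hr

/-- The inclusion of `J^{m,σ}_{0,γ}(Π)` in `L²(Π)`. -/
def toL2 (m : ℕ) (γ σ : ℝ) [hγ : Fact (1 / 2 < γ)] : J m γ σ →ₗ[ℂ] Lp ℂ 2 muPi where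
  toFun u := (J.memLp u).toLp
  map_add' u v := by
    refine Lp.ext ?_
    filter_upwards [(J.memLp (u + v)).coeFn_toLp, (J.memLp u).coeFn_toLp, (J.memLp v).coeFn_toLp,
      Lp.coeFn_add (J.memLp u).toLp (J.memLp v).toLp, AEEqFun.coeFn_add (u : FunPi) v]
      with x h1 h2 h3 h4 h5
    rw [h1, h4, Pi.add_apply, h2, h3]
    exact h5
  map_smul' c u := by
    refine Lp.ext ?_
    filter_upwards [(J.memLp (c • u)).coeFn_toLp, (J.memLp u).coeFn_toLp,
      Lp.coeFn_smul c (J.memLp u).toLp, AEEqFun.coeFn_smul c (u : FunPi)] with x h1 h2 h3 h4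
    rw [h1]
    refine Eq.trans ?_ h3.symm
    rw [Pi.smul_apply, h2]
    exact h4

theorem integral_Lp_mul_isTest1 (F : Lp ℂ 2 muPi) :
    ∃ g : FunPi, WeightedL2 0 g ∧ ⇑F =ᵐ[muPi] g := by
  obtain ⟨g, hg, hF⟩ := exists_weightedL2_of_Lp 0 F
  refine ⟨g, hg, ?_⟩
  rw [← hF]
  exact hg.coeFn_toLp.trans (Eventually.of_forall fun x => by simp)

/-- Closed graph theorem: a limit in `J` and a limit in L² have the same pairings with all χ(ψ)
e^(-ilθ), hence coincide. -/
theorem continuous_toL2 (m : ℕ) (γ : ℝ) {σ : ℝ} [hγ : Fact (1 / 2 < γ)] (hσ : 0 ≤ σ) :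
    Continuous (toL2 m γ σ) := by
  have := completeSpace_J m γ hσ
  refine (toL2 m γ σ).continuous_of_seq_closed_graph fun u x y hu hy => ?_
  obtain ⟨g, hg, hF⟩ := integral_Lp_mul_isTest1 y
  have hx0 := J0.weightedL2_zero (by linarith [hγ.out]) x.2.1
  have hxg : (x : FunPi) = g := by
    refine hx0.ext_integral hg fun χ hχ l => ?_
    obtain ⟨Λ, hΛ⟩ := exists_pairing_J m γ σ hχ l
    obtain ⟨P, hP⟩ := exists_pairing 0 (hχ.isTest (-l))
    have h1 := (Λ.continuous.tendsto x).comp hu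
    have h2 := (P.continuous.tendsto y).comp hy
    have e1 : ∀ v : J m γ σ, P (toL2 m γ σ v) = (2 * Real.pi : ℝ) * Λ v := by
      intro v
      rw [hP, hΛ, ← integral_mul_isTest1 (J0.weightedL2_zero (by linarith [hγ.out]) v.2.1) hχ]
      refine integral_congr_ae ?_
      filter_upwards [(J.memLp v).coeFn_toLp] with z hz
      change _ * (MemLp.toLp _ (J.memLp v)) z * _ = _
      rw [hz]
      simp
    have e2 : P y = (2 * Real.pi : ℝ) * ∫ r, fc g l r * χ r ∂mu1 := by
      rw [hP, ← integral_mul_isTest1 hg hχ]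
      refine integral_congr_ae ?_
      filter_upwards [hF] with z hz
      rw [hz]
      simp
    have h3 := (h1.const_mul ((2 * Real.pi : ℝ) : ℂ)).congr fun n => (e1 (u n)).symm
    have h4 := tendsto_nhds_unique h3 h2
    rw [e2, hΛ] at h4
    exact mul_left_cancel₀ (by exact_mod_cast Real.two_pi_pos.ne') h4
  refine Lp.ext (hF.trans ?_)
  rw [← hxg]
  exact (J.memLp x).coeFn_toLp.symm

theorem exists_integral_clm (m : ℕ) (γ : ℝ) {σ : ℝ} [hγ : Fact (1 / 2 < γ)] (hσ : 0 ≤ σ)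
    {h : ℝ × Circ → ℂ} (hh : MemLp h 2 muPi) :
    ∃ Λ : J m γ σ →L[ℂ] ℂ, ∀ u : J m γ σ, Λ u = ∫ x, (u : FunPi) x * h x ∂muPi := by
  have hm : MemLp (fun x => (starRingEnd ℂ) (h x)) 2 muPi := hh.star
  refine ⟨(innerSL ℂ hm.toLp) ∘L ⟨toL2 m γ σ, continuous_toL2 m γ hσ⟩, fun u => ?_⟩
  change inner ℂ hm.toLp (MemLp.toLp _ (J.memLp u)) = _
  rw [L2.inner_def]
  refine integral_congr_ae ?_
  filter_upwards [hm.coeFn_toLp, (J.memLp u).coeFn_toLp] with x hx hx'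
  rw [hx, hx', RCLike.inner_apply, RCLike.conj_conj]

theorem FunPi.add_mul (u v w : FunPi) : (u + v) * w = u * w + v * w := by
  refine AEEqFun.ext ?_
  filter_upwards [AEEqFun.coeFn_mul (u + v) w, AEEqFun.coeFn_add u v, AEEqFun.coeFn_mul u w,
    AEEqFun.coeFn_mul v w, AEEqFun.coeFn_add (u * w) (v * w)] with x h1 h2 h3 h4 h5
  rw [h1, h5, Pi.mul_apply, h2, Pi.add_apply, Pi.add_apply, h3, h4]
  exact _root_.add_mul _ _ _

theorem FunPi.smul_mul (c : ℂ) (u v : FunPi) : (c • u) * v = c • (u * v) := by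
  refine AEEqFun.ext ?_
  filter_upwards [AEEqFun.coeFn_mul (c • u) v, AEEqFun.coeFn_smul c u, AEEqFun.coeFn_mul u v,
    AEEqFun.coeFn_smul c (u * v)] with x h1 h2 h3 h4
  rw [h1, h4, Pi.mul_apply, h2, Pi.smul_apply, Pi.smul_apply, h3]
  exact smul_mul_assoc _ _ _

theorem FunPi.mul_add (u v w : FunPi) : u * (v + w) = u * v + u * w := by
  rw [mul_comm, FunPi.add_mul, mul_comm v, mul_comm w]

theorem FunPi.mul_smul (c : ℂ) (u v : FunPi) : u * (c • v) = c • (u * v) := by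
  rw [mul_comm, FunPi.smul_mul, mul_comm v]

/-- Multiplication, as a bilinear map. -/
def mulₗ {m : ℕ} (hm : 1 < m) (γ : ℝ) {σ : ℝ} [hγ : Fact (1 / 2 < γ)] (hσ : 0 ≤ σ) :
    J m γ σ →ₗ[ℂ] J m γ σ →ₗ[ℂ] J m γ σ :=
  LinearMap.mk₂ ℂ (fun u v => ⟨(u : FunPi) * v, J.mul_mem hm hσ u.2 v.2⟩)
    (fun u v w => Subtype.ext (FunPi.add_mul (u : FunPi) v w))
    (fun c u v => Subtype.ext (FunPi.smul_mul c (u : FunPi) v))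
    (fun u v w => Subtype.ext (FunPi.mul_add (u : FunPi) v w))
    (fun c u v => Subtype.ext (FunPi.mul_smul c (u : FunPi) v))

/-- Closed graph theorem again. Pairing uv with φ is pairing v with uφ, and uφ is in L² because u is
bounded, so the pairing is continuous in v and identifies the limit of the products. -/
theorem continuous_mulₗ_apply {m : ℕ} (hm : 1 < m) {γ : ℝ} {σ : ℝ} [hγ : Fact (1 / 2 < γ)]
    (hσ : 0 ≤ σ) (u : J m γ σ) : Continuous (mulₗ hm γ hσ u) := by
  have := completeSpace_J m γ hσ
  refine (mulₗ hm γ hσ u).continuous_of_seq_closed_graph fun v x y hv hy => ?_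
  obtain ⟨B, hB⟩ := J.exists_bound hm hγ.out hσ u.2
  have hw : ∀ v : J m γ σ, WeightedL2 0 (v : FunPi) := fun v =>
    J0.weightedL2_zero (by linarith [hγ.out]) v.2.1
  refine Subtype.ext ((hw _).ext_integral (hw _) fun χ hχ l => ?_)
  have hφ : MemLp (fun x : ℝ × Circ => (χ x.1 : ℂ) * fourier (-l) x.2) 2 muPi :=
    ((hχ.isTest (-l)).weighted_memLp 0).ae_eq (Eventually.of_forall fun x => by simp)
  have huφ : MemLp (fun x => (u : FunPi) x * ((χ x.1 : ℂ) * fourier (-l) x.2)) 2 muPi :=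
    MemLp.of_le_mul (c := B) hφ ((u : FunPi).aestronglyMeasurable.mul hφ.1) (by
      filter_upwards [hB] with x hx
      rw [norm_mul]
      gcongr)
  obtain ⟨Λ, hΛ⟩ := exists_integral_clm m γ hσ hφ
  obtain ⟨Λ', hΛ'⟩ := exists_integral_clm m γ hσ huφ
  have e : ∀ v, Λ (mulₗ hm γ hσ u v) = Λ' v := by
    intro v
    rw [hΛ, hΛ']
    refine integral_congr_ae ?_
    filter_upwards [AEEqFun.coeFn_mul (u : FunPi) v] with x hx
    change ((u : FunPi) * (v : FunPi) : FunPi) x * _ = _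
    rw [hx, Pi.mul_apply]
    ring
  have h1 := (Λ.continuous.tendsto y).comp hy
  have h2 := (Λ'.continuous.tendsto x).comp hv
  have h3 := tendsto_nhds_unique h1 (h2.congr fun n => (e (v n)).symm)
  rw [← e, hΛ, hΛ, integral_mul_isTest1 (hw _) hχ, integral_mul_isTest1 (hw _) hχ] at h3
  exact mul_left_cancel₀ (by exact_mod_cast Real.two_pi_pos.ne') h3

/-- Multiplication, as a linear map to the bounded operators. -/
def mulLin {m : ℕ} (hm : 1 < m) (γ : ℝ) {σ : ℝ} [hγ : Fact (1 / 2 < γ)] (hσ : 0 ≤ σ) :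
    J m γ σ →ₗ[ℂ] J m γ σ →L[ℂ] J m γ σ where
  toFun u := ⟨mulₗ hm γ hσ u, continuous_mulₗ_apply hm hσ u⟩
  map_add' u v := by ext1 w; exact LinearMap.congr_fun ((mulₗ hm γ hσ).map_add u v) w
  map_smul' c u := by ext1 w; exact LinearMap.congr_fun ((mulₗ hm γ hσ).map_smul c u) w

theorem mulLin_comm {m : ℕ} (hm : 1 < m) {γ : ℝ} {σ : ℝ} [hγ : Fact (1 / 2 < γ)] (hσ : 0 ≤ σ)
    (u v : J m γ σ) : mulLin hm γ hσ u v = mulLin hm γ hσ v u :=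
  Subtype.ext (mul_comm (u : FunPi) v)

/-- Separate continuity is upgraded to joint continuity by the closed graph theorem for the map into
bounded operators: its graph is closed since, by commutativity, u ↦ uv is continuous for each fixed
v. -/
theorem continuous_mulLin {m : ℕ} (hm : 1 < m) {γ : ℝ} {σ : ℝ} [hγ : Fact (1 / 2 < γ)]
    (hσ : 0 ≤ σ) : Continuous (mulLin hm γ hσ) := by
  have := completeSpace_J m γ hσ
  refine (mulLin hm γ hσ).continuous_of_seq_closed_graph fun u x y hu hy => ?_
  ext1 v
  have h1 := (ContinuousLinearMap.apply ℂ (J m γ σ) v).continuous.tendsto y |>.comp hy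
  have h2 := ((mulLin hm γ hσ v).continuous.tendsto x).comp hu
  have h3 := tendsto_nhds_unique h1 (h2.congr fun n => mulLin_comm hm hσ v (u n))
  rw [mulLin_comm hm hσ x v, ← h3]
  rfl

/-- Multiplication, as a bounded bilinear map. -/
def mulL {m : ℕ} (hm : 1 < m) (γ : ℝ) {σ : ℝ} [hγ : Fact (1 / 2 < γ)] (hσ : 0 ≤ σ) :
    J m γ σ →L[ℂ] J m γ σ →L[ℂ] J m γ σ := ⟨mulLin hm γ hσ, continuous_mulLin hm hσ⟩

/-! ### The Banach algebra `J^{m,σ}_{0,γ}(Π)` -/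

theorem weightedL2_el_const_add {γ : ℝ} {f : ℝ → ℂ} (hf : S0 γ f) (c : ℂ) (k : ℤ)
    (hm : AEStronglyMeasurable (fun r => c + f r) mu1) :
    WeightedL2 |γ| (el (fun r => c + f r) k hm) := by
  have h1 : WeightedL2 (-γ) (el f k hf.1) := by
    simpa using weightedL2_el (p := 0) (by simpa using hf) k hf.1
  have e := el_add (k := k) (aestronglyMeasurable_const (b := c)) hf.1
  exact e ▸ ((weightedL2_el_const c k).mono (abs_nonneg γ)).add (h1.mono (neg_le_abs γ))

theorem el_mem_J {m : ℕ} {γ σ : ℝ} [hγ : Fact (1 / 2 < γ)] (hσ : 0 ≤ σ) {f : ℝ → ℂ}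
    (hf : S γ m f) (c : ℂ) (k : ℤ) (hm : AEStronglyMeasurable (fun r => c + f r) mu1) :
    el (fun r => c + f r) k hm ∈ J m γ σ := by
  refine (mem_J_iff hσ).2 ⟨weightedL2_el_const_add hf.base c k hm, _, _, Y.single σ m k c,
    hf.single k, fun l => ?_⟩
  filter_upwards [fc_el hm (k := k) l] with r hr
  rw [hr]
  split_ifs <;> simp

theorem S.zero (γ : ℝ) (m : ℕ) : S γ m fun _ => 0 := (X.zero (σ := 0) m).component le_rfl 0

theorem el_mul_el {f g : ℝ → ℂ} {k l : ℤ} (hf : AEStronglyMeasurable f mu1)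
    (hg : AEStronglyMeasurable g mu1) (hfg : AEStronglyMeasurable (fun r => f r * g r) mu1) :
    el f k hf * el g l hg = el (fun r => f r * g r) (k + l) hfg := by
  refine AEEqFun.ext ?_
  filter_upwards [coeFn_el (k := k) hf, coeFn_el (k := l) hg, coeFn_el (k := k + l) hfg,
    AEEqFun.coeFn_mul (el f k hf) (el g l hg)] with x h1 h2 h3 h4
  rw [h4, Pi.mul_apply, h1, h2, h3, fourier_add]
  ring

theorem el_one : el (fun _ => 1) 0 aestronglyMeasurable_const = 1 := by
  refine AEEqFun.ext ?_
  filter_upwards [coeFn_el (f := fun _ => 1) (k := 0) aestronglyMeasurable_const,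
    AEEqFun.coeFn_one (α := ℝ × Circ) (β := ℂ) (μ := muPi)] with x h1 h2
  rw [h1, h2]
  simp

theorem const_mem_J {m : ℕ} {γ σ : ℝ} [hγ : Fact (1 / 2 < γ)] (hσ : 0 ≤ σ) (c : ℂ) (k : ℤ) :
    el (fun _ => c) k aestronglyMeasurable_const ∈ J m γ σ := by
  have := el_mem_J hσ (S.zero γ m) c k (by simpa using aestronglyMeasurable_const)
  simpa only [add_zero] using this

/-- `J^{m,σ}_{0,γ}(Π)` as an algebra, normed by the action on itself. -/
def Alg {m : ℕ} (_ : 1 < m) (γ : ℝ) {σ : ℝ} [Fact (1 / 2 < γ)] (_ : 0 ≤ σ) : Type := J m γ σ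

section Alg

variable {m : ℕ} (hm : 1 < m) (γ : ℝ) {σ : ℝ} [hγ : Fact (1 / 2 < γ)] (hσ : 0 ≤ σ)

instance instCommRingAlg : CommRing (Alg hm γ hσ) where
  __ := (inferInstance : AddCommGroup (J m γ σ))
  mul u v := mulLin hm γ hσ u v
  one := ⟨1, el_one ▸ const_mem_J hσ 1 0⟩
  mul_assoc u v w := Subtype.ext (mul_assoc (u.1 : FunPi) v.1 w.1)
  one_mul u := Subtype.ext (one_mul (u.1 : FunPi))
  mul_one u := Subtype.ext (mul_one (u.1 : FunPi))
  left_distrib u v w := Subtype.ext (FunPi.mul_add u.1 v.1 w.1)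
  right_distrib u v w := Subtype.ext (FunPi.add_mul u.1 v.1 w.1)
  zero_mul u := DFunLike.congr_fun (mulLin hm γ hσ).map_zero u
  mul_zero u := (mulLin hm γ hσ u).map_zero
  mul_comm u v := mulLin_comm hm hσ u v

instance instAlgebraAlg : Algebra ℂ (Alg hm γ hσ) :=
  let _ : Module ℂ (Alg hm γ hσ) := (inferInstance : Module ℂ (J m γ σ))
  Algebra.ofModule (fun c u v => Subtype.ext (FunPi.smul_mul c u.1 v.1))
    (fun c u v => Subtype.ext (FunPi.mul_smul c u.1 v.1))

/-- The action of `J^{m,σ}_{0,γ}(Π)` on itself by multiplication. -/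
def mulAlg : Alg hm γ hσ →ₐ[ℂ] (J m γ σ →L[ℂ] J m γ σ) :=
  AlgHom.ofLinearMap (mulLin hm γ hσ) (by ext1 u; exact Subtype.ext (one_mul (u : FunPi)))
    fun u v => by ext1 w; exact Subtype.ext (mul_assoc (u.1 : FunPi) v.1 w)

theorem mulAlg_apply_one (u : Alg hm γ hσ) : mulAlg hm γ hσ u (1 : Alg hm γ hσ) = u :=
  Subtype.ext (mul_one (u.1 : FunPi))

theorem mulAlg_injective : Function.Injective (mulAlg hm γ hσ) := fun u v h => by
  rw [← mulAlg_apply_one hm γ hσ u, h, mulAlg_apply_one]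

/-- The operator norm is submultiplicative, whereas the norm of `J` is so only up to a constant;
`toAlg` shows that the two are equivalent. -/
instance instNormedCommRingAlg : NormedCommRing (Alg hm γ hσ) :=
  NormedCommRing.induced _ _ (mulAlg hm γ hσ) (mulAlg_injective hm γ hσ)

theorem isometry_mulAlg : Isometry (mulAlg hm γ hσ) :=
  AddMonoidHomClass.isometry_of_norm (mulAlg hm γ hσ) fun _ => rfl

instance instNormedAlgebraAlg : NormedAlgebra ℂ (Alg hm γ hσ) where
  norm_smul_le c u := by
    change ‖mulAlg hm γ hσ (c • u)‖ ≤ ‖c‖ * ‖mulAlg hm γ hσ u‖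
    rw [map_smul]
    exact (norm_smul c (mulAlg hm γ hσ u)).le

/-- The identity, as a topological isomorphism from `J^{m,σ}_{0,γ}(Π)` to the algebra. -/
def toAlg : J m γ σ ≃L[ℂ] Alg hm γ hσ where
  toFun u := u
  invFun u := u
  map_add' _ _ := rfl
  map_smul' _ _ := rfl
  left_inv _ := rfl
  right_inv _ := rfl
  continuous_toFun := by
    have h := isometry_mulAlg hm γ hσ
    refine h.isUniformInducing.isInducing.continuous_iff.2 ?_
    exact continuous_mulLin hm hσ
  continuous_invFun := by
    have h := isometry_mulAlg hm γ hσ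
    -- An element is recovered from its multiplication operator by applying it to 1.
    let L : (J m γ σ →L[ℂ] J m γ σ) →L[ℂ] J m γ σ :=
      ContinuousLinearMap.apply ℂ (J m γ σ) (1 : Alg hm γ hσ)
    have hL : Continuous fun u => L (mulAlg hm γ hσ u) := L.continuous.comp h.continuous
    exact hL.congr fun u => mulAlg_apply_one hm γ hσ u

instance instCompleteSpaceAlg : CompleteSpace (Alg hm γ hσ) := by
  have := completeSpace_J m γ hσ
  exact (completeSpace_congr (e := (toAlg hm γ hσ).toEquiv)
    (toAlg hm γ hσ).isUniformEmbedding).1 this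

end Alg

/-! ### Extension to the closed strip -/

/-- The decaying part of each coefficient is bounded by a multiple of r^(γ-1/2), so it extends
continuously by 0 to ψ = 0; the majorants are uniform on [0,1]. -/
theorem J.exists_continuous_coeff {m : ℕ} (hm : 1 < m) {γ σ : ℝ} (hγ : 1 / 2 < γ) {u : FunPi}
    (hu : u ∈ J m γ σ) :
    ∃ (G : ℤ → ℝ → ℂ) (M : ℤ → ℝ), (∀ k, ContinuousOn (G k) (Icc 0 1)) ∧
      (∀ k, fc u k =ᵐ[mu1] G k) ∧ (∀ k, ∀ r ∈ Icc (0 : ℝ) 1, ‖G k r‖ ≤ M k) ∧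
      (∀ k, 0 ≤ M k) ∧ Summable fun k : ℤ => Real.exp (σ * |(k : ℝ)|) * M k := by
  obtain ⟨c, a, hc, ha, h⟩ := J.exists_data (by linarith) hu
  obtain ⟨M, hM0, hM, hM1⟩ := (ha.mono (by omega : 2 ≤ m)).exists_majorant hγ
  obtain ⟨-, -, a', -, hd⟩ := ha.mono (by omega : 2 ≤ m)
  choose F hF1 hF2 hF3 using fun k =>
    (hd k).exists_continuousOn (by linarith : 0 < γ - 1 / 2) (hM1 k)
  refine ⟨fun k r => c k + F k r, fun k => ‖c k‖ + M k, fun k => continuousOn_const.add (hF1 k),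
    fun k => ?_, fun k r hr => ?_, fun k => add_nonneg (norm_nonneg _) (hM0 k), ?_⟩
  · filter_upwards [h k, hF2 k] with r h1 h2
    rw [h1, h2]
  · refine (norm_add_le _ _).trans (add_le_add le_rfl ((hF3 k r hr).trans ?_))
    exact mul_le_of_le_one_right (hM0 k) (Real.rpow_le_one hr.1 hr.2 (by linarith))
  · simpa only [mul_add] using (hc.mono (by omega : 1 ≤ m)).summable.add hM

theorem norm_exp_mul_le {σ : ℝ} (k : ℤ) {z : ℂ} (hz : |z.im| ≤ σ) :
    ‖Complex.exp (Complex.I * k * z)‖ ≤ Real.exp (σ * |(k : ℝ)|) := by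
  rw [Complex.norm_exp, Real.exp_le_exp]
  have : (Complex.I * k * z).re = -(k * z.im) := by simp
  rw [this, mul_comm σ]
  calc -((k : ℝ) * z.im) ≤ |(k : ℝ) * z.im| := neg_le_abs _
    _ = |(k : ℝ)| * |z.im| := abs_mul _ _
    _ ≤ _ := by gcongr

theorem fourier_coe (k : ℤ) (t : ℝ) :
    (fourier k (t : Circ) : ℂ) = Complex.exp (Complex.I * k * t) := by
  rw [fourier_coe_apply]
  congr 1
  push_cast
  have : (Real.pi : ℂ) ≠ 0 := by exact_mod_cast Real.pi_ne_zero
  field_simp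

/-- The Weierstrass M-test for ∑ G_k(r) e^(ikz), as |e^(ikz)| ≤ e^(σ|k|) on the closed strip. -/
theorem J.exists_isStripExtension {m : ℕ} (hm : 1 < m) {γ σ : ℝ} (hγ : 1 / 2 < γ) (hσ : 0 ≤ σ)
    {u : FunPi} (hu : u ∈ J m γ σ) : ∃ U, IsStripExtension σ u U := by
  obtain ⟨G, M, hG, hu', hGM, hM0, hM⟩ := J.exists_continuous_coeff hm hγ hu
  have hb : ∀ k, ∀ r ∈ Icc (0 : ℝ) 1, ∀ z : ℂ, |z.im| ≤ σ →
      ‖G k r * Complex.exp (Complex.I * k * z)‖ ≤ Real.exp (σ * |(k : ℝ)|) * M k := by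
    intro k r hr z hz
    rw [norm_mul, mul_comm]
    exact mul_le_mul (norm_exp_mul_le k hz) (hGM k r hr) (norm_nonneg _) (Real.exp_pos _).le
  refine ⟨fun r z => ∑' k : ℤ, G k r * Complex.exp (Complex.I * k * z), ?_, ?_, ?_, ?_⟩
  · refine continuousOn_tsum (fun k => ?_) hM fun k x hx => hb k x.1 hx.1 x.2 hx.2
    exact ((hG k).comp continuousOn_fst fun x hx => hx.1).mul (by fun_prop)
  · intro r _ z _
    refine tsum_congr fun k => ?_
    congr 1
    rw [Complex.exp_eq_exp_iff_exists_int]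
    exact ⟨k, by push_cast; ring⟩
  · intro r hr
    refine Complex.differentiableOn_tsum_of_summable_norm hM (fun k => ?_) ?_
      fun k z hz => hb k r hr z (le_of_lt hz)
    · fun_prop
    · exact isOpen_lt (by fun_prop) continuous_const
  · have hM' := summable_of_exp_mul hσ hM0 hM
    have h1 := (J0_weightedL2 ⟨u, hu.1⟩).ae_eq_tsum (by
      filter_upwards [ae_all_iff.2 hu', ae_restrict_mem measurableSet_Ioc] with r hr hr0
      refine Summable.of_nonneg_of_le (fun k => norm_nonneg _) (fun k => ?_) hM'
      rw [hr]
      exact hGM k r (Ioc_subset_Icc_self hr0))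
    filter_upwards [h1, Measure.quasiMeasurePreserving_fst (ν := (volume : Measure Circ)) |>.ae
      (ae_all_iff.2 hu')] with x h2 h3 t ht
    rw [h2]
    refine tsum_congr fun k => ?_
    rw [h3, ← ht, fourier_coe]

/-! ### Uniqueness of the extension and operations on extensions. -/

theorem mem_closure_strip {σ : ℝ} (hσ : 0 < σ) {z : ℂ} (hz : |z.im| ≤ σ) :
    z ∈ closure {z : ℂ | |z.im| < σ} := by
  have h1 : Tendsto (fun t : ℝ => (t : ℂ) * z) (𝓝[<] 1) (𝓝 z) := by
    have : ContinuousAt (fun t : ℝ => (t : ℂ) * z) 1 := by fun_prop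
    simpa using this.tendsto.mono_left nhdsWithin_le_nhds
  refine mem_closure_of_tendsto h1 ?_
  filter_upwards [Ioo_mem_nhdsLT (show (0 : ℝ) < 1 by norm_num)] with t ht
  rw [Complex.im_ofReal_mul, abs_mul, abs_of_pos ht.1]
  nlinarith [abs_nonneg z.im, ht.1, ht.2]

theorem IsStripExtension.continuousOn_right {σ : ℝ} {a : FunPi} {U : ℝ → ℂ → ℂ}
    (h : IsStripExtension σ a U) {r : ℝ} (hr : r ∈ Icc (0 : ℝ) 1) :
    ContinuousOn (U r) {z : ℂ | |z.im| ≤ σ} :=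
  h.continuousOn.comp (f := fun z => (r, z)) (by fun_prop) fun _ hz => ⟨hr, hz⟩

theorem IsStripExtension.continuousOn_left {σ : ℝ} {a : FunPi} {U : ℝ → ℂ → ℂ}
    (h : IsStripExtension σ a U) {z : ℂ} (hz : |z.im| ≤ σ) :
    ContinuousOn (fun r => U r z) (Icc 0 1) :=
  h.continuousOn.comp (f := fun r => (r, z)) (by fun_prop) fun _ hr => ⟨hr, hz⟩

/-- Continuity removes the exceptional null sets, first in θ for almost every r and then in r. The
period interval starting at t - 1 is chosen so as to contain t. -/
theorem IsStripExtension.eq_real {σ : ℝ} (hσ : 0 ≤ σ) {a : FunPi} {U V : ℝ → ℂ → ℂ}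
    (hU : IsStripExtension σ a U) (hV : IsStripExtension σ a V) {r : ℝ} (hr : r ∈ Icc (0 : ℝ) 1)
    (t : ℝ) : U r t = V r t := by
  have h1 : ∀ᵐ s ∂mu1, ∀ t : ℝ, U s t = V s t := by
    filter_upwards [Measure.ae_ae_of_ae_prod (hU.ae_eq.and hV.ae_eq),
      ae_restrict_mem measurableSet_Ioc] with s hs hs0 t
    have hs1 := Ioc_subset_Icc_self hs0
    have hc : ∀ {W}, IsStripExtension σ a W →
        ContinuousOn (fun t : ℝ => W s t) (Ioc (t - 1) (t - 1 + 2 * Real.pi)) := fun hW =>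
      (hW.continuousOn_right hs1).comp (by fun_prop) fun x _ => by simpa using hσ
    refine Measure.eqOn_Ioc_of_ae_eq volume ?_ (hc hU) (hc hV)
      ⟨by linarith, by linarith [Real.pi_gt_three]⟩
    have hq := (AddCircle.measurePreserving_mk (2 * Real.pi) (t - 1)).quasiMeasurePreserving.ae hs
    filter_upwards [hq] with x hx
    rw [← hx.1 x rfl, hx.2 x rfl]
  have hz : |((t : ℂ)).im| ≤ σ := by simpa using hσ
  refine Measure.eqOn_Icc_of_ae_eq volume (zero_ne_one) ?_ (hU.continuousOn_left hz)
    (hV.continuousOn_left hz) hr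
  rw [← Measure.restrict_congr_set Ioc_ae_eq_Icc]
  exact h1.mono fun s hs => hs t

/-- For σ > 0 the identity theorem on the open strip, started from the real axis, and continuity up
to the boundary. For σ = 0 the strip is the real axis and there is nothing to continue. -/
theorem IsStripExtension.unique {σ : ℝ} (hσ : 0 ≤ σ) {a : FunPi} {U V : ℝ → ℂ → ℂ}
    (hU : IsStripExtension σ a U) (hV : IsStripExtension σ a V) {r : ℝ} (hr : r ∈ Icc (0 : ℝ) 1)
    {z : ℂ} (hz : |z.im| ≤ σ) : U r z = V r z := by
  rcases hσ.eq_or_lt with rfl | hσ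
  · have : z = (z.re : ℂ) := Complex.ext rfl (by simpa using hz)
    rw [this]
    exact hU.eq_real le_rfl hV hr _
  · have ho : IsOpen {z : ℂ | |z.im| < σ} := isOpen_lt (by fun_prop) continuous_const
    have hp : IsPreconnected {z : ℂ | |z.im| < σ} := by
      have : {z : ℂ | |z.im| < σ} = Complex.imCLM ⁻¹' (Metric.ball 0 σ) := by
        ext z
        simp
      rw [this]
      exact ((convex_ball 0 σ).linear_preimage Complex.imCLM.toLinearMap).isPreconnected
    have h0 : (0 : ℂ) ∈ closure ({z : ℂ | U r z = V r z} \ {0}) := by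
      have h1 : Tendsto (fun t : ℝ => (t : ℂ)) (𝓝[>] 0) (𝓝 0) := by
        have : ContinuousAt (fun t : ℝ => (t : ℂ)) 0 := by fun_prop
        simpa using this.tendsto.mono_left nhdsWithin_le_nhds
      refine mem_closure_of_tendsto h1 ?_
      filter_upwards [self_mem_nhdsWithin] with t ht
      exact ⟨hU.eq_real hσ.le hV hr t, by simpa using (ne_of_gt ht)⟩
    have h2 := (((hU.holomorphic r hr).analyticOnNhd ho)).eqOn_of_preconnected_of_mem_closure
      ((hV.holomorphic r hr).analyticOnNhd ho) hp (by simpa using hσ) h0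
    exact Set.EqOn.of_subset_closure h2 (hU.continuousOn_right hr) (hV.continuousOn_right hr)
      (fun z (hz : |z.im| < σ) => hz.le) (fun z hz => mem_closure_strip hσ hz) hz

theorem IsStripExtension.add {σ : ℝ} {a b : FunPi} {U V : ℝ → ℂ → ℂ}
    (hU : IsStripExtension σ a U) (hV : IsStripExtension σ b V) :
    IsStripExtension σ (a + b) fun r z => U r z + V r z where
  continuousOn := hU.continuousOn.add hV.continuousOn
  periodic r hr z hz := by rw [hU.periodic r hr z hz, hV.periodic r hr z hz]
  holomorphic r hr := (hU.holomorphic r hr).add (hV.holomorphic r hr)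
  ae_eq := by
    filter_upwards [hU.ae_eq, hV.ae_eq, AEEqFun.coeFn_add a b] with x h1 h2 h3 t ht
    rw [h3, Pi.add_apply, h1 t ht, h2 t ht]

theorem IsStripExtension.mul {σ : ℝ} {a b : FunPi} {U V : ℝ → ℂ → ℂ}
    (hU : IsStripExtension σ a U) (hV : IsStripExtension σ b V) :
    IsStripExtension σ (a * b) fun r z => U r z * V r z where
  continuousOn := hU.continuousOn.mul hV.continuousOn
  periodic r hr z hz := by rw [hU.periodic r hr z hz, hV.periodic r hr z hz]
  holomorphic r hr := (hU.holomorphic r hr).mul (hV.holomorphic r hr)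
  ae_eq := by
    filter_upwards [hU.ae_eq, hV.ae_eq, AEEqFun.coeFn_mul a b] with x h1 h2 h3 t ht
    rw [h3, Pi.mul_apply, h1 t ht, h2 t ht]

/-- The extension of `(c + F(ψ)) e^{ikθ}`. -/
theorem isStripExtension_el (σ : ℝ) {f F : ℝ → ℂ} (hf : AEStronglyMeasurable f mu1) (k : ℤ)
    (hF : ContinuousOn F (Icc 0 1)) (h : f =ᵐ[mu1] F) :
    IsStripExtension σ (el f k hf) fun r z => F r * Complex.exp (Complex.I * k * z) where
  continuousOn := (hF.comp continuousOn_fst fun x hx => hx.1).mul (by fun_prop)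
  periodic r _ z _ := by
    congr 1
    rw [Complex.exp_eq_exp_iff_exists_int]
    exact ⟨k, by push_cast; ring⟩
  holomorphic r _ := by fun_prop
  ae_eq := by
    filter_upwards [coeFn_el (k := k) hf, Measure.quasiMeasurePreserving_fst
      (ν := (volume : Measure Circ)) |>.ae h] with x h1 h2 t ht
    rw [h1, h2, ← ht, fourier_coe]

theorem IsStripExtension.smul {σ : ℝ} {a : FunPi} {U : ℝ → ℂ → ℂ}
    (hU : IsStripExtension σ a U) (c : ℂ) :
    IsStripExtension σ (c • a) fun r z => c * U r z where
  continuousOn := continuousOn_const.mul hU.continuousOn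
  periodic r hr z hz := by rw [hU.periodic r hr z hz]
  holomorphic r hr := (hU.holomorphic r hr).const_mul c
  ae_eq := by
    filter_upwards [hU.ae_eq, AEEqFun.coeFn_smul c a] with x h1 h3 t ht
    rw [h3, Pi.smul_apply, h1 t ht, smul_eq_mul]

theorem IsStripExtension.one (σ : ℝ) : IsStripExtension σ 1 fun _ _ => 1 := by
  have := isStripExtension_el σ (f := fun _ => 1) aestronglyMeasurable_const 0
    continuousOn_const .rfl
  rw [el_one] at this
  simpa using this

theorem IsStripExtension.image_eq {σ : ℝ} {a : FunPi} {U : ℝ → ℂ → ℂ}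
    (hU : IsStripExtension σ a U) {r : ℝ} (hr : r ∈ Icc (0 : ℝ) 1) {z : ℂ} (hz : |z.im| ≤ σ) :
    ∃ w ∈ Icc 0 (2 * Real.pi) ×ℂ Icc (-σ) σ, U r z = U r w := by
  have hp : Function.Periodic (fun t : ℝ => U r (t + z.im * Complex.I)) (2 * Real.pi) := by
    intro t
    have := hU.periodic r hr (t + z.im * Complex.I) (by simpa using hz)
    refine Eq.trans ?_ this
    change U r _ = U r _
    congr 1
    push_cast
    ring
  obtain ⟨y, hy, he⟩ := hp.exists_mem_Ico₀ Real.two_pi_pos z.re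
  refine ⟨y + z.im * Complex.I, ⟨?_, ?_⟩, ?_⟩
  · simpa using Ico_subset_Icc_self hy
  · simpa using abs_le.1 hz
  · rw [← he, Complex.re_add_im]

section Evaluation

variable {m : ℕ} (hm : 1 < m) (γ : ℝ) {σ : ℝ} [hγ : Fact (1 / 2 < γ)] (hσ : 0 ≤ σ)

/-- The extension of `u` to the closed strip. -/
def ext (u : Alg hm γ hσ) : ℝ → ℂ → ℂ := (J.exists_isStripExtension hm hγ.out hσ u.2).choose

theorem isStripExtension_ext (u : Alg hm γ hσ) : IsStripExtension σ u.1 (ext hm γ hσ u) :=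
  (J.exists_isStripExtension hm hγ.out hσ u.2).choose_spec

/-- Evaluation at a point of the closed strip. -/
def ev {r : ℝ} (hr : r ∈ Icc (0 : ℝ) 1) {z : ℂ} (hz : |z.im| ≤ σ) : Alg hm γ hσ →ₐ[ℂ] ℂ :=
  AlgHom.ofLinearMap
    { toFun := fun u => ext hm γ hσ u r z
      -- The sum of two extensions extends the sum, so uniqueness gives additivity; scalar
      -- multiples, 1 and products are treated alike.
      map_add' := fun u v => (isStripExtension_ext hm γ hσ (u + v)).unique hσ
        ((isStripExtension_ext hm γ hσ u).add (isStripExtension_ext hm γ hσ v)) hr hz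
      map_smul' := fun c u => (isStripExtension_ext hm γ hσ (c • u)).unique hσ
        ((isStripExtension_ext hm γ hσ u).smul c) hr hz }
    ((isStripExtension_ext hm γ hσ 1).unique hσ (IsStripExtension.one σ) hr hz)
    fun u v => (isStripExtension_ext hm γ hσ (u * v)).unique hσ
      ((isStripExtension_ext hm γ hσ u).mul (isStripExtension_ext hm γ hσ v)) hr hz

theorem ev_apply {r : ℝ} (hr : r ∈ Icc (0 : ℝ) 1) {z : ℂ} (hz : |z.im| ≤ σ) (u : Alg hm γ hσ) :
    ev hm γ hσ hr hz u = ext hm γ hσ u r z := rfl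

theorem ev_eq {r : ℝ} (hr : r ∈ Icc (0 : ℝ) 1) {z : ℂ} (hz : |z.im| ≤ σ) (u : Alg hm γ hσ)
    {U : ℝ → ℂ → ℂ} (hU : IsStripExtension σ u.1 U) : ev hm γ hσ hr hz u = U r z :=
  (isStripExtension_ext hm γ hσ u).unique hσ hU hr hz

/-- Characters of a Banach algebra are automatically continuous, here with a bound independent of
the point. -/
theorem norm_ev_le {r : ℝ} (hr : r ∈ Icc (0 : ℝ) 1) {z : ℂ} (hz : |z.im| ≤ σ) (u : Alg hm γ hσ) :
    ‖ev hm γ hσ hr hz u‖ ≤ ‖u‖ * ‖(1 : Alg hm γ hσ)‖ :=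
  AlgHom.norm_apply_le_self_mul_norm_one _ u

theorem mem_imageIn_iff {Ω : Set ℂ} {u : J m γ σ} : u ∈ imageIn m γ σ Ω ↔
    ∀ r ∈ Icc (0 : ℝ) 1, ∀ z : ℂ, |z.im| ≤ σ → ext hm γ hσ (toAlg hm γ hσ u) r z ∈ Ω := by
  refine ⟨?_, fun h => ⟨_, isStripExtension_ext hm γ hσ (toAlg hm γ hσ u), h⟩⟩
  rintro ⟨U, hU, h⟩ r hr z hz
  rw [(isStripExtension_ext hm γ hσ (toAlg hm γ hσ u)).unique hσ hU hr hz]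
  exact h r hr z hz

/-- The values of the extension of `u`. -/
def values (u : Alg hm γ hσ) : Set ℂ :=
  Function.uncurry (ext hm γ hσ u) '' (Icc (0 : ℝ) 1 ×ˢ {z : ℂ | |z.im| ≤ σ})

theorem isCompact_values (u : Alg hm γ hσ) : IsCompact (values hm γ hσ u) := by
  have hu := isStripExtension_ext hm γ hσ u
  have hsub : Icc 0 (2 * Real.pi) ×ℂ Icc (-σ) σ ⊆ {z : ℂ | |z.im| ≤ σ} :=
    fun z hz => abs_le.2 hz.2
  have e : values hm γ hσ u = Function.uncurry (ext hm γ hσ u) ''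
      (Icc (0 : ℝ) 1 ×ˢ (Icc 0 (2 * Real.pi) ×ℂ Icc (-σ) σ)) := by
    refine Subset.antisymm ?_ (image_mono (prod_mono_right hsub))
    rintro _ ⟨⟨r, z⟩, ⟨hr, hz⟩, rfl⟩
    obtain ⟨w, hw, he⟩ := hu.image_eq hr hz
    exact ⟨(r, w), ⟨hr, hw⟩, he.symm⟩
  rw [e]
  exact (isCompact_Icc.prod (isCompact_Icc.reProdIm isCompact_Icc)).image_of_continuousOn
    (hu.continuousOn.mono (prod_mono_right hsub))

end Evaluation

/-- By periodicity the values of u form a compact set, so a δ-neighbourhood of it lies in Ω;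
evaluations are uniformly bounded, so nearby elements have values in that neighbourhood. -/
theorem isOpen_imageIn {m : ℕ} (hm : 1 < m) (γ : ℝ) {σ : ℝ} [hγ : Fact (1 / 2 < γ)] (hσ : 0 ≤ σ)
    {Ω : Set ℂ} (hΩ : IsOpen Ω) : IsOpen (imageIn m γ σ Ω) := by
  rw [isOpen_iff_mem_nhds]
  intro u hu
  rw [mem_imageIn_iff hm γ hσ] at hu
  have hsub : values hm γ hσ (toAlg hm γ hσ u) ⊆ Ω := by
    rintro _ ⟨⟨r, z⟩, ⟨hr, hz⟩, rfl⟩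
    exact hu r hr z hz
  obtain ⟨δ, hδ, hd⟩ := (isCompact_values hm γ hσ (toAlg hm γ hσ u)).exists_thickening_subset_open
    hΩ hsub
  have hc : Tendsto (fun v => ‖toAlg hm γ hσ v - toAlg hm γ hσ u‖ * ‖(1 : Alg hm γ hσ)‖) (𝓝 u)
      (𝓝 0) := by
    have : Continuous fun v => ‖toAlg hm γ hσ v - toAlg hm γ hσ u‖ * ‖(1 : Alg hm γ hσ)‖ :=
      (((toAlg hm γ hσ).continuous.sub continuous_const).norm).mul continuous_const
    simpa using this.tendsto u
  filter_upwards [hc.eventually (gt_mem_nhds hδ)] with v hv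
  refine (mem_imageIn_iff hm γ hσ).2 fun r hr z hz => hd ?_
  refine Metric.mem_thickening_iff.2 ⟨_, ⟨(r, z), ⟨hr, hz⟩, rfl⟩, ?_⟩
  rw [dist_eq_norm]
  refine lt_of_le_of_lt ?_ hv
  have := norm_ev_le hm γ hσ hr hz (toAlg hm γ hσ v - toAlg hm γ hσ u)
  rwa [map_sub] at this

/-! ### Functions of `ψ` -/

/-- Continuous functions `g` on `[0,1]` for which `g - g(0)` belongs to `S γ m`. -/
def Rad (γ : ℝ) (m : ℕ) (g : ℝ → ℂ) : Prop :=
  ContinuousOn g (Icc 0 1) ∧ S γ m fun r => g r - g 0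

theorem S.exists_rad {γ : ℝ} (hγ : 1 / 2 < γ) {m : ℕ} (hm : 1 < m) {f : ℝ → ℂ} (hf : S γ m f)
    (c : ℂ) : ∃ g, Rad γ m g ∧ (fun r => c + f r) =ᵐ[mu1] g := by
  obtain ⟨F, hF, h, h0⟩ := (hf.mono hm.le).exists_continuousOn hγ
  refine ⟨fun r => c + F r, ⟨continuousOn_const.add hF, ?_⟩, ?_⟩
  · simpa [h0] using hf.congr h
  · filter_upwards [h] with r hr
    rw [hr]

theorem Rad.aestronglyMeasurable {γ : ℝ} {m : ℕ} {g : ℝ → ℂ} (h : Rad γ m g) :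
    AEStronglyMeasurable g mu1 :=
  (h.1.mono Ioc_subset_Icc_self).aestronglyMeasurable measurableSet_Ioc

theorem Rad.const (γ : ℝ) (m : ℕ) (c : ℂ) : Rad γ m fun _ => c :=
  ⟨continuousOn_const, by simpa using S.zero γ m⟩

theorem Rad.add {γ : ℝ} {m : ℕ} {f g : ℝ → ℂ} (hf : Rad γ m f) (hg : Rad γ m g) :
    Rad γ m fun r => f r + g r := by
  refine ⟨hf.1.add hg.1, ?_⟩
  convert hf.2.add hg.2 using 2
  ring

theorem Rad.conj {γ : ℝ} {m : ℕ} {g : ℝ → ℂ} (h : Rad γ m g) :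
    Rad γ m fun r => (starRingEnd ℂ) (g r) := by
  refine ⟨Complex.continuous_conj.comp_continuousOn h.1, ?_⟩
  simpa using h.2.conj

theorem Rad.mul {γ : ℝ} (hγ : 1 / 2 < γ) {m : ℕ} (hm : 1 < m) {f g : ℝ → ℂ} (hf : Rad γ m f)
    (hg : Rad γ m g) : Rad γ m fun r => f r * g r := by
  refine ⟨hf.1.mul hg.1, ?_⟩
  convert ((hf.2.const_mul (g 0)).add (hg.2.const_mul (f 0))).add
    (hf.2.mul hγ hg.2 le_rfl le_rfl (by omega)) using 2
  ring

theorem Rad.inv {γ : ℝ} (hγ : 1 / 2 < γ) {m : ℕ} (hm : 1 < m) {g : ℝ → ℂ} (h : Rad γ m g)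
    (hne : ∀ r ∈ Icc (0 : ℝ) 1, g r ≠ 0) : Rad γ m fun r => (g r)⁻¹ := by
  refine ⟨h.1.inv₀ hne, ?_⟩
  simpa using h.2.inv hγ hm (hne 0 (by simp)) (h.1.sub continuousOn_const) (by simpa using hne)

theorem Rad.el_mem {m : ℕ} {γ σ : ℝ} [hγ : Fact (1 / 2 < γ)] (hσ : 0 ≤ σ) {g : ℝ → ℂ}
    (h : Rad γ m g) (k : ℤ) : el g k h.aestronglyMeasurable ∈ J m γ σ := by
  have h1 := el_mem_J hσ h.2 (g 0) k (by simpa using h.aestronglyMeasurable)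
  convert h1 using 2
  simp

/-! ### Characters -/

theorem exists_H_single (m : ℕ) (k : ℤ) (c : ℂ) : ∃ v : H m,
    fourierCoeff (v : FunCirc) = (fun l => if l = k then c else 0) ∧
      ‖v‖ = (1 + (k : ℝ) ^ 2) ^ ((m : ℝ) / 2) * ‖c‖ := by
  obtain ⟨v, hv⟩ := exists_H (Y.iff_memℓp.1 (Y.single 0 m k c))
  refine ⟨v, hv, ?_⟩
  have h4 : coeffs m v = lp.single 2 k
      (((1 + (k : ℝ) ^ 2) ^ ((m : ℝ) / 2) : ℝ) * c : ℂ) := by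
    ext l
    rw [coeffs_apply, hv, lp.single_apply]
    by_cases h : l = k
    · subst h
      simp
    · simp [h]
  change ‖coeffs m v‖ = _
  rw [h4, lp.norm_single (by norm_num), norm_mul, Complex.norm_real,
    Real.norm_of_nonneg (by positivity)]

theorem isMultiplied_el_lift (σ : ℝ) (k : ℤ) {v : FunCirc}
    (hv : fourierCoeff v = fun l => if l = k then (Real.exp (σ * |(k : ℝ)|) : ℂ) else 0) :
    IsMultiplied σ (el (fun _ => 1) k aestronglyMeasurable_const) (lift v) := by
  intro l
  filter_upwards [fc_lift v l, fc_el (f := fun _ => 1) (k := k) aestronglyMeasurable_const l]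
    with r h2 h3
  refine h2.trans (Eq.trans ?_ (congrArg _ h3).symm)
  rw [hv]
  by_cases h : l = k
  · subst h
    simp only [if_true, mul_one]
  · simp only [h, if_false, mul_zero]

/-- The image of e^(ikθ) under `mult` is e^(σ|k|) e^(ikθ), with no component in `K`. The exact
growth in k is what confines characters to the strip. -/
theorem norm_J_of_eq_el {m : ℕ} {γ σ : ℝ} [hγ : Fact (1 / 2 < γ)] {k : ℤ} {u : J m γ σ}
    (hu : (u : FunPi) = el (fun _ => 1) k aestronglyMeasurable_const) :
    ‖u‖ = (1 + (k : ℝ) ^ 2) ^ ((m : ℝ) / 2) * Real.exp (σ * |(k : ℝ)|) := by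
  obtain ⟨v, hv, hn⟩ := exists_H_single m k (Real.exp (σ * |(k : ℝ)|) : ℂ)
  obtain ⟨b, e⟩ : ∃ b : J0 m γ, (b : FunPi) = lift (v : FunCirc) + ((0 : K m γ) : FunPi) :=
    ⟨⟨_, WithLp.toLp 2 (v, 0), rfl⟩, rfl⟩
  have h0 : (b : FunPi) = lift (v : FunCirc) := e.trans (add_zero _)
  have h1 : IsMultiplied σ (u : FunPi) (b : FunPi) := by
    rw [h0, hu]
    exact isMultiplied_el_lift σ k hv
  have h2 := norm_sq_J0 b v 0 e
  rw [norm_zero, zero_pow two_ne_zero, add_zero] at h2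
  rw [norm_J u b h1, (sq_eq_sq₀ (norm_nonneg _) (norm_nonneg _)).1 h2, hn, Complex.norm_real,
    Real.norm_of_nonneg (Real.exp_pos _).le]

theorem le_one_of_pow_le {x C : ℝ} (m : ℕ)
    (h : ∀ n : ℕ, x ^ n ≤ C * (1 + (n : ℝ) ^ 2) ^ ((m : ℝ) / 2)) : x ≤ 1 := by
  by_contra! hx
  have h0 : 0 ≤ C := by simpa using (zero_le_one).trans (h 0)
  have h1 : ∀ n : ℕ, 1 ≤ n → (1 + (n : ℝ) ^ 2) ^ ((m : ℝ) / 2) ≤ 2 ^ m * (n : ℝ) ^ m := by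
    intro n hn
    have hn' : (1 : ℝ) ≤ n := by exact_mod_cast hn
    rw [← mul_pow, ← Real.rpow_natCast (2 * (n : ℝ)) m]
    calc (1 + (n : ℝ) ^ 2) ^ ((m : ℝ) / 2) ≤ ((2 * (n : ℝ)) ^ (2 : ℝ)) ^ ((m : ℝ) / 2) := by
          gcongr
          rw [Real.rpow_two]
          nlinarith
      _ = _ := by
          rw [← Real.rpow_mul (by positivity)]
          congr 1
          ring
  have h2 := (tendsto_pow_const_div_const_pow_of_one_lt m hx).const_mul (C * 2 ^ m)
  rw [mul_zero] at h2
  obtain ⟨n, hn, hn1⟩ := ((h2.eventually (gt_mem_nhds zero_lt_one)).and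
    (eventually_ge_atTop 1)).exists
  have h3 := (h n).trans (mul_le_mul_of_nonneg_left (h1 n hn1) h0)
  have h4 : 0 < x ^ n := by positivity
  rw [mul_div_assoc', div_lt_one h4] at hn
  linarith

section Characters

variable {m : ℕ} (hm : 1 < m) (γ : ℝ) {σ : ℝ} [hγ : Fact (1 / 2 < γ)] (hσ : 0 ≤ σ)

/-- The element `g(ψ) e^{ikθ}`. -/
def rad {g : ℝ → ℂ} (hg : Rad γ m g) (k : ℤ) : Alg hm γ hσ := ⟨_, hg.el_mem hσ k⟩

theorem rad_mul_rad {f g : ℝ → ℂ} (hf : Rad γ m f) (hg : Rad γ m g) (k l : ℤ) :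
    rad hm γ hσ hf k * rad hm γ hσ hg l = rad hm γ hσ (hf.mul hγ.out hm hg) (k + l) :=
  
  Subtype.ext (el_mul_el hf.aestronglyMeasurable hg.aestronglyMeasurable
    (hf.mul hγ.out hm hg).aestronglyMeasurable)

theorem rad_one : rad hm γ hσ (Rad.const γ m 1) 0 = 1 := Subtype.ext el_one

theorem rad_congr {f g : ℝ → ℂ} (hf : Rad γ m f) (hg : Rad γ m g) (k : ℤ)
    (h : f =ᵐ[mu1] g) : rad hm γ hσ hf k = rad hm γ hσ hg k :=
  Subtype.ext (el_congr hf.aestronglyMeasurable hg.aestronglyMeasurable h)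

theorem rad_add {f g : ℝ → ℂ} (hf : Rad γ m f) (hg : Rad γ m g) (k : ℤ) :
    rad hm γ hσ (hf.add hg) k = rad hm γ hσ hf k + rad hm γ hσ hg k :=
  
  Subtype.ext (el_add hf.aestronglyMeasurable hg.aestronglyMeasurable)

theorem rad_const (c : ℂ) : rad hm γ hσ (Rad.const γ m c) 0 = algebraMap ℂ _ c := by
  rw [Algebra.algebraMap_eq_smul_one, ← rad_one hm γ hσ]
  refine Subtype.ext (AEEqFun.ext ?_)
  have e : ((c • rad hm γ hσ (Rad.const γ m 1) 0 : Alg hm γ hσ)).1 =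
    c • el (fun _ => 1) 0 aestronglyMeasurable_const := rfl
  rw [e]
  filter_upwards [coeFn_el (f := fun _ => c) (k := 0) aestronglyMeasurable_const,
    coeFn_el (f := fun _ => 1) (k := 0) aestronglyMeasurable_const,
    AEEqFun.coeFn_smul c (el (fun _ => 1) 0 aestronglyMeasurable_const)] with x h1 h2 h3
  rw [h3, Pi.smul_apply, h2]
  refine h1.trans ?_
  simp

theorem norm_map_rad_le (χ : Alg hm γ hσ →ₐ[ℂ] ℂ) : ∃ C : ℝ, ∀ k : ℤ,
    ‖χ (rad hm γ hσ (Rad.const γ m 1) k)‖ ≤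
      C * ((1 + (k : ℝ) ^ 2) ^ ((m : ℝ) / 2) * Real.exp (σ * |(k : ℝ)|)) := by
  refine ⟨‖(toAlg hm γ hσ : J m γ σ →L[ℂ] Alg hm γ hσ)‖ * ‖(1 : Alg hm γ hσ)‖, fun k => ?_⟩
  refine (AlgHom.norm_apply_le_self_mul_norm_one χ _).trans ?_
  rw [← norm_J_of_eq_el (u := (rad hm γ hσ (Rad.const γ m 1) k : J m γ σ)) rfl, mul_right_comm]
  refine mul_le_mul_of_nonneg_right ?_ (norm_nonneg _)
  exact (toAlg hm γ hσ : J m γ σ →L[ℂ] Alg hm γ hσ).le_opNorm _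

/-- The values χ(e^(ikθ)) are the powers of x = χ(e^(iθ)). Continuity of χ gives |x|^k ≤ C
(1+k²)^(m/2) e^(σ|k|) for all integers k; taking roots for k → ±∞ leaves e^(-σ) ≤ |x| ≤ e^σ, and z =
-i log x. -/
theorem exists_map_rad_eq_exp (χ : Alg hm γ hσ →ₐ[ℂ] ℂ) : ∃ z : ℂ, |z.im| ≤ σ ∧
    ∀ k : ℤ, χ (rad hm γ hσ (Rad.const γ m 1) k) = Complex.exp (Complex.I * k * z) := by
  set e : ℤ → ℂ := fun k => χ (rad hm γ hσ (Rad.const γ m 1) k) with he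
  have h0 : e 0 = 1 := by simp only [he, rad_one, map_one]
  have hadd : ∀ k l, e (k + l) = e k * e l := fun k l => by
    simp only [he, ← map_mul, rad_mul_rad]
    exact congrArg χ (rad_congr hm γ hσ _ _ _ (Eventually.of_forall fun _ => by simp))
  let E : Multiplicative ℤ →* ℂ :=
    { toFun := fun k => e k.toAdd, map_one' := h0, map_mul' := fun k l => hadd _ _ }
  have hne : e 1 ≠ 0 := fun h => by
    have := hadd 1 (-1)
    rw [h, zero_mul] at this
    exact one_ne_zero (h0.symm.trans this)
  have hpow : ∀ k : ℤ, e k = e 1 ^ k := by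
    have hn : ∀ n : ℕ, e n = e 1 ^ n := fun n => by
      induction n with
      | zero => simpa using h0
      | succ n ih => rw [Nat.cast_succ, hadd, ih, pow_succ]
    intro k
    obtain ⟨n, rfl | rfl⟩ := k.eq_nat_or_neg
    · rw [hn, zpow_natCast]
    · rw [zpow_neg, zpow_natCast, ← hn]
      refine eq_inv_of_mul_eq_one_left ?_
      rw [← hadd, neg_add_cancel, h0]
  obtain ⟨C, hC⟩ := norm_map_rad_le hm γ hσ χ
  have hb : ∀ {x : ℝ}, 0 ≤ x → (∀ n : ℕ, x ^ n ≤
      C * ((1 + (n : ℝ) ^ 2) ^ ((m : ℝ) / 2) * Real.exp (σ * n))) → x ≤ Real.exp σ := by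
    intro x hx h
    have : x * Real.exp (-σ) ≤ 1 := le_one_of_pow_le (C := C) m fun n => by
      rw [mul_pow, ← Real.exp_nat_mul]
      calc _ ≤ C * ((1 + (n : ℝ) ^ 2) ^ ((m : ℝ) / 2) * Real.exp (σ * n)) *
            Real.exp (n * -σ) := mul_le_mul_of_nonneg_right (h n) (Real.exp_pos _).le
        _ = C * (1 + (n : ℝ) ^ 2) ^ ((m : ℝ) / 2) * (Real.exp (σ * n) * Real.exp (n * -σ)) := by
            ring
        _ = _ := by
            rw [← Real.exp_add, show σ * n + n * -σ = 0 by ring, Real.exp_zero, mul_one]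
    rwa [Real.exp_neg, ← div_eq_mul_inv, div_le_one (Real.exp_pos _)] at this
  have h1 : ‖e 1‖ ≤ Real.exp σ := hb (norm_nonneg _) fun n => by
    have := hC n
    change ‖e n‖ ≤ _ at this
    rw [hpow, zpow_natCast, norm_pow] at this
    simpa using this
  have h2 : ‖e 1‖⁻¹ ≤ Real.exp σ := hb (by positivity) fun n => by
    have := hC (-n)
    change ‖e (-n)‖ ≤ _ at this
    rw [hpow, zpow_neg, zpow_natCast, norm_inv, norm_pow] at this
    simpa using this
  have hpos : 0 < ‖e 1‖ := norm_pos_iff.2 hne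
  refine ⟨-Complex.I * Complex.log (e 1), ?_, fun k => ?_⟩
  · have : (-Complex.I * Complex.log (e 1)).im = -Real.log ‖e 1‖ := by simp [Complex.log_re]
    rw [this, abs_neg, abs_le]
    refine ⟨?_, (Real.log_le_iff_le_exp hpos).2 h1⟩
    have h3 := (Real.log_le_iff_le_exp (inv_pos.2 hpos)).2 h2
    rw [Real.log_inv] at h3
    linarith
  · change e k = _
    have : Complex.I * k * (-Complex.I * Complex.log (e 1)) = k * Complex.log (e 1) := by
      linear_combination (-k * Complex.log (e 1)) * Complex.I_mul_I
    rw [hpow, this, Complex.exp_int_mul, Complex.exp_log hne]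

/-- If no point works, then for each r some g₁ = g - χ(g) in the kernel of χ does not vanish near r.
Compactness of [0,1] and finite sums of the functions |g₁|², which stay in the kernel, give a
strictly positive function there; its reciprocal is again admissible, so the kernel contains a unit.
-/
theorem exists_map_rad_zero_eq (χ : Alg hm γ hσ →ₐ[ℂ] ℂ) : ∃ r ∈ Icc (0 : ℝ) 1,
    ∀ g (hg : Rad γ m g), χ (rad hm γ hσ hg 0) = g r := by
  by_contra! hcon
  have key : ∃ g, ∃ hg : Rad γ m g, χ (rad hm γ hσ hg 0) = 0 ∧ (∀ r ∈ Icc (0 : ℝ) 1,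
      (g r).im = 0 ∧ 0 ≤ (g r).re) ∧ ∀ r ∈ Icc (0 : ℝ) 1 ∩ Icc 0 1, 0 < (g r).re := by
    refine isCompact_Icc.induction_on (p := fun s => ∃ g, ∃ hg : Rad γ m g,
      χ (rad hm γ hσ hg 0) = 0 ∧ (∀ r ∈ Icc (0 : ℝ) 1, (g r).im = 0 ∧ 0 ≤ (g r).re) ∧
        ∀ r ∈ s ∩ Icc 0 1, 0 < (g r).re) ?_ ?_ ?_ ?_
    · refine ⟨fun _ => 0, Rad.const γ m 0, ?_, fun r _ => by simp, fun r hr => hr.1.elim⟩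
      rw [rad_const, map_zero, map_zero]
    · rintro s t hst ⟨g, hg, h1, h2, h3⟩
      exact ⟨g, hg, h1, h2, fun r hr => h3 r ⟨hst hr.1, hr.2⟩⟩
    · rintro s t ⟨g, hg, h1, h2, h3⟩ ⟨f, hf, k1, k2, k3⟩
      refine ⟨_, hg.add hf, by rw [rad_add hm γ hσ hg hf, map_add, h1, k1, add_zero], fun r hr => ?_,
        fun r hr => ?_⟩
      · rw [Complex.add_im, Complex.add_re, (h2 r hr).1, (k2 r hr).1, add_zero]
        exact ⟨rfl, add_nonneg (h2 r hr).2 (k2 r hr).2⟩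
      · rw [Complex.add_re]
        rcases hr.1 with hr1 | hr1
        · exact add_pos_of_pos_of_nonneg (h3 r ⟨hr1, hr.2⟩) (k2 r hr.2).2
        · exact add_pos_of_nonneg_of_pos (h2 r hr.2).2 (k3 r ⟨hr1, hr.2⟩)
    · intro r hr
      obtain ⟨g, hg, hne⟩ := hcon r hr
      have hg1 := hg.add (Rad.const γ m (-χ (rad hm γ hσ hg 0)))
      have h1 : χ (rad hm γ hσ hg1 0) = 0 := by
        rw [rad_add hm γ hσ hg (Rad.const γ m _), rad_const, map_add, AlgHom.commutes, Algebra.algebraMap_self_apply,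
          add_neg_cancel]
      set g1 : ℝ → ℂ := fun r => g r + -χ (rad hm γ hσ hg 0)
      have e : ∀ s, g1 s * (starRingEnd ℂ) (g1 s) = (Complex.normSq (g1 s) : ℂ) := fun s =>
        Complex.mul_conj _
      have hs : {s | g1 s ≠ 0} ∈ 𝓝[Icc 0 1] r :=
        (hg1.1 r hr).eventually_ne fun h => hne (by linear_combination -h)
      refine ⟨_, hs, _, hg1.mul hγ.out hm hg1.conj, ?_, fun s _ => ?_, fun s hs => ?_⟩
      · rw [← zero_add (0 : ℤ), ← rad_mul_rad hm γ hσ hg1 hg1.conj, map_mul, h1, zero_mul]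
      · rw [e]
        exact ⟨Complex.ofReal_im _, Complex.normSq_nonneg _⟩
      · rw [e]
        exact Complex.normSq_pos.2 hs.1
  obtain ⟨g, hg, h0, -, h1⟩ := key
  have hne : ∀ r ∈ Icc (0 : ℝ) 1, g r ≠ 0 := fun r hr h => by
    have := h1 r ⟨hr, hr⟩
    simp [h] at this
  have h2 : rad hm γ hσ hg 0 * rad hm γ hσ (hg.inv hγ.out hm hne) 0 = 1 := by
    rw [rad_mul_rad, ← rad_one hm γ hσ, add_zero]
    refine rad_congr hm γ hσ _ _ _ ?_
    filter_upwards [ae_restrict_mem measurableSet_Ioc] with r hr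
    exact mul_inv_cancel₀ (hne r (Ioc_subset_Icc_self hr))
  have h3 := congrArg χ h2
  rw [map_mul, h0, zero_mul, map_one] at h3
  exact zero_ne_one h3

/-- A mode g(ψ) e^(ikθ) is the product of a function of ψ and an exponential, on which the two
previous lemmas determine χ. Since every element is a norm convergent sum of modes and both
characters are continuous, they agree everywhere. -/
theorem exists_eq_ev (χ : Alg hm γ hσ →ₐ[ℂ] ℂ) : ∃ (r : ℝ) (hr : r ∈ Icc (0 : ℝ) 1) (z : ℂ)
    (hz : |z.im| ≤ σ), χ = ev hm γ hσ hr hz := by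
  obtain ⟨z, hz, h1⟩ := exists_map_rad_eq_exp hm γ hσ χ
  obtain ⟨r, hr, h2⟩ := exists_map_rad_zero_eq hm γ hσ χ
  have h3 : ∀ g (hg : Rad γ m g) k, χ (rad hm γ hσ hg k) = ev hm γ hσ hr hz (rad hm γ hσ hg k) := by
    intro g hg k
    have e : rad hm γ hσ hg k = rad hm γ hσ hg 0 * rad hm γ hσ (Rad.const γ m 1) k := by
      rw [rad_mul_rad]
      refine Subtype.ext ?_
      simp only [rad, zero_add, mul_one]
    rw [e, map_mul, h2, h1, ← e]
    exact (ev_eq hm γ hσ hr hz (rad hm γ hσ hg k) (isStripExtension_el σ hg.aestronglyMeasurable k hg.1 .rfl)).symm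
  refine ⟨r, hr, z, hz, AlgHom.ext fun u => ?_⟩
  have hγ0 : 0 ≤ γ := by linarith [hγ.out]
  obtain ⟨c, a, hc, ha, hu⟩ := J.exists_data hγ0 u.2
  obtain ⟨v, hv, hvk⟩ := J.hasSum hσ u hc ha hu
  have h4 : ∀ k, ∃ g, ∃ hg : Rad γ m g, toAlg hm γ hσ (v k) = rad hm γ hσ hg k := by
    intro k
    obtain ⟨g, hg, he⟩ := (ha.component hσ k).exists_rad hγ.out hm (c k)
    refine ⟨g, hg, Subtype.ext ?_⟩
    refine WeightedL2.ext_fc (J0_weightedL2 ⟨_, (v k).2.1⟩)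
      (J0_weightedL2 ⟨_, (hg.el_mem hσ k).1⟩) fun l => ?_
    filter_upwards [hvk k l, fc_el hg.aestronglyMeasurable (k := k) l, he] with r h5 h6 h7
    refine h5.trans (Eq.trans ?_ h6.symm)
    rw [h7]
  have h5 := hv.mapL (toAlg hm γ hσ : J m γ σ →L[ℂ] Alg hm γ hσ)
  have h6 := h5.mapL χ.toContinuousLinearMap
  have h7 := h5.mapL (ev hm γ hσ hr hz).toContinuousLinearMap
  refine h6.unique ?_
  convert h7 using 2 with k
  swap
  · rfl
  obtain ⟨g, hg, he⟩ := h4 k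
  change χ (toAlg hm γ hσ (v k)) = ev hm γ hσ hr hz (toAlg hm γ hσ (v k))
  rw [he, h3]

/-- An element of the algebra is invertible if its extension has no zeros. -/
theorem isUnit_of_ext_ne_zero {u : Alg hm γ hσ}
    (h : ∀ r ∈ Icc (0 : ℝ) 1, ∀ z : ℂ, |z.im| ≤ σ → ext hm γ hσ u r z ≠ 0) : IsUnit u := by
  by_contra hu
  -- Gelfand: a nonunit is annihilated by some character, which is evaluation at a point and hence a
  -- zero of the extension.
  obtain ⟨χ, hχ⟩ := WeakDual.CharacterSpace.exists_apply_eq_zero hu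
  obtain ⟨r, hr, z, hz, he⟩ := exists_eq_ev hm γ hσ (WeakDual.CharacterSpace.toAlgHom χ)
  refine h r hr z hz ?_
  rw [← ev_apply hm γ hσ hr hz, ← he]
  exact hχ

end Characters

/-! ### The Cauchy–Pompeiu formula -/

/-- The operator `∂/∂\bar z`. -/
def dbar (g : ℂ → ℂ) (z : ℂ) : ℂ := (fderiv ℝ g z 1 + Complex.I * fderiv ℝ g z Complex.I) / 2

theorem continuous_dbar {g : ℂ → ℂ} (hg : ContDiff ℝ 1 g) : Continuous (dbar g) := by
  have h : Continuous (fderiv ℝ g) := hg.continuous_fderiv one_ne_zero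
  unfold dbar
  fun_prop

theorem dbar_eq_zero {f g : ℂ → ℂ} {z : ℂ} (hf : DifferentiableAt ℂ f z) (h : g =ᶠ[𝓝 z] f) :
    dbar g z = 0 := by
  rw [dbar, h.fderiv_eq, hf.fderiv_restrictScalars ℝ]
  have : fderiv ℂ f z Complex.I = Complex.I * fderiv ℂ f z 1 := by
    rw [← smul_eq_mul, ← map_smul, smul_eq_mul, mul_one]
  simp only [ContinuousLinearMap.coe_restrictScalars', this]
  linear_combination (fderiv ℂ f z 1 / 2) * Complex.I_mul_I

section Pompeiu

variable {h : ℂ → ℂ}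

theorem integrableOn_polar {R : ℝ} {A : ℝ × ℝ → ℂ} (hA : Continuous A)
    (h0 : ∀ p, R < p.1 → A p = 0) :
    IntegrableOn A (Ioi (0 : ℝ) ×ˢ Ioo (-Real.pi) Real.pi) (volume.prod volume) := by
  have h1 : IntegrableOn A (Icc 0 R ×ˢ Icc (-Real.pi) Real.pi) (volume.prod volume) :=
    hA.continuousOn.integrableOn_compact (isCompact_Icc.prod isCompact_Icc)
  refine h1.of_forall_sdiff_eq_zero (measurableSet_Ioi.prod measurableSet_Ioo) fun p hp => h0 p ?_
  by_contra! hR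
  exact hp.2 ⟨⟨hp.1.1.le, hR⟩, Ioo_subset_Icc_self hp.1.2⟩

theorem exists_bound_support (hc : HasCompactSupport h) : ∃ R : ℝ, 0 < R ∧
    (∀ z, R < ‖z‖ → h z = 0) ∧ ∀ z, R < ‖z‖ → fderiv ℝ h z = 0 := by
  obtain ⟨R, hR, hsub⟩ := hc.isCompact.isBounded.subset_closedBall_lt 0 0
  have h1 : ∀ z, R < ‖z‖ → z ∉ tsupport h := fun z hz hm => by
    have := hsub hm
    rw [mem_closedBall_zero_iff] at this
    linarith
  exact ⟨R, hR, fun z hz => image_eq_zero_of_notMem_tsupport (h1 z hz), fun z hz =>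
    Function.notMem_support.1 fun hm => h1 z hz (support_fderiv_subset ℝ hm)⟩

/-- The Cauchy–Pompeiu formula at the origin. -/
theorem integral_dbar_mul_inv (hh : ContDiff ℝ 1 h) (hc : HasCompactSupport h) :
    ∫ z, dbar h z * z⁻¹ = -Real.pi * h 0 := by
  obtain ⟨R, hR, hR1, hR2⟩ := exists_bound_support hc
  have hd : Continuous (fderiv ℝ h) := hh.continuous_fderiv one_ne_zero
  set e : ℝ → ℂ := fun t => Complex.exp (t * Complex.I) with he
  have hec : Continuous e := by fun_prop
  have hen : ∀ t, ‖e t‖ = 1 := fun t => Complex.norm_exp_ofReal_mul_I t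
  have hed : ∀ t, HasDerivAt e (Complex.I * e t) t := fun t => by
    have h1 : HasDerivAt (fun t : ℝ => (t : ℂ) * Complex.I) Complex.I t := by
      simpa using (Complex.ofRealCLM.hasDerivAt (x := t)).mul_const Complex.I
    convert h1.cexp using 1
    exact mul_comm _ _
  -- In polar coordinates A is the radial derivative of h and B is the angular derivative divided by
  -- r.
  set A : ℝ × ℝ → ℂ := fun p => fderiv ℝ h (p.1 * e p.2) (e p.2) with hA
  set B : ℝ × ℝ → ℂ := fun p => fderiv ℝ h (p.1 * e p.2) (Complex.I * e p.2) with hB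
  have hAc : Continuous A := by fun_prop
  have hBc : Continuous B := by fun_prop
  have hz : ∀ p : ℝ × ℝ, R < p.1 → fderiv ℝ h (p.1 * e p.2) = 0 := fun p hp => by
    refine hR2 _ ?_
    rw [norm_mul, hen, mul_one, Complex.norm_real]
    exact hp.trans_le (le_abs_self _)
  have hAi : IntegrableOn A (Ioi (0 : ℝ) ×ˢ Ioo (-Real.pi) Real.pi) :=
    integrableOn_polar (R := R) hAc (fun p hp => by simp [hA, hz p hp])
  have hBi : IntegrableOn B (Ioi (0 : ℝ) ×ˢ Ioo (-Real.pi) Real.pi) :=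
    integrableOn_polar (R := R) hBc (fun p hp => by simp [hB, hz p hp])
  -- The Jacobian r cancels the singularity of 1/z, leaving the integrand (A + iB)/2.
  have key : ∀ p : ℝ × ℝ, p ∈ polarCoord.target →
      p.1 • (dbar h (Complex.polarCoord.symm p) * (Complex.polarCoord.symm p)⁻¹) =
        2⁻¹ * (A p + Complex.I * B p) := by
    rintro ⟨r, t⟩ ⟨hr, -⟩
    have hr' : (r : ℂ) ≠ 0 := by exact_mod_cast (ne_of_gt hr)
    have hs : Complex.polarCoord.symm (r, t) = r * e t := by
      rw [Complex.polarCoord_symm_apply, he]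
      simp only [Complex.exp_mul_I, Complex.ofReal_cos, Complex.ofReal_sin]
    have hee : e t = Complex.cos t + Complex.sin t * Complex.I := Complex.exp_mul_I _
    have hei : (e t)⁻¹ = Complex.cos t - Complex.sin t * Complex.I := by
      refine inv_eq_of_mul_eq_one_right ?_
      rw [hee]
      linear_combination Complex.cos_sq_add_sin_sq (t : ℂ) -
        (Complex.sin t) ^ 2 * Complex.I_mul_I
    set D := fderiv ℝ h (r * e t) with hD
    have hlin : ∀ a b : ℝ, D (a + b * Complex.I) = a * D 1 + b * D Complex.I := fun a b => by
      have : (a + b * Complex.I : ℂ) = a • (1 : ℂ) + b • Complex.I := by simp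
      rw [this, map_add, map_smul, map_smul, Complex.real_smul, Complex.real_smul]
    have e1 : D (e t) = Complex.cos t * D 1 + Complex.sin t * D Complex.I := by
      rw [hee]
      simpa using hlin (Real.cos t) (Real.sin t)
    have e2 : D (Complex.I * e t) = -Complex.sin t * D 1 + Complex.cos t * D Complex.I := by
      have : Complex.I * e t = ((-Real.sin t : ℝ) : ℂ) + (Real.cos t : ℝ) * Complex.I := by
        rw [hee]
        push_cast
        linear_combination Complex.sin t * Complex.I_mul_I
      rw [this, hlin]
      push_cast
      ring
    rw [hs, dbar, ← hD, mul_inv, hei, Complex.real_smul]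
    change _ = 2⁻¹ * (D (e t) + Complex.I * D (Complex.I * e t))
    rw [e1, e2]
    field_simp
    linear_combination (-Complex.sin t * D Complex.I) * Complex.I_sq
  rw [← Complex.integral_comp_polarCoord_symm,
    setIntegral_congr_fun polarCoord.open_target.measurableSet key, polarCoord_target,
    integral_const_mul]
  rw [integral_add hAi (hBi.const_mul _), integral_const_mul]
  have iA : ∫ p in Ioi (0 : ℝ) ×ˢ Ioo (-Real.pi) Real.pi, A p = -(2 * Real.pi) * h 0 := by
    -- Along each ray the fundamental theorem of calculus gives -h(0), by compact support.
    have h1 : ∀ t, ∫ r in Ioi (0 : ℝ), A (r, t) = -h 0 := fun t => by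
      have hder : ∀ r ∈ Ici (0 : ℝ), HasDerivAt (fun r : ℝ => h (r * e t)) (A (r, t)) r := by
        intro r _
        have h2 : HasDerivAt (fun r : ℝ => (r : ℂ) * e t) (e t) r := by
          simpa using (Complex.ofRealCLM.hasDerivAt (x := r)).mul_const (e t)
        exact ((hh.differentiable one_ne_zero _).hasFDerivAt).comp_hasDerivAt r h2
      have hint : IntegrableOn (fun r => A (r, t)) (Ioi 0) := by
        have h2 : IntegrableOn (fun r => A (r, t)) (Icc 0 R) :=
          (hAc.comp (by fun_prop : Continuous fun r : ℝ => (r, t))).continuousOn.integrableOn_Icc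
        refine h2.of_forall_sdiff_eq_zero measurableSet_Ioi fun r hr => ?_
        have hr1 : R < r := by
          by_contra! hR
          exact hr.2 ⟨le_of_lt hr.1, hR⟩
        simp [hA, hz (r, t) hr1]
      have hlim : Tendsto (fun r : ℝ => h (r * e t)) atTop (𝓝 0) := by
        refine tendsto_const_nhds.congr' ?_
        filter_upwards [eventually_gt_atTop R] with r hr
        refine (hR1 _ ?_).symm
        rw [norm_mul, hen, mul_one, Complex.norm_real]
        exact hr.trans_le (le_abs_self _)
      rw [integral_Ioi_of_hasDerivAt_of_tendsto' hder hint hlim]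
      simp
    have h2 := integral_prod_symm (μ := volume.restrict (Ioi (0 : ℝ)))
      (ν := volume.restrict (Ioo (-Real.pi) Real.pi)) A (by rw [Measure.prod_restrict]; exact hAi)
    rw [Measure.prod_restrict] at h2
    refine h2.trans ?_
    simp only [h1, integral_const, measureReal_restrict_apply_univ, Real.volume_real_Ioo]
    rw [max_eq_left (by linarith [Real.pi_pos]), Complex.real_smul]
    push_cast
    ring
  have iB : ∫ p in Ioi (0 : ℝ) ×ˢ Ioo (-Real.pi) Real.pi, B p = 0 := by
    -- On each circle r B is the derivative of a periodic function of the angle, so its integral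
    -- vanishes.
    refine (setIntegral_prod B hBi).trans ?_
    refine setIntegral_eq_zero_of_forall_eq_zero fun r hr => ?_
    have hr' : (r : ℂ) ≠ 0 := by exact_mod_cast (ne_of_gt hr)
    have hder : ∀ t ∈ uIcc (-Real.pi) Real.pi,
        HasDerivAt (fun t : ℝ => h (r * e t)) (r * B (r, t)) t := by
      intro t _
      have h2 := ((hh.differentiable one_ne_zero (r * e t)).hasFDerivAt).comp_hasDerivAt t
        ((hed t).const_mul (r : ℂ))
      have h5 : fderiv ℝ h (r * e t) (r * (Complex.I * e t)) = r * B (r, t) := by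
        rw [← Complex.real_smul (x := r) (z := Complex.I * e t), map_smul, Complex.real_smul]
      rw [h5] at h2
      exact h2
    have hcont : Continuous fun t => (r : ℂ) * B (r, t) := by fun_prop
    have h3 := intervalIntegral.integral_eq_sub_of_hasDerivAt hder (hcont.intervalIntegrable _ _)
    have h4 : e Real.pi = e (-Real.pi) := by
      simp only [he, Complex.ofReal_neg, neg_mul, Complex.exp_neg, Complex.exp_pi_mul_I]
      norm_num
    rw [h4, sub_self, intervalIntegral.integral_const_mul,
      intervalIntegral.integral_of_le (by linarith [Real.pi_pos]),
      integral_Ioc_eq_integral_Ioo] at h3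
    exact (mul_eq_zero.1 h3).resolve_left hr'
  rw [iA, iB]
  ring

/-- The Cauchy–Pompeiu formula. -/
theorem integral_dbar_mul_inv_sub (hh : ContDiff ℝ 1 h) (hc : HasCompactSupport h) (w : ℂ) :
    ∫ z, dbar h z * (z - w)⁻¹ = -Real.pi * h w := by
  have h1 := integral_dbar_mul_inv (h := fun z => h (z + w)) (by fun_prop)
    (hc.comp_homeomorph (Homeomorph.addRight w))
  rw [zero_add] at h1
  rw [← h1, ← integral_add_right_eq_self _ w]
  refine integral_congr_ae (Eventually.of_forall fun z => ?_)
  simp only [dbar, fderiv_comp_add_right, add_sub_cancel_right]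

end Pompeiu

theorem exists_cutoff {K Ω : Set ℂ} (hK : IsCompact K) (hΩ : IsOpen Ω) (h : K ⊆ Ω) :
    ∃ (χ : ℂ → ℝ) (V : Set ℂ), ContDiff ℝ 1 χ ∧ HasCompactSupport χ ∧ tsupport χ ⊆ Ω ∧ IsOpen V ∧
      K ⊆ V ∧ V ⊆ Ω ∧ ∀ z ∈ V, χ z = 1 := by
  obtain ⟨δ, hδ, hd⟩ := hK.exists_cthickening_subset_open hΩ h
  have hsub : Metric.cthickening (δ / 2) K ⊆ Metric.thickening δ K :=
    Metric.cthickening_subset_thickening' hδ (by linarith) K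
  obtain ⟨χ, h1, -, h2, h3⟩ := exists_contMDiff_support_eq_eq_one_iff (modelWithCornersSelf ℝ ℂ)
    (n := 1) Metric.isOpen_thickening Metric.isClosed_cthickening hsub
  have h4 : tsupport χ ⊆ Metric.cthickening δ K := by
    rw [tsupport, h2]
    exact Metric.closure_thickening_subset_cthickening δ K
  refine ⟨χ, Metric.thickening (δ / 2) K, h1.contDiff,
    HasCompactSupport.of_support_subset_isCompact hK.cthickening ((subset_tsupport χ).trans h4),
    h4.trans hd, Metric.isOpen_thickening, Metric.self_subset_thickening (by linarith) K,
    fun z hz => hd (Metric.thickening_subset_cthickening_of_le (by linarith) K hz),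
    fun z hz => (h3 z).1 (Metric.thickening_subset_cthickening _ K hz)⟩

/-- Outside Ω nothing is known about f, but there the product vanishes in a neighbourhood of the
point. -/
theorem contDiff_cutoff_mul {χ : ℂ → ℝ} (hχ : ContDiff ℝ 1 χ) {Ω : Set ℂ} (hΩ : IsOpen Ω)
    (h : tsupport χ ⊆ Ω) {f : ℂ → ℂ} (hf : DifferentiableOn ℂ f Ω) :
    ContDiff ℝ 1 fun z => (χ z : ℂ) * f z := by
  rw [contDiff_iff_contDiffAt]
  intro z
  by_cases hz : z ∈ Ω
  · exact (Complex.ofRealCLM.contDiff.comp hχ).contDiffAt.mul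
      (((hf.analyticOnNhd hΩ) z hz).contDiffAt.restrict_scalars ℝ)
  · refine (contDiffAt_const (c := (0 : ℂ))).congr_of_eventuallyEq ?_
    have : z ∉ tsupport χ := fun hm => hz (h hm)
    filter_upwards [notMem_tsupport_iff_eventuallyEq.1 this] with w hw
    simp [hw]

/-- A holomorphic function is, near a compact set, an integral of `(z - w)⁻¹` over a compact set
of points `z`. -/
theorem exists_cauchy_kernel {Ω K : Set ℂ} (hΩ : IsOpen Ω) {f : ℂ → ℂ}
    (hf : DifferentiableOn ℂ f Ω) (hK : IsCompact K) (hKΩ : K ⊆ Ω) :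
    ∃ (S V : Set ℂ) (k : ℂ → ℂ), IsCompact S ∧ IsOpen V ∧ K ⊆ V ∧ Disjoint S V ∧ Continuous k ∧
      ∀ w ∈ V, ∫ z in S, k z * (z - w)⁻¹ = f w := by
  obtain ⟨χ, V, h1, h2, h3, h4, h5, h6, h7⟩ := exists_cutoff hK hΩ hKΩ
  have hg := contDiff_cutoff_mul h1 hΩ h3 hf
  set g : ℂ → ℂ := fun z => (χ z : ℂ) * f z with hgdef
  have hgs : Function.support g ⊆ tsupport χ := fun z hz => subset_tsupport χ fun h0 => by
    simp [hgdef, h0] at hz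
  have hgc : HasCompactSupport g := HasCompactSupport.of_support_subset_isCompact h2.isCompact hgs
  have hgt : tsupport g ⊆ tsupport χ := closure_minimal hgs (isClosed_tsupport χ)
  -- With g = χf, the function ∂g/∂z̄ vanishes on V, where g = f is holomorphic, and off the support
  -- of the cutoff. The Pompeiu integral therefore lives on S = supp χ \ V, away from V.
  refine ⟨tsupport χ \ V, V, fun z => -(Real.pi : ℂ)⁻¹ * dbar g z, h2.isCompact.diff h4, h4, h5,
    disjoint_sdiff_left, continuous_const.mul (continuous_dbar hg), fun w hw => ?_⟩
  have h8 : ∀ z, z ∉ tsupport χ \ V → -(Real.pi : ℂ)⁻¹ * dbar g z * (z - w)⁻¹ = 0 := by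
    intro z hz
    have : dbar g z = 0 := by
      by_cases hzV : z ∈ V
      · refine dbar_eq_zero ((hf z (h6 hzV)).differentiableAt (hΩ.mem_nhds (h6 hzV))) ?_
        filter_upwards [h4.mem_nhds hzV] with y hy
        simp [hgdef, h7 y hy]
      · have hz1 : z ∉ tsupport g := fun hm => hz ⟨hgt hm, hzV⟩
        exact dbar_eq_zero (differentiableAt_const (0 : ℂ)) (notMem_tsupport_iff_eventuallyEq.1 hz1)
    rw [this, mul_zero, zero_mul]
  rw [setIntegral_eq_integral_of_forall_compl_eq_zero h8]
  simp only [mul_assoc]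
  rw [integral_const_mul, integral_dbar_mul_inv_sub hg hgc]
  have hp : (Real.pi : ℂ) ≠ 0 := by exact_mod_cast Real.pi_ne_zero
  have hgw : g w = f w := by simp [hgdef, h7 w hw]
  rw [hgw]
  field_simp

/-! ### The holomorphic functional calculus -/

section Resolvent

variable {A : Type*} [NormedCommRing A] [NormedAlgebra ℂ A] {S : Set ℂ}

theorem isFiniteMeasure_comap_val (hS : IsCompact S) :
    IsFiniteMeasure (Measure.comap (Subtype.val : S → ℂ) volume) := by
  refine ⟨?_⟩
  rw [comap_subtype_coe_apply hS.measurableSet, image_univ, Subtype.range_coe]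
  exact hS.measure_lt_top

/-- The integral of a continuous function on `S` against a continuous kernel. -/
theorem exists_kernel_clm [CompleteSpace A] (hS : IsCompact S) {k : ℂ → ℂ} (hk : Continuous k) [CompactSpace S] :
    ∃ L : C(S, A) →L[ℂ] A, ∀ F : C(S, A), Integrable (fun z : S => k z • F z)
      (Measure.comap Subtype.val volume) ∧ L F = ∫ z : S, k z • F z ∂(Measure.comap Subtype.val volume) := by
  have := isFiniteMeasure_comap_val hS
  set μ : Measure S := Measure.comap Subtype.val volume
  have hi : ∀ F : C(S, A), Integrable (fun z : S => k z • F z) μ := fun F => by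
    have hc : Continuous fun z : S => k z • F z := by fun_prop
    exact hc.integrable_of_hasCompactSupport (HasCompactSupport.of_compactSpace _)
  have hki : Integrable (fun z : S => ‖k z‖) μ := by
    have hc : Continuous fun z : S => ‖k z‖ := by fun_prop
    exact hc.integrable_of_hasCompactSupport (HasCompactSupport.of_compactSpace _)
  refine ⟨LinearMap.mkContinuous
    { toFun := fun F => ∫ z : S, k z • F z ∂μ
      map_add' := fun F G => ?_
      map_smul' := fun c F => ?_ } (∫ z : S, ‖k z‖ ∂μ) fun F => ?_, fun F => ⟨hi F, rfl⟩⟩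
  · simp only [ContinuousMap.add_apply, smul_add]
    exact integral_add (hi F) (hi G)
  · simp only [ContinuousMap.smul_apply, smul_comm _ c, RingHom.id_apply]
    exact integral_smul c _
  · rw [← integral_mul_const]
    refine norm_integral_le_of_norm_le (hki.mul_const _) (Eventually.of_forall fun z => ?_)
    rw [norm_smul]
    exact mul_le_mul_of_nonneg_left (F.norm_coe_le_norm z) (norm_nonneg _)

/-- The function `z ↦ z - u` on `S`. -/
def pencil (S : Set ℂ) (u : A) : C(S, A) := ⟨fun z => algebraMap ℂ A z - u, by fun_prop⟩

theorem analyticAt_pencil [CompactSpace S] (u : A) : AnalyticAt ℂ (pencil S : A → C(S, A)) u := by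
  let c : A →L[ℂ] C(S, A) :=
    { toFun := ContinuousMap.const S
      map_add' := fun _ _ => rfl
      map_smul' := fun _ _ => rfl
      cont := ContinuousMap.continuous_const' }
  have h : (pencil S : A → C(S, A)) = fun u => pencil S 0 - c u := by
    funext u
    ext z
    change algebraMap ℂ A z - u = algebraMap ℂ A z - 0 - u
    rw [sub_zero]
  rw [h]
  exact analyticAt_const.sub (c.analyticAt u)

/-- Working in C(S, A) treats all resolvents at once: pointwise invertibility suffices, and
analyticity of inversion there replaces differentiation under the integral. -/
theorem isUnit_pencil [CompleteSpace A] {u : A} (h : ∀ z ∈ S, IsUnit (algebraMap ℂ A z - u)) :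
    IsUnit (pencil S u) :=
  ContinuousMap.isUnit_iff_forall_isUnit _ |>.2 fun z => h z z.2

theorem inverse_pencil_apply_mul {u : A} (h : IsUnit (pencil S u)) (z : S) :
    Ring.inverse (pencil S u) z * (algebraMap ℂ A z - u) = 1 :=
  DFunLike.congr_fun (Ring.inverse_mul_cancel _ h) z

end Resolvent

section Calculus

variable {m : ℕ} (hm : 1 < m) (γ : ℝ) {σ : ℝ} [hγ : Fact (1 / 2 < γ)] (hσ : 0 ≤ σ)

theorem isUnit_algebraMap_sub {S V : Set ℂ} (hSV : Disjoint S V) {u : Alg hm γ hσ}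
    (hu : ∀ r ∈ Icc (0 : ℝ) 1, ∀ z : ℂ, |z.im| ≤ σ → ext hm γ hσ u r z ∈ V) {w : ℂ} (hw : w ∈ S) :
    IsUnit (algebraMap ℂ (Alg hm γ hσ) w - u) := by
  refine isUnit_of_ext_ne_zero hm γ hσ fun r hr z hz h => ?_
  rw [← ev_apply hm γ hσ hr hz, map_sub, AlgHom.commutes, ev_apply, Algebra.algebraMap_self_apply,
    sub_eq_zero] at h
  exact disjoint_left.1 hSV hw (h ▸ hu r hr z hz)

theorem ext_injective {u v : Alg hm γ hσ} (h : ∀ r ∈ Icc (0 : ℝ) 1, ∀ z : ℂ, |z.im| ≤ σ →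
    ext hm γ hσ u r z = ext hm γ hσ v r z) : u = v := by
  refine Subtype.ext (AEEqFun.ext ?_)
  filter_upwards [(isStripExtension_ext hm γ hσ u).ae_eq, (isStripExtension_ext hm γ hσ v).ae_eq,
    ae_fst_mem] with x h1 h2 h3
  obtain ⟨t, ht⟩ := QuotientAddGroup.mk_surjective x.2
  rw [h1 t ht, h2 t ht]
  exact h _ (Ioc_subset_Icc_self h3) _ (by simpa using hσ)

/-- Locally f(v) = ∫_S k(z) (z - v)⁻¹ dz, with S disjoint from a neighbourhood V of the values of u.
The map is a composition of an affine map, inversion in C(S, A) and a bounded linear map. Applying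
an evaluation under the integral reduces the claim about extensions to the scalar formula for f. -/
theorem exists_analyticAt_comp {Ω : Set ℂ} (hΩ : IsOpen Ω) {f : ℂ → ℂ}
    (hf : DifferentiableOn ℂ f Ω) {u : J m γ σ} (hu : u ∈ imageIn m γ σ Ω) :
    ∃ Ψ : J m γ σ → J m γ σ, AnalyticAt ℂ Ψ u ∧ ∀ᶠ v in 𝓝 u, ∀ r ∈ Icc (0 : ℝ) 1, ∀ z : ℂ,
      |z.im| ≤ σ → ext hm γ hσ (toAlg hm γ hσ (Ψ v)) r z =
        f (ext hm γ hσ (toAlg hm γ hσ v) r z) := by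
  rw [mem_imageIn_iff hm γ hσ] at hu
  have hsub : values hm γ hσ (toAlg hm γ hσ u) ⊆ Ω := by
    rintro _ ⟨⟨r, z⟩, ⟨hr, hz⟩, rfl⟩
    exact hu r hr z hz
  obtain ⟨S, V, k, hS, hV, hKV, hSV, hk, hkf⟩ := exists_cauchy_kernel hΩ hf
    (isCompact_values hm γ hσ _) hsub
  have : CompactSpace S := isCompact_iff_compactSpace.1 hS
  obtain ⟨L, hL⟩ := exists_kernel_clm (A := Alg hm γ hσ) hS hk
  have huV : u ∈ imageIn m γ σ V := (mem_imageIn_iff hm γ hσ).2 fun r hr z hz =>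
    hKV ⟨(r, z), ⟨hr, hz⟩, rfl⟩
  have hunit : ∀ v ∈ imageIn m γ σ V, IsUnit (pencil S (toAlg hm γ hσ v)) := fun v hv =>
    isUnit_pencil fun w hw =>
      isUnit_algebraMap_sub hm γ hσ hSV ((mem_imageIn_iff hm γ hσ).1 hv) hw
  refine ⟨fun v => (toAlg hm γ hσ).symm (L (Ring.inverse (pencil S (toAlg hm γ hσ v)))), ?_, ?_⟩
  · obtain ⟨a, ha⟩ := hunit u huV
    have h1 : AnalyticAt ℂ (Ring.inverse : C(S, Alg hm γ hσ) → _) (pencil S (toAlg hm γ hσ u)) :=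
      ha ▸ analyticAt_inverse a
    have h2 : AnalyticAt ℂ (fun v => pencil S (toAlg hm γ hσ v)) u :=
      (analyticAt_pencil _).comp ((toAlg hm γ hσ : J m γ σ →L[ℂ] Alg hm γ hσ).analyticAt u)
    have h3 : AnalyticAt ℂ (fun v => Ring.inverse (pencil S (toAlg hm γ hσ v))) u :=
      AnalyticAt.comp (f := fun v => pencil S (toAlg hm γ hσ v)) (x := u) h1 h2
    have h4 : AnalyticAt ℂ (fun v => L (Ring.inverse (pencil S (toAlg hm γ hσ v)))) u :=
      (L.analyticAt _).comp h3
    exact (((toAlg hm γ hσ).symm : Alg hm γ hσ →L[ℂ] J m γ σ).analyticAt _).comp h4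
  · filter_upwards [(isOpen_imageIn hm γ hσ hV).mem_nhds huV] with v hv r hr z hz
    have hvV := (mem_imageIn_iff hm γ hσ).1 hv
    set F := Ring.inverse (pencil S (toAlg hm γ hσ v)) with hF
    have h1 : ∀ w : S, ev hm γ hσ hr hz (F w) =
        ((w : ℂ) - ext hm γ hσ (toAlg hm γ hσ v) r z)⁻¹ := fun w => by
      have h2 := congrArg (ev hm γ hσ hr hz) (inverse_pencil_apply_mul (hunit v hv) w)
      rw [map_mul, map_sub, AlgHom.commutes, Algebra.algebraMap_self_apply, map_one] at h2
      exact eq_inv_of_mul_eq_one_left h2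
    rw [ContinuousLinearEquiv.apply_symm_apply, ← ev_apply hm γ hσ hr hz, (hL F).2]
    have h3 := ((ev hm γ hσ hr hz).toContinuousLinearMap).integral_comp_comm (hL F).1
    refine h3.symm.trans ?_
    rw [← hkf _ (hvV r hr z hz), ← integral_subtype_comap hS.measurableSet]
    refine integral_congr_ae (Eventually.of_forall fun w => ?_)
    change ev hm γ hσ hr hz (k w • F w) = _
    rw [map_smul, h1, smul_eq_mul]

open Classical in
/-- The element of `J^{m,σ}_{0,γ}(Π)` with extension `f(u(ψ,z))`, or zero if there is none. -/
def comp (f : ℂ → ℂ) (u : J m γ σ) : J m γ σ :=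
  if h : ∃ v : J m γ σ, ∀ r ∈ Icc (0 : ℝ) 1, ∀ z : ℂ, |z.im| ≤ σ →
      ext hm γ hσ (toAlg hm γ hσ v) r z = f (ext hm γ hσ (toAlg hm γ hσ u) r z)
  then h.choose else 0

theorem comp_eq {f : ℂ → ℂ} {u v : J m γ σ} (h : ∀ r ∈ Icc (0 : ℝ) 1, ∀ z : ℂ, |z.im| ≤ σ →
      ext hm γ hσ (toAlg hm γ hσ v) r z = f (ext hm γ hσ (toAlg hm γ hσ u) r z)) :
    comp hm γ hσ f u = v := by
  have hex : ∃ v : J m γ σ, ∀ r ∈ Icc (0 : ℝ) 1, ∀ z : ℂ, |z.im| ≤ σ →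
      ext hm γ hσ (toAlg hm γ hσ v) r z = f (ext hm γ hσ (toAlg hm γ hσ u) r z) := ⟨v, h⟩
  rw [comp, dif_pos hex]
  refine (toAlg hm γ hσ).injective (ext_injective hm γ hσ fun r hr z hz => ?_)
  rw [hex.choose_spec r hr z hz, h r hr z hz]

/-- The kernel, S and V depend on the base point, but an element is determined by its extension, so
the local maps are all germs of one globally defined map. -/
theorem analyticOnNhd_comp {Ω : Set ℂ} (hΩ : IsOpen Ω) {f : ℂ → ℂ} (hf : DifferentiableOn ℂ f Ω) :
    AnalyticOnNhd ℂ (comp hm γ hσ f) (imageIn m γ σ Ω) := by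
  intro u hu
  obtain ⟨Ψ, hΨ, h⟩ := exists_analyticAt_comp hm γ hσ hΩ hf hu
  exact hΨ.congr (h.mono fun v hv => (comp_eq hm γ hσ hv).symm)

theorem isStripExtension_comp {Ω : Set ℂ} (hΩ : IsOpen Ω) {f : ℂ → ℂ}
    (hf : DifferentiableOn ℂ f Ω) {u : J m γ σ} (hu : u ∈ imageIn m γ σ Ω) {U : ℝ → ℂ → ℂ}
    (hU : IsStripExtension σ (u : FunPi) U) :
    IsStripExtension σ (comp hm γ hσ f u : FunPi) fun r z => f (U r z) := by
  obtain ⟨Ψ, -, h⟩ := exists_analyticAt_comp hm γ hσ hΩ hf hu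
  have h1 := h.self_of_nhds
  rw [← comp_eq hm γ hσ h1] at h1
  rw [mem_imageIn_iff hm γ hσ] at hu
  have hUe : ∀ r ∈ Icc (0 : ℝ) 1, ∀ z : ℂ, |z.im| ≤ σ →
      ext hm γ hσ (toAlg hm γ hσ u) r z = U r z := fun r hr z hz =>
    (isStripExtension_ext hm γ hσ (toAlg hm γ hσ u)).unique hσ hU hr hz
  have hUΩ : ∀ r ∈ Icc (0 : ℝ) 1, ∀ z : ℂ, |z.im| ≤ σ → U r z ∈ Ω := fun r hr z hz =>
    hUe r hr z hz ▸ hu r hr z hz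
  refine ⟨hf.continuousOn.comp hU.continuousOn fun x hx => hUΩ _ hx.1 _ hx.2, fun r hr z hz => ?_,
    fun r hr => hf.comp (hU.holomorphic r hr) fun z hz => hUΩ r hr z (le_of_lt hz), ?_⟩
  · rw [hU.periodic r hr z hz]
  · filter_upwards [(isStripExtension_ext hm γ hσ (toAlg hm γ hσ (comp hm γ hσ f u))).ae_eq,
      ae_fst_mem] with x h2 h3 t ht
    have hz : |((t : ℂ)).im| ≤ σ := by simpa using hσ
    refine (h2 t ht).trans ?_
    rw [h1 _ (Ioc_subset_Icc_self h3) _ hz, hUe _ (Ioc_subset_Icc_self h3) _ hz]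

end Calculus

end Kondratev

end

theorem mainTheorem7 (m : ℕ) (hm : 1 < m) (γ : ℝ) [hγ : Fact (1 / 2 < γ)] (σ : ℝ) (hσ : 0 ≤ σ) :
    CompleteSpace (Kondratev.J m γ σ) ∧
    (∃ hmul : ∀ u v : Kondratev.J m γ σ,
        (u : Kondratev.FunPi) * (v : Kondratev.FunPi) ∈ Kondratev.J m γ σ,
      (∃ C : ℝ, ∀ u v : Kondratev.J m γ σ,
        ‖(⟨(u : Kondratev.FunPi) * (v : Kondratev.FunPi), hmul u v⟩ : Kondratev.J m γ σ)‖ ≤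
          C * ‖u‖ * ‖v‖) ∧
      AnalyticOnNhd ℂ
        (fun p : Kondratev.J m γ σ × Kondratev.J m γ σ =>
          (⟨(p.1 : Kondratev.FunPi) * (p.2 : Kondratev.FunPi), hmul p.1 p.2⟩ :
            Kondratev.J m γ σ)) Set.univ) ∧
    (∀ u : Kondratev.J m γ σ,
      ∃ U : ℝ → ℂ → ℂ, Kondratev.IsStripExtension σ (u : Kondratev.FunPi) U) ∧
    (∀ (Ω : Set ℂ) (f : ℂ → ℂ), IsOpen Ω → DifferentiableOn ℂ f Ω →
      IsOpen (Kondratev.imageIn m γ σ Ω) ∧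
      ∃ Φ : Kondratev.J m γ σ → Kondratev.J m γ σ,
        AnalyticOnNhd ℂ Φ (Kondratev.imageIn m γ σ Ω) ∧
        ∀ u ∈ Kondratev.imageIn m γ σ Ω, ∀ U : ℝ → ℂ → ℂ,
          Kondratev.IsStripExtension σ (u : Kondratev.FunPi) U →
          Kondratev.IsStripExtension σ (Φ u : Kondratev.FunPi) (fun r z => f (U r z))) := by
  have hmul : ∀ u v : Kondratev.J m γ σ,
      (u : Kondratev.FunPi) * (v : Kondratev.FunPi) ∈ Kondratev.J m γ σ :=
    fun u v => Kondratev.J.mul_mem hm hσ u.2 v.2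
  refine ⟨Kondratev.completeSpace_J m γ hσ, ⟨hmul, ⟨‖Kondratev.mulL hm γ hσ‖, fun u v => ?_⟩,
    (Kondratev.mulL hm γ hσ).analyticOnNhd_bilinear _⟩,
    fun u => Kondratev.J.exists_isStripExtension hm hγ.out hσ u.2, fun Ω f hΩ hf =>
      ⟨Kondratev.isOpen_imageIn hm γ hσ hΩ, Kondratev.comp hm γ hσ f,
        Kondratev.analyticOnNhd_comp hm γ hσ hΩ hf,
        fun u hu U hU => Kondratev.isStripExtension_comp hm γ hσ hΩ hf hu hU⟩⟩
  exact (Kondratev.mulL hm γ hσ).le_opNorm₂ u v
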